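/- Let $r\ge 1$ be an integer, let $\mathcal U\subset\mathbb R^2$ be a bounded open neighbourhood of the origin, and let $\mathfrak X$ be the space of vector fields of class $C^r$ on $\overline{\mathcal U}$ (all derivatives of order $\le r$ extend continuously from $\mathcal U$ to $\overline{\mathcal U}$), with the $C^r$ topology. Let $\Omega=\mathfrak X\times\mathfrak X$, with the product topology, be the space of piecewise smooth vector fields $Z=(X,Y)$, $$Z(p)=X(p)\ \text{ if } p\in\mathcal U^+=\{x_1x_2>0\},\qquad Z(p)=Y(p)\ \text{ if } p\in\mathcal U^-=\{x_1x_2<0\},$$ with switching set $\Sigma=\Sigma_1\cup\Sigma_2$, $\Sigma_i=\{x_i=0\}$. *Trajectories.* In $\mathcal U^+$ and $\mathcal U^-$ trajectories of $Z$ are those of $X$ and $Y$. Through a crossing point $p\in\Sigma_i\setminus\{0\}$, $X_iY_i(p)>0$, they are concatenations of the two. At sliding and escaping points $p\in\Sigma_i\setminus\{0\}$, $X_iY_i(p)<0$, they are trajectories in $\Sigma_i$ of the Filippov sliding field $Z_i^s=(Y_iX_j-X_iY_j)/(Y_i-X_i)$, $j\ne i$ (a component of motion along $\Sigma_i$); trajectories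 in $\mathcal U^\pm$ do not include their end points on the sliding and escaping regions. At a point $p\in\Sigma_i\setminus\{0\}$ with $X_iY_i(p)=0$ the trajectory is the common limit of the trajectories through the neighbouring points of $\Sigma_i$ on both sides of $p$ if it exists, and $\{p\}$ otherwise. The trajectory of the origin is the trajectory of $X$ in $\overline{\mathcal U^+}$ or of $Y$ in $\overline{\mathcal U^-}$ through it, if both axes are crossing near $0$; it is the trajectory of $Z_i^s$, if near $0$ the axis $\Sigma_i$ is sliding or escaping and the other axis is crossing; and it is $\{0\}$ otherwise. *Structural stability.* $Z,\tilde Z\in\Omega$ are locally $\Sigma$-equivalent if there is an orientation preserving homeomorphism $h$ between two open neighbourhoods of the origin in $\mathcal U$, with $h(0)=0$, which maps $\Sigma$ to $\Sigma$ and the trajectories of $Z$ in the first neighbourhood onto the trajectories of $\tilde Z$ in the second one, preserving their direction. $Z$ is locally $\Sigma$-structurally stable at the origin if it has a neighbourhood in $\Omega$ all of whose elements are locally $\Sigma$-equivalent to $Z$. Let $\Omega_0\subset\Omega$ be the set of these $Z$. $Z$ is called transient if, near the origin, through every point of $\overline{\mathcal U^+}$ passes a solution of $X$, and through every point of $\overline{\mathcal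 U^-}$ a solution of $Y$, which stays close to the origin, meets $\Sigma_1$ and $\Sigma_2$ at some times $t_1$ and $t_2$, and lies in $\overline{\mathcal U^+}$, respectively $\overline{\mathcal U^-}$, between these times. **Theorem.** A field $Z\in\Omega$ belongs to $\Omega_0$ if and only if it satisfies one of the following conditions: (A) $X_i(0)Y_i(0)>0$ for $i=1,2$; (B) $X_i(0)Y_i(0)<0$ for $i=1,2$, and $\det Z(0)=X_1(0)Y_2(0)-X_2(0)Y_1(0)\neq0$; (C) $X_i(0)Y_i(0)>0$ and $X_j(0)Y_j(0)<0$ for some $i,j$ with $\{i,j\}=\{1,2\}$ and, if $Z$ is transient, $$\alpha_Z=\left(\frac{X_1(0)Y_2(0)}{X_2(0)Y_1(0)}\right)^2\neq1 .$$ Moreover, $\Omega_0$ is open and dense in $\Omega$. -/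

import Mathlib

open Set Filter Topology

noncomputable section

namespace PWS

/-- The plane; the coordinates `x₁, x₂` of a point `p` are `p 0, p 1`. For `i : Fin 2` the other
index is `i + 1`. -/
abbrev Plane : Type := EuclideanSpace ℝ (Fin 2)

/-- Vector fields of class `C^r` on the (bounded, open) set `U`, up to the boundary: all derivatives
of order at most `r` are uniformly continuous on `U`, that is, they extend continuously to the
compact closure of `U`. The values outside `U` carry no information and are normalised to `0`. -/
structure VField (U : Set Plane) (r : ℕ) where
  toFun : Plane → Plane
  contDiffOn : ContDiffOn ℝ r toFun U
  uniformContinuousOn : ∀ k ≤ r, UniformContinuousOn (iteratedFDerivWithin ℝ k toFun U) U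
  eq_zero : ∀ x, x ∉ U → toFun x = 0

instance (U : Set Plane) (r : ℕ) : CoeFun (VField U r) (fun _ => Plane → Plane) := ⟨VField.toFun⟩

/-- The `C^r` topology: uniform convergence on `U` of all derivatives of order at most `r`. -/
instance (U : Set Plane) (r : ℕ) : TopologicalSpace (VField U r) :=
  TopologicalSpace.induced
    (fun X => fun k : Fin (r + 1) =>
      UniformFun.ofFun (fun x : U => iteratedFDerivWithin ℝ (k : ℕ) X U (x : Plane)))
    (inferInstance :
      TopologicalSpace ((k : Fin (r + 1)) → UniformFun U (Plane [×(k : ℕ)]→L[ℝ] Plane)))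

/-- The space `Ω` of piecewise smooth fields `Z = (X, Y)`: the field `X` acts where `x₁ x₂ > 0` and
the field `Y` acts where `x₁ x₂ < 0`. It carries the product topology. -/
abbrev Omega (U : Set Plane) (r : ℕ) : Type := VField U r × VField U r

/-- The axis `Σ_i = {x_i = 0}`. -/
def axis (i : Fin 2) : Set Plane := {p | p i = 0}

/-- The switching set `Σ = Σ₁ ∪ Σ₂ = {x₁ x₂ = 0}`. -/
def switching : Set Plane := {p | p 0 * p 1 = 0}

/-! ### Trajectories -/

section Trajectories

variable {U : Set Plane} {r : ℕ}

/-- The points `p ≠ 0` of `Σ_i` at which `Z` crosses `Σ_i`. -/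
def crossing (Z : Omega U r) (i : Fin 2) : Set Plane :=
  {p | p ∈ axis i ∧ p ≠ 0 ∧ 0 < Z.1 p i * Z.2 p i}

/-- The union of the sliding and the escaping region of `Σ_i` (without the origin). -/
def sliding (Z : Omega U r) (i : Fin 2) : Set Plane :=
  {p | p ∈ axis i ∧ p ≠ 0 ∧ Z.1 p i * Z.2 p i < 0}

/-- The remaining points `p ≠ 0` of `Σ_i`: the tangency points. -/
def tangency (Z : Omega U r) (i : Fin 2) : Set Plane :=
  {p | p ∈ axis i ∧ p ≠ 0 ∧ Z.1 p i * Z.2 p i = 0}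

/-- The sliding vector field `Z_i^s = (Y_i X_j - X_i Y_j) / (Y_i - X_i)` of `Σ_i`, `j ≠ i`, as a
vector of the plane tangent to `Σ_i`. -/
def slidingField (Z : Omega U r) (i : Fin 2) (p : Plane) : Plane :=
  EuclideanSpace.single (i + 1)
    ((Z.2 p i * Z.1 p (i + 1) - Z.1 p i * Z.2 p (i + 1)) / (Z.2 p i - Z.1 p i))

/-- The curve `γ`, defined on the interval `J`, moves at time `t` along `Σ_i` with the velocity
given by the sliding vector field. -/
def SlidesAt (Z : Omega U r) (i : Fin 2) (J : Set ℝ) (γ : ℝ → Plane) (t : ℝ) : Prop :=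
  (∀ᶠ s in 𝓝[J] t, γ s ∈ axis i) ∧ HasDerivWithinAt γ (slidingField Z i (γ t)) J t

/-- The law of motion at the points of the open quadrants and at crossing, sliding and escaping
points. At a crossing point a motion in one quadrant is followed by a motion in the next one. Motions
in the quadrants do not include their end points on the sliding and escaping regions. -/
structure RegularLaw (Z : Omega U r) (J : Set ℝ) (γ : ℝ → Plane) (t : ℝ) : Prop where
  pos : 0 < γ t 0 * γ t 1 → HasDerivWithinAt γ (Z.1 (γ t)) J t
  neg : γ t 0 * γ t 1 < 0 → HasDerivWithinAt γ (Z.2 (γ t)) J t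
  cross : ∀ i, γ t ∈ crossing Z i → ∀ᶠ s in 𝓝[J \ {t}] t, γ s ∉ switching
  slide : ∀ i, γ t ∈ sliding Z i → SlidesAt Z i J γ t

/-- Trajectories that meet neither tangency points nor the origin. -/
structure IsRegularTrajectory (Z : Omega U r) (J : Set ℝ) (γ : ℝ → Plane) : Prop where
  continuousOn : ContinuousOn γ J
  mapsTo : MapsTo γ J U
  ne_zero : ∀ t ∈ J, γ t ≠ 0
  not_tangency : ∀ t ∈ J, ∀ i, γ t ∉ tangency Z i
  law : ∀ t ∈ J, RegularLaw Z J γ t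

/-- For `|τ| < δ` the trajectories through the points `q ≠ p` of `Σ_i`, on both sides of `p`,
satisfy `φ_Z(τ; q) → c τ` as `q → p`. -/
def IsTangencyLimit (Z : Omega U r) (i : Fin 2) (p : Plane) (c : ℝ → Plane) (δ : ℝ) : Prop :=
  ∀ τ, |τ| < δ → ∀ η > 0, ∀ᶠ q in 𝓝[axis i \ {p}] p,
    ∃ β : ℝ → Plane, β 0 = q ∧ IsRegularTrajectory Z (uIcc 0 τ) β ∧ dist (β τ) (c τ) < η

/-- The law of motion at a tangency point `p = γ t` of `Σ_i`: if the limits of the trajectories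
through neighbouring points from both sides exist and agree (regular tangency), the trajectory of `p`
is this limit; otherwise (singular tangency) it is `{p}`. -/
def TangencyLaw (Z : Omega U r) (i : Fin 2) (J : Set ℝ) (γ : ℝ → Plane) (t : ℝ) : Prop :=
  (∃ c δ, 0 < δ ∧ IsTangencyLimit Z i (γ t) c δ ∧ ∀ᶠ s in 𝓝[J] t, γ s = c (s - t)) ∨
  ((¬ ∃ c δ, 0 < δ ∧ IsTangencyLimit Z i (γ t) c δ) ∧ ∀ᶠ s in 𝓝[J] t, γ s = γ t)

/-- Near the origin, `Σ_i` without the origin is a crossing region. -/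
def CrossesNear (Z : Omega U r) (i : Fin 2) : Prop :=
  ∀ᶠ q in 𝓝[axis i \ {0}] (0 : Plane), q ∈ crossing Z i

/-- Near the origin, `Σ_i` without the origin consists of sliding and escaping points. -/
def SlidesNear (Z : Omega U r) (i : Fin 2) : Prop :=
  ∀ᶠ q in 𝓝[axis i \ {0}] (0 : Plane), q ∈ sliding Z i

/-- The law of motion at the origin, `γ t = 0`. If both axes are crossing, the trajectory is the
trajectory of `X` in the closure of `{x₁ x₂ > 0}`, or of `Y` in the closure of `{x₁ x₂ < 0}`, through
the origin. If one axis is sliding or escaping and the other one crossing, the trajectory is the one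
of the sliding vector field. In the remaining cases it is `{0}`. -/
structure OriginLaw (Z : Omega U r) (J : Set ℝ) (γ : ℝ → Plane) (t : ℝ) : Prop where
  cross : (∀ i, CrossesNear Z i) →
    (∀ᶠ s in 𝓝[J] t, 0 ≤ γ s 0 * γ s 1 ∧ HasDerivWithinAt γ (Z.1 (γ s)) J s) ∨
    (∀ᶠ s in 𝓝[J] t, γ s 0 * γ s 1 ≤ 0 ∧ HasDerivWithinAt γ (Z.2 (γ s)) J s)
  slide : ∀ i, SlidesNear Z i → CrossesNear Z (i + 1) → SlidesAt Z i J γ t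
  stay : ¬ (∀ i, CrossesNear Z i) → ¬ (∃ i, SlidesNear Z i ∧ CrossesNear Z (i + 1)) →
    ∀ᶠ s in 𝓝[J] t, γ s = 0

/-- `γ`, restricted to the interval `J`, is an arc of a trajectory of `Z`. -/
structure IsTrajectory (Z : Omega U r) (J : Set ℝ) (γ : ℝ → Plane) : Prop where
  continuousOn : ContinuousOn γ J
  mapsTo : MapsTo γ J U
  regular : ∀ t ∈ J, RegularLaw Z J γ t
  tangency : ∀ t ∈ J, ∀ i, γ t ∈ tangency Z i → TangencyLaw Z i J γ t
  origin : ∀ t ∈ J, γ t = 0 → OriginLaw Z J γ t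

end Trajectories

/-! ### Orientation -/

/-- The closed curve `c`, parametrised by `[0, 1]`, turns `n` times counterclockwise around `p`. -/
def HasWindingNumber (c : ℝ → Plane) (p : Plane) (n : ℤ) : Prop :=
  ∃ θ : ℝ → ℝ, ContinuousOn θ (Icc 0 1) ∧
    (∀ t ∈ Icc (0 : ℝ) 1, c t 0 - p 0 = ‖c t - p‖ * Real.cos (θ t) ∧
      c t 1 - p 1 = ‖c t - p‖ * Real.sin (θ t)) ∧
    θ 1 - θ 0 = 2 * Real.pi * n

/-- `h` preserves the orientation of the plane at `p`: it preserves the winding numbers around `p`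
of the closed curves in a small punctured disc centred at `p`. (For a homeomorphism of a connected
plane domain this condition at one point is equivalent to the condition at all points.) -/
def PreservesOrientationAt (h : Plane → Plane) (p : Plane) : Prop :=
  ∃ ε > 0, ∀ c : ℝ → Plane, ContinuousOn c (Icc 0 1) → c 0 = c 1 →
    (∀ t ∈ Icc (0 : ℝ) 1, c t ∈ Metric.ball p ε ∧ c t ≠ p) →
    ∀ n : ℤ, HasWindingNumber c p n → HasWindingNumber (fun t => h (c t)) (h p) n

/-! ### Local equivalence and structural stability -/

section Stability

variable {U : Set Plane} {r : ℕ}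

/-- On the set `W` the map `h` sends trajectory arcs of `Z`, up to an increasing change of the
parameter, to trajectory arcs of `Z'`. (Arcs are parametrised by compact intervals; a trajectory in
`W` is an increasing union of such arcs.) -/
def MapsTrajectories (h : Plane → Plane) (W : Set Plane) (Z Z' : Omega U r) : Prop :=
  ∀ (a b : ℝ) (γ : ℝ → Plane), a < b → IsTrajectory Z (Icc a b) γ → MapsTo γ (Icc a b) W →
    ∃ (c d : ℝ) (σ : ℝ → ℝ), c < d ∧ StrictMonoOn σ (Icc c d) ∧ σ '' Icc c d = Icc a b ∧
      IsTrajectory Z' (Icc c d) (fun s => h (γ (σ s)))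

/-- Local `Σ`-equivalence at the origin: an orientation preserving homeomorphism `h` between two
open neighbourhoods of the origin sends `Σ` to `Σ` and the oriented trajectories of `Z` to the
oriented trajectories of `Z'`, and so does its inverse. (That `h` fixes the origin, the only point at
which `Σ` is not a topological curve, is automatic.) -/
def LocallyEquivalent (Z Z' : Omega U r) : Prop :=
  ∃ h : OpenPartialHomeomorph Plane Plane,
    h.source ⊆ U ∧ h.target ⊆ U ∧ 0 ∈ h.source ∧ 0 ∈ h.target ∧ h 0 = 0 ∧
    PreservesOrientationAt h 0 ∧
    (∀ p ∈ h.source, h p ∈ switching ↔ p ∈ switching) ∧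
    MapsTrajectories h h.source Z Z' ∧ MapsTrajectories h.symm h.target Z' Z

/-- Local `Σ`-structural stability at the origin. -/
def StructurallyStable (Z : Omega U r) : Prop :=
  ∃ V ∈ 𝓝 Z, ∀ Z' ∈ V, LocallyEquivalent Z Z'

/-! ### The conditions -/

/-- The field `F` is transient in the closed region `Q`, near the origin: through every point `p` of
`Q` close to the origin there is a solution of `F`, close to the origin, which meets `Σ₁` and `Σ₂` at
some times `t₁` and `t₂` and lies in `Q` between these times. -/
def TransientIn (F : Plane → Plane) (Q : Set Plane) : Prop :=
  ∀ N ∈ 𝓝 (0 : Plane), ∀ᶠ p in 𝓝 (0 : Plane), p ∈ Q →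
    ∃ (γ : ℝ → Plane) (a b t₁ t₂ : ℝ), 0 ∈ Icc a b ∧ t₁ ∈ Icc a b ∧ t₂ ∈ Icc a b ∧ γ 0 = p ∧
      (∀ t ∈ Icc a b, γ t ∈ N ∧ HasDerivWithinAt γ (F (γ t)) (Icc a b) t) ∧
      γ t₁ ∈ axis 0 ∧ γ t₂ ∈ axis 1 ∧ ∀ t ∈ uIcc t₁ t₂, γ t ∈ Q

/-- `Z` is transient: so are `X` in `{x₁ x₂ ≥ 0}` and `Y` in `{x₁ x₂ ≤ 0}`. -/
def IsTransient (Z : Omega U r) : Prop :=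
  TransientIn Z.1 {p | 0 ≤ p 0 * p 1} ∧ TransientIn Z.2 {p | p 0 * p 1 ≤ 0}

/-- Both axes are crossing at the origin. -/
def ConditionA (Z : Omega U r) : Prop :=
  ∀ i, 0 < Z.1 0 i * Z.2 0 i

/-- Both axes are sliding or escaping at the origin, and `det Z (0) ≠ 0`. -/
def ConditionB (Z : Omega U r) : Prop :=
  (∀ i, Z.1 0 i * Z.2 0 i < 0) ∧ Z.1 0 0 * Z.2 0 1 - Z.1 0 1 * Z.2 0 0 ≠ 0

/-- One axis is crossing, the other one is sliding or escaping, and `α_Z ≠ 1` if `Z` is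
transient. -/
def ConditionC (Z : Omega U r) : Prop :=
  (∃ i : Fin 2, 0 < Z.1 0 i * Z.2 0 i ∧ Z.1 0 (i + 1) * Z.2 0 (i + 1) < 0) ∧
  (IsTransient Z → ((Z.1 0 0 * Z.2 0 1) / (Z.1 0 1 * Z.2 0 0)) ^ 2 ≠ 1)

end Stability

end PWS

end

open Set Filter Topology

noncomputable section

namespace PWS

section


/-! ### Global solutions of scalar differential equations -/

section ScalarODE

variable {F : ℝ → ℝ → ℝ} {L : NNReal}

/-! Suppose that no component of `X` and `Y` vanishes at the origin. Near it, the trajectories of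
each field are graphs over one coordinate: leaves of a foliation, each named by the height (its
label) at which it crosses the line where this coordinate vanishes. Since an equivalence may change
the time, a trajectory of `Z` is replaced by a curve described only through labels, signs and
monotonicity: `GraphOrbit` if some axis is crossing, `CellOrbit` if both axes slide or escape.
Travelling such a curve with the correct speed (`exists_reparam`) gives back a trajectory. Hence a
homeomorphism which preserves the quadrants and maps leaves to leaves inside each of them is an
equivalence, provided that the motions along the axes have the same directions.

Sufficiency. Such a homeomorphism is built from maps of the two axes which respect the leaves
joining the axes (`Matching`). In the quadrants of `X` leaves join the axes exactly if `X` has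
negative slope, in those of `Y` exactly if `Y` has positive slope. If at most one of these holds,
the axis maps can be written down. If both hold, the field is transient, and the map of one axis has
to conjugate the two maps that hop from the axis back to itself along a leaf of `Y` and a leaf of
`X`. These are decreasing homeomorphisms of the line fixing the origin. The number `α_Z` is the
squared ratio of the two slopes, so `α_Z ≠ 1` makes either the hop or its inverse a contraction, and
any two decreasing contractions are conjugate (`exists_conjugacy`). Under (A) the two slopes have
the same sign, so the obstruction is absent. Under (C) the sliding speed is a mean of two speeds of
the same sign and cannot vanish. Under (B) its numerator is `det Z` up to sign, and this explains
the condition there. All data used are open conditions on the values at the origin, so the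
equivalence class is a neighbourhood.

Necessity. All fields near a stable field are equivalent to it, hence to each other, and it suffices
to find among them two which a topological invariant distinguishes. If `X_i Y_i (0) = 0`, both signs
of this product occur nearby; the existence of trajectory arcs inside the switching set, or of arcs
landing on it, tells them apart. If both axes slide and `det Z (0) = 0`, some nearby fields have one
inward and one outward half on each axis, so two adjacent half axes lead inward; for others the
sliding speed has a simple zero on both axes, so opposite halves have the same type
(`HasAdjacentInwardArcs`). If `Z` is transient and `α_Z = 1`, an orientation preserving equivalence
maps the sliding axis increasingly and preserves its sides. The two leaves ending at a point of the
negative half axis, one on each side, have other ends whose order is therefore preserved;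
perturbations with `α` on the two sides of `1` would impose opposite orders on `Z` itself.

Openness and density hold for the conditions: they involve finitely many values at the origin, since
transience depends on signs only (`SignPattern.isTransient_iff`), and constant perturbations make
all relevant polynomials nonzero. -/

theorem exists_solution_Ioo (hc : Continuous (Function.uncurry F))
    (hL : ∀ x, LipschitzWith L (F x)) {M : ℝ} (hM : ∀ x y, |F x y| ≤ M) (x₀ y₀ : ℝ) {T : ℝ}
    (hT : 0 < T) :
    ∃ φ : ℝ → ℝ, φ x₀ = y₀ ∧ ∀ x ∈ Ioo (x₀ - T) (x₀ + T), HasDerivAt φ (F x (φ x)) x := by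
  have hM0 : 0 ≤ M := (abs_nonneg _).trans (hM 0 0)
  have ht : x₀ ∈ Icc (x₀ - T) (x₀ + T) := ⟨by linarith, by linarith⟩
  -- The radius `M * T` is the farthest that a solution of speed at most `M` can travel in time `T`.
  have hpl : IsPicardLindelof F (⟨x₀, ht⟩ : Icc (x₀ - T) (x₀ + T)) y₀
      (⟨M, hM0⟩ * ⟨T, hT.le⟩) 0 ⟨M, hM0⟩ L := by
    refine ⟨fun t _ => (hL t).lipschitzOnWith, fun y _ => ?_, fun t _ y _ => ?_, ?_⟩
    · exact (hc.comp (Continuous.prodMk continuous_id continuous_const)).continuousOn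
    · exact hM t y
    · simp only [add_sub_cancel_left, sub_sub_cancel, max_self, NNReal.coe_zero, sub_zero]
      exact le_of_eq rfl
  obtain ⟨φ, h0, hφ⟩ := hpl.exists_eq_forall_mem_Icc_hasDerivWithinAt₀
  exact ⟨φ, h0, fun x hx => (hφ x (Ioo_subset_Icc_self hx)).hasDerivAt (Icc_mem_nhds hx.1 hx.2)⟩

/-- As `F` is bounded, solutions exist on intervals of every length, and by uniqueness they extend
each other. The value at `x` is read off from the interval of index `⌈|x - x₀|⌉₊`. -/
theorem exists_global_solution (hc : Continuous (Function.uncurry F))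
    (hL : ∀ x, LipschitzWith L (F x)) {M : ℝ} (hM : ∀ x y, |F x y| ≤ M) (x₀ y₀ : ℝ) :
    ∃ φ : ℝ → ℝ, φ x₀ = y₀ ∧ ∀ x, HasDerivAt φ (F x (φ x)) x := by
  have hn : ∀ n : ℕ, (0 : ℝ) < n + 1 := fun n => by positivity
  choose α h0 hα using fun n : ℕ => exists_solution_Ioo hc hL hM x₀ y₀ (hn n)
  have huniq : ∀ m n : ℕ, m ≤ n → ∀ x ∈ Ioo (x₀ - (m + 1)) (x₀ + (m + 1)), α m x = α n x := by
    intro m n hmn x hx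
    have hmn' : (m : ℝ) ≤ n := by exact_mod_cast hmn
    refine ODE_solution_unique_of_mem_Ioo (v := F) (K := L) (s := fun _ => univ) (t₀ := x₀)
      (fun t _ => (hL t).lipschitzOnWith)
      ⟨by linarith [hn m], by linarith [hn m]⟩ (fun t ht => ⟨hα m t ht, trivial⟩)
      (fun t ht => ⟨hα n t ⟨by linarith [ht.1], by linarith [ht.2]⟩, trivial⟩)
      ((h0 m).trans (h0 n).symm) hx
  have key : ∀ (n : ℕ), ∀ x ∈ Ioo (x₀ - (n + 1)) (x₀ + (n + 1)),
      α ⌈|x - x₀|⌉₊ x = α n x := by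
    intro n x hx
    have hx' : |x - x₀| < (⌈|x - x₀|⌉₊ : ℝ) + 1 := (Nat.le_ceil _).trans_lt (lt_add_one _)
    have hx1 := abs_lt.1 hx'
    rcases le_total ⌈|x - x₀|⌉₊ n with h | h
    · exact huniq _ _ h x ⟨by linarith, by linarith⟩
    · exact (huniq _ _ h x hx).symm
  refine ⟨fun x => α ⌈|x - x₀|⌉₊ x, by simpa using h0 0, fun x => ?_⟩
  obtain ⟨n, hnx⟩ := exists_nat_gt |x - x₀|
  have hx1 := abs_lt.1 hnx
  have hx : x ∈ Ioo (x₀ - (n + 1)) (x₀ + (n + 1)) := ⟨by linarith, by linarith⟩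
  have := hα n x hx
  rw [← key n x hx] at this
  refine this.congr_of_eventuallyEq ?_
  filter_upwards [Ioo_mem_nhds hx.1 hx.2] with z hz using key n z hz

theorem solution_unique (hL : ∀ x, LipschitzWith L (F x)) {φ ψ : ℝ → ℝ}
    (hφ : ∀ x, HasDerivAt φ (F x (φ x)) x) (hψ : ∀ x, HasDerivAt ψ (F x (ψ x)) x) {x₀ : ℝ}
    (h : φ x₀ = ψ x₀) : φ = ψ := by
  funext x
  have h1 := abs_lt.1 (lt_add_one |x - x₀|)
  refine ODE_solution_unique_of_mem_Ioo (v := F) (K := L) (s := fun _ => univ) (t₀ := x₀)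
    (a := x₀ - (|x - x₀| + 1)) (b := x₀ + (|x - x₀| + 1)) (fun t _ => (hL t).lipschitzOnWith)
    ?_ (fun t _ => ⟨hφ t, trivial⟩) (fun t _ => ⟨hψ t, trivial⟩) h ?_
  · constructor <;> linarith [abs_nonneg (x - x₀)]
  · constructor <;> linarith

end ScalarODE

/-! ### Foliations by graphs of solutions. -/

/-- The foliation of the plane by the graphs of the solutions of `v' = F u v`: the leaf `W · c` meets
the line `u = 0` at height `c`, and `H` labels the points by their leaves. The sign `s = ±1` is the
sign of `F`, and `-s * K u` is the label of the point `(u, 0)`. -/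
structure Foliation (F : ℝ → ℝ → ℝ) (s m M : ℝ) where
  W : ℝ → ℝ → ℝ
  H : ℝ → ℝ → ℝ
  K : ℝ ≃o ℝ
  W_zero : ∀ c, W 0 c = c
  hasDerivAt_W : ∀ u c, HasDerivAt (fun x => W x c) (F u (W u c)) u
  H_W : ∀ u c, H u (W u c) = c
  W_H : ∀ u v, W u (H u v) = v
  continuous_H : Continuous (Function.uncurry H)
  continuous_W : Continuous (Function.uncurry W)
  strictMono_H : ∀ u, StrictMono (H u)
  H_axis : ∀ u, H u 0 = -s * K u
  le_K : ∀ u, m * |u| ≤ |K u|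
  K_le : ∀ u, |K u| ≤ M * |u|

theorem pos_of_ne_zero_of_continuous {f : ℝ → ℝ} (hf : Continuous f) (h0 : ∀ x, f x ≠ 0) {a : ℝ}
    (ha : 0 < f a) (x : ℝ) : 0 < f x := by
  by_contra! h
  obtain ⟨y, hy⟩ := mem_range_of_exists_le_of_exists_ge hf ⟨x, h⟩ ⟨a, ha.le⟩
  exact h0 y hy

/-- Solutions are global and never cross, so they are graphs ordered by their heights over any line
`u = const`. The bounds for `K` come from integrating `m ≤ s * F ≤ M` along the leaf through `(u,
0)` back to `u = 0`. -/
theorem exists_foliation {F : ℝ → ℝ → ℝ} {L : NNReal} (hc : Continuous (Function.uncurry F))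
    (hL : ∀ x, LipschitzWith L (F x)) {s m M : ℝ} (hs : s = 1 ∨ s = -1) (hm : 0 < m)
    (hb : ∀ x y, m ≤ s * F x y ∧ s * F x y ≤ M) : Nonempty (Foliation F s m M) := by
  have hss : s * s = 1 := by rcases hs with rfl | rfl <;> norm_num
  have habs : ∀ x y, |F x y| ≤ M := by
    intro x y
    have := hb x y
    rcases hs with rfl | rfl
    · rw [abs_of_nonneg] <;> linarith
    · rw [abs_of_nonpos] <;> linarith
  choose S hS0 hS using exists_global_solution hc hL habs
  have hSS : ∀ x y x', S x' (S x y x') = S x y := fun x y x' =>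
    solution_unique hL (hS _ _) (hS _ _) (x₀ := x') (hS0 _ _)
  have hScont : ∀ x y, Continuous (S x y) := fun x y =>
    continuous_iff_continuousAt.2 fun z => (hS x y z).continuousAt
  have hmono : ∀ x x', StrictMono fun y => S x y x' := by
    intro x x' y y' hy
    have := pos_of_ne_zero_of_continuous (f := fun z => S x y' z - S x y z)
      ((hScont _ _).sub (hScont _ _)) (fun z hz => hy.ne ?_) (a := x) (by simpa [hS0] using hy) x'
    · simpa using this
    · have := solution_unique hL (hS x y) (hS x y') (x₀ := z) (by linarith)
      rw [← hS0 x y, this, hS0]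
  let W : ℝ → ℝ → ℝ := fun u c => S 0 c u
  let H : ℝ → ℝ → ℝ := fun u v => S u v 0
  have H_W : ∀ u c, H u (W u c) = c := fun u c => by simp only [H, W, hSS, hS0]
  have W_H : ∀ u v, W u (H u v) = v := fun u c => by simp only [H, W, hSS, hS0]
  have hH : ∀ u, StrictMono (H u) := fun u => hmono u 0
  have hW : ∀ u, StrictMono (W u) := fun u => hmono 0 u
  have hcW : ∀ c, Continuous fun u => W u c := fun c => hScont 0 c
  -- Joint continuity from the order alone: `c < H u v` means `W u c < v`, an open condition on `(u,
  -- v)` because the single leaf `W · c` is continuous. The same argument with the roles exchanged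
  -- serves for `W`.
  have hcH : Continuous (Function.uncurry H) := by
    refine continuous_iff_continuousAt.2 fun ⟨u, v⟩ => ?_
    refine tendsto_order.2 ⟨fun c hc' => ?_, fun c hc' => ?_⟩
    · have : W u c < v := by
        have := hW u hc'
        simpa [W_H] using this
      have h1 : ∀ᶠ p : ℝ × ℝ in 𝓝 (u, v), W p.1 c < p.2 :=
        ((hcW c).comp continuous_fst).continuousAt.eventually_lt continuous_snd.continuousAt this
      filter_upwards [h1] with p hp
      have := hH p.1 hp
      simpa [H_W, Function.uncurry] using this
    · have : v < W u c := by
        have := hW u hc'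
        simpa [W_H] using this
      have h1 : ∀ᶠ p : ℝ × ℝ in 𝓝 (u, v), p.2 < W p.1 c :=
        continuous_snd.continuousAt.eventually_lt ((hcW c).comp continuous_fst).continuousAt this
      filter_upwards [h1] with p hp
      have := hH p.1 hp
      simpa [H_W, Function.uncurry] using this
  have hcW' : Continuous (Function.uncurry W) := by
    refine continuous_iff_continuousAt.2 fun ⟨u, c⟩ => ?_
    refine tendsto_order.2 ⟨fun v hv => ?_, fun v hv => ?_⟩
    · have : H u v < c := by
        have := hH u hv
        simpa [H_W] using this
      have h1 : ∀ᶠ p : ℝ × ℝ in 𝓝 (u, c), H p.1 v < p.2 :=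
        (hcH.comp (continuous_fst.prodMk continuous_const)).continuousAt.eventually_lt
          continuous_snd.continuousAt this
      filter_upwards [h1] with p hp
      have := hW p.1 hp
      simpa [W_H, Function.uncurry] using this
    · have : c < H u v := by
        have := hH u hv
        simpa [H_W] using this
      have h1 : ∀ᶠ p : ℝ × ℝ in 𝓝 (u, c), p.2 < H p.1 v :=
        continuous_snd.continuousAt.eventually_lt
          (hcH.comp (continuous_fst.prodMk continuous_const)).continuousAt this
      filter_upwards [h1] with p hp
      have := hW p.1 hp
      simpa [W_H, Function.uncurry] using this
  -- increments of the leaves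
  have hinc : ∀ c x x', x ≤ x' → m * (x' - x) ≤ s * W x' c - s * W x c ∧
      s * W x' c - s * W x c ≤ M * (x' - x) := by
    intro c x x' hxx
    have hd : ∀ z, HasDerivAt (fun u => s * W u c) (s * F z (W z c)) z := fun z =>
      (hS 0 c z).const_mul s
    constructor
    · have := mul_sub_le_image_sub_of_le_deriv (f := fun u => s * W u c) (C := m)
        (fun z => (hd z).differentiableAt) (fun z => by rw [(hd z).deriv]; exact (hb _ _).1)
        hxx
      simpa using this
    · have := image_sub_le_mul_sub_of_deriv_le (f := fun u => s * W u c) (C := M)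
        (fun z => (hd z).differentiableAt) (fun z => by rw [(hd z).deriv]; exact (hb _ _).2)
        hxx
      simpa using this
  -- The factor `-s` makes the label of `(u, 0)` an increasing function of `u` for both signs of the
  -- slope.
  let k : ℝ → ℝ := fun u => -s * H u 0
  have hk0 : ∀ u, s * W 0 (H u 0) = - k u := fun u => by simp [W, k, hS0]
  have hWk : ∀ u, W u (H u 0) = 0 := fun u => W_H u 0
  have hk1 : ∀ u, 0 ≤ u → m * u ≤ k u ∧ k u ≤ M * u := by
    intro u hu
    have := hinc (H u 0) 0 u hu
    rw [hk0, hWk] at this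
    constructor <;> nlinarith
  have hk2 : ∀ u, u ≤ 0 → M * u ≤ k u ∧ k u ≤ m * u := by
    intro u hu
    have := hinc (H u 0) u 0 hu
    rw [hk0, hWk] at this
    constructor <;> nlinarith
  have hM : 0 < M := hm.trans_le ((hb 0 0).1.trans (hb 0 0).2)
  have hkmono : StrictMono k := by
    intro x x' hx
    have h1 := (hinc (H x 0) x x' hx.le).1
    rw [hWk] at h1
    have h2 : 0 < s * W x' (H x 0) := by nlinarith
    simp only [k]
    rcases hs with rfl | rfl
    · have : W x' (H x' 0) < W x' (H x 0) := by rw [hWk]; linarith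
      have := (hW x').lt_iff_lt.1 this
      linarith
    · have : W x' (H x 0) < W x' (H x' 0) := by rw [hWk]; linarith
      have := (hW x').lt_iff_lt.1 this
      linarith
  have hkcont : Continuous k :=
    continuous_const.mul (hcH.comp (continuous_id.prodMk continuous_const))
  have hksurj : Function.Surjective k := by
    intro y
    refine mem_range_of_exists_le_of_exists_ge hkcont ⟨-|y| / m, ?_⟩ ⟨|y| / m, ?_⟩
    · have h : -|y| / m ≤ 0 := div_nonpos_of_nonpos_of_nonneg (by simp) hm.le
      refine (hk2 _ h).2.trans ?_
      rw [mul_div_cancel₀ _ hm.ne']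
      exact neg_abs_le y
    · have h : 0 ≤ |y| / m := by positivity
      refine le_trans ?_ (hk1 _ h).1
      rw [mul_div_cancel₀ _ hm.ne']
      exact le_abs_self y
  refine ⟨⟨W, H, hkmono.orderIsoOfSurjective k hksurj, fun c => hS0 0 c, fun u c => hS 0 c u,
    H_W, W_H, hcH, hcW', hH, fun u => ?_, fun u => ?_, fun u => ?_⟩⟩
  · change H u 0 = -s * (-s * H u 0)
    linear_combination (-(H u 0)) * hss
  · change m * |u| ≤ |k u|
    rcases le_total 0 u with h | h
    · rw [abs_of_nonneg h]
      exact (hk1 u h).1.trans (le_abs_self _)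
    · rw [abs_of_nonpos h]
      have := (hk2 u h).2
      have h3 := neg_abs_le (k u)
      nlinarith
  · change |k u| ≤ M * |u|
    rcases le_total 0 u with h | h
    · rw [abs_of_nonneg h, abs_of_nonneg ((by positivity : 0 ≤ m * u).trans (hk1 u h).1)]
      exact (hk1 u h).2
    · rw [abs_of_nonpos h, abs_of_nonpos ((hk2 u h).2.trans (by nlinarith))]
      linarith [(hk2 u h).1]

namespace Foliation

variable {F : ℝ → ℝ → ℝ} {s m M : ℝ} (f : Foliation F s m M)

theorem H_zero (v : ℝ) : f.H 0 v = v := by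
  conv_lhs => rw [← f.W_zero v]
  exact f.H_W 0 v

theorem strictMono_W (u : ℝ) : StrictMono (f.W u) := fun c c' h => by
  have : f.H u (f.W u c) < f.H u (f.W u c') := by simpa [f.H_W] using h
  exact (f.strictMono_H u).lt_iff_lt.1 this

theorem K_zero : f.K 0 = 0 := by
  have := f.K_le 0
  simpa using this

theorem H_axis_of_one (h : s = 1) (u : ℝ) : f.H u 0 = -f.K u :=
  (f.H_axis u).trans ((congrArg (fun x => -x * f.K u) h).trans (by ring))

theorem H_axis_of_neg_one (h : s = -1) (u : ℝ) : f.H u 0 = f.K u :=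
  (f.H_axis u).trans ((congrArg (fun x => -x * f.K u) h).trans (by ring))

end Foliation

end

section


/-! ### Coordinates -/

theorem fin_two_add (i : Fin 2) : i + 1 + 1 = i := by
  fin_cases i <;> rfl

theorem fin_two_ne (i : Fin 2) : i + 1 ≠ i := by
  fin_cases i <;> decide

theorem fin_two_cases (i k : Fin 2) : k = i ∨ k = i + 1 := by
  fin_cases i <;> fin_cases k <;> decide

theorem forall_fin_two' (i : Fin 2) {P : Fin 2 → Prop} : (∀ k, P k) ↔ P i ∧ P (i + 1) :=
  ⟨fun h => ⟨h _, h _⟩, fun h k => (fin_two_cases i k).elim (fun e => e ▸ h.1) fun e => e ▸ h.2⟩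

/-- The point with coordinates `p i = u` and `p (i + 1) = v`. -/
def pt (i : Fin 2) (u v : ℝ) : Plane := EuclideanSpace.single i u + EuclideanSpace.single (i + 1) v

@[simp]
theorem pt_fst (i : Fin 2) (u v : ℝ) : pt i u v i = u := by
  simp [pt]

@[simp]
theorem pt_snd (i : Fin 2) (u v : ℝ) : pt i u v (i + 1) = v := by
  simp [pt]

theorem plane_ext (i : Fin 2) {p q : Plane} (h : p i = q i) (h' : p (i + 1) = q (i + 1)) :
    p = q := by
  ext k
  rcases fin_two_cases i k with rfl | rfl <;> assumption

theorem pt_eta (i : Fin 2) (p : Plane) : pt i (p i) (p (i + 1)) = p :=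
  plane_ext i (pt_fst ..) (pt_snd ..)

@[simp]
theorem pt_zero (i : Fin 2) : pt i 0 0 = 0 := plane_ext i (by simp) (by simp)

theorem plane_eq_zero (i : Fin 2) {p : Plane} : p = 0 ↔ p i = 0 ∧ p (i + 1) = 0 :=
  ⟨fun h => by simp [h], fun h => plane_ext i (by simpa using h.1) (by simpa using h.2)⟩

theorem continuous_coord (k : Fin 2) : Continuous fun p : Plane => p k := by fun_prop

theorem continuous_pt (i : Fin 2) : Continuous fun q : ℝ × ℝ => pt i q.1 q.2 := by
  have h : ∀ k : Fin 2, Continuous fun x : ℝ => (EuclideanSpace.single k x : Plane) := fun k =>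
    (PiLp.continuous_toLp 2 _).comp (_root_.continuous_single (A := fun _ => ℝ) k)
  exact ((h i).comp continuous_fst).add ((h (i + 1)).comp continuous_snd)

theorem abs_coord_le (p : Plane) (k : Fin 2) : |p k| ≤ ‖p‖ := PiLp.norm_apply_le p k

theorem norm_pt_le (i : Fin 2) (u v : ℝ) : ‖pt i u v‖ ≤ |u| + |v| := by
  refine (norm_add_le _ _).trans ?_
  simp

theorem norm_le_coord (i : Fin 2) (p : Plane) : ‖p‖ ≤ |p i| + |p (i + 1)| := by
  conv_lhs => rw [← pt_eta i p]
  exact norm_pt_le ..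

theorem pt_sub_pt (i : Fin 2) (u v v' : ℝ) : pt i u v - pt i u v' = pt i 0 (v - v') :=
  plane_ext i (by simp) (by simp)

theorem mul_coord (i : Fin 2) (p : Plane) : p 0 * p 1 = p i * p (i + 1) := by
  fin_cases i
  · rfl
  · exact mul_comm _ _

theorem mem_switching (i : Fin 2) {p : Plane} : p ∈ switching ↔ p i = 0 ∨ p (i + 1) = 0 := by
  rw [switching, mem_ofPred_eq, mul_coord i, mul_eq_zero]

/-- The square of half-width `ρ`. -/
def box (ρ : ℝ) : Set Plane := {p | ∀ k, |p k| ≤ ρ}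

theorem box_mem_nhds {ρ : ℝ} (hρ : 0 < ρ) : box ρ ∈ 𝓝 (0 : Plane) := by
  filter_upwards [Metric.ball_mem_nhds (0 : Plane) hρ] with p hp k
  exact (abs_coord_le p k).trans (mem_ball_zero_iff.1 hp).le

theorem exists_box_subset {s : Set Plane} (hs : s ∈ 𝓝 (0 : Plane)) :
    ∃ ρ₀ > 0, ∀ ρ ≤ ρ₀, box ρ ⊆ s := by
  obtain ⟨ε, hε, h⟩ := Metric.mem_nhds_iff.1 hs
  refine ⟨ε / 3, by positivity, fun ρ hρ p hp => h (mem_ball_zero_iff.2 ?_)⟩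
  have := norm_le_coord 0 p
  linarith [hp 0, hp (0 + 1)]

theorem box_mono {ρ ρ' : ℝ} (h : ρ ≤ ρ') : box ρ ⊆ box ρ' := fun _ hp k => (hp k).trans h

theorem pt_mem_box {i : Fin 2} {ρ u v : ℝ} : pt i u v ∈ box ρ ↔ |u| ≤ ρ ∧ |v| ≤ ρ := by
  rw [box, mem_ofPred_eq, forall_fin_two' i, pt_fst, pt_snd]

theorem hasDerivWithinAt_coord {γ : ℝ → Plane} {w : Plane} {J : Set ℝ} {t : ℝ}
    (h : HasDerivWithinAt γ w J t) (k : Fin 2) : HasDerivWithinAt (fun s => γ s k) (w k) J t :=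
  (EuclideanSpace.proj (𝕜 := ℝ) k : Plane →L[ℝ] ℝ).hasFDerivAt.comp_hasDerivWithinAt t h

/-! ### The foliation defined by a vector field near the origin -/

/-- In the square of half-width `ρ` the field `V` is bounded and has the slope `F`, which is defined
on the whole plane. The signs of `V_i` and of the slope are `ε` and `s`. -/
structure FieldChart (V : Plane → Plane) (i : Fin 2) (ε s m M ρ : ℝ) where
  F : ℝ → ℝ → ℝ
  L : NNReal
  lip : ∀ x, LipschitzWith L (F x)
  fol : Foliation F s m M
  slope : ∀ p ∈ box ρ, V p (i + 1) = F (p i) (p (i + 1)) * V p i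
  le_slope : ∀ x y, m ≤ s * F x y
  c : ℝ
  C : ℝ
  c_pos : 0 < c
  speed : ∀ p ∈ box ρ, c ≤ ε * V p i ∧ ε * V p i ≤ C
  cont : ContinuousOn V (box ρ)

theorem mem_box_zero {ρ : ℝ} (hρ : 0 ≤ ρ) : (0 : Plane) ∈ box ρ := fun k => by simpa using hρ

theorem abs_eq_one_of_sign {s : ℝ} (hs : s = 1 ∨ s = -1) : |s| = 1 := by
  rcases hs with rfl | rfl <;> simp

/-- Since `V_i` does not vanish near the origin, the slope `V_{i+1} / V_i` is of class `C^1`, hence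
Lipschitz on a small square. Evaluating it at the point clamped to the square extends it to the
plane with the same bounds and the same Lipschitz constant in the second variable. -/
theorem exists_fieldChart {U : Set Plane} {r : ℕ} (hr : 1 ≤ r) (hU : IsOpen U)
    (h0 : (0 : Plane) ∈ U) (V : VField U r) (i : Fin 2) {ε s m M : ℝ}
    (hs : s = 1 ∨ s = -1) (hVi : 0 < ε * V 0 i) (hm : 0 < m)
    (hm1 : m < s * (V 0 (i + 1) / V 0 i)) (hM1 : s * (V 0 (i + 1) / V 0 i) < M) :
    ∃ ρ₀ > 0, ∀ ρ, 0 < ρ → ρ ≤ ρ₀ → box ρ ⊆ U ∧ Nonempty (FieldChart V i ε s m M ρ) := by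
  have hcd : ContDiffAt ℝ 1 V 0 :=
    (V.contDiffOn.contDiffAt (hU.mem_nhds h0)).of_le (by exact_mod_cast hr)
  have hcdk : ∀ k : Fin 2, ContDiffAt ℝ 1 (fun p => V p k) 0 := fun k =>
    (contDiffAt_piLp 2).1 hcd k
  have hVi0 : V 0 i ≠ 0 := by
    rintro h
    rw [h] at hVi
    simp at hVi
  set g : Plane → ℝ := fun p => V p (i + 1) / V p i with hg
  have hgcd : ContDiffAt ℝ 1 g 0 := (hcdk (i + 1)).div (hcdk i) hVi0
  obtain ⟨L, t, ht, hLt⟩ := hgcd.exists_lipschitzOnWith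
  have e1 : ∀ᶠ p in 𝓝 (0 : Plane), ε * V 0 i / 2 < ε * V p i :=
    continuousAt_const.eventually_lt ((hcdk i).continuousAt.const_mul ε)
      (by linarith)
  have e2 : ∀ᶠ p in 𝓝 (0 : Plane), ε * V p i < 2 * (ε * V 0 i) :=
    ((hcdk i).continuousAt.const_mul ε).eventually_lt continuousAt_const (by linarith)
  have e3 : ∀ᶠ p in 𝓝 (0 : Plane), m < s * g p :=
    continuousAt_const.eventually_lt (hgcd.continuousAt.const_mul s) hm1
  have e4 : ∀ᶠ p in 𝓝 (0 : Plane), s * g p < M :=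
    (hgcd.continuousAt.const_mul s).eventually_lt continuousAt_const hM1
  obtain ⟨ρ₀, hρ₀, hbox⟩ := exists_box_subset
    (((e1.and e2).and (e3.and e4)).and ((show ∀ᶠ p in 𝓝 (0 : Plane), p ∈ U from hU.mem_nhds h0).and
      (show ∀ᶠ p in 𝓝 (0 : Plane), p ∈ t from ht)))
  refine ⟨ρ₀, hρ₀, fun ρ hρ hρ' => ?_⟩
  replace hbox := hbox ρ hρ'
  refine ⟨fun p hp => (hbox hp).2.1, ?_⟩
  let cl : ℝ → ℝ := fun x => max (-ρ) (min x ρ)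
  have hcl : ∀ x, |cl x| ≤ ρ := fun x =>
    abs_le.2 ⟨le_max_left _ _, max_le (by linarith) (min_le_right _ _)⟩
  have hcl' : ∀ x, |x| ≤ ρ → cl x = x := fun x hx => by
    have := abs_le.1 hx
    simp only [cl]
    rw [min_eq_left this.2, max_eq_right this.1]
  have hclc : Continuous cl := by fun_prop
  have hcl1 : ∀ x y, |cl x - cl y| ≤ |x - y| := fun x y =>
    (abs_max_sub_max_le_max _ _ _ _).trans
      (max_le (by simp) ((abs_min_sub_min_le_max _ _ _ _).trans (max_le le_rfl (by simp))))
  let q : ℝ → ℝ → Plane := fun x y => pt i (cl x) (cl y)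
  have hq : ∀ x y, q x y ∈ box ρ := fun x y => pt_mem_box.2 ⟨hcl x, hcl y⟩
  have hcdU : ContinuousOn V U := V.contDiffOn.continuousOn
  have hVne : ∀ p ∈ box ρ, V p i ≠ 0 := fun p hp h => by
    have := (hbox hp).1.1.1
    simp only [h, mul_zero] at this
    linarith
  have hVc : ContinuousOn V (box ρ) := hcdU.mono fun p hp => (hbox hp).2.1
  have hgc : ContinuousOn g (box ρ) :=
    ((continuous_coord _).comp_continuousOn hVc).div ((continuous_coord _).comp_continuousOn hVc)
      hVne
  let F : ℝ → ℝ → ℝ := fun x y => g (q x y)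
  have hFc : Continuous (Function.uncurry F) :=
    hgc.comp_continuous ((continuous_pt i).comp
      ((hclc.comp continuous_fst).prodMk (hclc.comp continuous_snd))) fun z => hq z.1 z.2
  have hFL : ∀ x, LipschitzWith L (F x) := fun x => LipschitzWith.of_dist_le_mul fun y y' => by
    refine (hLt.dist_le_mul _ (hbox (hq x y)).2.2 _ (hbox (hq x y')).2.2).trans ?_
    refine mul_le_mul_of_nonneg_left ?_ L.2
    rw [dist_eq_norm, pt_sub_pt]
    refine (norm_pt_le _ _ _).trans ?_
    simpa [Real.dist_eq] using hcl1 y y'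
  obtain ⟨fol⟩ := exists_foliation hFc hFL hs hm
    (fun x y => ⟨(hbox (hq x y)).1.2.1.le, (hbox (hq x y)).1.2.2.le⟩)
  refine ⟨⟨F, L, hFL, fol, fun p hp => ?_, fun x y => (hbox (hq x y)).1.2.1.le,
    ε * V 0 i / 2, 2 * (ε * V 0 i), by positivity,
    fun p hp => ⟨(hbox hp).1.1.1.le, (hbox hp).1.1.2.le⟩, hVc⟩⟩
  have : q (p i) (p (i + 1)) = p := by
    simp only [q]
    rw [hcl' _ (hp _), hcl' _ (hp _), pt_eta]
  simp only [F, this, hg]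
  rw [div_mul_cancel₀ _ (hVne p hp)]

namespace FieldChart

variable {V : Plane → Plane} {i : Fin 2} {ε s m M ρ : ℝ} (ch : FieldChart V i ε s m M ρ)

/-- The label of the leaf through `p`. -/
def lab (p : Plane) : ℝ := ch.fol.H (p i) (p (i + 1))

theorem continuous_lab : Continuous ch.lab :=
  ch.fol.continuous_H.comp ((continuous_coord _).prodMk (continuous_coord _))

theorem speed_snd (ch : FieldChart V i ε s m M ρ) (hm : 0 < m) {p : Plane} (hp : p ∈ box ρ) :
    0 < s * (ε * V p (i + 1)) := by
  rw [ch.slope p hp]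
  have h1 := ch.le_slope (p i) (p (i + 1))
  have h2 := (ch.speed p hp).1
  have h3 := ch.c_pos
  calc 0 < (s * ch.F (p i) (p (i + 1))) * (ε * V p i) := by
        apply mul_pos <;> linarith
    _ = _ := by ring

/-- Grönwall: the vertical distance `d` between the solution and the leaf through `γ a` satisfies
`|d'| ≤ L * C * |d|` and vanishes at `a`. -/
theorem lab_eq_of_solution (hε : ε = 1 ∨ ε = -1) {γ : ℝ → Plane} {a b : ℝ} (hab : a ≤ b)
    (hγ : ∀ t ∈ Icc a b, γ t ∈ box ρ ∧ HasDerivWithinAt γ (V (γ t)) (Icc a b) t) :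
    ch.lab (γ b) = ch.lab (γ a) := by
  set c := ch.lab (γ a) with hc
  have hcont : ContinuousOn γ (Icc a b) := fun t ht => (hγ t ht).2.continuousWithinAt
  have hd : ∀ t ∈ Icc a b, HasDerivWithinAt (fun t => γ t (i + 1) - ch.fol.W (γ t i) c)
      (V (γ t) (i + 1) - ch.F (γ t i) (ch.fol.W (γ t i) c) * V (γ t) i) (Icc a b) t := by
    intro t ht
    exact (hasDerivWithinAt_coord (hγ t ht).2 (i + 1)).sub
      (HasDerivAt.comp_hasDerivWithinAt (h₂ := fun x => ch.fol.W x c) (h := fun t => γ t i) t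
        (ch.fol.hasDerivAt_W (γ t i) c) (hasDerivWithinAt_coord (hγ t ht).2 i))
  have hb := eq_zero_of_abs_deriv_le_mul_abs_self_of_eq_zero_right (K := ch.L * ch.C)
    (fun t ht => (hd t ht).continuousWithinAt)
    (fun t ht => (hd t (Ico_subset_Icc_self ht)).mono_of_mem_nhdsWithin
      (Icc_mem_nhdsGE_of_mem ht))
    (by simp [hc, lab, ch.fol.W_H]) ?_ b (right_mem_Icc.2 hab)
  · rw [sub_eq_zero] at hb
    rw [lab, hb, ch.fol.H_W]
  · intro t ht
    have ht' := Ico_subset_Icc_self ht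
    rw [ch.slope _ (hγ t ht').1, ← sub_mul, norm_mul]
    have h1 := (ch.lip (γ t i)).dist_le_mul (γ t (i + 1)) (ch.fol.W (γ t i) c)
    rw [Real.dist_eq, Real.dist_eq] at h1
    have h2 : |V (γ t) i| ≤ ch.C := by
      have := ch.speed _ (hγ t ht').1
      have h3 := ch.c_pos
      rw [← one_mul |V (γ t) i|, ← abs_eq_one_of_sign hε, ← abs_mul, abs_of_nonneg (by linarith)]
      exact this.2
    simp only [Real.norm_eq_abs]
    calc _ ≤ (ch.L * |γ t (i + 1) - ch.fol.W (γ t i) c|) * ch.C :=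
          mul_le_mul h1 h2 (abs_nonneg _) (by positivity)
      _ = _ := by ring

end FieldChart

end

section


/-! ### Increasing homeomorphisms of the line -/

/-- The conjugate of `e` by `x ↦ -x`. -/
def negConj (e : ℝ ≃o ℝ) : ℝ ≃o ℝ where
  toFun x := -e (-x)
  invFun x := -e.symm (-x)
  left_inv x := by simp
  right_inv x := by simp
  map_rel_iff' := by simp

@[simp]
theorem negConj_apply (e : ℝ ≃o ℝ) (x : ℝ) : negConj e x = -e (-x) := rfl

@[simp]
theorem negConj_symm_apply (e : ℝ ≃o ℝ) (x : ℝ) : (negConj e).symm x = -e.symm (-x) := rfl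

theorem symm_fix {e : ℝ ≃o ℝ} (h : e 0 = 0) : e.symm 0 = 0 := by
  rw [OrderIso.symm_apply_eq, h]

theorem apply_nonneg {e : ℝ ≃o ℝ} (h : e 0 = 0) {x : ℝ} : 0 ≤ e x ↔ 0 ≤ x := by
  conv_lhs => rw [← h]
  exact e.le_iff_le

theorem apply_nonpos {e : ℝ ≃o ℝ} (h : e 0 = 0) {x : ℝ} : e x ≤ 0 ↔ x ≤ 0 := by
  conv_lhs => rw [← h]
  exact e.le_iff_le

theorem apply_pos {e : ℝ ≃o ℝ} (h : e 0 = 0) {x : ℝ} : 0 < e x ↔ 0 < x := by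
  conv_lhs => rw [← h]
  exact e.lt_iff_lt

theorem apply_neg {e : ℝ ≃o ℝ} (h : e 0 = 0) {x : ℝ} : e x < 0 ↔ x < 0 := by
  conv_lhs => rw [← h]
  exact e.lt_iff_lt

theorem apply_eq_zero {e : ℝ ≃o ℝ} (h : e 0 = 0) {x : ℝ} : e x = 0 ↔ x = 0 := by
  conv_lhs => rw [← h]
  exact e.injective.eq_iff

/-- The function equal to `a` on `[0, ∞)` and to `b` on `(-∞, 0)`. -/
def glueFun (a b : ℝ ≃o ℝ) (x : ℝ) : ℝ := if 0 ≤ x then a x else b x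

theorem glueFun_symm {a b : ℝ ≃o ℝ} (ha : a 0 = 0) (hb : b 0 = 0) (x : ℝ) :
    glueFun a.symm b.symm (glueFun a b x) = x := by
  unfold glueFun
  by_cases h : 0 ≤ x
  · rw [if_pos h, if_pos ((apply_nonneg ha).2 h), a.symm_apply_apply]
  · rw [if_neg h, if_neg (fun h' => h ((apply_nonneg hb).1 h')), b.symm_apply_apply]

theorem strictMono_glueFun {a b : ℝ ≃o ℝ} (ha : a 0 = 0) (hb : b 0 = 0) :
    StrictMono (glueFun a b) := by
  intro x y hxy
  unfold glueFun
  by_cases h : 0 ≤ x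
  · rw [if_pos h, if_pos (h.trans hxy.le)]
    exact a.strictMono hxy
  · rw [if_neg h]
    by_cases h' : 0 ≤ y
    · rw [if_pos h']
      exact ((apply_neg hb).2 (not_le.1 h)).trans_le ((apply_nonneg ha).2 h')
    · rw [if_neg h']
      exact b.strictMono hxy

/-- The homeomorphism equal to `a` on `[0, ∞)` and to `b` on `(-∞, 0]`. -/
def glue (a b : ℝ ≃o ℝ) (ha : a 0 = 0) (hb : b 0 = 0) : ℝ ≃o ℝ where
  toFun := glueFun a b
  invFun := glueFun a.symm b.symm
  left_inv := glueFun_symm ha hb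
  right_inv := glueFun_symm (symm_fix ha) (symm_fix hb)
  map_rel_iff' := (strictMono_glueFun ha hb).le_iff_le

theorem glue_of_nonneg {a b : ℝ ≃o ℝ} (ha : a 0 = 0) (hb : b 0 = 0) {x : ℝ} (hx : 0 ≤ x) :
    glue a b ha hb x = a x := if_pos hx

theorem glue_of_nonpos {a b : ℝ ≃o ℝ} (ha : a 0 = 0) (hb : b 0 = 0) {x : ℝ} (hx : x ≤ 0) :
    glue a b ha hb x = b x := by
  rcases hx.eq_or_lt with rfl | h
  · rw [glue_of_nonneg ha hb le_rfl, ha, hb]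
  · exact if_neg (not_le.2 h)

/-! ### Conjugacy of contractions -/

/-- The interval `[f 1, 1)` is a fundamental domain of the contraction `f` on the positive half
line. Its translates by the integer powers of `f` cover this half line, and this yields a coordinate
in which `f` becomes `t ↦ t - 1`. -/
theorem exists_abel_coordinate (f : ℝ ≃o ℝ) {l : ℝ} (hl0 : 0 < l) (hl : l < 1)
    (hf : ∀ x, 0 ≤ x → 0 ≤ f x ∧ f x ≤ l * x) :
    ∃ E : ℝ → ℝ, StrictMono E ∧ (∀ t, 0 < E t) ∧ (∀ x, 0 < x → ∃ t, E t = x) ∧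
      ∀ t, f (E (t + 1)) = E t := by
  have hf0 : f 0 = 0 := le_antisymm (by simpa using (hf 0 le_rfl).2) (hf 0 le_rfl).1
  have hz0 : ∀ n : ℤ, (f ^ n) 0 = 0 := by
    have h1 : ∀ n : ℕ, (f ^ n) 0 = 0 := by
      intro n
      induction n with
      | zero => simp
      | succ n ih => rw [pow_succ, RelIso.mul_apply, hf0, ih]
    intro n
    obtain ⟨k, rfl | rfl⟩ := n.eq_nat_or_neg
    · simpa using h1 k
    · rw [zpow_neg, zpow_natCast]
      exact symm_fix (h1 k)
  have hpow : ∀ (n : ℕ) x, 0 ≤ x → (f ^ n) x ≤ l ^ n * x := by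
    intro n
    induction n with
    | zero => simp
    | succ n ih =>
      intro x hx
      rw [pow_succ, RelIso.mul_apply]
      refine (ih _ (hf x hx).1).trans ?_
      rw [pow_succ, mul_assoc]
      exact mul_le_mul_of_nonneg_left (hf x hx).2 (by positivity)
  have hf1 : f 1 < 1 := (hf 1 zero_le_one).2.trans_lt (by simpa using hl)
  have hf1' : 0 < f 1 := (apply_pos hf0).2 one_pos
  -- Affine parametrisation of the fundamental domain by `[0, 1)`. The integer part of `t` selects
  -- the power of `f`, with a minus sign so that `E` increases.
  let A : ℝ → ℝ := fun s => f 1 + s * (1 - f 1)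
  have hA : ∀ s, 0 ≤ s → s < 1 → f 1 ≤ A s ∧ A s < 1 := fun s h1 h2 => by
    simp only [A]
    constructor <;> nlinarith
  let E : ℝ → ℝ := fun t => (f ^ (-⌊t⌋)) (A (Int.fract t))
  have hEA : ∀ t, f 1 ≤ A (Int.fract t) ∧ A (Int.fract t) < 1 := fun t =>
    hA _ (Int.fract_nonneg t) (Int.fract_lt_one t)
  have hzmono : ∀ n m : ℤ, n ≤ m → (f ^ m) 1 ≤ (f ^ n) 1 := by
    intro n m hnm
    obtain ⟨k, rfl⟩ := Int.le.dest hnm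
    rw [zpow_add, RelIso.mul_apply, zpow_natCast]
    refine (f ^ n).monotone ((hpow k 1 zero_le_one).trans ?_)
    rw [mul_one]
    exact pow_le_one₀ hl0.le hl.le
  refine ⟨E, fun t t' htt => ?_, fun t => ?_, fun x hx => ?_, fun t => ?_⟩
  · rcases (Int.floor_mono htt.le).eq_or_lt with h | h
    · simp only [E]
      rw [h]
      refine (f ^ (-⌊t'⌋)).strictMono ?_
      simp only [A, Int.fract, h]
      nlinarith
    · calc E t < (f ^ (-⌊t⌋)) 1 := (f ^ (-⌊t⌋)).strictMono (hEA t).2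
        _ ≤ (f ^ (-⌊t'⌋ + 1)) 1 := hzmono _ _ (by omega)
        _ = (f ^ (-⌊t'⌋)) (f 1) := by rw [zpow_add_one, RelIso.mul_apply]
        _ ≤ E t' := (f ^ (-⌊t'⌋)).monotone (hEA t').1
  · simp only [E]
    rw [apply_pos (hz0 _)]
    exact hf1'.trans_le (hEA t).1
  · have hbig : ∃ k : ℕ, l ^ k * x < 1 := by
      obtain ⟨k, hk⟩ := exists_pow_lt_of_lt_one (by positivity : 0 < 1 / x) hl
      exact ⟨k, by rwa [lt_div_iff₀ hx] at hk⟩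
    have hsmall : ∃ k : ℕ, l ^ k < x := exists_pow_lt_of_lt_one hx hl
    obtain ⟨k, hk⟩ := hbig
    obtain ⟨k', hk'⟩ := hsmall
    have hbdd : ∀ n : ℤ, (f ^ n) x < 1 → -(k' : ℤ) ≤ n := by
      intro n hn
      by_contra! hlt
      have h1 : (f ^ (-n)) 1 ≤ (f ^ (k' : ℤ)) 1 := hzmono _ _ (by omega)
      have h2 : (f ^ (k' : ℤ)) 1 < x := by
        rw [zpow_natCast]
        exact (hpow k' 1 zero_le_one).trans_lt (by simpa using hk')
      have h3 : x < (f ^ (-n)) 1 := by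
        have := (f ^ (-n)).strictMono hn
        rwa [← RelIso.mul_apply, ← zpow_add, neg_add_cancel, zpow_zero] at this
      linarith
    -- The least `n` with `(f ^ n) x < 1` brings `x` into the fundamental domain: by minimality the
    -- previous iterate is at least `1`.
    obtain ⟨n, hn, hmin⟩ := Int.exists_least_of_bdd (P := fun n : ℤ => (f ^ n) x < 1)
      ⟨-(k' : ℤ), hbdd⟩ ⟨k, by
        rw [zpow_natCast]
        exact (hpow k x hx.le).trans_lt hk⟩
    have hn' : f 1 ≤ (f ^ n) x := by
      have : 1 ≤ (f ^ (n - 1)) x := by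
        by_contra! h
        have := hmin _ h
        omega
      have := f.monotone this
      rwa [← RelIso.mul_apply, ← zpow_one_add, add_sub_cancel] at this
    let s : ℝ := ((f ^ n) x - f 1) / (1 - f 1)
    have hs0 : 0 ≤ s := div_nonneg (by linarith) (by linarith)
    have hs1 : s < 1 := by
      rw [div_lt_one (by linarith)]
      linarith
    have hAs : A s = (f ^ n) x := by
      simp only [A, s]
      rw [div_mul_cancel₀ _ (by linarith)]
      ring
    refine ⟨n + s, ?_⟩
    simp only [E]
    have hfl : ⌊(n : ℝ) + s⌋ = n := by
      rw [Int.floor_intCast_add, Int.floor_eq_zero_iff.2 ⟨hs0, hs1⟩, add_zero]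
    rw [Int.fract, hfl, add_sub_cancel_left, hAs, ← RelIso.mul_apply, ← zpow_add, neg_add_cancel,
      zpow_zero]
    rfl
  · simp only [E]
    rw [Int.floor_add_one, Int.fract_add_one, ← RelIso.mul_apply, ← zpow_one_add]
    congr 2
    ring

/-- The square of `P` preserves the positive half line and contracts it by `l ^ 2 ≤ l`, so Abel
coordinates of both squares give a conjugacy there. On the negative half line, the image of the
positive one under `P`, the equation `χ ∘ P = P' ∘ χ` dictates the values. -/
theorem exists_conjugacy {P P' : ℝ → ℝ} (hP : StrictAnti P) (hPs : Function.Surjective P)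
    (hP' : StrictAnti P') (hPs' : Function.Surjective P') {l : ℝ} (hl0 : 0 < l) (hl : l < 1)
    (h : ∀ x, |P x| ≤ l * |x|) (h' : ∀ x, |P' x| ≤ l * |x|) :
    ∃ χ : ℝ ≃o ℝ, χ 0 = 0 ∧ ∀ x, χ (P x) = P' (χ x) := by
  have key : ∀ P : ℝ → ℝ, StrictAnti P → Function.Surjective P → (∀ x, |P x| ≤ l * |x|) →
      P 0 = 0 ∧ ∃ E : ℝ → ℝ, StrictMono E ∧ (∀ t, 0 < E t) ∧ (∀ x, 0 < x → ∃ t, E t = x) ∧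
      ∀ t, P (P (E (t + 1))) = E t := by
    intro P hP hPs h
    have h0 : P 0 = 0 := by simpa using h 0
    refine ⟨h0, ?_⟩
    let f : ℝ ≃o ℝ := (hP.comp hP).orderIsoOfSurjective _ (hPs.comp hPs)
    have hf : ∀ x, f x = P (P x) := fun x => rfl
    refine exists_abel_coordinate f hl0 hl fun x hx => ?_
    have h1 : P x ≤ 0 := h0 ▸ hP.antitone hx
    have h2 : 0 ≤ P (P x) := h0 ▸ hP.antitone h1
    have h3 := h x
    have h4 := h (P x)
    rw [abs_of_nonneg h2] at h4
    rw [abs_of_nonneg hx] at h3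
    refine ⟨h2, (h4.trans ?_ : P (P x) ≤ l * x)⟩
    nlinarith
  obtain ⟨h0, E, hE, hEp, hEs, hEf⟩ := key P hP hPs h
  obtain ⟨h0', E', hE', hEp', hEs', hEf'⟩ := key P' hP' hPs' h'
  have hT : ∃ T : ℝ → ℝ, ∀ x, 0 < x → E (T x) = x :=
    ⟨fun x => if hx : 0 < x then (hEs x hx).choose else 0, fun x hx => by
      simp only [hx, dif_pos]
      exact (hEs x hx).choose_spec⟩
  obtain ⟨T, hT⟩ := hT
  have hTE : ∀ t, T (E t) = t := fun t => hE.injective (hT _ (hEp t))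
  obtain ⟨Q, hQ⟩ := hPs.hasRightInverse
  have hQP : ∀ x, Q (P x) = x := fun x => hP.injective (hQ _)
  have hPneg : ∀ x, 0 < x → P x < 0 := fun x hx => h0 ▸ hP hx
  have hPneg' : ∀ x, 0 < x → P' x < 0 := fun x hx => h0' ▸ hP' hx
  have hPpos : ∀ x, x < 0 → 0 < P x := fun x hx => h0 ▸ hP hx
  have hQpos : ∀ x, x < 0 → 0 < Q x := fun x hx => by
    by_contra! hn
    have := hP.antitone hn
    rw [hQ, h0] at this
    linarith
  have hTm : ∀ x y, 0 < x → x < y → T x < T y := fun x y hx hxy => by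
    rw [← hE.lt_iff_lt, hT x hx, hT y (hx.trans hxy)]
    exact hxy
  -- `T` inverts the Abel coordinate `E`, and `Q` inverts `P`. The third branch is forced by the
  -- conjugacy equation at `Q x > 0`.
  let X : ℝ → ℝ := fun x => if 0 < x then E' (T x) else if x = 0 then 0 else P' (E' (T (Q x)))
  have X0 : X 0 = 0 := by simp [X]
  have Xp : ∀ x, 0 < x → X x = E' (T x) := fun x hx => if_pos hx
  have Xn : ∀ x, x < 0 → X x = P' (E' (T (Q x))) := fun x hx => by
    simp only [X]
    rw [if_neg (not_lt.2 hx.le), if_neg hx.ne]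
  have Xpos : ∀ x, 0 < x → 0 < X x := fun x hx => by rw [Xp x hx]; exact hEp' _
  have Xneg : ∀ x, x < 0 → X x < 0 := fun x hx => by rw [Xn x hx]; exact hPneg' _ (hEp' _)
  have Xmono : StrictMono X := by
    intro x y hxy
    rcases lt_trichotomy x 0 with hx | rfl | hx
    · rcases lt_trichotomy y 0 with hy | rfl | hy
      · rw [Xn x hx, Xn y hy]
        refine hP' (hE' (hTm _ _ (hQpos y hy) ?_))
        rw [← hP.lt_iff_gt, hQ, hQ]
        exact hxy
      · rw [X0]; exact Xneg x hx
      · exact (Xneg x hx).trans (Xpos y hy)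
    · rw [X0]; exact Xpos y hxy
    · rw [Xp x hx, Xp y (hx.trans hxy)]
      exact hE' (hTm _ _ hx hxy)
  have Xsurj : Function.Surjective X := by
    intro y
    rcases lt_trichotomy y 0 with hy | rfl | hy
    · obtain ⟨z, rfl⟩ := hPs' y
      have hz : 0 < z := by
        by_contra! hn
        have := hP'.antitone hn
        rw [h0'] at this
        linarith
      obtain ⟨t, rfl⟩ := hEs' z hz
      exact ⟨P (E t), by rw [Xn _ (hPneg _ (hEp t)), hQP, hTE]⟩
    · exact ⟨0, X0⟩
    · obtain ⟨t, rfl⟩ := hEs' y hy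
      exact ⟨E t, by rw [Xp _ (hEp t), hTE]⟩
  refine ⟨Xmono.orderIsoOfSurjective X Xsurj, X0, fun x => (?_ : X (P x) = P' (X x))⟩
  rcases lt_trichotomy x 0 with hx | rfl | hx
  · obtain ⟨t, ht⟩ := hEs _ (hQpos x hx)
    have hPx : P x = E (t - 1) := by
      have := hEf (t - 1)
      rw [sub_add_cancel, ht, hQ] at this
      exact this
    have := hEf' (t - 1)
    rw [sub_add_cancel] at this
    rw [Xn x hx, Xp _ (hPpos x hx), hPx, ← ht, hTE, hTE, this]
  · rw [h0, X0, h0']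
  · rw [Xn _ (hPneg x hx), Xp x hx, hQP]

end

section


/-! ### Fibre preserving homeomorphisms matching two pairs of foliations -/

/-- The map over `χ` sending the leaf labelled `c` to the leaf labelled `e c`. -/
def leafMap {F F' : ℝ → ℝ → ℝ} {s m M m' M' : ℝ} (f : Foliation F s m M)
    (f' : Foliation F' s m' M') (χ e : ℝ ≃o ℝ) (u v : ℝ) : ℝ :=
  f'.W (χ u) (e (f.H u v))

section leafMap

variable {F F' : ℝ → ℝ → ℝ} {s m M m' M' : ℝ} (f : Foliation F s m M)
    (f' : Foliation F' s m' M') (χ e : ℝ ≃o ℝ)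

theorem continuous_leafMap : Continuous (Function.uncurry (leafMap f f' χ e)) :=
  f'.continuous_W.comp ((χ.continuous.comp continuous_fst).prodMk
    (e.continuous.comp f.continuous_H))

theorem strictMono_leafMap (u : ℝ) : StrictMono (leafMap f f' χ e u) := fun _ _ h =>
  f'.strictMono_W _ (e.strictMono (f.strictMono_H u h))

theorem H_leafMap (u v : ℝ) : f'.H (χ u) (leafMap f f' χ e u v) = e (f.H u v) := f'.H_W _ _

theorem leafMap_leafMap (u v : ℝ) :
    leafMap f' f χ.symm e.symm (χ u) (leafMap f f' χ e u v) = v := by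
  rw [leafMap, H_leafMap, e.symm_apply_apply, χ.symm_apply_apply, f.W_H]

theorem leafMap_axis (u : ℝ) (h : e (f.H u 0) = f'.H (χ u) 0) : leafMap f f' χ e u 0 = 0 := by
  rw [leafMap, h, f'.W_H]

theorem leafMap_zero (hχ : χ 0 = 0) (v : ℝ) : leafMap f f' χ e 0 v = e v := by
  rw [leafMap, hχ, f.H_zero, f'.W_zero]

end leafMap

/-- Correspondences `A`, `B`, `C`, `D` of the leaves in the four closed quadrants (`X` acts in the
first and third one, `Y` in the second and fourth one), which agree with the maps `χ` and `ζ` of the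
axes. -/
structure Matching {FX FY FX' FY' : ℝ → ℝ → ℝ} {sX sY mX MX mY MY mX' MX' mY' MY' : ℝ}
    (fX : Foliation FX sX mX MX) (fY : Foliation FY sY mY MY) (fX' : Foliation FX' sX mX' MX')
    (fY' : Foliation FY' sY mY' MY') where
  χ : ℝ ≃o ℝ
  ζ : ℝ ≃o ℝ
  A : ℝ ≃o ℝ
  B : ℝ ≃o ℝ
  C : ℝ ≃o ℝ
  D : ℝ ≃o ℝ
  χ_zero : χ 0 = 0
  ζ_zero : ζ 0 = 0
  A_eq : ∀ c, 0 ≤ c → A c = ζ c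
  B_eq : ∀ c, 0 ≤ c → B c = ζ c
  C_eq : ∀ c, c ≤ 0 → C c = ζ c
  D_eq : ∀ c, c ≤ 0 → D c = ζ c
  A_axis : ∀ u, 0 ≤ u → A (fX.H u 0) = fX'.H (χ u) 0
  B_axis : ∀ u, u ≤ 0 → B (fY.H u 0) = fY'.H (χ u) 0
  C_axis : ∀ u, u ≤ 0 → C (fX.H u 0) = fX'.H (χ u) 0
  D_axis : ∀ u, 0 ≤ u → D (fY.H u 0) = fY'.H (χ u) 0

namespace Matching

variable {FX FY FX' FY' : ℝ → ℝ → ℝ} {sX sY mX MX mY MY mX' MX' mY' MY' : ℝ}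
    {fX : Foliation FX sX mX MX} {fY : Foliation FY sY mY MY} {fX' : Foliation FX' sX mX' MX'}
    {fY' : Foliation FY' sY mY' MY'} (g : Matching fX fY fX' fY')

/-- The inverse correspondences. -/
def symm : Matching fX' fY' fX fY where
  χ := g.χ.symm
  ζ := g.ζ.symm
  A := g.A.symm
  B := g.B.symm
  C := g.C.symm
  D := g.D.symm
  χ_zero := symm_fix g.χ_zero
  ζ_zero := symm_fix g.ζ_zero
  A_eq c hc := by
    rw [OrderIso.symm_apply_eq, g.A_eq _ ((apply_nonneg (symm_fix g.ζ_zero)).2 hc),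
      OrderIso.apply_symm_apply]
  B_eq c hc := by
    rw [OrderIso.symm_apply_eq, g.B_eq _ ((apply_nonneg (symm_fix g.ζ_zero)).2 hc),
      OrderIso.apply_symm_apply]
  C_eq c hc := by
    rw [OrderIso.symm_apply_eq, g.C_eq _ ((apply_nonpos (symm_fix g.ζ_zero)).2 hc),
      OrderIso.apply_symm_apply]
  D_eq c hc := by
    rw [OrderIso.symm_apply_eq, g.D_eq _ ((apply_nonpos (symm_fix g.ζ_zero)).2 hc),
      OrderIso.apply_symm_apply]
  A_axis u hu := by
    rw [OrderIso.symm_apply_eq, g.A_axis _ ((apply_nonneg (symm_fix g.χ_zero)).2 hu),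
      OrderIso.apply_symm_apply]
  B_axis u hu := by
    rw [OrderIso.symm_apply_eq, g.B_axis _ ((apply_nonpos (symm_fix g.χ_zero)).2 hu),
      OrderIso.apply_symm_apply]
  C_axis u hu := by
    rw [OrderIso.symm_apply_eq, g.C_axis _ ((apply_nonpos (symm_fix g.χ_zero)).2 hu),
      OrderIso.apply_symm_apply]
  D_axis u hu := by
    rw [OrderIso.symm_apply_eq, g.D_axis _ ((apply_nonneg (symm_fix g.χ_zero)).2 hu),
      OrderIso.apply_symm_apply]

/-- The second component of the homeomorphism, glued from the maps of the four quadrants. -/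
def η (u v : ℝ) : ℝ :=
  -- Each summand is evaluated at the point clamped to its own quadrant. In a given quadrant the
  -- other three reduce to values on the axes, namely `0` or values of `ζ`, which the last two terms
  -- remove. A formula without cases makes continuity immediate.
  leafMap fX fX' g.χ g.A (max u 0) (max v 0) + leafMap fY fY' g.χ g.B (min u 0) (max v 0) +
    leafMap fX fX' g.χ g.C (min u 0) (min v 0) + leafMap fY fY' g.χ g.D (max u 0) (min v 0) -
    g.ζ (max v 0) - g.ζ (min v 0)

theorem continuous_η : Continuous (Function.uncurry g.η) := by
  have hM : ∀ k : ℝ × ℝ → ℝ, Continuous k → Continuous fun q => max (k q) 0 := fun k hk =>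
    hk.max continuous_const
  have hm : ∀ k : ℝ × ℝ → ℝ, Continuous k → Continuous fun q => min (k q) 0 := fun k hk =>
    hk.min continuous_const
  have h1 := hM _ continuous_fst
  have h2 := hM _ continuous_snd
  have h3 := hm _ continuous_fst
  have h4 := hm _ continuous_snd
  exact ((((((continuous_leafMap fX fX' g.χ g.A).comp (h1.prodMk h2)).add
    ((continuous_leafMap fY fY' g.χ g.B).comp (h3.prodMk h2))).add
    ((continuous_leafMap fX fX' g.χ g.C).comp (h3.prodMk h4))).add
    ((continuous_leafMap fY fY' g.χ g.D).comp (h1.prodMk h4))).sub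
    (g.ζ.continuous.comp h2)).sub (g.ζ.continuous.comp h4)

theorem A_zero : g.A 0 = 0 := (g.A_eq 0 le_rfl).trans g.ζ_zero
theorem B_zero : g.B 0 = 0 := (g.B_eq 0 le_rfl).trans g.ζ_zero
theorem C_zero : g.C 0 = 0 := (g.C_eq 0 le_rfl).trans g.ζ_zero
theorem D_zero : g.D 0 = 0 := (g.D_eq 0 le_rfl).trans g.ζ_zero

theorem η_fst {u v : ℝ} (hu : 0 ≤ u) (hv : 0 ≤ v) : g.η u v = leafMap fX fX' g.χ g.A u v := by
  rw [η, max_eq_left hu, max_eq_left hv, min_eq_right hu, min_eq_right hv,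
    leafMap_zero _ _ _ _ g.χ_zero, leafMap_zero _ _ _ _ g.χ_zero, g.B_eq v hv, g.C_zero,
    leafMap_axis _ _ _ _ _ (g.D_axis u hu), g.ζ_zero]
  ring

theorem η_snd {u v : ℝ} (hu : u ≤ 0) (hv : 0 ≤ v) : g.η u v = leafMap fY fY' g.χ g.B u v := by
  rw [η, max_eq_right hu, max_eq_left hv, min_eq_left hu, min_eq_right hv,
    leafMap_zero _ _ _ _ g.χ_zero, leafMap_zero _ _ _ _ g.χ_zero, g.A_eq v hv, g.D_zero,
    leafMap_axis _ _ _ _ _ (g.C_axis u hu), g.ζ_zero]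
  ring

theorem η_trd {u v : ℝ} (hu : u ≤ 0) (hv : v ≤ 0) : g.η u v = leafMap fX fX' g.χ g.C u v := by
  rw [η, max_eq_right hu, max_eq_right hv, min_eq_left hu, min_eq_left hv,
    leafMap_zero _ _ _ _ g.χ_zero, leafMap_zero _ _ _ _ g.χ_zero, g.A_zero, g.D_eq v hv,
    leafMap_axis _ _ _ _ _ (g.B_axis u hu), g.ζ_zero]
  ring

theorem η_fth {u v : ℝ} (hu : 0 ≤ u) (hv : v ≤ 0) : g.η u v = leafMap fY fY' g.χ g.D u v := by
  rw [η, max_eq_left hu, max_eq_right hv, min_eq_right hu, min_eq_left hv,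
    leafMap_zero _ _ _ _ g.χ_zero, leafMap_zero _ _ _ _ g.χ_zero, g.B_zero, g.C_eq v hv,
    leafMap_axis _ _ _ _ _ (g.A_axis u hu), g.ζ_zero]
  ring

theorem η_axis (u : ℝ) : g.η u 0 = 0 := by
  rcases le_total 0 u with hu | hu
  · rw [g.η_fst hu le_rfl, leafMap_axis _ _ _ _ _ (g.A_axis u hu)]
  · rw [g.η_snd hu le_rfl, leafMap_axis _ _ _ _ _ (g.B_axis u hu)]

theorem η_pos {u v : ℝ} (hv : 0 < v) : 0 < g.η u v := by
  rw [← g.η_axis u]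
  rcases le_total 0 u with hu | hu
  · rw [g.η_fst hu le_rfl, g.η_fst hu hv.le]
    exact strictMono_leafMap _ _ _ _ _ hv
  · rw [g.η_snd hu le_rfl, g.η_snd hu hv.le]
    exact strictMono_leafMap _ _ _ _ _ hv

theorem η_neg {u v : ℝ} (hv : v < 0) : g.η u v < 0 := by
  rw [← g.η_axis u]
  rcases le_total 0 u with hu | hu
  · rw [g.η_fth hu le_rfl, g.η_fth hu hv.le]
    exact strictMono_leafMap _ _ _ _ _ hv
  · rw [g.η_trd hu le_rfl, g.η_trd hu hv.le]
    exact strictMono_leafMap _ _ _ _ _ hv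

theorem η_pos_iff {u v : ℝ} : 0 < g.η u v ↔ 0 < v := by
  refine ⟨fun h => ?_, g.η_pos⟩
  rcases lt_trichotomy v 0 with hv | rfl | hv
  · exact absurd (g.η_neg (u := u) hv) h.not_gt
  · exact absurd (g.η_axis u) h.ne'
  · exact hv

theorem η_neg_iff {u v : ℝ} : g.η u v < 0 ↔ v < 0 := by
  refine ⟨fun h => ?_, g.η_neg⟩
  rcases lt_trichotomy v 0 with hv | rfl | hv
  · exact hv
  · exact absurd (g.η_axis u) h.ne
  · exact absurd (g.η_pos (u := u) hv) h.not_gt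

theorem η_symm (u v : ℝ) : g.symm.η (g.χ u) (g.η u v) = v := by
  have hn : ∀ {x : ℝ}, 0 ≤ x → 0 ≤ g.χ x := (apply_nonneg g.χ_zero).2
  have hp : ∀ {x : ℝ}, x ≤ 0 → g.χ x ≤ 0 := (apply_nonpos g.χ_zero).2
  have h1 : 0 ≤ v → 0 ≤ g.η u v := fun hv => not_lt.1 fun h => hv.not_gt (g.η_neg_iff.1 h)
  have h2 : v ≤ 0 → g.η u v ≤ 0 := fun hv => not_lt.1 fun h => hv.not_gt (g.η_pos_iff.1 h)
  rcases le_total 0 u with hu | hu <;> rcases le_total 0 v with hv | hv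
  · rw [g.symm.η_fst (hn hu) (h1 hv), g.η_fst hu hv]
    exact leafMap_leafMap ..
  · rw [g.symm.η_fth (hn hu) (h2 hv), g.η_fth hu hv]
    exact leafMap_leafMap ..
  · rw [g.symm.η_snd (hp hu) (h1 hv), g.η_snd hu hv]
    exact leafMap_leafMap ..
  · rw [g.symm.η_trd (hp hu) (h2 hv), g.η_trd hu hv]
    exact leafMap_leafMap ..

/-- The homeomorphism `(u, v) ↦ (χ u, η u v)` of the plane, `u = p i`, `v = p (i + 1)`. -/
def homeo (i : Fin 2) : Plane ≃ₜ Plane where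
  toFun p := pt i (g.χ (p i)) (g.η (p i) (p (i + 1)))
  invFun p := pt i (g.symm.χ (p i)) (g.symm.η (p i) (p (i + 1)))
  left_inv p := by
    refine plane_ext i ?_ ?_
    · simp [symm]
    · simp [η_symm]
  right_inv p := by
    refine plane_ext i ?_ ?_
    · simp [symm]
    · rw [pt_snd, pt_fst, pt_snd]
      exact g.symm.η_symm (p i) (p (i + 1))
  continuous_toFun := (continuous_pt i).comp ((g.χ.continuous.comp (continuous_coord i)).prodMk
    (g.continuous_η.comp ((continuous_coord i).prodMk (continuous_coord (i + 1)))))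
  continuous_invFun := (continuous_pt i).comp
    ((g.symm.χ.continuous.comp (continuous_coord i)).prodMk
    (g.symm.continuous_η.comp ((continuous_coord i).prodMk (continuous_coord (i + 1)))))

theorem homeo_fst (i : Fin 2) (p : Plane) : g.homeo i p i = g.χ (p i) := pt_fst ..

theorem homeo_snd (i : Fin 2) (p : Plane) : g.homeo i p (i + 1) = g.η (p i) (p (i + 1)) :=
  pt_snd ..

theorem homeo_fst_pos {i : Fin 2} {p : Plane} : 0 < g.homeo i p i ↔ 0 < p i := by
  rw [homeo_fst, apply_pos g.χ_zero]

theorem homeo_fst_neg {i : Fin 2} {p : Plane} : g.homeo i p i < 0 ↔ p i < 0 := by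
  rw [homeo_fst, apply_neg g.χ_zero]

theorem homeo_fst_eq {i : Fin 2} {p : Plane} : g.homeo i p i = 0 ↔ p i = 0 := by
  rw [homeo_fst, apply_eq_zero g.χ_zero]

theorem homeo_snd_pos {i : Fin 2} {p : Plane} : 0 < g.homeo i p (i + 1) ↔ 0 < p (i + 1) := by
  rw [homeo_snd, g.η_pos_iff]

theorem homeo_snd_neg {i : Fin 2} {p : Plane} : g.homeo i p (i + 1) < 0 ↔ p (i + 1) < 0 := by
  rw [homeo_snd, g.η_neg_iff]

theorem homeo_snd_eq {i : Fin 2} {p : Plane} : g.homeo i p (i + 1) = 0 ↔ p (i + 1) = 0 := by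
  have h1 := g.homeo_snd_pos (i := i) (p := p)
  have h2 := g.homeo_snd_neg (i := i) (p := p)
  constructor
  · intro h
    rw [h] at h1 h2
    exact le_antisymm (not_lt.1 (mt h1.2 (lt_irrefl _))) (not_lt.1 (mt h2.2 (lt_irrefl _)))
  · intro h
    rw [h] at h1 h2
    exact le_antisymm (not_lt.1 (mt h1.1 (lt_irrefl _))) (not_lt.1 (mt h2.1 (lt_irrefl _)))

theorem homeo_zero (i : Fin 2) : g.homeo i 0 = 0 :=
  (plane_eq_zero i).2 ⟨g.homeo_fst_eq.2 rfl, g.homeo_snd_eq.2 rfl⟩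

theorem homeo_mem_switching {i : Fin 2} {p : Plane} :
    g.homeo i p ∈ switching ↔ p ∈ switching := by
  rw [mem_switching i, mem_switching i, g.homeo_fst_eq, g.homeo_snd_eq]

/-- In the closed quadrant of `p` the leaves of `X` go to leaves of `X'`. -/
theorem lab_fst {i : Fin 2} {p : Plane} (hp : 0 ≤ p i * p (i + 1)) :
    fX'.H (g.homeo i p i) (g.homeo i p (i + 1)) =
      (if 0 ≤ p i ∧ 0 ≤ p (i + 1) then g.A else g.C) (fX.H (p i) (p (i + 1))) := by
  rw [homeo_fst, homeo_snd]
  split_ifs with h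
  · rw [g.η_fst h.1 h.2, H_leafMap]
  · rcases mul_nonneg_iff.1 hp with h' | h'
    · exact absurd h' h
    · rw [g.η_trd h'.1 h'.2, H_leafMap]

theorem lab_snd {i : Fin 2} {p : Plane} (hp : p i * p (i + 1) ≤ 0) :
    fY'.H (g.homeo i p i) (g.homeo i p (i + 1)) =
      (if p i ≤ 0 ∧ 0 ≤ p (i + 1) then g.B else g.D) (fY.H (p i) (p (i + 1))) := by
  rw [homeo_fst, homeo_snd]
  split_ifs with h
  · rw [g.η_snd h.1 h.2, H_leafMap]
  · rcases mul_nonpos_iff.1 hp with h' | h'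
    · rw [g.η_fth h'.1 h'.2, H_leafMap]
    · exact absurd h' h

end Matching

/-! ### Existence of matchings -/

section Existence

/-- Here `A` and `B` stand for the maps `K` of `X` and `Y`. A leaf of `X` with negative slope joins
`(x, 0)` to height `A x`, a leaf of `Y` with positive slope joins `(x, 0)` to height `-B x`; each
family that joins the axes determines `ζ` from `χ`. The two prescriptions agree exactly if `χ`
conjugates the hops `x ↦ A⁻¹ (-B x)` of both fields, and this is the only place where dynamics
enters. -/
theorem exists_axis_maps {A B A' B' : ℝ ≃o ℝ} (hA : A 0 = 0) (hB : B 0 = 0) (hA' : A' 0 = 0)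
    (hB' : B' 0 = 0) {sX sY : ℝ} (hsX : sX = 1 ∨ sX = -1) (hsY : sY = 1 ∨ sY = -1)
    (hdyn : sX = -1 → sY = 1 → ∃ l, 0 < l ∧ l < 1 ∧
      (((∀ x, |A.symm (-B x)| ≤ l * |x|) ∧ (∀ x, |A'.symm (-B' x)| ≤ l * |x|)) ∨
       ((∀ x, |B.symm (-A x)| ≤ l * |x|) ∧ (∀ x, |B'.symm (-A' x)| ≤ l * |x|)))) :
    ∃ χ ζ : ℝ ≃o ℝ, χ 0 = 0 ∧ ζ 0 = 0 ∧ (sX = -1 → ∀ x, ζ (A x) = A' (χ x)) ∧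
      (sY = 1 → ∀ x, ζ (-B x) = -B' (χ x)) := by
  have anti : ∀ A B : ℝ ≃o ℝ, StrictAnti fun x => A.symm (-B x) := fun A B x y h =>
    A.symm.strictMono (neg_lt_neg (B.strictMono h))
  have surj : ∀ A B : ℝ ≃o ℝ, Function.Surjective fun x => A.symm (-B x) := fun A B y =>
    ⟨B.symm (-A y), by simp⟩
  rcases hsX with rfl | rfl <;> rcases hsY with rfl | rfl
  · refine ⟨OrderIso.refl ℝ, negConj (B.symm.trans B'), rfl, ?_, fun h => ?_, fun _ x => ?_⟩
    · simp [symm_fix hB, hB']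
    · norm_num at h
    · simp
  · refine ⟨OrderIso.refl ℝ, OrderIso.refl ℝ, rfl, rfl, fun h => ?_, fun h => ?_⟩ <;>
    norm_num at h
  · obtain ⟨l, hl0, hl, h⟩ := hdyn rfl rfl
    have : ∃ χ : ℝ ≃o ℝ, χ 0 = 0 ∧ ∀ x, χ (A.symm (-B x)) = A'.symm (-B' (χ x)) := by
      rcases h with ⟨h1, h2⟩ | ⟨h1, h2⟩
      · exact exists_conjugacy (anti A B) (surj A B) (anti A' B') (surj A' B') hl0 hl h1 h2
      -- `x ↦ B⁻¹ (-A x)` is the inverse of `x ↦ A⁻¹ (-B x)`, so a conjugacy of the inverses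
      -- conjugates the maps themselves.
      · obtain ⟨χ, h0, hχ⟩ :=
          exists_conjugacy (anti B A) (surj B A) (anti B' A') (surj B' A') hl0 hl h1 h2
        refine ⟨χ, h0, fun x => ?_⟩
        have := hχ (A.symm (-B x))
        simp only [OrderIso.apply_symm_apply, neg_neg, OrderIso.symm_apply_apply] at this
        rw [this]
        simp
    obtain ⟨χ, h0, hχ⟩ := this
    refine ⟨χ, (A.symm.trans χ).trans A', h0, ?_, fun _ x => ?_, fun _ x => ?_⟩
    · simp [symm_fix hA, h0, hA']
    · simp
    · simp [hχ]
  · refine ⟨OrderIso.refl ℝ, A.symm.trans A', rfl, ?_, fun _ x => ?_, fun h => ?_⟩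
    · simp [symm_fix hA, hA']
    · simp
    · norm_num at h

variable {FX FY FX' FY' : ℝ → ℝ → ℝ} {sX sY mX MX mY MY mX' MX' mY' MY' : ℝ}
    (fX : Foliation FX sX mX MX) (fY : Foliation FY sY mY MY) (fX' : Foliation FX' sX mX' MX')
    (fY' : Foliation FY' sY mY' MY')

/-- In a closed quadrant the leaves through the half axis `u = 0` have labels of one sign, where the
correspondence must be `ζ`. The leaves through the other half axis have labels of the same sign if
they join both axes, and then the axis maps already agree; otherwise their labels have the opposite
sign, where the correspondence is induced by `χ`. Hence each correspondence is glued at `0` from two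
pieces. -/
theorem exists_matching (hsX : sX = 1 ∨ sX = -1) (hsY : sY = 1 ∨ sY = -1)
    (hdyn : sX = -1 → sY = 1 → ∃ l, 0 < l ∧ l < 1 ∧
      (((∀ x, |fX.K.symm (-fY.K x)| ≤ l * |x|) ∧ (∀ x, |fX'.K.symm (-fY'.K x)| ≤ l * |x|)) ∨
       ((∀ x, |fY.K.symm (-fX.K x)| ≤ l * |x|) ∧ (∀ x, |fY'.K.symm (-fX'.K x)| ≤ l * |x|)))) :
    Nonempty (Matching fX fY fX' fY') := by
  obtain ⟨χ, ζ, χ0, ζ0, h1, h2⟩ := exists_axis_maps fX.K_zero fY.K_zero fX'.K_zero fY'.K_zero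
    hsX hsY hdyn
  -- The correspondence of labels induced by `χ` through the points where the leaves meet the line
  -- `v = 0`.
  have κ : ∀ {F F' : ℝ → ℝ → ℝ} {s m M m' M' : ℝ} (f : Foliation F s m M)
      (f' : Foliation F' s m' M'), (s = 1 ∨ s = -1) →
      ∃ e : ℝ ≃o ℝ, e 0 = 0 ∧ ∀ u, e (f.H u 0) = f'.H (χ u) 0 := by
    intro F F' s m M m' M' f f' hs
    rcases hs with rfl | rfl
    · refine ⟨negConj ((f.K.symm.trans χ).trans f'.K), ?_, fun u => ?_⟩
      · simp [symm_fix f.K_zero, χ0, f'.K_zero]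
      · simp [f.H_axis, f'.H_axis]
    · refine ⟨(f.K.symm.trans χ).trans f'.K, ?_, fun u => ?_⟩
      · simp [symm_fix f.K_zero, χ0, f'.K_zero]
      · simp [f.H_axis, f'.H_axis]
  obtain ⟨a, a0, ha⟩ := κ fX fX' hsX
  obtain ⟨b, b0, hb⟩ := κ fY fY' hsY
  have hXc : sX = -1 → ∀ u, ζ (fX.H u 0) = fX'.H (χ u) 0 := by
    intro h u
    have := h1 h u
    rwa [fX.H_axis_of_neg_one h, fX'.H_axis_of_neg_one h]
  have hYc : sY = 1 → ∀ u, ζ (fY.H u 0) = fY'.H (χ u) 0 := by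
    intro h u
    have := h2 h u
    rwa [fY.H_axis_of_one h, fY'.H_axis_of_one h]
  refine ⟨⟨χ, ζ, glue ζ a ζ0 a0, glue ζ b ζ0 b0, glue a ζ a0 ζ0, glue b ζ b0 ζ0, χ0, ζ0,
    fun c hc => glue_of_nonneg _ _ hc, fun c hc => glue_of_nonneg _ _ hc,
    fun c hc => glue_of_nonpos _ _ hc, fun c hc => glue_of_nonpos _ _ hc,
    fun u hu => ?_, fun u hu => ?_, fun u hu => ?_, fun u hu => ?_⟩⟩
  · rcases hsX with h | h
    · rw [glue_of_nonpos, ha]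
      rw [fX.H_axis_of_one h]
      have := (apply_nonneg fX.K_zero).2 hu
      linarith
    · rw [glue_of_nonneg, hXc h]
      rw [fX.H_axis_of_neg_one h]
      have := (apply_nonneg fX.K_zero).2 hu
      linarith
  · rcases hsY with h | h
    · rw [glue_of_nonneg, hYc h]
      rw [fY.H_axis_of_one h]
      have := (apply_nonpos fY.K_zero).2 hu
      linarith
    · rw [glue_of_nonpos, hb]
      rw [fY.H_axis_of_neg_one h]
      have := (apply_nonpos fY.K_zero).2 hu
      linarith
  · rcases hsX with h | h
    · rw [glue_of_nonneg, ha]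
      rw [fX.H_axis_of_one h]
      have := (apply_nonpos fX.K_zero).2 hu
      linarith
    · rw [glue_of_nonpos, hXc h]
      rw [fX.H_axis_of_neg_one h]
      have := (apply_nonpos fX.K_zero).2 hu
      linarith
  · rcases hsY with h | h
    · rw [glue_of_nonpos, hYc h]
      rw [fY.H_axis_of_one h]
      have := (apply_nonneg fY.K_zero).2 hu
      linarith
    · rw [glue_of_nonneg, hb]
      rw [fY.H_axis_of_neg_one h]
      have := (apply_nonneg fY.K_zero).2 hu
      linarith

end Existence

end

section


/-! ### Reparametrisation -/

/-- A function `g` increasing along `[a, b]` can be reparametrised such that its speed is a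
prescribed function `w`, at the points of continuity of `w`. -/
theorem exists_reparam {a b : ℝ} (hab : a < b) {g w : ℝ → ℝ} (hg : ContinuousOn g (Icc a b))
    (hm : StrictMonoOn g (Icc a b)) (hw : Measurable fun t => w (projIcc a b hab.le t)) {c C : ℝ}
    (hc : 0 < c) (hwb : ∀ t ∈ Icc a b, c ≤ w t ∧ w t ≤ C) :
    ∃ (c₀ d₀ : ℝ) (σ : ℝ → ℝ), c₀ < d₀ ∧ StrictMonoOn σ (Icc c₀ d₀) ∧
      σ '' Icc c₀ d₀ = Icc a b ∧ ContinuousOn σ (Icc c₀ d₀) ∧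
      ∀ s ∈ Icc c₀ d₀, ContinuousWithinAt w (Icc a b) (σ s) →
        HasDerivWithinAt (fun s => g (σ s)) (w (σ s)) (Icc c₀ d₀) s := by
  have hC : 0 < C := hc.trans_le ((hwb a ⟨le_rfl, hab.le⟩).1.trans (hwb a ⟨le_rfl, hab.le⟩).2)
  set π : ℝ → ℝ := fun t => projIcc a b hab.le t with hπ
  have hπm : ∀ t, π t ∈ Icc a b := fun t => (projIcc a b hab.le t).2
  have hπe : ∀ t ∈ Icc a b, π t = t := fun t ht => by simp [hπ, projIcc_of_mem hab.le ht]
  have hπc : Continuous π := continuous_subtype_val.comp continuous_projIcc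
  have hπmono : Monotone π := fun x y h => monotone_projIcc hab.le h
  have hπl : ∀ t t', t ≤ t' → π t' - π t ≤ t' - t := by
    intro t t' htt
    simp only [hπ, coe_projIcc]
    have h1 : min b t' - min b t ≤ t' - t := by
      rcases le_total b t with h | h <;> rcases le_total b t' with h' | h' <;>
        simp [h, h'] <;> linarith
    rcases le_total a (min b t) with h | h <;> rcases le_total a (min b t') with h' | h'
    · simpa only [max_eq_right h, max_eq_right h'] using h1
    · rw [max_eq_right h, max_eq_left h']
      linarith
    · rw [max_eq_left h, max_eq_right h']
      linarith
    · rw [max_eq_left h, max_eq_left h']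
      linarith
  -- Extension of `g` with slope one beyond `[a, b]`, to obtain a homeomorphism of the line that can
  -- be inverted everywhere.
  let g1 : ℝ → ℝ := fun t => g (π t) + (t - π t)
  have hg1c : Continuous g1 :=
    (hg.comp_continuous hπc hπm).add (continuous_id.sub hπc)
  have hg1m : StrictMono g1 := by
    intro t t' htt
    have h1 := hπl t t' htt.le
    rcases (hπmono htt.le).eq_or_lt with h | h
    · simp only [g1, h]
      linarith
    · have := hm (hπm t) (hπm t') h
      simp only [g1]
      linarith
  have hg1s : Function.Surjective g1 := by
    intro y
    have e1 : ∀ t, t ≤ a → π t = a := fun t h => by simp [hπ, projIcc_of_le_left hab.le h]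
    have e2 : ∀ t, b ≤ t → π t = b := fun t h => by simp [hπ, projIcc_of_right_le hab.le h]
    refine mem_range_of_exists_le_of_exists_ge hg1c ⟨a - |y - g a|, ?_⟩ ⟨b + |y - g b|, ?_⟩
    · simp only [g1]
      rw [e1 _ (by linarith [abs_nonneg (y - g a)])]
      linarith [neg_abs_le (y - g a)]
    · simp only [g1]
      rw [e2 _ (by linarith [abs_nonneg (y - g b)])]
      linarith [le_abs_self (y - g b)]
  let Gi : ℝ ≃o ℝ := hg1m.orderIsoOfSurjective g1 hg1s
  have hGi : ∀ t ∈ Icc a b, Gi t = g t := fun t ht => by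
    change g1 t = g t
    simp [g1, hπe t ht]
  let f : ℝ → ℝ := fun τ => (w (π (Gi.symm τ)))⁻¹
  have hfm : Measurable f := (hw.comp Gi.symm.continuous.measurable).inv
  have hfb : ∀ τ, C⁻¹ ≤ f τ ∧ f τ ≤ c⁻¹ := fun τ => by
    have := hwb _ (hπm (Gi.symm τ))
    exact ⟨inv_anti₀ (hc.trans_le this.1) this.2, inv_anti₀ hc this.1⟩
  have hC' : 0 < C⁻¹ := inv_pos.2 hC
  have hfi : ∀ x y, IntervalIntegrable f MeasureTheory.volume x y := fun x y => by
    refine (intervalIntegrable_const (c := c⁻¹)).mono_fun hfm.aestronglyMeasurable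
      (Eventually.of_forall fun τ => ?_)
    change ‖f τ‖ ≤ ‖c⁻¹‖
    rw [Real.norm_of_nonneg (hC'.le.trans (hfb τ).1),
      Real.norm_of_nonneg (inv_pos.2 hc).le]
    exact (hfb τ).2
  -- The time needed to bring the value of `g` from `0` to `τ` at the prescribed speed. The new
  -- parameter is this time, so `σ` inverts `T ∘ g`.
  let T : ℝ → ℝ := fun τ => ∫ x in (0)..τ, f x
  have hTinc : ∀ x y, x ≤ y → C⁻¹ * (y - x) ≤ T y - T x := by
    intro x y hxy
    have h1 : T y - T x = ∫ z in x..y, f z :=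
      intervalIntegral.integral_interval_sub_left (hfi _ _) (hfi _ _)
    rw [h1]
    have := intervalIntegral.integral_mono_on hxy (intervalIntegrable_const (c := C⁻¹)) (hfi x y)
      (fun z _ => (hfb z).1)
    simp only [intervalIntegral.integral_const, smul_eq_mul] at this
    linarith
  have hTm : StrictMono T := fun x y h => by
    have := hTinc x y h.le
    have : 0 < C⁻¹ * (y - x) := mul_pos hC' (sub_pos.2 h)
    linarith
  have hTc : Continuous T := intervalIntegral.continuous_primitive hfi 0
  have hT0 : T 0 = 0 := intervalIntegral.integral_same
  have hTs : Function.Surjective T := by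
    intro y
    refine mem_range_of_exists_le_of_exists_ge hTc ⟨-(C * |y|), ?_⟩ ⟨C * |y|, ?_⟩
    · have := hTinc (-(C * |y|)) 0 (by have := abs_nonneg y; nlinarith)
      rw [hT0, zero_sub, zero_sub, neg_neg, inv_mul_cancel_left₀ hC.ne'] at this
      linarith [neg_abs_le y]
    · have := hTinc 0 (C * |y|) (by positivity)
      rw [hT0, sub_zero, sub_zero, inv_mul_cancel_left₀ hC.ne'] at this
      linarith [le_abs_self y]
  let Ti : ℝ ≃o ℝ := hTm.orderIsoOfSurjective T hTs
  let σ : ℝ ≃o ℝ := Ti.symm.trans Gi.symm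
  have hσ : ∀ t ∈ Icc a b, σ (T (g t)) = t := fun t ht => by
    have h1 : Ti.symm (T (g t)) = g t := Ti.symm_apply_apply (g t)
    have h2 : Gi.symm (g t) = t := by rw [← hGi t ht, Gi.symm_apply_apply]
    change Gi.symm (Ti.symm (T (g t))) = t
    rw [h1, h2]
  have ha := left_mem_Icc.2 hab.le
  have hb := right_mem_Icc.2 hab.le
  have himg : σ '' Icc (T (g a)) (T (g b)) = Icc a b := by
    rw [OrderIso.image_Icc, hσ a ha, hσ b hb]
  have hgσ : ∀ s ∈ Icc (T (g a)) (T (g b)), g (σ s) = Ti.symm s := fun s hs => by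
    have : σ s ∈ Icc a b := himg ▸ mem_image_of_mem _ hs
    rw [← hGi _ this]
    exact Gi.apply_symm_apply _
  refine ⟨T (g a), T (g b), σ, hTm (hm ha hb hab), σ.strictMono.strictMonoOn _, himg,
    σ.continuous.continuousOn, fun s hs hcw => ?_⟩
  have hmem : σ s ∈ Icc a b := himg ▸ mem_image_of_mem _ hs
  have hGτ : Gi.symm (Ti.symm s) = σ s := rfl
  have hwc : ContinuousAt (fun t => w (π t)) (σ s) := by
    have : Tendsto π (𝓝 (σ s)) (𝓝[Icc a b] (σ s)) := by
      refine tendsto_nhdsWithin_iff.2 ⟨?_, Eventually.of_forall hπm⟩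
      have := hπc.tendsto (σ s)
      rwa [hπe _ hmem] at this
    have := hcw.tendsto.comp this
    simp only [ContinuousAt, hπe _ hmem]
    exact this
  have hwpos : 0 < w (σ s) := hc.trans_le (hwb _ hmem).1
  have hfτ : f (Ti.symm s) = (w (σ s))⁻¹ := by
    simp only [f, hGτ, hπe _ hmem]
  have hfc : ContinuousAt f (Ti.symm s) := by
    refine ContinuousAt.inv₀ ?_ ?_
    · exact ContinuousAt.comp (g := fun t => w (π t)) (by rw [hGτ]; exact hwc)
        Gi.symm.continuous.continuousAt
    · rw [hGτ, hπe _ hmem]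
      exact hwpos.ne'
  have hTd : HasDerivAt T (w (σ s))⁻¹ (Ti.symm s) := by
    rw [← hfτ]
    exact intervalIntegral.integral_hasDerivAt_right (hfi _ _)
      hfm.stronglyMeasurable.stronglyMeasurableAtFilter hfc
  have hd : HasDerivAt (fun s => Ti.symm s) (w (σ s)) s := by
    have := HasDerivAt.of_local_left_inverse (f := T) (g := Ti.symm)
      Ti.symm.continuous.continuousAt hTd (inv_ne_zero hwpos.ne')
      (Eventually.of_forall fun y => Ti.apply_symm_apply y)
    rwa [inv_inv] at this
  exact hd.hasDerivWithinAt.congr hgσ (hgσ s hs)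

/-- A continuous function on an interval which increases at every point is increasing. -/
theorem strictMonoOn_of_local {a b : ℝ} {f : ℝ → ℝ} (hf : ContinuousOn f (Icc a b))
    (h : ∀ t ∈ Icc a b, ∀ᶠ s in 𝓝[Icc a b] t, (s < t → f s < f t) ∧ (t < s → f t < f s)) :
    StrictMonoOn f (Icc a b) := by
  have key : ∀ x ∈ Icc a b, ∀ y ∈ Icc a b, x < y → f x ≤ f y := by
    intro x hx y hy hxy
    let S := {z | f x ≤ f z} ∩ Icc x y
    have hS : IsClosed ({z | f x ≤ f z} ∩ Icc x y) := by
      have : ContinuousOn f (Icc x y) := hf.mono (Icc_subset_Icc hx.1 hy.2)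
      rw [inter_comm]
      exact this.preimage_isClosed_of_isClosed isClosed_Icc isClosed_Ici
    -- Continuous induction: the set where `f x ≤ f z` is closed, and the local hypothesis pushes it
    -- to the right of each of its points.
    have := hS.Icc_subset_of_forall_exists_gt (by simp) (fun z hz w hw => ?_)
      (right_mem_Icc.2 hxy.le)
    · exact this
    · obtain ⟨hz1, hz2⟩ := hz
      have hzI : z ∈ Icc a b := ⟨hx.1.trans hz2.1, hz2.2.le.trans hy.2⟩
      have hw' : z < w := hw
      have hzb : z < b := hz2.2.trans_le hy.2
      have h1 : ∀ᶠ s in 𝓝[>] z, (s < z → f s < f z) ∧ (z < s → f z < f s) := by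
        have := h z hzI
        refine this.filter_mono ?_
        rw [nhdsWithin_le_iff]
        filter_upwards [Ioo_mem_nhdsGT hzb] with s hs using ⟨hzI.1.trans hs.1.le, hs.2.le⟩
      obtain ⟨s, hs1, hs2⟩ := (h1.and (Ioc_mem_nhdsGT hw')).exists
      exact ⟨s, (hz1.trans (hs1.2 hs2.1).le : f x ≤ f s), hs2⟩
  intro x hx y hy hxy
  have h1 : ∀ᶠ s in 𝓝[>] x, (s < x → f s < f x) ∧ (x < s → f x < f s) := by
    refine (h x hx).filter_mono ?_
    rw [nhdsWithin_le_iff]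
    filter_upwards [Ioo_mem_nhdsGT (hxy.trans_le hy.2)] with s hs
      using ⟨hx.1.trans hs.1.le, hs.2.le⟩
  obtain ⟨s, hs1, hs2⟩ := (h1.and (Ioo_mem_nhdsGT hxy)).exists
  exact (hs1.2 hs2.1).trans_le (key s ⟨hx.1.trans hs2.1.le, hs2.2.le.trans hy.2⟩ y hy hs2.2)

theorem eventually_lt_of_hasDerivWithinAt_pos {f : ℝ → ℝ} {f' t : ℝ} {J : Set ℝ}
    (hf : HasDerivWithinAt f f' J t) (h : 0 < f') :
    ∀ᶠ s in 𝓝[J] t, (s < t → f s < f t) ∧ (t < s → f t < f s) := by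
  have h1 := hasDerivWithinAt_iff_tendsto_slope.1 hf
  have h2 : ∀ᶠ s in 𝓝[J \ {t}] t, 0 < slope f t s := h1.eventually (lt_mem_nhds h)
  rw [eventually_nhdsWithin_iff] at h2 ⊢
  filter_upwards [h2] with s hs hsJ
  constructor
  · intro hst
    have := hs ⟨hsJ, hst.ne⟩
    rw [slope_def_field, div_pos_iff] at this
    rcases this with h | h <;> linarith [h.1, h.2]
  · intro hst
    have := hs ⟨hsJ, hst.ne'⟩
    rw [slope_def_field, div_pos_iff] at this
    rcases this with h | h <;> linarith [h.1, h.2]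

/-- The conclusion of `eventually_lt_of_hasDerivWithinAt_pos` holds at points around which the
derivative is positive. -/
theorem eventually_lt_of_punctured {f : ℝ → ℝ} {t a b : ℝ} (ht : t ∈ Icc a b)
    (hf : ContinuousOn f (Icc a b))
    (h : ∀ᶠ s in 𝓝[Icc a b \ {t}] t, ∃ f', 0 < f' ∧ HasDerivWithinAt f f' (Icc a b) s) :
    ∀ᶠ s in 𝓝[Icc a b] t, (s < t → f s < f t) ∧ (t < s → f t < f s) := by
  rw [eventually_nhdsWithin_iff, Metric.eventually_nhds_iff] at h
  obtain ⟨ε, hε, h⟩ := h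
  have hmono : ∀ x y, x ∈ Icc a b → y ∈ Icc a b → x < y → (∀ z ∈ Ioo x y, dist z t < ε ∧ z ≠ t) →
      f x < f y := by
    intro x y hx hy hxy hz
    have hsub : Icc x y ⊆ Icc a b := Icc_subset_Icc hx.1 hy.2
    refine strictMonoOn_of_deriv_pos (convex_Icc x y) (hf.mono hsub) (fun z hzI => ?_)
      (left_mem_Icc.2 hxy.le) (right_mem_Icc.2 hxy.le) hxy
    rw [interior_Icc] at hzI
    obtain ⟨f', hf', hd⟩ := h (hz z hzI).1 ⟨hsub (Ioo_subset_Icc_self hzI), (hz z hzI).2⟩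
    have := hd.hasDerivAt (Icc_mem_nhds (hx.1.trans_lt hzI.1) (hzI.2.trans_le hy.2))
    rwa [this.deriv]
  rw [eventually_nhdsWithin_iff, Metric.eventually_nhds_iff]
  refine ⟨ε, hε, fun s hs hsI => ⟨fun hst => ?_, fun hst => ?_⟩⟩
  · refine hmono s t hsI ht hst fun z hz => ⟨?_, hz.2.ne⟩
    rw [Real.dist_eq, abs_lt] at *
    constructor <;> linarith [hz.1, hz.2]
  · refine hmono t s ht hsI hst fun z hz => ⟨?_, hz.1.ne'⟩
    rw [Real.dist_eq, abs_lt] at *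
    constructor <;> linarith [hz.1, hz.2]

end

/-! ### Charts of both fields, and orbits when one axis is crossing. -/

section


theorem hasDerivWithinAt_of_coord (i : Fin 2) {γ : ℝ → Plane} {w : Plane} {J : Set ℝ} {t : ℝ}
    (h : HasDerivWithinAt (fun s => γ s i) (w i) J t)
    (h' : HasDerivWithinAt (fun s => γ s (i + 1)) (w (i + 1)) J t) :
    HasDerivWithinAt γ w J t := by
  have h1 : HasDerivWithinAt (fun s k => γ s k) (fun k => w k) J t := by
    rw [hasDerivWithinAt_pi]
    intro k
    rcases fin_two_cases i k with rfl | rfl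
    exacts [h, h']
  exact (PiLp.continuousLinearEquiv 2 ℝ (fun _ : Fin 2 => ℝ)).symm.hasFDerivAt.comp_hasDerivWithinAt
    t h1

/-- Without this, crossing and sliding near the origin could both hold vacuously. -/
theorem nhdsWithin_axis_neBot (i : Fin 2) : (𝓝[axis i \ {0}] (0 : Plane)).NeBot := by
  rw [← mem_closure_iff_nhdsWithin_neBot]
  refine mem_closure_iff_nhds.2 fun s hs => ?_
  obtain ⟨ρ, hρ, h⟩ := exists_box_subset hs
  refine ⟨pt i 0 ρ, h ρ le_rfl (pt_mem_box.2 ⟨by simpa using hρ.le, (abs_of_pos hρ).le⟩), ?_, ?_⟩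
  · simp [axis]
  · intro h0
    have := (plane_eq_zero i).1 h0
    simp only [pt_snd] at this
    linarith [this.2]

theorem mul_self_sign {ε : ℝ} (hε : ε = 1 ∨ ε = -1) : ε * ε = 1 := by
  rcases hε with rfl | rfl <;> norm_num

variable {U : Set Plane} {r : ℕ}

/-- Charts of both fields of `Z` on the same square. -/
structure LocalChart (Z : Omega U r) (i : Fin 2) (εX εY sX sY mX MX mY MY ρ : ℝ) where
  X : FieldChart Z.1 i εX sX mX MX ρ
  Y : FieldChart Z.2 i εY sY mY MY ρ
  sub : box ρ ⊆ U
  ρ_pos : 0 < ρ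
  mX_pos : 0 < mX
  mY_pos : 0 < mY
  εX_sign : εX = 1 ∨ εX = -1
  εY_sign : εY = 1 ∨ εY = -1
  sX_sign : sX = 1 ∨ sX = -1
  sY_sign : sY = 1 ∨ sY = -1

namespace LocalChart

section Signs

variable {Z : Omega U r} {i : Fin 2} {εX εY sX sY mX MX mY MY ρ : ℝ}

theorem X_fst (c : LocalChart Z i εX εY sX sY mX MX mY MY ρ) {p : Plane} (hp : p ∈ box ρ) :
    0 < εX * Z.1 p i := c.X.c_pos.trans_le (c.X.speed p hp).1

theorem Y_fst (c : LocalChart Z i εX εY sX sY mX MX mY MY ρ) {p : Plane} (hp : p ∈ box ρ) :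
    0 < εY * Z.2 p i := c.Y.c_pos.trans_le (c.Y.speed p hp).1

theorem X_snd (c : LocalChart Z i εX εY sX sY mX MX mY MY ρ) {p : Plane} (hp : p ∈ box ρ) :
    0 < sX * (εX * Z.1 p (i + 1)) := c.X.speed_snd c.mX_pos hp

theorem Y_snd (c : LocalChart Z i εX εY sX sY mX MX mY MY ρ) {p : Plane} (hp : p ∈ box ρ) :
    0 < sY * (εY * Z.2 p (i + 1)) := c.Y.speed_snd c.mY_pos hp

theorem mem_box_eventually (c : LocalChart Z i εX εY sX sY mX MX mY MY ρ) (k : Fin 2) :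
    ∀ᶠ q in 𝓝[axis k \ {0}] (0 : Plane), q ∈ box ρ ∧ q ∈ axis k ∧ q ≠ 0 := by
  filter_upwards [nhdsWithin_le_nhds (box_mem_nhds c.ρ_pos), self_mem_nhdsWithin] with q h1 h2
    using ⟨h1, h2.1, h2.2⟩

theorem prod_fst (c : LocalChart Z i εX εY sX sY mX MX mY MY ρ) {p : Plane} (hp : p ∈ box ρ) :
    0 < εX * εY * (Z.1 p i * Z.2 p i) := by
  have := mul_pos (c.X_fst hp) (c.Y_fst hp)
  nlinarith

theorem prod_snd (c : LocalChart Z i εX εY sX sY mX MX mY MY ρ) {p : Plane} (hp : p ∈ box ρ) :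
    0 < (εX * εY * (sX * sY)) * (Z.1 p (i + 1) * Z.2 p (i + 1)) := by
  have := mul_pos (c.X_snd hp) (c.Y_snd hp)
  nlinarith

theorem not_tangency (c : LocalChart Z i εX εY sX sY mX MX mY MY ρ) {p : Plane} (hp : p ∈ box ρ)
    (k : Fin 2) : p ∉ tangency Z k := by
  rintro ⟨-, -, h⟩
  rcases fin_two_cases i k with rfl | rfl
  · have := c.prod_fst hp
    rw [h, mul_zero] at this
    exact lt_irrefl _ this
  · have := c.prod_snd hp
    rw [h, mul_zero] at this
    exact lt_irrefl _ this

end Signs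

section Graph

variable {Z : Omega U r} {i : Fin 2} {ε sX sY mX MX mY MY ρ : ℝ}

theorem fst_pos (c : LocalChart Z i ε ε sX sY mX MX mY MY ρ) {p : Plane} (hp : p ∈ box ρ) :
    0 < Z.1 p i * Z.2 p i := by
  have := c.prod_fst hp
  rwa [mul_self_sign c.εX_sign, one_mul] at this

theorem snd_pos (c : LocalChart Z i ε ε sX sY mX MX mY MY ρ) (h : sX = sY) {p : Plane}
    (hp : p ∈ box ρ) : 0 < Z.1 p (i + 1) * Z.2 p (i + 1) := by
  have := c.prod_snd hp
  rwa [mul_self_sign c.εX_sign, h, mul_self_sign c.sY_sign, one_mul, one_mul] at this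

theorem snd_neg (c : LocalChart Z i ε ε sX sY mX MX mY MY ρ) (h : sX = -sY) {p : Plane}
    (hp : p ∈ box ρ) : Z.1 p (i + 1) * Z.2 p (i + 1) < 0 := by
  have := c.prod_snd hp
  rw [mul_self_sign c.εX_sign, h, neg_mul, mul_self_sign c.sY_sign, one_mul] at this
  linarith

theorem sign_cases (c : LocalChart Z i ε ε sX sY mX MX mY MY ρ) : sX = sY ∨ sX = -sY := by
  rcases c.sX_sign with h | h <;> rcases c.sY_sign with h' | h' <;> simp [h, h']

theorem crossesNear_fst (c : LocalChart Z i ε ε sX sY mX MX mY MY ρ) : CrossesNear Z i := by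
  filter_upwards [c.mem_box_eventually i] with q hq using ⟨hq.2.1, hq.2.2, c.fst_pos hq.1⟩

theorem crossesNear_snd (c : LocalChart Z i ε ε sX sY mX MX mY MY ρ) (h : sX = sY) :
    CrossesNear Z (i + 1) := by
  filter_upwards [c.mem_box_eventually (i + 1)] with q hq using ⟨hq.2.1, hq.2.2, c.snd_pos h hq.1⟩

theorem slidesNear_snd (c : LocalChart Z i ε ε sX sY mX MX mY MY ρ) (h : sX = -sY) :
    SlidesNear Z (i + 1) := by
  filter_upwards [c.mem_box_eventually (i + 1)] with q hq using ⟨hq.2.1, hq.2.2, c.snd_neg h hq.1⟩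

theorem not_slidesNear_of_crossesNear {Z : Omega U r} {k : Fin 2} (h : CrossesNear Z k) :
    ¬ SlidesNear Z k := fun h' => by
  have := nhdsWithin_axis_neBot k
  obtain ⟨q, h1, h2⟩ := (h.and h').exists
  exact lt_asymm h1.2.2 h2.2.2

end Graph

end LocalChart

/-- The component along `Σ_{i+1}` of the sliding field of `Σ_{i+1}`. -/
def slideSpeed (Z : Omega U r) (i : Fin 2) (p : Plane) : ℝ :=
  (Z.2 p (i + 1) * Z.1 p i - Z.1 p (i + 1) * Z.2 p i) / (Z.2 p (i + 1) - Z.1 p (i + 1))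

theorem slidingField_fst (Z : Omega U r) (i : Fin 2) (p : Plane) :
    slidingField Z (i + 1) p i = slideSpeed Z i p := by
  rw [slidingField, slideSpeed, fin_two_add]
  simp

theorem slidingField_snd (Z : Omega U r) (i : Fin 2) (p : Plane) :
    slidingField Z (i + 1) p (i + 1) = 0 := by
  rw [slidingField, fin_two_add]
  simp

/-- If the field points to the same side of `Σ_i` the sliding speed lies between the speeds of both
fields. -/
theorem slideSpeed_bounds {Z : Omega U r} {i : Fin 2} {p : Plane} {ε a b : ℝ}
    (hneg : Z.1 p (i + 1) * Z.2 p (i + 1) < 0) (hX : a ≤ ε * Z.1 p i ∧ ε * Z.1 p i ≤ b)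
    (hY : a ≤ ε * Z.2 p i ∧ ε * Z.2 p i ≤ b) :
    a ≤ ε * slideSpeed Z i p ∧ ε * slideSpeed Z i p ≤ b := by
  unfold slideSpeed
  set x := Z.1 p (i + 1)
  set y := Z.2 p (i + 1)
  -- The numbers `y` and `-x` have the same sign, so this is a convex combination of the speeds `ε *
  -- X_i` and `ε * Y_i`.
  have e : ε * ((y * Z.1 p i - x * Z.2 p i) / (y - x)) =
      (y * (ε * Z.1 p i) - x * (ε * Z.2 p i)) / (y - x) := by ring
  rw [e]
  rcases mul_neg_iff.1 hneg with h | h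
  · have hd : y - x < 0 := by linarith
    rw [le_div_iff_of_neg hd, div_le_iff_of_neg hd]
    constructor <;> nlinarith
  · have hd : 0 < y - x := by linarith
    rw [le_div_iff₀ hd, div_le_iff₀ hd]
    constructor <;> nlinarith

/-- Topological description of the trajectories of a field for which the axis `Σ_i` is crossing:
they are graphs over `Σ_{i+1}`, composed of leaves of both foliations. -/
structure GraphOrbit {Z : Omega U r} {i : Fin 2} {ε sX sY mX MX mY MY ρ : ℝ}
    (c : LocalChart Z i ε ε sX sY mX MX mY MY ρ) (a b : ℝ) (δ : ℝ → Plane) : Prop where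
  cont : ContinuousOn δ (Icc a b)
  mono : StrictMonoOn (fun t => ε * δ t i) (Icc a b)
  pos : ∀ t ∈ Icc a b, 0 < δ t i * δ t (i + 1) →
    ∀ᶠ s in 𝓝[Icc a b] t, c.X.lab (δ s) = c.X.lab (δ t)
  neg : ∀ t ∈ Icc a b, δ t i * δ t (i + 1) < 0 →
    ∀ᶠ s in 𝓝[Icc a b] t, c.Y.lab (δ s) = c.Y.lab (δ t)
  slide : sX = -sY → ∀ t ∈ Icc a b, δ t (i + 1) = 0 → ∀ᶠ s in 𝓝[Icc a b] t, δ s (i + 1) = 0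
  cross : sX = sY → ∀ t ∈ Icc a b, δ t (i + 1) = 0 →
    ∀ᶠ s in 𝓝[Icc a b \ {t}] t, δ s (i + 1) ≠ 0
  -- With positive slopes the motion through the origin runs in `{u v ≥ 0}`, where `X` acts; with
  -- negative slopes it runs in `{u v ≤ 0}`, where `Y` acts. The label `0` is that of the leaf
  -- through the origin.
  originX : sX = sY → sX = 1 → ∀ t ∈ Icc a b, δ t = 0 →
    ∀ᶠ s in 𝓝[Icc a b] t, 0 ≤ δ s i * δ s (i + 1) ∧ c.X.lab (δ s) = 0
  originY : sX = sY → sX = -1 → ∀ t ∈ Icc a b, δ t = 0 →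
    ∀ᶠ s in 𝓝[Icc a b] t, δ s i * δ s (i + 1) ≤ 0 ∧ c.Y.lab (δ s) = 0

theorem FieldChart.lab_zero {V : Plane → Plane} {i : Fin 2} {ε s m M ρ : ℝ}
    (ch : FieldChart V i ε s m M ρ) : ch.lab 0 = 0 := by
  simp [FieldChart.lab, ch.fol.H_zero]

theorem FieldChart.eventually_lab_eq {V : Plane → Plane} {i : Fin 2} {ε s m M ρ : ℝ}
    (ch : FieldChart V i ε s m M ρ) (hε : ε = 1 ∨ ε = -1) {γ : ℝ → Plane} {a b t : ℝ}
    (ht : t ∈ Icc a b) (hbox : MapsTo γ (Icc a b) (box ρ))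
    (h : ∀ᶠ s in 𝓝[Icc a b] t, HasDerivWithinAt γ (V (γ s)) (Icc a b) s) :
    ∀ᶠ s in 𝓝[Icc a b] t, ch.lab (γ s) = ch.lab (γ t) := by
  rw [eventually_nhdsWithin_iff, Metric.eventually_nhds_iff] at h ⊢
  obtain ⟨η, hη, h⟩ := h
  refine ⟨η, hη, fun s hs hsI => ?_⟩
  rw [Real.dist_eq, abs_lt] at hs
  have key : ∀ x y, x ∈ Icc a b → y ∈ Icc a b → x ≤ y → t - η < x → y < t + η →
      ch.lab (γ y) = ch.lab (γ x) := by
    intro x y hx hy hxy h1 h2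
    have hsub : Icc x y ⊆ Icc a b := Icc_subset_Icc hx.1 hy.2
    refine ch.lab_eq_of_solution hε hxy fun z hz => ⟨hbox (hsub hz), (h ?_ (hsub hz)).mono hsub⟩
    rw [Real.dist_eq, abs_lt]
    constructor <;> linarith [hz.1, hz.2]
  rcases le_total s t with hst | hst
  · exact (key s t hsI ht hst (by linarith) (by linarith)).symm
  · exact key t s ht hsI hst (by linarith) (by linarith)

theorem nhdsWithin_diff_neBot {a b t : ℝ} (hab : a < b) (ht : t ∈ Icc a b) :
    (𝓝[Icc a b \ {t}] t).NeBot := by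
  rw [← mem_closure_iff_nhdsWithin_neBot]
  rcases ht.2.lt_or_eq with h | h
  · have : t ∈ closure (Ioo t b) := by
      rw [closure_Ioo h.ne]
      exact left_mem_Icc.2 h.le
    refine closure_mono (s := Ioo t b) ?_ this
    exact fun s hs => ⟨⟨ht.1.trans hs.1.le, hs.2.le⟩, hs.1.ne'⟩
  · have h' : a < t := h ▸ hab
    have : t ∈ closure (Ioo a t) := by
      rw [closure_Ioo h'.ne]
      exact right_mem_Icc.2 h'.le
    refine closure_mono (s := Ioo a t) ?_ this
    exact fun s hs => ⟨⟨hs.1.le, hs.2.le.trans ht.2⟩, hs.2.ne⟩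

end

/-! ### From trajectories to graph orbits. -/

section


variable {U : Set Plane} {r : ℕ} {Z : Omega U r} {i : Fin 2}

theorem RegularLaw.hasDeriv_pos {J : Set ℝ} {γ : ℝ → Plane} {t : ℝ} (h : RegularLaw Z J γ t)
    (i : Fin 2) (hp : 0 < γ t i * γ t (i + 1)) : HasDerivWithinAt γ (Z.1 (γ t)) J t :=
  h.pos (by rwa [mul_coord i])

theorem RegularLaw.hasDeriv_neg {J : Set ℝ} {γ : ℝ → Plane} {t : ℝ} (h : RegularLaw Z J γ t)
    (i : Fin 2) (hp : γ t i * γ t (i + 1) < 0) : HasDerivWithinAt γ (Z.2 (γ t)) J t :=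
  h.neg (by rwa [mul_coord i])

theorem mul_ne_zero_of_not_mem_switching (i : Fin 2) {p : Plane} (hp : p ∉ switching) :
    0 < p i * p (i + 1) ∨ p i * p (i + 1) < 0 := by
  rw [mem_switching i, not_or] at hp
  exact (mul_ne_zero hp.1 hp.2).lt_or_gt.symm

theorem eventually_nhdsWithin_of_continuousOn {γ : ℝ → Plane} {J : Set ℝ} {t : ℝ}
    (hγ : ContinuousOn γ J) (ht : t ∈ J) {P : Plane → Prop} (hP : ∀ᶠ p in 𝓝 (γ t), P p) :
    ∀ᶠ s in 𝓝[J] t, P (γ s) :=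
  (hγ t ht).eventually hP

theorem eventually_mul_pos (i : Fin 2) {p : Plane} (hp : 0 < p i * p (i + 1)) :
    ∀ᶠ q in 𝓝 p, 0 < q i * q (i + 1) :=
  ((continuous_coord i).mul (continuous_coord (i + 1))).continuousAt.eventually (lt_mem_nhds hp)

theorem eventually_mul_neg (i : Fin 2) {p : Plane} (hp : p i * p (i + 1) < 0) :
    ∀ᶠ q in 𝓝 p, q i * q (i + 1) < 0 :=
  ((continuous_coord i).mul (continuous_coord (i + 1))).continuousAt.eventually (gt_mem_nhds hp)

theorem eventually_coord_ne {k : Fin 2} {p : Plane} (hp : p k ≠ 0) : ∀ᶠ q in 𝓝 p, q k ≠ 0 :=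
  (continuous_coord k).continuousAt.eventually_ne hp

section TrajectoryToOrbit

variable {ε sX sY mX MX mY MY ρ : ℝ}

namespace LocalChart

/-- Whichever field carries the motion through the origin, its velocity has the same known signs,
because both fields share `ε` and `sX = sY`. These signs later decide which of the two fields it is.
-/
theorem origin_deriv (c : LocalChart Z i ε ε sX sY mX MX mY MY ρ) (h : sX = sY)
    {γ : ℝ → Plane} {J : Set ℝ} {t : ℝ} (ht : t ∈ J) (h0 : γ t = 0) (hlaw : OriginLaw Z J γ t) :
    ((∀ᶠ s in 𝓝[J] t, 0 ≤ γ s i * γ s (i + 1) ∧ HasDerivWithinAt γ (Z.1 (γ s)) J s) ∨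
      (∀ᶠ s in 𝓝[J] t, γ s i * γ s (i + 1) ≤ 0 ∧ HasDerivWithinAt γ (Z.2 (γ s)) J s)) ∧
    ∃ w : Plane, HasDerivWithinAt γ w J t ∧ 0 < ε * w i ∧ 0 < sX * (ε * w (i + 1)) := by
  have hc : ∀ k, CrossesNear Z k :=
    (forall_fin_two' i).2 ⟨c.crossesNear_fst, c.crossesNear_snd h⟩
  have h0b : (0 : Plane) ∈ box ρ := mem_box_zero c.ρ_pos.le
  have := hlaw.cross hc
  simp only [mul_coord i] at this
  refine ⟨this, ?_⟩
  rcases this with h1 | h1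
  · have := (h1.self_of_nhdsWithin ht).2
    rw [h0] at this
    exact ⟨_, this, c.X_fst h0b, c.X_snd h0b⟩
  · have := (h1.self_of_nhdsWithin ht).2
    rw [h0] at this
    exact ⟨_, this, c.Y_fst h0b, h ▸ c.Y_snd h0b⟩

theorem slidesAt_of_trajectory (c : LocalChart Z i ε ε sX sY mX MX mY MY ρ) (h : sX = -sY)
    {γ : ℝ → Plane} {J : Set ℝ} {t : ℝ} (hγ : IsTrajectory Z J γ) (hbox : MapsTo γ J (box ρ))
    (ht : t ∈ J) (hv : γ t (i + 1) = 0) : SlidesAt Z (i + 1) J γ t := by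
  by_cases h0 : γ t = 0
  · refine (hγ.origin t ht h0).slide _ (c.slidesNear_snd h) ?_
    rw [fin_two_add]
    exact c.crossesNear_fst
  · exact (hγ.regular t ht).slide _ ⟨hv, h0, c.snd_neg h (hbox ht)⟩

theorem slideSpeed_pos (c : LocalChart Z i ε ε sX sY mX MX mY MY ρ) (h : sX = -sY) {p : Plane}
    (hp : p ∈ box ρ) : min c.X.c c.Y.c ≤ ε * slideSpeed Z i p ∧
      ε * slideSpeed Z i p ≤ max c.X.C c.Y.C :=
  slideSpeed_bounds (c.snd_neg h hp)
    ⟨(min_le_left _ _).trans (c.X.speed p hp).1, (c.X.speed p hp).2.trans (le_max_left _ _)⟩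
    ⟨(min_le_right _ _).trans (c.Y.speed p hp).1, (c.Y.speed p hp).2.trans (le_max_right _ _)⟩

theorem min_c_pos (c : LocalChart Z i ε ε sX sY mX MX mY MY ρ) : 0 < min c.X.c c.Y.c :=
  lt_min c.X.c_pos c.Y.c_pos

/-- Off the switching set the coordinate `p i` is monotone along trajectories. -/
theorem deriv_of_not_switching (c : LocalChart Z i ε ε sX sY mX MX mY MY ρ)
    {γ : ℝ → Plane} {J : Set ℝ} {t : ℝ} (hγ : IsTrajectory Z J γ) (hbox : MapsTo γ J (box ρ))
    (ht : t ∈ J) (hs : γ t ∉ switching) :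
    ∃ f', 0 < f' ∧ HasDerivWithinAt (fun s => ε * γ s i) f' J t := by
  rcases mul_ne_zero_of_not_mem_switching i hs with h | h
  · exact ⟨_, c.X_fst (hbox ht), (hasDerivWithinAt_coord ((hγ.regular t ht).hasDeriv_pos i h)
      i).const_mul ε⟩
  · exact ⟨_, c.Y_fst (hbox ht), (hasDerivWithinAt_coord ((hγ.regular t ht).hasDeriv_neg i h)
      i).const_mul ε⟩

theorem continuousOn_coord {γ : ℝ → Plane} {J : Set ℝ} (hγ : ContinuousOn γ J) (ε : ℝ) (k : Fin 2) :
    ContinuousOn (fun t => ε * γ t k) J :=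
  continuousOn_const.mul ((continuous_coord k).comp_continuousOn hγ)

/-- Both fields and, as a mean of them, the sliding field move in the direction `ε` along the
coordinate `i`. At a crossing point no derivative need exist, but the curve is off the switching set
at all other nearby times, and this suffices. -/
theorem strictMonoOn_of_trajectory (c : LocalChart Z i ε ε sX sY mX MX mY MY ρ)
    {γ : ℝ → Plane} {a b : ℝ} (hγ : IsTrajectory Z (Icc a b) γ)
    (hbox : MapsTo γ (Icc a b) (box ρ)) :
    StrictMonoOn (fun t => ε * γ t i) (Icc a b) := by
  refine strictMonoOn_of_local (continuousOn_coord hγ.continuousOn ε i) fun t ht => ?_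
  have hcross : ∀ k, γ t ∈ crossing Z k →
      ∀ᶠ s in 𝓝[Icc a b] t, (s < t → ε * γ s i < ε * γ t i) ∧ (t < s → ε * γ t i < ε * γ s i) := by
    intro k hk
    refine eventually_lt_of_punctured ht (continuousOn_coord hγ.continuousOn ε i) ?_
    filter_upwards [(hγ.regular t ht).cross k hk, self_mem_nhdsWithin] with s hs hsI
    exact c.deriv_of_not_switching hγ hbox hsI.1 hs
  by_cases hs : γ t ∈ switching
  swap
  · obtain ⟨f', hf', hd⟩ := c.deriv_of_not_switching hγ hbox ht hs
    exact eventually_lt_of_hasDerivWithinAt_pos hd hf'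
  by_cases hv : γ t (i + 1) = 0
  · rcases c.sign_cases with h | h
    · by_cases h0 : γ t = 0
      · obtain ⟨-, w, hw, hw1, -⟩ := c.origin_deriv h ht h0 (hγ.origin t ht h0)
        exact eventually_lt_of_hasDerivWithinAt_pos
          ((hasDerivWithinAt_coord hw i).const_mul ε) hw1
      · exact hcross (i + 1) ⟨hv, h0, c.snd_pos h (hbox ht)⟩
    · have := (c.slidesAt_of_trajectory h hγ hbox ht hv).2
      refine eventually_lt_of_hasDerivWithinAt_pos
        ((hasDerivWithinAt_coord this i).const_mul ε) ?_
      rw [slidingField_fst]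
      exact c.min_c_pos.trans_le (c.slideSpeed_pos h (hbox ht)).1
  · have hu : γ t i = 0 := ((mem_switching i).1 hs).resolve_right hv
    refine hcross i ⟨hu, fun h0 => hv ?_, c.fst_pos (hbox ht)⟩
    rw [h0]
    rfl

/-- In a quadrant the trajectory solves the equation of one field and stays in a leaf. At the origin
with both axes crossing, the signs of the velocity put `γ` at once into the quadrants where `u v`
has the sign `sX`, and this rules out one of the two alternatives of `OriginLaw`. -/
theorem graphOrbit_of_trajectory (c : LocalChart Z i ε ε sX sY mX MX mY MY ρ)
    {γ : ℝ → Plane} {a b : ℝ} (hab : a < b) (hγ : IsTrajectory Z (Icc a b) γ)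
    (hbox : MapsTo γ (Icc a b) (box ρ)) : GraphOrbit c a b γ := by
  have hcont := hγ.continuousOn
  -- at the origin both coordinates have a derivative with a known sign
  have horig : sX = sY → ∀ t ∈ Icc a b, γ t = 0 →
      ∀ᶠ s in 𝓝[Icc a b \ {t}] t, γ s (i + 1) ≠ 0 ∧ 0 < sX * (γ s i * γ s (i + 1)) := by
    intro h t ht h0
    obtain ⟨-, w, hw, hw1, hw2⟩ := c.origin_deriv h ht h0 (hγ.origin t ht h0)
    have e1 := eventually_lt_of_hasDerivWithinAt_pos ((hasDerivWithinAt_coord hw i).const_mul ε) hw1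
    have e2 := eventually_lt_of_hasDerivWithinAt_pos
      (((hasDerivWithinAt_coord hw (i + 1)).const_mul ε).const_mul sX) hw2
    filter_upwards [nhdsWithin_mono t sdiff_subset e1, nhdsWithin_mono t sdiff_subset e2,
      self_mem_nhdsWithin] with s h1 h2 h3
    have h0k : ∀ k, γ t k = 0 := fun k => by rw [h0]; rfl
    simp only [h0k, mul_zero] at h1 h2
    have hpos : 0 < (ε * γ s i) * (sX * (ε * γ s (i + 1))) := by
      rcases lt_or_gt_of_ne h3.2 with h | h
      · exact mul_pos_of_neg_of_neg (h1.1 h) (h2.1 h)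
      · exact mul_pos (h1.2 h) (h2.2 h)
    refine ⟨fun hz => ?_, ?_⟩
    · rw [hz] at hpos
      simp at hpos
    · have e : (ε * γ s i) * (sX * (ε * γ s (i + 1))) =
        (ε * ε) * (sX * (γ s i * γ s (i + 1))) := by ring
      rwa [e, mul_self_sign c.εX_sign, one_mul] at hpos
  refine ⟨hcont, c.strictMonoOn_of_trajectory hγ hbox, fun t ht h => ?_, fun t ht h => ?_,
    fun h t ht hv => (c.slidesAt_of_trajectory h hγ hbox ht hv).1, fun h t ht hv => ?_,
    fun h h1 t ht h0 => ?_, fun h h1 t ht h0 => ?_⟩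
  · refine c.X.eventually_lab_eq c.εX_sign ht hbox ?_
    filter_upwards [eventually_nhdsWithin_of_continuousOn hcont ht (eventually_mul_pos i h),
      self_mem_nhdsWithin] with s hs hsI using (hγ.regular s hsI).hasDeriv_pos i hs
  · refine c.Y.eventually_lab_eq c.εX_sign ht hbox ?_
    filter_upwards [eventually_nhdsWithin_of_continuousOn hcont ht (eventually_mul_neg i h),
      self_mem_nhdsWithin] with s hs hsI using (hγ.regular s hsI).hasDeriv_neg i hs
  · by_cases h0 : γ t = 0
    · exact (horig h t ht h0).mono fun s hs => hs.1
    · filter_upwards [(hγ.regular t ht).cross (i + 1) ⟨hv, h0, c.snd_pos h (hbox ht)⟩] with s hs h'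
      exact hs ((mem_switching i).2 (Or.inr h'))
  · rcases (c.origin_deriv h ht h0 (hγ.origin t ht h0)).1 with h2 | h2
    · have := c.X.eventually_lab_eq c.εX_sign ht hbox (h2.mono fun s hs => hs.2)
      filter_upwards [h2, this] with s hs1 hs2
      exact ⟨hs1.1, by rw [hs2, h0, c.X.lab_zero]⟩
    -- The motion would remain in `{u v ≤ 0}`, although its velocity at the origin leads into `{u v
    -- > 0}`.
    · exfalso
      have := nhdsWithin_diff_neBot hab ht
      obtain ⟨s, hs1, hs2⟩ := ((horig h t ht h0).and (nhdsWithin_mono t sdiff_subset h2)).exists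
      rw [h1, one_mul] at hs1
      linarith [hs1.2, hs2.1]
  · rcases (c.origin_deriv h ht h0 (hγ.origin t ht h0)).1 with h2 | h2
    · exfalso
      have := nhdsWithin_diff_neBot hab ht
      obtain ⟨s, hs1, hs2⟩ := ((horig h t ht h0).and (nhdsWithin_mono t sdiff_subset h2)).exists
      rw [h1] at hs1
      linarith [hs1.2, hs2.1]
    · have := c.Y.eventually_lab_eq c.εX_sign ht hbox (h2.mono fun s hs => hs.2)
      filter_upwards [h2, this] with s hs1 hs2
      exact ⟨hs1.1, by rw [hs2, h0, c.Y.lab_zero]⟩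

end LocalChart

end TrajectoryToOrbit

end

/-! ### From graph orbits back to trajectories. -/

section


variable {U : Set Plane} {r : ℕ} {Z : Omega U r} {i : Fin 2}

section OrbitToTrajectory

variable {ε sX sY mX MX mY MY ρ : ℝ}

/-- Along a leaf of the foliation of `V`, travelled with the speed of `V`, a curve solves the
equation `γ' = V γ`. -/
theorem FieldChart.hasDerivWithinAt_of_lab {V : Plane → Plane} {s m M : ℝ}
    (ch : FieldChart V i ε s m M ρ) (hε : ε = 1 ∨ ε = -1) {β : ℝ → Plane} {J : Set ℝ} {t k : ℝ}
    (ht : t ∈ J) (hβ : β t ∈ box ρ) (hlab : ∀ᶠ s in 𝓝[J] t, ch.lab (β s) = k)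
    (hd : HasDerivWithinAt (fun s => ε * β s i) (ε * V (β t) i) J t) :
    HasDerivWithinAt β (V (β t)) J t := by
  have hu : HasDerivWithinAt (fun s => β s i) (V (β t) i) J t := by
    have := hd.const_mul ε
    simpa only [← mul_assoc, mul_self_sign hε, one_mul] using this
  refine hasDerivWithinAt_of_coord i hu ?_
  have hW : ∀ s, ch.lab (β s) = k → β s (i + 1) = ch.fol.W (β s i) k := fun s hs => by
    rw [← hs, FieldChart.lab, ch.fol.W_H]
  have ht' := hW t (hlab.self_of_nhdsWithin ht)
  have h1 : HasDerivWithinAt (fun s => ch.fol.W (β s i) k)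
      (ch.F (β t i) (ch.fol.W (β t i) k) * V (β t) i) J t :=
    HasDerivAt.comp_hasDerivWithinAt (h₂ := fun x => ch.fol.W x k) (h := fun s => β s i) t
      (ch.fol.hasDerivAt_W (β t i) k) hu
  rw [← ht', ← ch.slope _ hβ] at h1
  exact h1.congr_of_eventuallyEq (hlab.mono hW) ht'

namespace LocalChart

/-- The speed, in the direction of the coordinate `p i`, of the trajectories of `Z`. -/
def speed (_c : LocalChart Z i ε ε sX sY mX MX mY MY ρ) (p : Plane) : ℝ :=
  if 0 < p i * p (i + 1) then ε * Z.1 p i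
  else if p i * p (i + 1) < 0 then ε * Z.2 p i
  -- Among the points of the axes, this value matters only on `Σ_{i+1}`: at a crossing point of
  -- `Σ_i` no velocity is prescribed. For the same reason the last branch matters only at the
  -- origin.
  else if sX = -sY then ε * slideSpeed Z i p
  else if sX = 1 then ε * Z.1 p i else ε * Z.2 p i

theorem speed_bounds (c : LocalChart Z i ε ε sX sY mX MX mY MY ρ) {p : Plane} (hp : p ∈ box ρ) :
    min c.X.c c.Y.c ≤ c.speed p ∧ c.speed p ≤ max c.X.C c.Y.C := by
  have hX : min c.X.c c.Y.c ≤ ε * Z.1 p i ∧ ε * Z.1 p i ≤ max c.X.C c.Y.C :=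
    ⟨(min_le_left _ _).trans (c.X.speed p hp).1, (c.X.speed p hp).2.trans (le_max_left _ _)⟩
  have hY : min c.X.c c.Y.c ≤ ε * Z.2 p i ∧ ε * Z.2 p i ≤ max c.X.C c.Y.C :=
    ⟨(min_le_right _ _).trans (c.Y.speed p hp).1, (c.Y.speed p hp).2.trans (le_max_right _ _)⟩
  unfold speed
  split_ifs with h1 h2 h3 h4
  exacts [hX, hY, c.slideSpeed_pos h3 hp, hX, hY]

theorem continuousOn_X (c : LocalChart Z i ε ε sX sY mX MX mY MY ρ) (k : Fin 2) :
    ContinuousOn (fun p => Z.1 p k) (box ρ) := (continuous_coord k).comp_continuousOn c.X.cont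

theorem continuousOn_Y (c : LocalChart Z i ε ε sX sY mX MX mY MY ρ) (k : Fin 2) :
    ContinuousOn (fun p => Z.2 p k) (box ρ) := (continuous_coord k).comp_continuousOn c.Y.cont

theorem continuousOn_slideSpeed (c : LocalChart Z i ε ε sX sY mX MX mY MY ρ) (h : sX = -sY) :
    ContinuousOn (slideSpeed Z i) (box ρ) := by
  refine (((c.continuousOn_Y (i + 1)).mul (c.continuousOn_X i)).sub
    ((c.continuousOn_X (i + 1)).mul (c.continuousOn_Y i))).div
    ((c.continuousOn_Y (i + 1)).sub (c.continuousOn_X (i + 1)))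
    fun p hp (h0 : Z.2 p (i + 1) - Z.1 p (i + 1) = 0) => ?_
  have h1 := c.snd_neg h hp
  rw [sub_eq_zero.1 h0] at h1
  exact absurd h1 (not_lt.2 (mul_self_nonneg _))

theorem measurable_speed (c : LocalChart Z i ε ε sX sY mX MX mY MY ρ) {D : ℝ → Plane}
    (hD : Continuous D) (hb : ∀ t, D t ∈ box ρ) : Measurable fun t => c.speed (D t) := by
  have hm : Continuous fun t => D t i * D t (i + 1) :=
    ((continuous_coord i).comp hD).mul ((continuous_coord (i + 1)).comp hD)
  have hX : Measurable fun t => ε * Z.1 (D t) i :=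
    (continuous_const.mul ((c.continuousOn_X i).comp_continuous hD hb)).measurable
  have hY : Measurable fun t => ε * Z.2 (D t) i :=
    (continuous_const.mul ((c.continuousOn_Y i).comp_continuous hD hb)).measurable
  unfold speed
  refine Measurable.ite (measurableSet_lt measurable_const hm.measurable) hX
    (Measurable.ite (measurableSet_lt hm.measurable measurable_const) hY ?_)
  by_cases h : sX = -sY
  · simp only [h, if_true]
    exact (continuous_const.mul ((c.continuousOn_slideSpeed h).comp_continuous hD hb)).measurable
  · simp only [h, if_false]
    by_cases h1 : sX = 1
    · simpa only [h1, if_true] using hX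
    · simpa only [h1, if_false] using hY

end LocalChart

/-- The leaves fix the direction of the motion, so only the speed has to be adjusted. The required
speed may jump at crossings, but it is measurable and lies between positive constants, as
`exists_reparam` asks; at every time at which the laws of motion prescribe a velocity it is
continuous along the curve. -/
theorem GraphOrbit.exists_trajectory {c : LocalChart Z i ε ε sX sY mX MX mY MY ρ} {a b : ℝ}
    {δ : ℝ → Plane} (hab : a < b) (hδ : GraphOrbit c a b δ) (hbox : MapsTo δ (Icc a b) (box ρ)) :
    ∃ (c₀ d₀ : ℝ) (σ : ℝ → ℝ), c₀ < d₀ ∧ StrictMonoOn σ (Icc c₀ d₀) ∧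
      σ '' Icc c₀ d₀ = Icc a b ∧ IsTrajectory Z (Icc c₀ d₀) (fun s => δ (σ s)) := by
  have hD : Continuous fun t => δ (projIcc a b hab.le t) :=
    hδ.cont.comp_continuous (continuous_subtype_val.comp continuous_projIcc) fun t =>
      (projIcc a b hab.le t).2
  obtain ⟨c₀, d₀, σ, hcd, hσ, himg, hσc, hder⟩ := exists_reparam (w := fun t => c.speed (δ t)) hab
    (LocalChart.continuousOn_coord hδ.cont ε i) hδ.mono
    (c.measurable_speed hD fun t => hbox (projIcc a b hab.le t).2) c.min_c_pos
    (fun t ht => c.speed_bounds (hbox ht))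
  refine ⟨c₀, d₀, σ, hcd, hσ, himg, ?_⟩
  set J := Icc c₀ d₀ with hJ
  have hmaps : MapsTo σ J (Icc a b) := fun s hs => himg ▸ mem_image_of_mem σ hs
  have htend : ∀ s ∈ J, Tendsto σ (𝓝[J] s) (𝓝[Icc a b] (σ s)) := fun s hs =>
    tendsto_nhdsWithin_of_tendsto_nhds_of_eventually_within σ (hσc s hs)
      (eventually_nhdsWithin_of_forall hmaps)
  have htend' : ∀ s ∈ J, Tendsto σ (𝓝[J \ {s}] s) (𝓝[Icc a b \ {σ s}] (σ s)) := fun s hs =>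
    tendsto_nhdsWithin_of_tendsto_nhds_of_eventually_within σ
      ((hσc s hs).mono_left (nhdsWithin_mono s sdiff_subset))
      (eventually_nhdsWithin_of_forall fun x hx =>
        ⟨hmaps hx.1, fun h => hx.2 (hσ.injOn hx.1 hs h)⟩)
  have hβc : ContinuousOn (fun s => δ (σ s)) J := hδ.cont.comp hσc hmaps
  have hβb : MapsTo (fun s => δ (σ s)) J (box ρ) := fun s hs => hbox (hmaps hs)
  -- continuity of the speed along the curve
  have hspeed : ∀ s ∈ J, ∀ f : Plane → ℝ, ContinuousOn f (box ρ) →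
      (∀ᶠ t in 𝓝[Icc a b] (σ s), c.speed (δ t) = f (δ t)) →
      HasDerivWithinAt (fun s => ε * δ (σ s) i) (f (δ (σ s))) J s := by
    intro s hs f hf he
    have h1 := he.self_of_nhdsWithin (hmaps hs)
    rw [← h1]
    refine hder s hs (ContinuousWithinAt.congr_of_eventuallyEq ?_ he h1)
    exact (hf _ (hbox (hmaps hs))).comp (hδ.cont _ (hmaps hs)) hbox
  have hX : ContinuousOn (fun p => ε * Z.1 p i) (box ρ) := continuousOn_const.mul (c.continuousOn_X i)
  have hY : ContinuousOn (fun p => ε * Z.2 p i) (box ρ) := continuousOn_const.mul (c.continuousOn_Y i)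
  have hderX : ∀ s ∈ J, ∀ k, (∀ᶠ t in 𝓝[Icc a b] (σ s), c.speed (δ t) = ε * Z.1 (δ t) i) →
      (∀ᶠ t in 𝓝[Icc a b] (σ s), c.X.lab (δ t) = k) →
      HasDerivWithinAt (fun s => δ (σ s)) (Z.1 (δ (σ s))) J s := fun s hs k he hk =>
    c.X.hasDerivWithinAt_of_lab c.εX_sign hs (hβb hs) ((htend s hs).eventually hk)
      (hspeed s hs _ hX he)
  have hderY : ∀ s ∈ J, ∀ k, (∀ᶠ t in 𝓝[Icc a b] (σ s), c.speed (δ t) = ε * Z.2 (δ t) i) →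
      (∀ᶠ t in 𝓝[Icc a b] (σ s), c.Y.lab (δ t) = k) →
      HasDerivWithinAt (fun s => δ (σ s)) (Z.2 (δ (σ s))) J s := fun s hs k he hk =>
    c.Y.hasDerivWithinAt_of_lab c.εX_sign hs (hβb hs) ((htend s hs).eventually hk)
      (hspeed s hs _ hY he)
  have hpos : ∀ s ∈ J, 0 < δ (σ s) i * δ (σ s) (i + 1) →
      HasDerivWithinAt (fun s => δ (σ s)) (Z.1 (δ (σ s))) J s := fun s hs h => by
    refine hderX s hs _ ?_ (hδ.pos _ (hmaps hs) h)
    filter_upwards [eventually_nhdsWithin_of_continuousOn hδ.cont (hmaps hs)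
      (eventually_mul_pos i h)] with t ht
    rw [LocalChart.speed, if_pos ht]
  have hneg : ∀ s ∈ J, δ (σ s) i * δ (σ s) (i + 1) < 0 →
      HasDerivWithinAt (fun s => δ (σ s)) (Z.2 (δ (σ s))) J s := fun s hs h => by
    refine hderY s hs _ ?_ (hδ.neg _ (hmaps hs) h)
    filter_upwards [eventually_nhdsWithin_of_continuousOn hδ.cont (hmaps hs)
      (eventually_mul_neg i h)] with t ht
    rw [LocalChart.speed, if_neg ht.not_gt, if_pos ht]
  have hslide : sX = -sY → ∀ s ∈ J, δ (σ s) (i + 1) = 0 →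
      SlidesAt Z (i + 1) J (fun s => δ (σ s)) s := by
    intro h s hs hv
    have he := hδ.slide h _ (hmaps hs) hv
    have he' := (htend s hs).eventually he
    refine ⟨he', hasDerivWithinAt_of_coord i ?_ ?_⟩
    · have h1 : HasDerivWithinAt (fun s => ε * δ (σ s) i) (ε * slideSpeed Z i (δ (σ s))) J s := by
        refine hspeed s hs (fun p => ε * slideSpeed Z i p)
          (continuousOn_const.mul (c.continuousOn_slideSpeed h)) ?_
        filter_upwards [he] with t ht
        rw [LocalChart.speed, ht, mul_zero, if_neg (lt_irrefl _), if_neg (lt_irrefl _), if_pos h]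
      rw [slidingField_fst]
      have := h1.const_mul ε
      simpa only [← mul_assoc, mul_self_sign c.εX_sign, one_mul] using this
    · rw [slidingField_snd]
      exact (hasDerivWithinAt_const s J (0 : ℝ)).congr_of_eventuallyEq he' hv
  -- off the tangency points of the sliding axis, the curve leaves the switching set at once
  have hpunct : ∀ t ∈ Icc a b, (δ t (i + 1) ≠ 0 ∨ sX = sY) →
      ∀ᶠ t' in 𝓝[Icc a b \ {t}] t, δ t' ∉ switching := by
    intro t ht h
    have hu : ∀ᶠ t' in 𝓝[Icc a b \ {t}] t, δ t' i ≠ 0 := by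
      by_cases h0 : δ t i = 0
      -- Strict monotonicity of the coordinate `i` allows only one meeting with `Σ_i`.
      · filter_upwards [self_mem_nhdsWithin] with t' ht' h'
        exact ht'.2 (hδ.mono.injOn ht'.1 ht (by simp only [h0, h']))
      · exact nhdsWithin_mono t sdiff_subset
          (eventually_nhdsWithin_of_continuousOn hδ.cont ht (eventually_coord_ne h0))
    have hv : ∀ᶠ t' in 𝓝[Icc a b \ {t}] t, δ t' (i + 1) ≠ 0 := by
      by_cases h0 : δ t (i + 1) = 0
      · exact hδ.cross (h.resolve_left (fun h' => h' h0)) t ht h0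
      · exact nhdsWithin_mono t sdiff_subset
          (eventually_nhdsWithin_of_continuousOn hδ.cont ht (eventually_coord_ne h0))
    filter_upwards [hu, hv] with t' h1 h2
    rw [mem_switching i, not_or]
    exact ⟨h1, h2⟩
  refine ⟨hβc, fun s hs => c.sub (hβb hs), fun s hs => ⟨?_, ?_, ?_, ?_⟩,
    fun s hs k hk => absurd hk (c.not_tangency (hβb hs) k), fun s hs h0 => ⟨?_, ?_, ?_⟩⟩
  · rw [mul_coord i]
    exact hpos s hs
  · rw [mul_coord i]
    exact hneg s hs
  · intro k hk
    refine (htend' s hs).eventually (hpunct _ (hmaps hs) ?_)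
    rcases fin_two_cases i k with rfl | rfl
    · left
      intro hv
      exact hk.2.1 ((plane_eq_zero k).2 ⟨hk.1, hv⟩)
    · right
      refine c.sign_cases.resolve_right fun h => ?_
      exact lt_asymm hk.2.2 (c.snd_neg h (hβb hs))
  · intro k hk
    rcases fin_two_cases i k with rfl | rfl
    · exact absurd hk.2.2 (not_lt.2 (c.fst_pos (hβb hs)).le)
    · refine hslide ?_ s hs hk.1
      refine c.sign_cases.resolve_left fun h => ?_
      exact lt_asymm hk.2.2 (c.snd_pos h (hβb hs))
  · intro hc
    have h : sX = sY := c.sign_cases.resolve_right fun h =>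
      LocalChart.not_slidesNear_of_crossesNear (hc (i + 1)) (c.slidesNear_snd h)
    have hne : sX ≠ -sY := fun h' =>
      LocalChart.not_slidesNear_of_crossesNear (hc (i + 1)) (c.slidesNear_snd h')
    have hev : ∀ᶠ s' in 𝓝[J] s, s' = s ∨ δ (σ s') ∉ switching := by
      have := (htend' s hs).eventually (hpunct _ (hmaps hs) (Or.inr h))
      rw [eventually_nhdsWithin_iff] at this ⊢
      filter_upwards [this] with s' h1 h2
      by_cases h3 : s' = s
      · exact Or.inl h3
      · exact Or.inr (h1 ⟨h2, h3⟩)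
    simp only [mul_coord i]
    rcases c.sX_sign with h1 | h1
    · left
      have ho := hδ.originX h h1 _ (hmaps hs) h0
      filter_upwards [hev, (htend s hs).eventually ho, self_mem_nhdsWithin] with s' h2 h3 h4
      refine ⟨h3.1, ?_⟩
      rcases h2 with rfl | h2
      · refine hderX s' hs 0 ?_ (ho.mono fun t ht => ht.2)
        filter_upwards [ho] with t ht
        rcases ht.1.lt_or_eq with h5 | h5
        · rw [LocalChart.speed, if_pos h5]
        · rw [LocalChart.speed, if_neg h5.not_lt, if_neg h5.not_gt, if_neg hne, if_pos h1]
      · rcases mul_ne_zero_of_not_mem_switching i h2 with h5 | h5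
        · exact hpos s' h4 h5
        · exact absurd h3.1 (not_le.2 h5)
    · right
      have h1' : sX ≠ 1 := by rw [h1]; norm_num
      have ho := hδ.originY h h1 _ (hmaps hs) h0
      filter_upwards [hev, (htend s hs).eventually ho, self_mem_nhdsWithin] with s' h2 h3 h4
      refine ⟨h3.1, ?_⟩
      rcases h2 with rfl | h2
      · refine hderY s' hs 0 ?_ (ho.mono fun t ht => ht.2)
        filter_upwards [ho] with t ht
        rcases ht.1.lt_or_eq with h5 | h5
        · rw [LocalChart.speed, if_neg h5.not_gt, if_pos h5]
        · rw [LocalChart.speed, if_neg h5.not_gt, if_neg h5.not_lt, if_neg hne, if_neg h1']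
      · rcases mul_ne_zero_of_not_mem_switching i h2 with h5 | h5
        · exact absurd h3.1 (not_le.2 h5)
        · exact hneg s' h4 h5
  · intro k hk hk'
    rcases fin_two_cases i k with rfl | rfl
    · exact absurd hk (LocalChart.not_slidesNear_of_crossesNear c.crossesNear_fst)
    · have h : sX = -sY := c.sign_cases.resolve_left fun h =>
        LocalChart.not_slidesNear_of_crossesNear (c.crossesNear_snd h) hk
      exact hslide h s hs (by rw [h0]; rfl)
  · intro h1 h2
    rcases c.sign_cases with h | h
    · exact absurd ((forall_fin_two' i).2 ⟨c.crossesNear_fst, c.crossesNear_snd h⟩) h1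
    · refine absurd ⟨i + 1, c.slidesNear_snd h, ?_⟩ h2
      rw [fin_two_add]
      exact c.crossesNear_fst

end OrbitToTrajectory

end

/-! ### Orbits when both axes are sliding or escaping. -/

section


variable {U : Set Plane} {r : ℕ} {Z : Omega U r} {i : Fin 2}

section Cells

variable {ε s mX MX mY MY ρ : ℝ}

/-- Topological description of the trajectories of a field for which both axes are sliding or
escaping: each of them stays in an open quadrant, in an open half axis or at the origin. The sign of
the sliding motion along `Σ_{k+1}` is `e k`. -/
structure CellOrbit (c : LocalChart Z i ε (-ε) s s mX MX mY MY ρ) (e : Fin 2 → ℝ) (a b : ℝ)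
    (δ : ℝ → Plane) : Prop where
  cont : ContinuousOn δ (Icc a b)
  sign_eq : ∀ t ∈ Icc a b, ∀ t' ∈ Icc a b, ∀ k, SignType.sign (δ t k) = SignType.sign (δ t' k)
  pos : 0 < δ a i * δ a (i + 1) → StrictMonoOn (fun t => ε * δ t i) (Icc a b) ∧
    ∀ t ∈ Icc a b, c.X.lab (δ t) = c.X.lab (δ a)
  neg : δ a i * δ a (i + 1) < 0 → StrictMonoOn (fun t => -ε * δ t i) (Icc a b) ∧
    ∀ t ∈ Icc a b, c.Y.lab (δ t) = c.Y.lab (δ a)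
  slide : ∀ k, δ a (k + 1) = 0 → δ a k ≠ 0 → StrictMonoOn (fun t => e k * δ t k) (Icc a b)

theorem mul_pos_iff_of_sign_eq {x y x' y' : ℝ} (h : SignType.sign x = SignType.sign x')
    (h' : SignType.sign y = SignType.sign y') : 0 < x * y ↔ 0 < x' * y' := by
  rw [← sign_eq_one_iff, ← sign_eq_one_iff, sign_mul, sign_mul, h, h']

theorem mul_neg_iff_of_sign_eq {x y x' y' : ℝ} (h : SignType.sign x = SignType.sign x')
    (h' : SignType.sign y = SignType.sign y') : x * y < 0 ↔ x' * y' < 0 := by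
  rw [← sign_eq_neg_one_iff, ← sign_eq_neg_one_iff, sign_mul, sign_mul, h, h']

theorem eq_zero_iff_of_sign_eq {x x' : ℝ} (h : SignType.sign x = SignType.sign x') :
    x = 0 ↔ x' = 0 := by
  rw [← sign_eq_zero_iff (a := x), h, sign_eq_zero_iff]

namespace LocalChart

theorem prod_neg (c : LocalChart Z i ε (-ε) s s mX MX mY MY ρ) {p : Plane} (hp : p ∈ box ρ)
    (k : Fin 2) : Z.1 p k * Z.2 p k < 0 := by
  have h1 := c.prod_fst hp
  have h2 := c.prod_snd hp
  rw [mul_neg, mul_self_sign c.εX_sign] at h1 h2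
  rw [mul_self_sign c.sX_sign] at h2
  rcases fin_two_cases i k with rfl | rfl <;> linarith

theorem slidesNear (c : LocalChart Z i ε (-ε) s s mX MX mY MY ρ) (k : Fin 2) : SlidesNear Z k := by
  filter_upwards [c.mem_box_eventually k] with q hq using ⟨hq.2.1, hq.2.2, c.prod_neg hq.1 k⟩

theorem not_crossesNear (c : LocalChart Z i ε (-ε) s s mX MX mY MY ρ) (k : Fin 2) :
    ¬ CrossesNear Z k := fun h =>
  LocalChart.not_slidesNear_of_crossesNear h (c.slidesNear k)

/-- Near the origin there are neither crossing nor tangency points, and the law at the origin is to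
stay there. The definition therefore reduces to one equation on each kind of cell. -/
theorem isTrajectory_iff (c : LocalChart Z i ε (-ε) s s mX MX mY MY ρ) {γ : ℝ → Plane} {J : Set ℝ}
    (hbox : MapsTo γ J (box ρ)) :
    IsTrajectory Z J γ ↔ ContinuousOn γ J ∧
      (∀ t ∈ J, 0 < γ t i * γ t (i + 1) → HasDerivWithinAt γ (Z.1 (γ t)) J t) ∧
      (∀ t ∈ J, γ t i * γ t (i + 1) < 0 → HasDerivWithinAt γ (Z.2 (γ t)) J t) ∧
      (∀ t ∈ J, ∀ k, γ t (k + 1) = 0 → γ t k ≠ 0 → SlidesAt Z (k + 1) J γ t) ∧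
      ∀ t ∈ J, γ t = 0 → ∀ᶠ s in 𝓝[J] t, γ s = 0 := by
  constructor
  · intro h
    refine ⟨h.continuousOn, fun t ht => (h.regular t ht).hasDeriv_pos i,
      fun t ht => (h.regular t ht).hasDeriv_neg i, fun t ht k hk hk' => ?_, fun t ht h0 => ?_⟩
    · refine (h.regular t ht).slide _ ⟨hk, fun h0 => hk' ?_, c.prod_neg (hbox ht) _⟩
      rw [h0]
      rfl
    · exact (h.origin t ht h0).stay (fun h => c.not_crossesNear 0 (h 0))
        (fun ⟨k, _, h⟩ => c.not_crossesNear _ h)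
  · rintro ⟨h1, h2, h3, h4, h5⟩
    refine ⟨h1, fun t ht => c.sub (hbox ht), fun t ht => ⟨?_, ?_, ?_, ?_⟩,
      fun t ht k hk => absurd hk (c.not_tangency (hbox ht) k), fun t ht h0 => ⟨?_, ?_, ?_⟩⟩
    · rw [mul_coord i]
      exact h2 t ht
    · rw [mul_coord i]
      exact h3 t ht
    · exact fun k hk => absurd hk.2.2 (c.prod_neg (hbox ht) k).not_gt
    · intro k hk
      have := h4 t ht (k + 1)
      rw [fin_two_add] at this
      exact this hk.1 fun h => hk.2.1 ((plane_eq_zero k).2 ⟨hk.1, h⟩)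
    · exact fun h => absurd (h 0) (c.not_crossesNear 0)
    · exact fun k _ h => absurd h (c.not_crossesNear _)
    · exact fun _ _ => h5 t ht h0

/-- Nonzero coordinates keep their signs by continuity, and sliding or resting points keep their
zero coordinates by the laws of motion. So the signs are locally constant in time, hence constant:
motions in the quadrants never reach the axes. -/
theorem sign_eq_of_trajectory (c : LocalChart Z i ε (-ε) s s mX MX mY MY ρ)
    {γ : ℝ → Plane} {a b : ℝ} (hγ : IsTrajectory Z (Icc a b) γ)
    (hbox : MapsTo γ (Icc a b) (box ρ)) : ∀ t ∈ Icc a b, ∀ t' ∈ Icc a b, ∀ k,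
      SignType.sign (γ t k) = SignType.sign (γ t' k) := by
  obtain ⟨hc, hX, hY, hs, h0⟩ := (c.isTrajectory_iff hbox).1 hγ
  intro t ht t' ht'
  refine isPreconnected_Icc.induction₂
    (fun t t' => ∀ k, SignType.sign (γ t k) = SignType.sign (γ t' k)) ?_
    (fun x y z _ _ _ h1 h2 k => (h1 k).trans (h2 k)) (fun x y _ _ h k => (h k).symm) ht ht'
  intro t ht
  have hne : ∀ k, γ t k ≠ 0 → ∀ᶠ t' in 𝓝[Icc a b] t,
      SignType.sign (γ t k) = SignType.sign (γ t' k) := fun k hk => by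
    have hcont : ContinuousWithinAt (fun t => γ t k) (Icc a b) t :=
      ((continuous_coord k).comp_continuousOn hc) t ht
    rcases hk.lt_or_gt with h | h
    · filter_upwards [hcont.eventually (gt_mem_nhds h)] with t' h'
      rw [sign_neg h, sign_neg h']
    · filter_upwards [hcont.eventually (lt_mem_nhds h)] with t' h'
      rw [sign_pos h, sign_pos h']
  by_cases hz : γ t = 0
  · filter_upwards [h0 t ht hz] with t' h'
    simp [hz, h']
  rw [Filter.eventually_all]
  intro k
  by_cases hk : γ t k = 0
  · have hk' : γ t (k + 1) ≠ 0 := fun h => hz ((plane_eq_zero k).2 ⟨hk, h⟩)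
    have := (hs t ht (k + 1) (by rwa [fin_two_add]) hk').1
    rw [fin_two_add] at this
    filter_upwards [this] with t' h'
    rw [hk, show γ t' k = 0 from h']
  · exact hne k hk

theorem cellOrbit_of_trajectory (c : LocalChart Z i ε (-ε) s s mX MX mY MY ρ) {e : Fin 2 → ℝ}
    (he : ∀ k, ∀ p ∈ box ρ, 0 < e k * slideSpeed Z k p)
    {γ : ℝ → Plane} {a b : ℝ} (hab : a < b) (hγ : IsTrajectory Z (Icc a b) γ)
    (hbox : MapsTo γ (Icc a b) (box ρ)) : CellOrbit c e a b γ := by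
  obtain ⟨hc, hX, hY, hs, h0⟩ := (c.isTrajectory_iff hbox).1 hγ
  have hsign := c.sign_eq_of_trajectory hγ hbox
  have hmemA : a ∈ Icc a b := left_mem_Icc.2 hab.le
  refine ⟨hc, hsign, fun hp => ?_, fun hp => ?_, fun k hk hk' => ?_⟩
  · have hp' : ∀ t ∈ Icc a b, 0 < γ t i * γ t (i + 1) := fun t ht =>
      (mul_pos_iff_of_sign_eq (hsign a hmemA t ht i) (hsign a hmemA t ht (i + 1))).1 hp
    refine ⟨strictMonoOn_of_local (continuousOn_coord hc ε i) fun t ht => ?_, fun t ht => ?_⟩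
    · exact eventually_lt_of_hasDerivWithinAt_pos
        ((hasDerivWithinAt_coord (hX t ht (hp' t ht)) i).const_mul ε) (c.X_fst (hbox ht))
    · have hsub : Icc a t ⊆ Icc a b := Icc_subset_Icc_right ht.2
      exact c.X.lab_eq_of_solution c.εX_sign ht.1 fun z hz =>
        ⟨hbox (hsub hz), (hX z (hsub hz) (hp' z (hsub hz))).mono hsub⟩
  · have hp' : ∀ t ∈ Icc a b, γ t i * γ t (i + 1) < 0 := fun t ht =>
      (mul_neg_iff_of_sign_eq (hsign a hmemA t ht i) (hsign a hmemA t ht (i + 1))).1 hp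
    refine ⟨strictMonoOn_of_local (continuousOn_coord hc (-ε) i) fun t ht => ?_, fun t ht => ?_⟩
    · exact eventually_lt_of_hasDerivWithinAt_pos
        ((hasDerivWithinAt_coord (hY t ht (hp' t ht)) i).const_mul (-ε)) (c.Y_fst (hbox ht))
    · have hsub : Icc a t ⊆ Icc a b := Icc_subset_Icc_right ht.2
      exact c.Y.lab_eq_of_solution c.εY_sign ht.1 fun z hz =>
        ⟨hbox (hsub hz), (hY z (hsub hz) (hp' z (hsub hz))).mono hsub⟩
  · refine strictMonoOn_of_local (continuousOn_coord hc (e k) k) fun t ht => ?_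
    have h1 := (eq_zero_iff_of_sign_eq (hsign a hmemA t ht (k + 1))).1 hk
    have h2 := mt (eq_zero_iff_of_sign_eq (hsign a hmemA t ht k)).2 hk'
    have := (hs t ht k h1 h2).2
    refine eventually_lt_of_hasDerivWithinAt_pos
      ((hasDerivWithinAt_coord this k).const_mul (e k)) ?_
    rw [slidingField_fst]
    exact he k _ (hbox ht)

theorem continuousOn_slideSpeed_of_prod_neg (c : LocalChart Z i ε (-ε) s s mX MX mY MY ρ)
    (k : Fin 2) : ContinuousOn (slideSpeed Z k) (box ρ) := by
  have hX : ∀ k, ContinuousOn (fun p => Z.1 p k) (box ρ) := fun k =>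
    (continuous_coord k).comp_continuousOn c.X.cont
  have hY : ∀ k, ContinuousOn (fun p => Z.2 p k) (box ρ) := fun k =>
    (continuous_coord k).comp_continuousOn c.Y.cont
  refine (((hY (k + 1)).mul (hX k)).sub ((hX (k + 1)).mul (hY k))).div
    ((hY (k + 1)).sub (hX (k + 1)))
    fun p hp (h0 : Z.2 p (k + 1) - Z.1 p (k + 1) = 0) => ?_
  have h1 := c.prod_neg hp (k + 1)
  rw [sub_eq_zero.1 h0] at h1
  exact absurd h1 (not_lt.2 (mul_self_nonneg _))

end LocalChart

/-- A curve with a strictly monotone coordinate can be reparametrised so as to have a given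
continuous speed. -/
theorem exists_reparam_of_continuousOn {a b : ℝ} (hab : a < b) {g w : ℝ → ℝ}
    (hg : ContinuousOn g (Icc a b)) (hm : StrictMonoOn g (Icc a b)) (hw : ContinuousOn w (Icc a b))
    (hpos : ∀ t ∈ Icc a b, 0 < w t) :
    ∃ (c₀ d₀ : ℝ) (σ : ℝ → ℝ), c₀ < d₀ ∧ StrictMonoOn σ (Icc c₀ d₀) ∧
      σ '' Icc c₀ d₀ = Icc a b ∧ ContinuousOn σ (Icc c₀ d₀) ∧
      ∀ s ∈ Icc c₀ d₀, HasDerivWithinAt (fun s => g (σ s)) (w (σ s)) (Icc c₀ d₀) s := by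
  have hne : (Icc a b).Nonempty := nonempty_Icc.2 hab.le
  obtain ⟨t₁, ht₁, h1⟩ := isCompact_Icc.exists_isMinOn hne hw
  obtain ⟨t₂, ht₂, h2⟩ := isCompact_Icc.exists_isMaxOn hne hw
  have hm' : Measurable fun t => w (projIcc a b hab.le t) :=
    (hw.comp_continuous (continuous_subtype_val.comp continuous_projIcc) fun t =>
      (projIcc a b hab.le t).2).measurable
  obtain ⟨c₀, d₀, σ, h3, h4, h5, h6, h7⟩ := exists_reparam hab hg hm hm' (hpos t₁ ht₁)
    (fun t ht => ⟨h1 ht, h2 ht⟩)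
  exact ⟨c₀, d₀, σ, h3, h4, h5, h6, fun s hs => h7 s hs (hw _ (h5 ▸ mem_image_of_mem σ hs))⟩

/-- A cell orbit is governed by a single field with continuous nonvanishing speed along the
coordinate used as parameter, so one reparametrisation per type of cell suffices. -/
theorem CellOrbit.exists_trajectory {c : LocalChart Z i ε (-ε) s s mX MX mY MY ρ} {e : Fin 2 → ℝ}
    (he : ∀ k, ∀ p ∈ box ρ, 0 < e k * slideSpeed Z k p) (he1 : ∀ k, e k = 1 ∨ e k = -1) {a b : ℝ}
    {δ : ℝ → Plane} (hab : a < b) (hδ : CellOrbit c e a b δ) (hbox : MapsTo δ (Icc a b) (box ρ)) :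
    ∃ (c₀ d₀ : ℝ) (σ : ℝ → ℝ), c₀ < d₀ ∧ StrictMonoOn σ (Icc c₀ d₀) ∧
      σ '' Icc c₀ d₀ = Icc a b ∧ IsTrajectory Z (Icc c₀ d₀) (fun s => δ (σ s)) := by
  have hcoord : ∀ k, ContinuousOn (fun p => Z.1 p k) (box ρ) ∧
      ContinuousOn (fun p => Z.2 p k) (box ρ) := fun k =>
    ⟨(continuous_coord k).comp_continuousOn c.X.cont,
      (continuous_coord k).comp_continuousOn c.Y.cont⟩
  have ha : a ∈ Icc a b := left_mem_Icc.2 hab.le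
  have hsg : ∀ t ∈ Icc a b, ∀ k, SignType.sign (δ a k) = SignType.sign (δ t k) :=
    fun t ht k => hδ.sign_eq a ha t ht k
  have hzero : ∀ t ∈ Icc a b, ∀ k, δ a k = 0 → δ t k = 0 := fun t ht k =>
    (eq_zero_iff_of_sign_eq (hsg t ht k)).1
  have hzero' : ∀ t ∈ Icc a b, ∀ k, δ t k = 0 → δ a k = 0 := fun t ht k =>
    (eq_zero_iff_of_sign_eq (hsg t ht k)).2
  have hP : ∀ t ∈ Icc a b, 0 < δ t i * δ t (i + 1) → 0 < δ a i * δ a (i + 1) := fun t ht =>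
    (mul_pos_iff_of_sign_eq (hsg t ht i) (hsg t ht (i + 1))).2
  have hN : ∀ t ∈ Icc a b, δ t i * δ t (i + 1) < 0 → δ a i * δ a (i + 1) < 0 := fun t ht =>
    (mul_neg_iff_of_sign_eq (hsg t ht i) (hsg t ht (i + 1))).2
  have build : ∀ (g w : ℝ → ℝ), ContinuousOn g (Icc a b) → StrictMonoOn g (Icc a b) →
      ContinuousOn w (Icc a b) → (∀ t ∈ Icc a b, 0 < w t) →
      (∀ (c₀ d₀ : ℝ) (σ : ℝ → ℝ), MapsTo σ (Icc c₀ d₀) (Icc a b) → ContinuousOn σ (Icc c₀ d₀) →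
        (∀ s ∈ Icc c₀ d₀, HasDerivWithinAt (fun s => g (σ s)) (w (σ s)) (Icc c₀ d₀) s) →
        IsTrajectory Z (Icc c₀ d₀) (fun s => δ (σ s))) →
      ∃ (c₀ d₀ : ℝ) (σ : ℝ → ℝ), c₀ < d₀ ∧ StrictMonoOn σ (Icc c₀ d₀) ∧
        σ '' Icc c₀ d₀ = Icc a b ∧ IsTrajectory Z (Icc c₀ d₀) (fun s => δ (σ s)) := by
    intro g w h1 h2 h3 h4 h5
    obtain ⟨c₀, d₀, σ, k1, k2, k3, k4, k5⟩ := exists_reparam_of_continuousOn hab h1 h2 h3 h4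
    exact ⟨c₀, d₀, σ, k1, k2, k3, h5 c₀ d₀ σ (fun s hs => k3 ▸ mem_image_of_mem σ hs) k4 k5⟩
  by_cases h0 : δ a = 0
  -- The curve rests at the origin and any parametrisation serves.
  · refine build id (fun _ => 1) continuousOn_id strictMonoOn_id continuousOn_const
      (fun _ _ => one_pos) fun c₀ d₀ σ hm hσ _ => ?_
    have hz : ∀ t ∈ Icc c₀ d₀, δ (σ t) = 0 := fun t ht => (plane_eq_zero i).2
      ⟨hzero _ (hm ht) i (by rw [h0]; rfl), hzero _ (hm ht) (i + 1) (by rw [h0]; rfl)⟩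
    refine (c.isTrajectory_iff fun t ht => hbox (hm ht)).2 ⟨hδ.cont.comp hσ hm,
      fun t ht h => ?_, fun t ht h => ?_, fun t ht k _ h => ?_, fun t ht _ => ?_⟩
    · simp [hz t ht] at h
    · simp [hz t ht] at h
    · simp [hz t ht] at h
    · exact eventually_nhdsWithin_of_forall hz
  by_cases hax : ∃ k, δ a (k + 1) = 0
  · obtain ⟨k, hk⟩ := hax
    have hk' : δ a k ≠ 0 := fun h => h0 ((plane_eq_zero k).2 ⟨h, hk⟩)
    refine build (fun t => e k * δ t k) (fun t => e k * slideSpeed Z k (δ t))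
      (LocalChart.continuousOn_coord hδ.cont (e k) k) (hδ.slide k hk hk')
      (continuousOn_const.mul ((c.continuousOn_slideSpeed_of_prod_neg k).comp hδ.cont hbox))
      (fun t ht => he k _ (hbox ht)) fun c₀ d₀ σ hm hσ hd => ?_
    have hz : ∀ t ∈ Icc c₀ d₀, δ (σ t) (k + 1) = 0 := fun t ht => hzero _ (hm ht) _ hk
    have hmul : ∀ t ∈ Icc c₀ d₀, δ (σ t) i * δ (σ t) (i + 1) = 0 := fun t ht => by
      rcases fin_two_cases i k with rfl | rfl
      · rw [hz t ht, mul_zero]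
      · have := hz t ht
        rw [fin_two_add] at this
        rw [this, zero_mul]
    refine (c.isTrajectory_iff fun t ht => hbox (hm ht)).2 ⟨hδ.cont.comp hσ hm,
      fun t ht h => absurd (hmul t ht) h.ne', fun t ht h => absurd (hmul t ht) h.ne,
      fun t ht l hl hl' => ?_, fun t ht h => ?_⟩
    · have hlk : l = k := by
        rcases fin_two_cases k l with h | h
        · exact h
        · exact absurd (h ▸ hz t ht) hl'
      subst hlk
      refine ⟨eventually_nhdsWithin_of_forall hz, hasDerivWithinAt_of_coord l ?_ ?_⟩
      · rw [slidingField_fst]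
        have := (hd t ht).const_mul (e l)
        simpa only [← mul_assoc, mul_self_sign (he1 l), one_mul] using this
      · rw [slidingField_snd]
        exact (hasDerivWithinAt_const t _ (0 : ℝ)).congr_of_eventuallyEq
          (eventually_nhdsWithin_of_forall hz) (hz t ht)
    · exact absurd (hzero' _ (hm ht) k (by rw [h]; rfl)) hk'
  have hne : ∀ k, δ a k ≠ 0 := fun k h => hax ⟨k + 1, by rwa [fin_two_add]⟩
  have hne' : ∀ t ∈ Icc a b, ∀ k, δ t k ≠ 0 := fun t ht k h => hne k (hzero' t ht k h)
  have hz : ∀ t ∈ Icc a b, δ t ≠ 0 := fun t ht h => hne' t ht i (by rw [h]; rfl)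
  rcases (mul_ne_zero (hne i) (hne (i + 1))).lt_or_gt with hs | hs
  · obtain ⟨hmono, hlab⟩ := hδ.neg hs
    refine build (fun t => -ε * δ t i) (fun t => -ε * Z.2 (δ t) i)
      (LocalChart.continuousOn_coord hδ.cont (-ε) i) hmono
      (continuousOn_const.mul ((hcoord i).2.comp hδ.cont hbox))
      (fun t ht => c.Y_fst (hbox ht)) fun c₀ d₀ σ hm hσ hd => ?_
    refine (c.isTrajectory_iff fun t ht => hbox (hm ht)).2 ⟨hδ.cont.comp hσ hm,
      fun t ht h => absurd (hP _ (hm ht) h) hs.not_gt, fun t ht _ => ?_,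
      fun t ht l hl _ => absurd hl (hne' _ (hm ht) _), fun t ht h => absurd h (hz _ (hm ht))⟩
    exact c.Y.hasDerivWithinAt_of_lab c.εY_sign ht (hbox (hm ht))
      (eventually_nhdsWithin_of_forall fun t' ht' => hlab _ (hm ht')) (hd t ht)
  · obtain ⟨hmono, hlab⟩ := hδ.pos hs
    refine build (fun t => ε * δ t i) (fun t => ε * Z.1 (δ t) i)
      (LocalChart.continuousOn_coord hδ.cont ε i) hmono
      (continuousOn_const.mul ((hcoord i).1.comp hδ.cont hbox))
      (fun t ht => c.X_fst (hbox ht)) fun c₀ d₀ σ hm hσ hd => ?_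
    refine (c.isTrajectory_iff fun t ht => hbox (hm ht)).2 ⟨hδ.cont.comp hσ hm,
      fun t ht _ => ?_, fun t ht h => absurd (hN _ (hm ht) h) hs.not_gt,
      fun t ht l hl _ => absurd hl (hne' _ (hm ht) _), fun t ht h => absurd h (hz _ (hm ht))⟩
    exact c.X.hasDerivWithinAt_of_lab c.εX_sign ht (hbox (hm ht))
      (eventually_nhdsWithin_of_forall fun t' ht' => hlab _ (hm ht')) (hd t ht)

end Cells

end

/-! ### Local equivalences from homeomorphisms which match the leaves. -/

section


variable {U : Set Plane} {r : ℕ} {Z Z' : Omega U r} {i : Fin 2}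

/-- A map which turns every point by less than a right angle preserves the orientation. -/
theorem preservesOrientationAt_of_inner_pos {h : Plane → Plane} (hc : Continuous h) (h0 : h 0 = 0)
    (hpos : ∀ p, p ≠ 0 → 0 < p 0 * h p 0 + p 1 * h p 1) : PreservesOrientationAt h 0 := by
  refine ⟨1, one_pos, fun c hcc hloop hball n ⟨θ, hθc, hθ, hθn⟩ => ?_⟩
  have hne : ∀ t ∈ Icc (0 : ℝ) 1, c t ≠ 0 := fun t ht => (hball t ht).2
  have hk : ∀ k, ContinuousOn (fun t => c t k) (Icc 0 1) := fun k =>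
    (continuous_coord k).comp_continuousOn hcc
  have hhk : ∀ k, ContinuousOn (fun t => h (c t) k) (Icc 0 1) := fun k =>
    ((continuous_coord k).comp hc).comp_continuousOn hcc
  -- The added term is the angle from `c t` to `h (c t)`, the arctangent of cross product over inner
  -- product; it is continuous because the inner product is positive. It has the same value at both
  -- ends of the loop, so the total turning is unchanged.
  refine ⟨fun t => θ t + Real.arctan ((c t 0 * h (c t) 1 - c t 1 * h (c t) 0) /
      (c t 0 * h (c t) 0 + c t 1 * h (c t) 1)), ?_, fun t ht => ?_, ?_⟩
  · refine hθc.add (Real.continuous_arctan.comp_continuousOn ?_)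
    exact (((hk 0).mul (hhk 1)).sub ((hk 1).mul (hhk 0))).div
      (((hk 0).mul (hhk 0)).add ((hk 1).mul (hhk 1))) fun t ht => (hpos _ (hne t ht)).ne'
  · obtain ⟨e1, e2⟩ := hθ t ht
    have hd := hpos _ (hne t ht)
    have hn1 : 0 < ‖c t‖ := norm_pos_iff.2 (hne t ht)
    have hsq : ∀ p : Plane, ‖p‖ ^ 2 = p 0 ^ 2 + p 1 ^ 2 := fun p => by
      rw [EuclideanSpace.real_norm_sq_eq, Fin.sum_univ_two]
    have hn2 : 0 < ‖h (c t)‖ := by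
      refine norm_pos_iff.2 fun hz => ?_
      rw [hz] at hd
      simp at hd
    have s1 := hsq (c t)
    have s2 := hsq (h (c t))
    simp only [h0, sub_zero] at e1 e2 ⊢
    simp only [PiLp.zero_apply, sub_zero] at e1 e2 ⊢
    set x := c t 0
    set y := c t 1
    set x' := h (c t) 0
    set y' := h (c t) 1
    set D := x * x' + y * y'
    set E := x * y' - y * x'
    have hR : √(1 + (E / D) ^ 2) = ‖c t‖ * ‖h (c t)‖ / D := by
      rw [Real.sqrt_eq_iff_mul_self_eq (by positivity) (by positivity)]
      field_simp
      rw [s1, s2]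
      ring
    have c1 : Real.cos (Real.arctan (E / D)) = D / (‖c t‖ * ‖h (c t)‖) := by
      rw [Real.cos_arctan, hR, one_div_div]
    have c2 : Real.sin (Real.arctan (E / D)) = E / (‖c t‖ * ‖h (c t)‖) := by
      rw [Real.sin_arctan, hR]
      field_simp
    have f1 : Real.cos (θ t) = x / ‖c t‖ := by
      rw [e1]
      field_simp
    have f2 : Real.sin (θ t) = y / ‖c t‖ := by
      rw [e2]
      field_simp
    constructor
    · rw [Real.cos_add, c1, c2, f1, f2]
      field_simp
      rw [s1]
      ring
    · rw [Real.sin_add, c1, c2, f1, f2]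
      field_simp
      rw [s1]
      ring
  · simp only [← hθn, ← hloop]
    ring

/-- The homeomorphism is restricted to the points of the first square whose images lie in the second
one. Arcs and their images then stay in the charts, where alone the correspondence of trajectories
is required. -/
theorem locallyEquivalent_of_homeo {h : Plane ≃ₜ Plane} (h0 : h 0 = 0)
    (hpos : ∀ p, p ≠ 0 → 0 < p 0 * h p 0 + p 1 * h p 1)
    (hsw : ∀ p, h p ∈ switching ↔ p ∈ switching) {ρ ρ' : ℝ} (hρ : 0 < ρ) (hρ' : 0 < ρ')
    (hsub : box ρ ⊆ U) (hsub' : box ρ' ⊆ U)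
    (h1 : ∀ (a b : ℝ) (γ : ℝ → Plane), a < b → IsTrajectory Z (Icc a b) γ →
      MapsTo γ (Icc a b) (box ρ) → MapsTo (fun t => h (γ t)) (Icc a b) (box ρ') →
      ∃ (c d : ℝ) (σ : ℝ → ℝ), c < d ∧ StrictMonoOn σ (Icc c d) ∧ σ '' Icc c d = Icc a b ∧
        IsTrajectory Z' (Icc c d) (fun s => h (γ (σ s))))
    (h2 : ∀ (a b : ℝ) (γ : ℝ → Plane), a < b → IsTrajectory Z' (Icc a b) γ →
      MapsTo γ (Icc a b) (box ρ') → MapsTo (fun t => h.symm (γ t)) (Icc a b) (box ρ) →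
      ∃ (c d : ℝ) (σ : ℝ → ℝ), c < d ∧ StrictMonoOn σ (Icc c d) ∧ σ '' Icc c d = Icc a b ∧
        IsTrajectory Z (Icc c d) (fun s => h.symm (γ (σ s)))) :
    LocallyEquivalent Z Z' := by
  set s : Set Plane := interior (box ρ) ∩ h ⁻¹' interior (box ρ') with hs
  have hso : IsOpen s := isOpen_interior.inter (isOpen_interior.preimage h.continuous)
  have z1 : (0 : Plane) ∈ interior (box ρ) := mem_interior_iff_mem_nhds.2 (box_mem_nhds hρ)
  have z2 : (0 : Plane) ∈ interior (box ρ') := mem_interior_iff_mem_nhds.2 (box_mem_nhds hρ')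
  have z : (0 : Plane) ∈ s := ⟨z1, by rw [mem_preimage, h0]; exact z2⟩
  have hsy : h.symm 0 = 0 := by rw [h.symm_apply_eq, h0]
  set e := h.toOpenPartialHomeomorph.restrOpen s hso with he
  have hsrc : ∀ p, p ∈ e.source ↔ p ∈ s := fun p => by simp [he]
  have htgt : ∀ p, p ∈ e.target ↔ h.symm p ∈ s := fun p => by
    simp [he]
  have m2 : ∀ p, p ∈ e.target → p ∈ box ρ' := fun p hp => by
    have := ((htgt p).1 hp).2
    rw [mem_preimage, h.apply_symm_apply] at this
    exact interior_subset this
  refine ⟨e, fun p hp => hsub (interior_subset ((hsrc p).1 hp).1), fun p hp => hsub' (m2 p hp),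
    (hsrc 0).2 z, (htgt 0).2 (by rwa [hsy]), h0,
    preservesOrientationAt_of_inner_pos h.continuous h0 hpos, fun p _ => hsw p, ?_, ?_⟩
  · intro a b γ hab hγ hm
    exact h1 a b γ hab hγ (fun t ht => interior_subset ((hsrc _).1 (hm ht)).1)
      (fun t ht => interior_subset ((hsrc _).1 (hm ht)).2)
  · intro a b γ hab hγ hm
    exact h2 a b γ hab hγ (fun t ht => m2 _ (hm ht))
      (fun t ht => interior_subset ((htgt _).1 (hm ht)).1)

theorem Matching.strictMono_η {FX FY FX' FY' : ℝ → ℝ → ℝ}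
    {sX sY mX MX mY MY mX' MX' mY' MY' : ℝ} {fX : Foliation FX sX mX MX}
    {fY : Foliation FY sY mY MY} {fX' : Foliation FX' sX mX' MX'} {fY' : Foliation FY' sY mY' MY'}
    (g : Matching fX fY fX' fY') (u : ℝ) : StrictMono (g.η u) := by
  intro v w h
  rcases lt_or_ge v 0 with hv | hv
  · rcases lt_or_ge 0 w with hw | hw
    · exact (g.η_neg hv).trans (g.η_pos hw)
    · rcases le_total 0 u with hu | hu
      · rw [g.η_fth hu hv.le, g.η_fth hu hw]
        exact strictMono_leafMap _ _ _ _ _ h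
      · rw [g.η_trd hu hv.le, g.η_trd hu hw]
        exact strictMono_leafMap _ _ _ _ _ h
  · have hw := hv.trans h.le
    rcases le_total 0 u with hu | hu
    · rw [g.η_fst hu hv, g.η_fst hu hw]
      exact strictMono_leafMap _ _ _ _ _ h
    · rw [g.η_snd hu hv, g.η_snd hu hw]
      exact strictMono_leafMap _ _ _ _ _ h

theorem Matching.sign_homeo {FX FY FX' FY' : ℝ → ℝ → ℝ}
    {sX sY mX MX mY MY mX' MX' mY' MY' : ℝ} {fX : Foliation FX sX mX MX}
    {fY : Foliation FY sY mY MY} {fX' : Foliation FX' sX mX' MX'} {fY' : Foliation FY' sY mY' MY'}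
    (g : Matching fX fY fX' fY') (i : Fin 2) (p : Plane) (k : Fin 2) :
    SignType.sign (g.homeo i p k) = SignType.sign (p k) := by
  rcases fin_two_cases i k with rfl | rfl
  · rcases lt_trichotomy (p k) 0 with h | h | h
    · rw [sign_neg h, sign_neg (g.homeo_fst_neg.2 h)]
    · rw [h, g.homeo_fst_eq.2 h]
    · rw [sign_pos h, sign_pos (g.homeo_fst_pos.2 h)]
  · rcases lt_trichotomy (p (i + 1)) 0 with h | h | h
    · rw [sign_neg h, sign_neg (g.homeo_snd_neg.2 h)]
    · rw [h, g.homeo_snd_eq.2 h]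
    · rw [sign_pos h, sign_pos (g.homeo_snd_pos.2 h)]

theorem mul_pos_of_sign_eq {x y : ℝ} (hx : x ≠ 0) (h : SignType.sign y = SignType.sign x) :
    0 < x * y := by
  rcases hx.lt_or_gt with h1 | h1
  · rw [sign_neg h1, sign_eq_neg_one_iff] at h
    exact mul_pos_of_neg_of_neg h1 h
  · rw [sign_pos h1, sign_eq_one_iff] at h
    exact mul_pos h1 h

/-- A map preserving the signs of both coordinates moves no point by a right angle or more, and
hence preserves the orientation. -/
theorem inner_pos_of_sign_eq {p q : Plane} (hp : p ≠ 0)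
    (h : ∀ k, SignType.sign (q k) = SignType.sign (p k)) : 0 < p 0 * q 0 + p 1 * q 1 := by
  have h0 : ∀ k, 0 ≤ p k * q k := fun k => by
    by_cases hk : p k = 0
    · simp [hk]
    · exact (mul_pos_of_sign_eq hk (h k)).le
  by_cases hk : p 0 = 0
  · have hk' : p 1 ≠ 0 := fun h' => hp ((plane_eq_zero 0).2 ⟨hk, h'⟩)
    exact add_pos_of_nonneg_of_pos (h0 0) (mul_pos_of_sign_eq hk' (h 1))
  · exact add_pos_of_pos_of_nonneg (mul_pos_of_sign_eq hk (h 0)) (h0 1)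

theorem nonneg_iff_of_sign_eq {x x' : ℝ} (h : SignType.sign x = SignType.sign x') :
    0 ≤ x ↔ 0 ≤ x' := by
  rw [← sign_nonneg_iff, h, sign_nonneg_iff]

theorem nonpos_iff_of_sign_eq {x x' : ℝ} (h : SignType.sign x = SignType.sign x') :
    x ≤ 0 ↔ x' ≤ 0 := by
  rw [← sign_nonpos_iff, h, sign_nonpos_iff]

theorem strictMonoOn_mul_comp {ε : ℝ} (hε : ε = 1 ∨ ε = -1) {f g : ℝ → ℝ} {J : Set ℝ}
    (hf : StrictMono f) (hg : StrictMonoOn (fun t => ε * g t) J) :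
    StrictMonoOn (fun t => ε * f (g t)) J := by
  intro x hx y hy hxy
  have := hg hx hy hxy
  rcases hε with rfl | rfl
  · simp only [one_mul] at this ⊢
    exact hf this
  · simp only [neg_mul, one_mul, neg_lt_neg_iff] at this ⊢
    exact hf this

section Transport

variable {εX εY sX sY mX MX mY MY ρ mX' MX' mY' MY' ρ' : ℝ}

/-- The correspondence of labels is one map on each closed quadrant. The sign hypothesis keeps `p`
and `q` in the same one. -/
theorem Matching.lab_X_eq {c : LocalChart Z i εX εY sX sY mX MX mY MY ρ}
    {c' : LocalChart Z' i εX εY sX sY mX' MX' mY' MY' ρ'}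
    (g : Matching c.X.fol c.Y.fol c'.X.fol c'.Y.fol) {p q : Plane} (hp : 0 ≤ p i * p (i + 1))
    (hs : ∀ k, SignType.sign (q k) = SignType.sign (p k)) (h : c.X.lab q = c.X.lab p) :
    c'.X.lab (g.homeo i q) = c'.X.lab (g.homeo i p) := by
  have hq : 0 ≤ q i * q (i + 1) := by
    refine (nonneg_iff_of_sign_eq ?_).2 hp
    rw [sign_mul, sign_mul, hs, hs]
  have h1 := g.lab_fst hp
  have h2 := g.lab_fst hq
  have e : (0 ≤ q i ∧ 0 ≤ q (i + 1)) ↔ (0 ≤ p i ∧ 0 ≤ p (i + 1)) := by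
    rw [nonneg_iff_of_sign_eq (hs i), nonneg_iff_of_sign_eq (hs (i + 1))]
  unfold FieldChart.lab at h ⊢
  rw [h1, h2, h]
  simp only [e]

theorem Matching.lab_Y_eq {c : LocalChart Z i εX εY sX sY mX MX mY MY ρ}
    {c' : LocalChart Z' i εX εY sX sY mX' MX' mY' MY' ρ'}
    (g : Matching c.X.fol c.Y.fol c'.X.fol c'.Y.fol) {p q : Plane} (hp : p i * p (i + 1) ≤ 0)
    (hs : ∀ k, SignType.sign (q k) = SignType.sign (p k)) (h : c.Y.lab q = c.Y.lab p) :
    c'.Y.lab (g.homeo i q) = c'.Y.lab (g.homeo i p) := by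
  have hq : q i * q (i + 1) ≤ 0 := by
    refine (nonpos_iff_of_sign_eq ?_).2 hp
    rw [sign_mul, sign_mul, hs, hs]
  have h1 := g.lab_snd hp
  have h2 := g.lab_snd hq
  have e : (q i ≤ 0 ∧ 0 ≤ q (i + 1)) ↔ (p i ≤ 0 ∧ 0 ≤ p (i + 1)) := by
    rw [nonpos_iff_of_sign_eq (hs i), nonneg_iff_of_sign_eq (hs (i + 1))]
  unfold FieldChart.lab at h ⊢
  rw [h1, h2, h]
  simp only [e]

theorem Matching.lab_X_zero {c : LocalChart Z i εX εY sX sY mX MX mY MY ρ}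
    {c' : LocalChart Z' i εX εY sX sY mX' MX' mY' MY' ρ'}
    (g : Matching c.X.fol c.Y.fol c'.X.fol c'.Y.fol) {p : Plane} (hp : 0 ≤ p i * p (i + 1))
    (h : c.X.lab p = 0) : c'.X.lab (g.homeo i p) = 0 := by
  have h1 := g.lab_fst hp
  unfold FieldChart.lab at h ⊢
  rw [h1, h]
  split_ifs
  exacts [g.A_zero, g.C_zero]

theorem Matching.lab_Y_zero {c : LocalChart Z i εX εY sX sY mX MX mY MY ρ}
    {c' : LocalChart Z' i εX εY sX sY mX' MX' mY' MY' ρ'}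
    (g : Matching c.X.fol c.Y.fol c'.X.fol c'.Y.fol) {p : Plane} (hp : p i * p (i + 1) ≤ 0)
    (h : c.Y.lab p = 0) : c'.Y.lab (g.homeo i p) = 0 := by
  have h1 := g.lab_snd hp
  unfold FieldChart.lab at h ⊢
  rw [h1, h]
  split_ifs
  exacts [g.B_zero, g.D_zero]

theorem eventually_sign_eq {δ : ℝ → Plane} {J : Set ℝ} {t : ℝ} (hδ : ContinuousOn δ J) (ht : t ∈ J)
    (h : δ t i * δ t (i + 1) ≠ 0) :
    ∀ᶠ s in 𝓝[J] t, ∀ k, SignType.sign (δ s k) = SignType.sign (δ t k) := by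
  have hne : ∀ k, δ t k ≠ 0 := (forall_fin_two' i).2 ⟨left_ne_zero_of_mul h, right_ne_zero_of_mul h⟩
  rw [Filter.eventually_all]
  intro k
  have hcont : ContinuousWithinAt (fun t => δ t k) J t :=
    ((continuous_coord k).comp_continuousOn hδ) t ht
  rcases (hne k).lt_or_gt with h | h
  · filter_upwards [hcont.eventually (gt_mem_nhds h)] with t' h'
    rw [sign_neg h, sign_neg h']
  · filter_upwards [hcont.eventually (lt_mem_nhds h)] with t' h'
    rw [sign_pos h, sign_pos h']

/-- Labels within a quadrant, signs of the coordinates and the order of the coordinate `i` are all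
that an orbit is made of, and the homeomorphism respects each of them. -/
theorem GraphOrbit.map {ε : ℝ} {c : LocalChart Z i ε ε sX sY mX MX mY MY ρ}
    {c' : LocalChart Z' i ε ε sX sY mX' MX' mY' MY' ρ'}
    (g : Matching c.X.fol c.Y.fol c'.X.fol c'.Y.fol) {a b : ℝ} {δ : ℝ → Plane}
    (hδ : GraphOrbit c a b δ) : GraphOrbit c' a b (fun t => g.homeo i (δ t)) := by
  have hs := fun p => g.sign_homeo i p
  have hmul : ∀ p, SignType.sign (g.homeo i p i * g.homeo i p (i + 1)) =
      SignType.sign (p i * p (i + 1)) := fun p => by rw [sign_mul, sign_mul, hs, hs]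
  have hp : ∀ p, 0 < g.homeo i p i * g.homeo i p (i + 1) ↔ 0 < p i * p (i + 1) := fun p => by
    rw [← sign_eq_one_iff, hmul, sign_eq_one_iff]
  have hn : ∀ p, g.homeo i p i * g.homeo i p (i + 1) < 0 ↔ p i * p (i + 1) < 0 := fun p => by
    rw [← sign_eq_neg_one_iff, hmul, sign_eq_neg_one_iff]
  have hz : ∀ p, g.homeo i p = 0 ↔ p = 0 := fun p => by
    rw [plane_eq_zero i, plane_eq_zero i, g.homeo_fst_eq, g.homeo_snd_eq]
  refine ⟨(g.homeo i).continuous.comp_continuousOn hδ.cont, ?_, ?_, ?_, ?_, ?_, ?_, ?_⟩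
  · have := strictMonoOn_mul_comp c.εX_sign g.χ.strictMono hδ.mono
    simpa only [g.homeo_fst] using this
  · intro t ht h
    rw [hp] at h
    filter_upwards [hδ.pos t ht h, eventually_sign_eq hδ.cont ht h.ne'] with s h1 h2
    exact g.lab_X_eq h.le h2 h1
  · intro t ht h
    rw [hn] at h
    filter_upwards [hδ.neg t ht h, eventually_sign_eq hδ.cont ht h.ne] with s h1 h2
    exact g.lab_Y_eq h.le h2 h1
  · intro h t ht h0
    simp only [g.homeo_snd_eq] at h0 ⊢
    exact hδ.slide h t ht h0
  · intro h t ht h0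
    simp only [ne_eq, g.homeo_snd_eq] at h0 ⊢
    exact hδ.cross h t ht h0
  · intro h h1 t ht h0
    filter_upwards [hδ.originX h h1 t ht ((hz _).1 h0)] with s h2
    exact ⟨(nonneg_iff_of_sign_eq (hmul _)).2 h2.1, g.lab_X_zero h2.1 h2.2⟩
  · intro h h1 t ht h0
    filter_upwards [hδ.originY h h1 t ht ((hz _).1 h0)] with s h2
    exact ⟨(nonpos_iff_of_sign_eq (hmul _)).2 h2.1, g.lab_Y_zero h2.1 h2.2⟩

theorem CellOrbit.map {ε s : ℝ} {c : LocalChart Z i ε (-ε) s s mX MX mY MY ρ}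
    {c' : LocalChart Z' i ε (-ε) s s mX' MX' mY' MY' ρ'}
    (g : Matching c.X.fol c.Y.fol c'.X.fol c'.Y.fol) {e : Fin 2 → ℝ} (he : ∀ k, e k = 1 ∨ e k = -1)
    {a b : ℝ} {δ : ℝ → Plane} (hab : a < b)
    (hδ : CellOrbit c e a b δ) : CellOrbit c' e a b (fun t => g.homeo i (δ t)) := by
  have hs := fun p => g.sign_homeo i p
  have hmul : ∀ p, SignType.sign (g.homeo i p i * g.homeo i p (i + 1)) =
      SignType.sign (p i * p (i + 1)) := fun p => by rw [sign_mul, sign_mul, hs, hs]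
  have hp : ∀ p, 0 < g.homeo i p i * g.homeo i p (i + 1) ↔ 0 < p i * p (i + 1) := fun p => by
    rw [← sign_eq_one_iff, hmul, sign_eq_one_iff]
  have hn : ∀ p, g.homeo i p i * g.homeo i p (i + 1) < 0 ↔ p i * p (i + 1) < 0 := fun p => by
    rw [← sign_eq_neg_one_iff, hmul, sign_eq_neg_one_iff]
  have ha : a ∈ Icc a b := left_mem_Icc.2 hab.le
  refine ⟨(g.homeo i).continuous.comp_continuousOn hδ.cont, fun t ht t' ht' k => ?_, fun h => ?_,
    fun h => ?_, fun k hk hk' => ?_⟩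
  · rw [hs, hs]
    exact hδ.sign_eq t ht t' ht' k
  · rw [hp] at h
    obtain ⟨h1, h2⟩ := hδ.pos h
    refine ⟨?_, fun t ht => g.lab_X_eq h.le (hδ.sign_eq t ht a ha) (h2 t ht)⟩
    have := strictMonoOn_mul_comp c.εX_sign g.χ.strictMono h1
    simpa only [g.homeo_fst] using this
  · rw [hn] at h
    obtain ⟨h1, h2⟩ := hδ.neg h
    refine ⟨?_, fun t ht => g.lab_Y_eq h.le (hδ.sign_eq t ht a ha) (h2 t ht)⟩
    have := strictMonoOn_mul_comp c.εY_sign g.χ.strictMono h1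
    simpa only [g.homeo_fst] using this
  · have hk1 := (eq_zero_iff_of_sign_eq (hs (δ a) (k + 1))).1 hk
    have hk2 := mt (eq_zero_iff_of_sign_eq (hs (δ a) k)).2 hk'
    have h1 := hδ.slide k hk1 hk2
    rcases fin_two_cases i k with rfl | rfl
    · have := strictMonoOn_mul_comp (he k) g.χ.strictMono h1
      simpa only [g.homeo_fst] using this
    -- Motion along the axis `p i = 0`, on which the homeomorphism acts by the increasing map `η 0`.
    · have h3 : ∀ t ∈ Icc a b, δ t i = 0 := fun t ht => by
        rw [fin_two_add] at hk1
        exact (eq_zero_iff_of_sign_eq (hδ.sign_eq a ha t ht i)).1 hk1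
      refine (strictMonoOn_mul_comp (he (i + 1)) (g.strictMono_η 0) h1).congr fun t ht => ?_
      simp only [g.homeo_snd, h3 t ht]

end Transport

/-! ### Equivalence of fields with the same signs -/

theorem exists_localChart (hr : 1 ≤ r) (hU : IsOpen U) (h0 : (0 : Plane) ∈ U) (Z : Omega U r)
    (i : Fin 2) {εX εY sX sY mX MX mY MY : ℝ} (hεX : εX = 1 ∨ εX = -1) (hεY : εY = 1 ∨ εY = -1)
    (hsX : sX = 1 ∨ sX = -1) (hsY : sY = 1 ∨ sY = -1) (hX : 0 < εX * Z.1 0 i)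
    (hY : 0 < εY * Z.2 0 i) (hmX : 0 < mX) (hmY : 0 < mY)
    (hX1 : mX < sX * (Z.1 0 (i + 1) / Z.1 0 i)) (hX2 : sX * (Z.1 0 (i + 1) / Z.1 0 i) < MX)
    (hY1 : mY < sY * (Z.2 0 (i + 1) / Z.2 0 i)) (hY2 : sY * (Z.2 0 (i + 1) / Z.2 0 i) < MY) :
    ∃ ρ₀ > 0, ∀ ρ, 0 < ρ → ρ ≤ ρ₀ →
      Nonempty (LocalChart Z i εX εY sX sY mX MX mY MY ρ) := by
  obtain ⟨ρ₁, h1, h1'⟩ := exists_fieldChart hr hU h0 Z.1 i hsX hX hmX hX1 hX2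
  obtain ⟨ρ₂, h2, h2'⟩ := exists_fieldChart hr hU h0 Z.2 i hsY hY hmY hY1 hY2
  refine ⟨min ρ₁ ρ₂, lt_min h1 h2, fun ρ hρ hρ' => ?_⟩
  obtain ⟨hs, ⟨cX⟩⟩ := h1' ρ hρ (hρ'.trans (min_le_left _ _))
  obtain ⟨-, ⟨cY⟩⟩ := h2' ρ hρ (hρ'.trans (min_le_right _ _))
  exact ⟨⟨cX, cY, hs, hρ, hmX, hmY, hεX, hεY, hsX, hsY⟩⟩

/-- Bounds for the absolute slopes at the origin. Different slopes get disjoint brackets, so that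
the ratio of the bounds `M / m'` or `M' / m` is less than one and can serve as a contraction
constant. -/
theorem exists_brackets {x y : ℝ} (hx : 0 < x) (hy : 0 < y) : ∃ m M m' M' : ℝ,
    0 < m ∧ m < x ∧ x < M ∧ 0 < m' ∧ m' < y ∧ y < M' ∧ (x < y → M < m') ∧ (y < x → M' < m) := by
  rcases lt_trichotomy x y with h | h | h
  · exact ⟨x / 2, (2 * x + y) / 3, (x + 2 * y) / 3, y + 1, by linarith, by linarith, by linarith,
      by linarith, by linarith, by linarith, fun _ => by linarith, fun _ => by linarith⟩
  · exact ⟨x / 2, x + 1, y / 2, y + 1, by linarith, by linarith, by linarith,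
      by linarith, by linarith, by linarith, fun _ => by linarith, fun _ => by linarith⟩
  · exact ⟨(2 * x + y) / 3, x + 1, y / 2, (x + 2 * y) / 3, by linarith, by linarith, by linarith,
      by linarith, by linarith, by linarith, fun _ => by linarith, fun _ => by linarith⟩

/-- A hop along a leaf of each foliation changes the distance to the origin by at most the ratio of
the extreme slopes. -/
theorem Foliation.abs_symm_le {F F' : ℝ → ℝ → ℝ} {s s' m M m' M' l : ℝ} (f : Foliation F s m M)
    (f' : Foliation F' s' m' M') (hm : 0 < m) (hl : M' / m ≤ l) (x : ℝ) :
    |f.K.symm (-f'.K x)| ≤ l * |x| := by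
  have h1 := f.le_K (f.K.symm (-f'.K x))
  rw [OrderIso.apply_symm_apply, abs_neg] at h1
  have h2 := f'.K_le x
  have h3 : |f.K.symm (-f'.K x)| ≤ M' / m * |x| := by
    rw [div_mul_eq_mul_div, le_div_iff₀ hm]
    linarith
  exact h3.trans (mul_le_mul_of_nonneg_right hl (abs_nonneg x))

end

section


variable {U : Set Plane} {r : ℕ} {Z Z' : Omega U r} {i : Fin 2}

/-- The signs of the components of `X` and `Y` at the origin, none of which vanishes. -/
structure SignPattern (Z : Omega U r) (i : Fin 2) (εX εY sX sY : ℝ) : Prop where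
  X_fst : 0 < εX * Z.1 0 i
  Y_fst : 0 < εY * Z.2 0 i
  X_snd : 0 < sX * (εX * Z.1 0 (i + 1))
  Y_snd : 0 < sY * (εY * Z.2 0 (i + 1))
  εX_sign : εX = 1 ∨ εX = -1
  εY_sign : εY = 1 ∨ εY = -1
  sX_sign : sX = 1 ∨ sX = -1
  sY_sign : sY = 1 ∨ sY = -1

theorem slope_pos {ε s x y : ℝ} (hx : 0 < ε * x) (hy : 0 < s * (ε * y)) :
    0 < s * (y / x) := by
  have hε : ε ≠ 0 := left_ne_zero_of_mul hx.ne'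
  have hx0 : x ≠ 0 := right_ne_zero_of_mul hx.ne'
  have : s * (y / x) = s * (ε * y) / (ε * x) := by field_simp
  rw [this]
  exact div_pos hy hx

variable {εX εY sX sY : ℝ}

/-- For `sX = -1` and `sY = 1` the factors in `hα` are the differences of the absolute slopes of `X`
and `Y`. If they have the same sign, the hops of both fields contract, or the inverse hops of both
do; a common contraction constant is the larger of the two. -/
theorem SignPattern.exists_matching (hr : 1 ≤ r) (hU : IsOpen U) (h0 : (0 : Plane) ∈ U)
    (hZ : SignPattern Z i εX εY sX sY) (hZ' : SignPattern Z' i εX εY sX sY)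
    (hα : sX = -1 → sY = 1 → 0 <
      (sX * (Z.1 0 (i + 1) / Z.1 0 i) - sY * (Z.2 0 (i + 1) / Z.2 0 i)) *
      (sX * (Z'.1 0 (i + 1) / Z'.1 0 i) - sY * (Z'.2 0 (i + 1) / Z'.2 0 i))) :
    ∃ mX MX mY MY mX' MX' mY' MY' ρ₀ : ℝ, 0 < ρ₀ ∧ ∀ ρ, 0 < ρ → ρ ≤ ρ₀ →
      ∃ (c : LocalChart Z i εX εY sX sY mX MX mY MY ρ)
        (c' : LocalChart Z' i εX εY sX sY mX' MX' mY' MY' ρ),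
        Nonempty (Matching c.X.fol c.Y.fol c'.X.fol c'.Y.fol) := by
  obtain ⟨mX, MX, mY, MY, k1, k2, k3, k4, k5, k6, k7, k8⟩ :=
    exists_brackets (slope_pos hZ.X_fst hZ.X_snd) (slope_pos hZ.Y_fst hZ.Y_snd)
  obtain ⟨mX', MX', mY', MY', k1', k2', k3', k4', k5', k6', k7', k8'⟩ :=
    exists_brackets (slope_pos hZ'.X_fst hZ'.X_snd) (slope_pos hZ'.Y_fst hZ'.Y_snd)
  obtain ⟨ρ₁, hρ₁, h1⟩ := exists_localChart hr hU h0 Z i hZ.εX_sign hZ.εY_sign hZ.sX_sign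
    hZ.sY_sign hZ.X_fst hZ.Y_fst k1 k4 k2 k3 k5 k6
  obtain ⟨ρ₂, hρ₂, h2⟩ := exists_localChart hr hU h0 Z' i hZ'.εX_sign hZ'.εY_sign hZ'.sX_sign
    hZ'.sY_sign hZ'.X_fst hZ'.Y_fst k1' k4' k2' k3' k5' k6'
  refine ⟨mX, MX, mY, MY, mX', MX', mY', MY', min ρ₁ ρ₂, lt_min hρ₁ hρ₂, fun ρ hρ hρ' => ?_⟩
  obtain ⟨c⟩ := h1 ρ hρ (hρ'.trans (min_le_left _ _))
  obtain ⟨c'⟩ := h2 ρ hρ (hρ'.trans (min_le_right _ _))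
  refine ⟨c, c', PWS.exists_matching _ _ _ _ hZ.sX_sign hZ.sY_sign fun hs hs' => ?_⟩
  rcases mul_pos_iff.1 (hα hs hs') with ⟨h, h'⟩ | ⟨h, h'⟩
  · have q1 := k8 (sub_pos.1 h)
    have q2 := k8' (sub_pos.1 h')
    refine ⟨max (MY / mX) (MY' / mX'), lt_max_of_lt_left (div_pos (k4.trans (k5.trans k6)) k1),
      max_lt ((div_lt_one k1).2 q1) ((div_lt_one k1').2 q2), Or.inl ⟨?_, ?_⟩⟩
    · exact c.X.fol.abs_symm_le c.Y.fol k1 (le_max_left _ _)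
    · exact c'.X.fol.abs_symm_le c'.Y.fol k1' (le_max_right _ _)
  · have q1 := k7 (sub_neg.1 h)
    have q2 := k7' (sub_neg.1 h')
    refine ⟨max (MX / mY) (MX' / mY'), lt_max_of_lt_left (div_pos (k1.trans (k2.trans k3)) k4),
      max_lt ((div_lt_one k4).2 q1) ((div_lt_one k4').2 q2), Or.inr ⟨?_, ?_⟩⟩
    · exact c.Y.fol.abs_symm_le c.X.fol k4 (le_max_left _ _)
    · exact c'.Y.fol.abs_symm_le c'.X.fol k4' (le_max_right _ _)

/-- Fields which cross one of the axes are equivalent if they have the same signs and if, in the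
case of a return map of the other axis, both return maps contract or both expand. -/
theorem locallyEquivalent_of_crossing (hr : 1 ≤ r) (hU : IsOpen U) (h0 : (0 : Plane) ∈ U)
    {ε : ℝ} (hZ : SignPattern Z i ε ε sX sY) (hZ' : SignPattern Z' i ε ε sX sY)
    (hα : sX = -1 → sY = 1 → 0 <
      (sX * (Z.1 0 (i + 1) / Z.1 0 i) - sY * (Z.2 0 (i + 1) / Z.2 0 i)) *
      (sX * (Z'.1 0 (i + 1) / Z'.1 0 i) - sY * (Z'.2 0 (i + 1) / Z'.2 0 i))) :
    LocallyEquivalent Z Z' := by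
  obtain ⟨mX, MX, mY, MY, mX', MX', mY', MY', ρ, hρ, h⟩ := hZ.exists_matching hr hU h0 hZ' hα
  obtain ⟨c, c', ⟨g⟩⟩ := h ρ hρ le_rfl
  refine locallyEquivalent_of_homeo (h := g.homeo i) (g.homeo_zero i)
    (fun p hp => inner_pos_of_sign_eq hp (g.sign_homeo i p)) (fun p => g.homeo_mem_switching)
    hρ hρ c.sub c'.sub (fun a b γ hab hγ hm hm' => ?_) (fun a b γ hab hγ hm hm' => ?_)
  · exact ((c.graphOrbit_of_trajectory hab hγ hm).map g).exists_trajectory hab hm'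
  · exact ((c'.graphOrbit_of_trajectory hab hγ hm).map g.symm).exists_trajectory hab hm'

theorem continuousAt_slideSpeed (hU : IsOpen U) (h0 : (0 : Plane) ∈ U) (Z : Omega U r) (k : Fin 2)
    (h : Z.2 0 (k + 1) - Z.1 0 (k + 1) ≠ 0) : ContinuousAt (slideSpeed Z k) 0 := by
  have hX : ∀ k, ContinuousAt (fun p => Z.1 p k) 0 := fun k =>
    (continuous_coord k).continuousAt.comp (Z.1.contDiffOn.continuousOn.continuousAt (hU.mem_nhds h0))
  have hY : ∀ k, ContinuousAt (fun p => Z.2 p k) 0 := fun k =>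
    (continuous_coord k).continuousAt.comp (Z.2.contDiffOn.continuousOn.continuousAt (hU.mem_nhds h0))
  exact (((hY (k + 1)).mul (hX k)).sub ((hX (k + 1)).mul (hY k))).div
    ((hY (k + 1)).sub (hX (k + 1))) h

theorem exists_box_slideSpeed (hU : IsOpen U) (h0 : (0 : Plane) ∈ U) {e : Fin 2 → ℝ}
    (he : ∀ k, 0 < e k * slideSpeed Z k 0) :
    ∃ ρ₀ > 0, ∀ ρ ≤ ρ₀, ∀ k, ∀ p ∈ box ρ, 0 < e k * slideSpeed Z k p := by
  have : ∀ᶠ p in 𝓝 (0 : Plane), ∀ k, 0 < e k * slideSpeed Z k p := by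
    rw [Filter.eventually_all]
    intro k
    have hne : Z.2 0 (k + 1) - Z.1 0 (k + 1) ≠ 0 := fun h => by
      have := he k
      rw [slideSpeed, h, div_zero, mul_zero] at this
      exact lt_irrefl _ this
    exact (continuousAt_const.mul (continuousAt_slideSpeed hU h0 Z k hne)).eventually
      (lt_mem_nhds (he k))
  obtain ⟨ρ₀, hρ₀, h⟩ := exists_box_subset this
  exact ⟨ρ₀, hρ₀, fun ρ hρ k p hp => h ρ hρ hp k⟩

/-- Fields for which both axes are sliding or escaping are equivalent if they have the same signs
and slide in the same directions. -/
theorem locallyEquivalent_of_sliding (hr : 1 ≤ r) (hU : IsOpen U) (h0 : (0 : Plane) ∈ U)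
    {ε s : ℝ} (hZ : SignPattern Z i ε (-ε) s s) (hZ' : SignPattern Z' i ε (-ε) s s)
    {e : Fin 2 → ℝ} (he1 : ∀ k, e k = 1 ∨ e k = -1) (he : ∀ k, 0 < e k * slideSpeed Z k 0)
    (he' : ∀ k, 0 < e k * slideSpeed Z' k 0) : LocallyEquivalent Z Z' := by
  obtain ⟨mX, MX, mY, MY, mX', MX', mY', MY', ρ₀, hρ₀, h⟩ := hZ.exists_matching hr hU h0 hZ'
    (fun h1 h2 => by rw [h1] at h2; norm_num at h2)
  obtain ⟨ρ₁, hρ₁, h1⟩ := exists_box_slideSpeed hU h0 he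
  obtain ⟨ρ₂, hρ₂, h2⟩ := exists_box_slideSpeed hU h0 he'
  set ρ := min ρ₀ (min ρ₁ ρ₂) with hρdef
  have hρ : 0 < ρ := lt_min hρ₀ (lt_min hρ₁ hρ₂)
  have he2 := h1 ρ ((min_le_right _ _).trans (min_le_left _ _))
  have he2' := h2 ρ ((min_le_right _ _).trans (min_le_right _ _))
  obtain ⟨c, c', ⟨g⟩⟩ := h ρ hρ (min_le_left _ _)
  refine locallyEquivalent_of_homeo (h := g.homeo i) (g.homeo_zero i)
    (fun p hp => inner_pos_of_sign_eq hp (g.sign_homeo i p)) (fun p => g.homeo_mem_switching)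
    hρ hρ c.sub c'.sub (fun a b γ hab hγ hm hm' => ?_) (fun a b γ hab hγ hm hm' => ?_)
  · exact ((c.cellOrbit_of_trajectory he2 hab hγ hm).map g he1 hab).exists_trajectory he2' he1
      hab hm'
  · exact ((c'.cellOrbit_of_trajectory he2' hab hγ hm).map g.symm he1 hab).exists_trajectory he2 he1
      hab hm'

end

section


variable {U : Set Plane} {r : ℕ}

/-! ### The topology of the space of fields -/

/-- The value at a point is the derivative of order zero, whose uniform convergence is part of the
topology. -/
theorem VField.continuous_eval (h0 : (0 : Plane) ∈ U) (k : Fin 2) :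
    Continuous fun X : VField U r => X 0 k := by
  have h1 : Continuous fun X : VField U r => fun k : Fin (r + 1) =>
      UniformFun.ofFun (fun x : U => iteratedFDerivWithin ℝ (k : ℕ) X U (x : Plane)) :=
    continuous_induced_dom
  have h2 := (continuous_apply (0 : Fin (r + 1))).comp h1
  have h3 := (UniformFun.uniformContinuous_eval (Plane [×((0 : Fin (r + 1)) : ℕ)]→L[ℝ] Plane)
    (⟨0, h0⟩ : U)).continuous.comp h2
  have h4 : Continuous fun X : VField U r =>
      iteratedFDerivWithin ℝ ((0 : Fin (r + 1)) : ℕ) X U 0 (fun _ => 0) :=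
    (ContinuousMultilinearMap.apply ℝ (fun _ => Plane) Plane (fun _ => 0)).continuous.comp h3
  exact (continuous_coord k).comp h4

theorem Omega.continuous_fst (h0 : (0 : Plane) ∈ U) (k : Fin 2) :
    Continuous fun Z : Omega U r => Z.1 0 k :=
  (VField.continuous_eval h0 k).comp _root_.continuous_fst

theorem Omega.continuous_snd (h0 : (0 : Plane) ∈ U) (k : Fin 2) :
    Continuous fun Z : Omega U r => Z.2 0 k :=
  (VField.continuous_eval h0 k).comp _root_.continuous_snd

section Perturb

variable (hU : IsOpen U) (hUb : Bornology.IsBounded U)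

theorem contDiff_smul_const {G : Plane → Plane} (hG : ContDiff ℝ r G) (t : ℝ) :
    ContDiff ℝ r (t • G) := contDiff_const.smul hG

theorem iteratedFDerivWithin_add_smul (hU : IsOpen U) (X : VField U r) {G : Plane → Plane}
    (hG : ContDiff ℝ r G) (t : ℝ) {k : ℕ} (hk : k ≤ r) {x : Plane} (hx : x ∈ U) :
    iteratedFDerivWithin ℝ k (U.indicator (X.toFun + t • G)) U x =
      iteratedFDerivWithin ℝ k X U x + t • iteratedFDeriv ℝ k G x := by
  have hk' : (k : WithTop ℕ∞) ≤ (r : WithTop ℕ∞) := by exact_mod_cast hk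
  have h1 : EqOn (U.indicator (X.toFun + t • G)) (X.toFun + t • G) U := fun y hy => indicator_of_mem hy _
  have hX : ContDiffWithinAt ℝ k X U x := (X.contDiffOn.of_le hk') x hx
  have hG' : ContDiffWithinAt ℝ k (t • G) U x :=
    ((contDiff_smul_const hG t).of_le hk').contDiffAt.contDiffWithinAt
  have hG'' : ContDiffAt ℝ k G x := (hG.of_le hk').contDiffAt
  rw [iteratedFDerivWithin_congr h1 hx, iteratedFDerivWithin_add_apply hX hG' hU.uniqueDiffOn hx,
    iteratedFDerivWithin_const_smul_apply hG''.contDiffWithinAt hU.uniqueDiffOn hx,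
    iteratedFDerivWithin_eq_iteratedFDeriv hU.uniqueDiffOn hG'' hx]

theorem uniformContinuousOn_iteratedFDeriv (hUb : Bornology.IsBounded U) {G : Plane → Plane}
    (hG : ContDiff ℝ r G) {k : ℕ} (hk : k ≤ r) :
    UniformContinuousOn (iteratedFDeriv ℝ k G) U := by
  have hc : Continuous (iteratedFDeriv ℝ k G) := hG.continuous_iteratedFDeriv (by exact_mod_cast hk)
  have := (hUb.isCompact_closure).uniformContinuousOn_of_continuous hc.continuousOn
  exact this.mono subset_closure

/-- The field `X + t G` for a field `G` of class `C^r` on the whole plane. -/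
def VField.perturb (hU : IsOpen U) (hUb : Bornology.IsBounded U) (X : VField U r)
    {G : Plane → Plane} (hG : ContDiff ℝ r G) (t : ℝ) : VField U r where
  toFun := U.indicator (X.toFun + t • G)
  contDiffOn := (X.contDiffOn.add (contDiff_smul_const hG t).contDiffOn).congr
    fun _ hy => indicator_of_mem hy _
  uniformContinuousOn k hk := by
    have h1 := X.uniformContinuousOn k hk
    have h2 := uniformContinuousOn_iteratedFDeriv hUb hG hk
    rw [uniformContinuousOn_iff_restrict] at h1 h2 ⊢
    convert h1.add (h2.const_smul t) using 1
    exact funext fun x => iteratedFDerivWithin_add_smul hU X hG t hk x.2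
  eq_zero x hx := indicator_of_notMem hx _

theorem VField.perturb_apply (X : VField U r) {G : Plane → Plane} (hG : ContDiff ℝ r G) (t : ℝ)
    {p : Plane} (hp : p ∈ U) (k : Fin 2) :
    X.perturb hU hUb hG t p k = X p k + t * G p k := by
  have : X.perturb hU hUb hG t p = X p + t • G p := indicator_of_mem hp _
  rw [this]
  simp

/-- The derivatives of `G` are bounded on the closure of `U`, which is compact, so the perturbation
is of size `O(t)` in the `C^r` topology. -/
theorem VField.tendsto_perturb (X : VField U r) {G : Plane → Plane} (hG : ContDiff ℝ r G) :
    Tendsto (X.perturb hU hUb hG) (𝓝 0) (𝓝 X) := by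
  rw [nhds_induced, tendsto_comap_iff, tendsto_pi_nhds]
  intro k
  have hk : (k : ℕ) ≤ r := Nat.lt_succ_iff.1 k.2
  have hc : Continuous (iteratedFDeriv ℝ (k : ℕ) G) :=
    hG.continuous_iteratedFDeriv (by exact_mod_cast hk)
  obtain ⟨C, hC⟩ := hUb.isCompact_closure.exists_bound_of_continuousOn hc.continuousOn
  rw [UniformFun.tendsto_iff_tendstoUniformly, Metric.tendstoUniformly_iff]
  intro η hη
  have h1 : ∀ᶠ t : ℝ in 𝓝 0, |t| * (|C| + 1) < η := by
    have : Tendsto (fun t : ℝ => |t| * (|C| + 1)) (𝓝 0) (𝓝 (|0| * (|C| + 1))) :=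
      (continuous_abs.mul continuous_const).tendsto 0
    rw [abs_zero, zero_mul] at this
    exact this.eventually (gt_mem_nhds hη)
  filter_upwards [h1] with t ht x
  have h2 := iteratedFDerivWithin_add_smul hU X hG t hk x.2
  have h3 : dist (iteratedFDerivWithin ℝ (k : ℕ) X U x)
      (iteratedFDerivWithin ℝ (k : ℕ) (U.indicator (X.toFun + t • G)) U x) < η := by
    rw [h2, dist_self_add_right, norm_smul, Real.norm_eq_abs]
    refine lt_of_le_of_lt (mul_le_mul_of_nonneg_left ?_ (abs_nonneg t)) ht
    exact (hC x (subset_closure x.2)).trans ((le_abs_self C).trans (by linarith))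
  exact h3

end Perturb

end

section


variable {U : Set Plane} {r : ℕ} {i : Fin 2}

/-! ### Transience -/

section

variable {V : Plane → Plane} {ε s τ m M ρ : ℝ}

theorem FieldChart.strictMonoOn_fst (ch : FieldChart V i ε s m M ρ) {γ : ℝ → Plane} {a b : ℝ}
    (hγ : ∀ t ∈ Icc a b, γ t ∈ box ρ ∧ HasDerivWithinAt γ (V (γ t)) (Icc a b) t) :
    StrictMonoOn (fun t => ε * γ t i) (Icc a b) := by
  refine strictMonoOn_of_local (LocalChart.continuousOn_coord
    (fun t ht => (hγ t ht).2.continuousWithinAt) ε i) fun t ht => ?_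
  exact eventually_lt_of_hasDerivWithinAt_pos
    ((hasDerivWithinAt_coord (hγ t ht).2 i).const_mul ε)
    (ch.c_pos.trans_le (ch.speed _ (hγ t ht).1).1)

theorem FieldChart.strictMonoOn_snd (ch : FieldChart V i ε s m M ρ) (hm : 0 < m) {γ : ℝ → Plane}
    {a b : ℝ} (hγ : ∀ t ∈ Icc a b, γ t ∈ box ρ ∧ HasDerivWithinAt γ (V (γ t)) (Icc a b) t) :
    StrictMonoOn (fun t => s * (ε * γ t (i + 1))) (Icc a b) := by
  refine strictMonoOn_of_local (continuousOn_const.mul (LocalChart.continuousOn_coord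
    (fun t ht => (hγ t ht).2.continuousWithinAt) ε (i + 1))) fun t ht => ?_
  exact eventually_lt_of_hasDerivWithinAt_pos
    (((hasDerivWithinAt_coord (hγ t ht).2 (i + 1)).const_mul ε).const_mul s)
    (ch.speed_snd hm (hγ t ht).1)

/-- Both coordinates are strictly monotone along solutions. A solution through `(0, κ)` meets the
line `u = 0` only there; on the way to the line `v = 0` the product `u * v` has the sign opposite to
`s`, so it has to leave the region. -/
theorem FieldChart.not_transientIn (ch : FieldChart V i ε s m M ρ) (hm : 0 < m) (hρ : 0 < ρ)
    (hε : ε = 1 ∨ ε = -1) : ¬ TransientIn V {p | 0 ≤ s * (p 0 * p 1)} := by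
  intro h
  obtain ⟨κ, hκ, hsub⟩ := exists_box_subset (h (box ρ) (box_mem_nhds hρ))
  have hp : pt i 0 κ ∈ box κ := pt_mem_box.2 ⟨by simpa using hκ.le, (abs_of_pos hκ).le⟩
  obtain ⟨γ, a, b, t₁, t₂, h0, ht₁, ht₂, hγ0, hγ, hax₁, hax₂, hQ⟩ :=
    hsub κ le_rfl hp (by simp [mul_coord i])
  have hu := ch.strictMonoOn_fst hγ
  have hv := ch.strictMonoOn_snd hm hγ
  have key : ∀ t ∈ Icc a b, ∀ t' ∈ Icc a b, γ t i = 0 → γ t' (i + 1) = 0 →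
      (∀ x ∈ uIcc t t', 0 ≤ s * (γ x 0 * γ x 1)) → False := by
    intro t ht t' ht' hti ht'i hq
    have ht0 : t = 0 := hu.injOn ht h0 (by simp [hti, hγ0])
    subst ht0
    have hne : t' ≠ 0 := by
      rintro rfl
      rw [hγ0, pt_snd] at ht'i
      exact hκ.ne' ht'i
    have hmid : t' / 2 ∈ uIcc 0 t' := by
      rcases hne.lt_or_gt with h | h
      · rw [uIcc_of_ge h.le]
        constructor <;> linarith
      · rw [uIcc_of_le h.le]
        constructor <;> linarith
    have hmI : t' / 2 ∈ Icc a b := uIcc_subset_Icc h0 ht' hmid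
    have hq' := hq _ hmid
    rw [mul_coord i] at hq'
    have hpos : 0 < (ε * γ (t' / 2) i) * -(s * (ε * γ (t' / 2) (i + 1))) := by
      rcases hne.lt_or_gt with h | h
      · have e1 : ε * γ (t' / 2) i < ε * γ 0 i := hu hmI h0 (by linarith)
        have e2 : s * (ε * γ t' (i + 1)) < s * (ε * γ (t' / 2) (i + 1)) :=
          hv ht' hmI (by linarith)
        rw [hti, mul_zero] at e1
        rw [ht'i, mul_zero, mul_zero] at e2
        exact mul_pos_of_neg_of_neg e1 (by linarith)
      · have e1 : ε * γ 0 i < ε * γ (t' / 2) i := hu h0 hmI (by linarith)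
        have e2 : s * (ε * γ (t' / 2) (i + 1)) < s * (ε * γ t' (i + 1)) :=
          hv hmI ht' (by linarith)
        rw [hti, mul_zero] at e1
        rw [ht'i, mul_zero, mul_zero] at e2
        exact mul_pos e1 (by linarith)
    have e : (ε * γ (t' / 2) i) * -(s * (ε * γ (t' / 2) (i + 1))) =
        (ε * ε) * -(s * (γ (t' / 2) i * γ (t' / 2) (i + 1))) := by ring
    rw [e, mul_self_sign hε, one_mul] at hpos
    linarith
  rcases fin_two_cases i 0 with h | h
  · subst h
    exact key t₁ ht₁ t₂ ht₂ hax₁ hax₂ fun x hx => hQ x hx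
  · have hi : i = 1 := by
      rcases fin_two_cases 1 i with h' | h'
      · exact h'
      · rw [h'] at h
        exact absurd h (by decide)
    subst hi
    exact key t₂ ht₂ t₁ ht₁ hax₂ hax₁ fun x hx => hQ x (by rwa [uIcc_comm])

theorem Foliation.monotone_W {F : ℝ → ℝ → ℝ} (f : Foliation F s m M) (h : ∀ x y, 0 ≤ s * F x y)
    (c : ℝ) : Monotone fun u => s * f.W u c :=
  monotone_of_deriv_nonneg (fun u => ((f.hasDerivAt_W u c).const_mul s).differentiableAt) fun u => by
    rw [((f.hasDerivAt_W u c).const_mul s).deriv]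
    exact h _ _

/-- The leaf through a point near the origin meets both axes near the origin. Between these two
points the product of the coordinates has the sign opposite to the slope, because the height is
monotone and vanishes at the second of them. -/
theorem FieldChart.transientIn (ch : FieldChart V i ε s m M ρ) (hm : 0 < m) (hρ : 0 < ρ)
    (hε : ε = 1 ∨ ε = -1) (hs : s = 1 ∨ s = -1) :
    TransientIn V {p | s * (p 0 * p 1) ≤ 0} := by
  intro N hN
  obtain ⟨ρ₁, hρ₁, hsub⟩ := exists_box_subset hN
  set ρ' := min ρ ρ₁ with hρ'
  have hρ'0 : 0 < ρ' := lt_min hρ hρ₁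
  -- a square of leaves
  have hW : ∀ᶠ q : ℝ × ℝ in 𝓝 (0, 0), |ch.fol.W q.1 q.2| < ρ' := by
    have h1 : Continuous fun q : ℝ × ℝ => |ch.fol.W q.1 q.2| :=
      continuous_abs.comp ch.fol.continuous_W
    refine h1.continuousAt.eventually (gt_mem_nhds ?_)
    simpa [ch.fol.W_zero] using hρ'0
  obtain ⟨κ₀, hκ₀, hball⟩ := Metric.eventually_nhds_iff.1 hW
  set κ := min ρ' (κ₀ / 2) with hκdef
  have hκ : 0 < κ := lt_min hρ'0 (by linarith)
  have hWκ : ∀ u c, |u| ≤ κ → |c| ≤ κ → |ch.fol.W u c| ≤ ρ' := fun u c hu hc => by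
    refine (hball (y := (u, c)) ?_).le
    have h2 : κ < κ₀ := (min_le_right _ _).trans_lt (by linarith)
    rw [Prod.dist_eq, max_lt_iff, Real.dist_eq, Real.dist_eq, sub_zero, sub_zero]
    exact ⟨hu.trans_lt h2, hc.trans_lt h2⟩
  -- The bound `m * κ` for the label keeps the intersection `u₁` with the second axis in `[-κ, κ]`,
  -- because `m * |u₁| ≤ |K u₁|`.
  have hlab : ∀ᶠ p in 𝓝 (0 : Plane), |ch.lab p| < min κ (m * κ) := by
    refine (continuous_abs.comp ch.continuous_lab).continuousAt.eventually (gt_mem_nhds ?_)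
    simpa [ch.lab_zero] using ⟨hκ, mul_pos hm hκ⟩
  filter_upwards [hlab, box_mem_nhds hκ] with p hp hpκ _
  set c := ch.lab p with hc
  have hcκ : |c| ≤ κ := (hp.trans_le (min_le_left _ _)).le
  -- the leaf through `p` meets the second axis in `u₁`
  set u₁ := ch.fol.K.symm (-s * c) with hu₁
  have hu₁κ : |u₁| ≤ κ := by
    have h1 := ch.fol.le_K u₁
    rw [hu₁, OrderIso.apply_symm_apply, ← hu₁, abs_mul, abs_neg, abs_eq_one_of_sign hs, one_mul]
      at h1
    have h2 : m * |u₁| ≤ m * κ := h1.trans (hp.trans_le (min_le_right _ _)).le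
    exact le_of_mul_le_mul_left h2 hm
  have hWu₁ : ch.fol.W u₁ c = 0 := by
    have h1 : ch.fol.H u₁ 0 = c := by
      rw [ch.fol.H_axis, hu₁, OrderIso.apply_symm_apply]
      have := mul_self_sign hs
      linear_combination c * this
    rw [← h1, ch.fol.W_H]
  set δ : ℝ → Plane := fun t => pt i (ε * t) (ch.fol.W (ε * t) c) with hδ
  have hδi : ∀ t, δ t i = ε * t := fun t => pt_fst ..
  have hδi' : ∀ t, δ t (i + 1) = ch.fol.W (ε * t) c := fun t => pt_snd ..
  have habs : ∀ t, |ε * t| = |t| := fun t => by rw [abs_mul, abs_eq_one_of_sign hε, one_mul]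
  have hδc : Continuous δ := by
    refine (continuous_pt i).comp (f := fun t => (ε * t, ch.fol.W (ε * t) c)) ?_
    refine (continuous_const.mul continuous_id).prodMk ?_
    exact ch.fol.continuous_W.comp (f := fun t => (ε * t, c))
      ((continuous_const.mul continuous_id).prodMk continuous_const)
  have hδb : MapsTo δ (Icc (-κ) κ) (box ρ') := fun t ht => by
    have ht' : |ε * t| ≤ κ := by
      rw [habs]
      exact abs_le.2 ht
    exact pt_mem_box.2 ⟨ht'.trans (min_le_left _ _), hWκ _ _ ht' hcκ⟩
  have hδb' : MapsTo δ (Icc (-κ) κ) (box ρ) := fun t ht => box_mono (min_le_left _ _) (hδb ht)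
  have hg : (fun t => ε * δ t i) = id := by
    funext t
    rw [hδi, ← mul_assoc, mul_self_sign hε, one_mul, id]
  obtain ⟨c₀, d₀, σ, h1, h2, h3, h4, h5⟩ := exists_reparam_of_continuousOn
    (g := fun t => ε * δ t i) (w := fun t => ε * V (δ t) i) (show -κ < κ by linarith)
    (hg ▸ continuousOn_id) (hg ▸ strictMonoOn_id)
    (continuousOn_const.mul ((continuous_coord i).comp_continuousOn
      (ch.cont.comp hδc.continuousOn hδb')))
    (fun t ht => ch.c_pos.trans_le (ch.speed _ (hδb' ht)).1)
  have hσ : MapsTo σ (Icc c₀ d₀) (Icc (-κ) κ) := fun t ht => h3 ▸ mem_image_of_mem σ ht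
  have hβ : ∀ t ∈ Icc c₀ d₀,
      HasDerivWithinAt (fun t => δ (σ t)) (V (δ (σ t))) (Icc c₀ d₀) t := fun t ht =>
    ch.hasDerivWithinAt_of_lab hε ht (hδb' (hσ ht)) (k := c)
      (Eventually.of_forall fun t' => by
        rw [FieldChart.lab, hδi, hδi', ch.fol.H_W]) (h5 t ht)
  have hpre : ∀ u, |u| ≤ κ → ∃ t ∈ Icc c₀ d₀, δ (σ t) i = u ∧ δ (σ t) (i + 1) = ch.fol.W u c := by
    intro u hu
    have hmem : ε * u ∈ Icc (-κ) κ := abs_le.1 (by rwa [habs])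
    rw [← h3] at hmem
    obtain ⟨t, ht, htu⟩ := hmem
    have e : ε * σ t = u := by rw [htu, ← mul_assoc, mul_self_sign hε, one_mul]
    exact ⟨t, ht, by rw [hδi, e], by rw [hδi', e]⟩
  obtain ⟨s₀, hs₀, e1, e2⟩ := hpre (p i) (hpκ i)
  obtain ⟨sa, hsa, a1, a2⟩ := hpre 0 (by simpa using hκ.le)
  obtain ⟨sb, hsb, b1, b2⟩ := hpre u₁ hu₁κ
  -- `s * W` is nondecreasing in `u` and vanishes at `u₁`, so between `0` and `u₁` its sign is
  -- opposite to that of `u`.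
  have hbetween : ∀ x ∈ uIcc sa sb, s * (δ (σ x) 0 * δ (σ x) 1) ≤ 0 := by
    intro x hx
    have hxI : x ∈ Icc c₀ d₀ := uIcc_subset_Icc hsa hsb hx
    rw [mul_coord i, hδi, hδi']
    have hmono := ch.fol.monotone_W (fun x y => hm.le.trans (ch.le_slope x y)) c
    have hmi := h2.monotoneOn
    have ea : σ sa = 0 := by
      rw [hδi] at a1
      rcases hε with h | h <;> rw [h] at a1 <;> linarith
    have hb0 : s * ch.fol.W (ε * σ sb) c = 0 := by
      rw [← hδi, b1, hWu₁, mul_zero]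
    have hx' : (0 ≤ ε * σ x ∧ ε * σ x ≤ ε * σ sb) ∨ (ε * σ x ≤ 0 ∧ ε * σ sb ≤ ε * σ x) := by
      have : (σ sa ≤ σ x ∧ σ x ≤ σ sb) ∨ (σ sb ≤ σ x ∧ σ x ≤ σ sa) := by
        rcases le_total sa sb with h | h
        · rw [uIcc_of_le h] at hx
          exact Or.inl ⟨hmi hsa hxI hx.1, hmi hxI hsb hx.2⟩
        · rw [uIcc_of_ge h] at hx
          exact Or.inr ⟨hmi hsb hxI hx.1, hmi hxI hsa hx.2⟩
      rw [ea] at this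
      rcases hε with h | h <;> rw [h] <;> rcases this with h | h
      · exact Or.inl ⟨by linarith [h.1], by linarith [h.2]⟩
      · exact Or.inr ⟨by linarith [h.2], by linarith [h.1]⟩
      · exact Or.inr ⟨by linarith [h.1], by linarith [h.2]⟩
      · exact Or.inl ⟨by linarith [h.2], by linarith [h.1]⟩
    have e : s * (ε * σ x * ch.fol.W (ε * σ x) c) = (ε * σ x) * (s * ch.fol.W (ε * σ x) c) := by ring
    rw [e]
    rcases hx' with ⟨q1, q2⟩ | ⟨q1, q2⟩
    · exact mul_nonpos_of_nonneg_of_nonpos q1 ((hmono q2).trans hb0.le)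
    · exact mul_nonpos_of_nonpos_of_nonneg q1 (hb0.symm.le.trans (hmono q2))
  have hshift : ∀ x, x ∈ Icc c₀ d₀ → x - s₀ ∈ Icc (c₀ - s₀) (d₀ - s₀) := fun x hx =>
    ⟨by linarith [hx.1], by linarith [hx.2]⟩
  have hγ : ∀ t ∈ Icc (c₀ - s₀) (d₀ - s₀), δ (σ (t + s₀)) ∈ N ∧
      HasDerivWithinAt (fun t => δ (σ (t + s₀))) (V (δ (σ (t + s₀)))) (Icc (c₀ - s₀) (d₀ - s₀)) t := by
    intro t ht
    have hmaps : MapsTo (fun t => t + s₀) (Icc (c₀ - s₀) (d₀ - s₀)) (Icc c₀ d₀) := fun x hx =>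
      ⟨by linarith [hx.1], by linarith [hx.2]⟩
    refine ⟨hsub ρ' (min_le_right _ _) (hδb (hσ (hmaps ht))), ?_⟩
    have := (hβ _ (hmaps ht)).scomp t ((hasDerivWithinAt_id t _).add_const s₀) hmaps
    rw [one_smul] at this
    exact this
  have hγ0 : δ (σ (0 + s₀)) = p := by
    rw [zero_add]
    refine plane_ext i e1 ?_
    rw [e2, hc, FieldChart.lab, ch.fol.W_H]
  have h0mem : (0 : ℝ) ∈ Icc (c₀ - s₀) (d₀ - s₀) := by
    have := hshift s₀ hs₀
    rwa [sub_self] at this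
  have hu : ∀ x ∈ uIcc (sa - s₀) (sb - s₀), s * (δ (σ (x + s₀)) 0 * δ (σ (x + s₀)) 1) ≤ 0 := by
    intro x hx
    refine hbetween _ ?_
    rw [mem_uIcc] at hx ⊢
    rcases hx with h | h
    · exact Or.inl ⟨by linarith, by linarith⟩
    · exact Or.inr ⟨by linarith, by linarith⟩
  have za : δ (σ (sa - s₀ + s₀)) i = 0 := by rw [sub_add_cancel, a1]
  have zb : δ (σ (sb - s₀ + s₀)) (i + 1) = 0 := by rw [sub_add_cancel, b2, hWu₁]
  rcases fin_two_cases i 0 with h | h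
  · subst h
    exact ⟨_, _, _, _, _, h0mem, hshift _ hsa, hshift _ hsb, hγ0, hγ, za, zb, hu⟩
  · have hi : i = 1 := by
      rcases fin_two_cases 1 i with h' | h'
      · exact h'
      · rw [h'] at h
        exact absurd h (by decide)
    subst hi
    refine ⟨_, _, _, _, _, h0mem, hshift _ hsb, hshift _ hsa, hγ0, hγ, zb, za, ?_⟩
    rw [uIcc_comm]
    exact hu

end

/-- A field is transient in the closed quadrants that its leaves cut across: those with `u v ≥ 0`
for negative slope, those with `u v ≤ 0` for positive slope. Transience thus depends on signs at the
origin only. -/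
theorem SignPattern.isTransient_iff (hr : 1 ≤ r) (hU : IsOpen U) (h0 : (0 : Plane) ∈ U)
    {Z : Omega U r} {εX εY sX sY : ℝ} (hZ : SignPattern Z i εX εY sX sY) :
    IsTransient Z ↔ sX = -1 ∧ sY = 1 := by
  obtain ⟨mX, MX, mY, MY, k1, k2, k3, k4, k5, k6, -, -⟩ :=
    exists_brackets (slope_pos hZ.X_fst hZ.X_snd) (slope_pos hZ.Y_fst hZ.Y_snd)
  obtain ⟨ρ, hρ, h⟩ := exists_localChart hr hU h0 Z i hZ.εX_sign hZ.εY_sign hZ.sX_sign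
    hZ.sY_sign hZ.X_fst hZ.Y_fst k1 k4 k2 k3 k5 k6
  obtain ⟨c⟩ := h ρ hρ le_rfl
  constructor
  · rintro ⟨hX, hY⟩
    refine ⟨hZ.sX_sign.resolve_left fun h => ?_, hZ.sY_sign.resolve_right fun h => ?_⟩
    · refine c.X.not_transientIn k1 hρ hZ.εX_sign ?_
      simpa only [h, one_mul] using hX
    · refine c.Y.not_transientIn k4 hρ hZ.εY_sign ?_
      simpa only [h, neg_mul, one_mul, neg_nonneg] using hY
  · rintro ⟨h, h'⟩
    have hX := c.X.transientIn k1 hρ hZ.εX_sign hZ.sX_sign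
    have hY := c.Y.transientIn k4 hρ hZ.εY_sign hZ.sY_sign
    simp only [h, neg_mul, one_mul, neg_nonpos] at hX
    simp only [h', one_mul] at hY
    exact ⟨hX, hY⟩

end

section


variable {U : Set Plane} {r : ℕ} {Z : Omega U r} {i : Fin 2} {εX εY sX sY : ℝ}

/-! ### Sufficiency of the conditions -/

theorem exists_sign {x : ℝ} (h : x ≠ 0) : ∃ ε : ℝ, (ε = 1 ∨ ε = -1) ∧ 0 < ε * x := by
  rcases h.lt_or_gt with h | h
  · exact ⟨-1, Or.inr rfl, by linarith⟩
  · exact ⟨1, Or.inl rfl, by linarith⟩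

theorem exists_signPattern (i : Fin 2) (h : ∀ k, Z.1 0 k * Z.2 0 k ≠ 0) :
    ∃ εX εY sX sY, SignPattern Z i εX εY sX sY := by
  obtain ⟨εX, h1, h1'⟩ := exists_sign (left_ne_zero_of_mul (h i))
  obtain ⟨εY, h2, h2'⟩ := exists_sign (right_ne_zero_of_mul (h i))
  obtain ⟨sX, h3, h3'⟩ := exists_sign (mul_ne_zero (left_ne_zero_of_mul h1'.ne')
    (left_ne_zero_of_mul (h (i + 1))))
  obtain ⟨sY, h4, h4'⟩ := exists_sign (mul_ne_zero (left_ne_zero_of_mul h2'.ne')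
    (right_ne_zero_of_mul (h (i + 1))))
  exact ⟨εX, εY, sX, sY, h1', h2', h3', h4', h1, h2, h3, h4⟩

theorem SignPattern.mul_fst (h : SignPattern Z i εX εY sX sY) :
    0 < εX * εY * (Z.1 0 i * Z.2 0 i) := by
  have := mul_pos h.X_fst h.Y_fst
  nlinarith

theorem SignPattern.mul_snd (h : SignPattern Z i εX εY sX sY) :
    0 < (εX * εY * (sX * sY)) * (Z.1 0 (i + 1) * Z.2 0 (i + 1)) := by
  have := mul_pos h.X_snd h.Y_snd
  nlinarith

theorem eq_of_sign_mul_pos {ε s x : ℝ} (hε : ε = 1 ∨ ε = -1) (hs : s = 1 ∨ s = -1)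
    (h : 0 < ε * s * x) : (0 < x → s = ε) ∧ (x < 0 → s = -ε) := by
  rcases hε with rfl | rfl <;> rcases hs with rfl | rfl <;> constructor <;> intro hx <;>
    first | rfl | (exfalso; linarith) | norm_num

theorem SignPattern.sign_fst (h : SignPattern Z i εX εY sX sY) :
    (0 < Z.1 0 i * Z.2 0 i → εY = εX) ∧ (Z.1 0 i * Z.2 0 i < 0 → εY = -εX) :=
  eq_of_sign_mul_pos h.εX_sign h.εY_sign h.mul_fst

theorem exists_signPattern_crossing (hi : 0 < Z.1 0 i * Z.2 0 i)
    (hj : Z.1 0 (i + 1) * Z.2 0 (i + 1) ≠ 0) : ∃ ε sX sY, SignPattern Z i ε ε sX sY ∧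
      (0 < Z.1 0 (i + 1) * Z.2 0 (i + 1) → sY = sX) ∧
      (Z.1 0 (i + 1) * Z.2 0 (i + 1) < 0 → sY = -sX) := by
  obtain ⟨εX, εY, sX, sY, h⟩ := exists_signPattern (Z := Z) i ((forall_fin_two' i).2 ⟨hi.ne', hj⟩)
  obtain rfl := h.sign_fst.1 hi
  refine ⟨εY, sX, sY, h, eq_of_sign_mul_pos h.sX_sign h.sY_sign ?_⟩
  have := h.mul_snd
  rwa [mul_self_sign h.εX_sign, one_mul] at this

theorem exists_signPattern_sliding (i : Fin 2) (h : ∀ k, Z.1 0 k * Z.2 0 k < 0) :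
    ∃ ε s, SignPattern Z i ε (-ε) s s := by
  obtain ⟨εX, εY, sX, sY, hp⟩ := exists_signPattern (Z := Z) i fun k => (h k).ne
  obtain rfl := hp.sign_fst.2 (h i)
  have h1 := hp.mul_snd
  rw [mul_neg, mul_self_sign hp.εX_sign] at h1
  have h2 : sY = sX := (eq_of_sign_mul_pos hp.sX_sign hp.sY_sign (x := -(Z.1 0 (i + 1) *
    Z.2 0 (i + 1))) (by linarith)).1 (by linarith [h (i + 1)])
  subst h2
  exact ⟨εX, sY, hp⟩

theorem SignPattern.eventually (h0 : (0 : Plane) ∈ U) (h : SignPattern Z i εX εY sX sY) :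
    ∀ᶠ Z' in 𝓝 Z, SignPattern Z' i εX εY sX sY := by
  have e1 := (continuous_const (y := εX)).mul (Omega.continuous_fst (r := r) h0 i)
  have e2 := (continuous_const (y := εY)).mul (Omega.continuous_snd (r := r) h0 i)
  have e3 := (continuous_const (y := sX)).mul
    ((continuous_const (y := εX)).mul (Omega.continuous_fst (r := r) h0 (i + 1)))
  have e4 := (continuous_const (y := sY)).mul
    ((continuous_const (y := εY)).mul (Omega.continuous_snd (r := r) h0 (i + 1)))
  filter_upwards [e1.continuousAt.eventually (lt_mem_nhds h.X_fst),
    e2.continuousAt.eventually (lt_mem_nhds h.Y_fst),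
    e3.continuousAt.eventually (lt_mem_nhds h.X_snd),
    e4.continuousAt.eventually (lt_mem_nhds h.Y_snd)] with Z' h1 h2 h3 h4
  exact ⟨h1, h2, h3, h4, h.εX_sign, h.εY_sign, h.sX_sign, h.sY_sign⟩

/-- The sign pattern and, in the transient case, the sign of the difference of the absolute slopes
are the same for all nearby fields, and they determine the equivalence class. -/
theorem SignPattern.stable_of_crossing (hr : 1 ≤ r) (hU : IsOpen U) (h0 : (0 : Plane) ∈ U) {ε : ℝ}
    (hZ : SignPattern Z i ε ε sX sY) (hα : sX = -1 → sY = 1 →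
      sX * (Z.1 0 (i + 1) / Z.1 0 i) - sY * (Z.2 0 (i + 1) / Z.2 0 i) ≠ 0) :
    StructurallyStable Z := by
  refine ⟨{Z' | LocallyEquivalent Z Z'}, ?_, fun Z' h => h⟩
  have hc : ContinuousAt (fun Z' : Omega U r =>
      sX * (Z'.1 0 (i + 1) / Z'.1 0 i) - sY * (Z'.2 0 (i + 1) / Z'.2 0 i)) Z :=
    (continuousAt_const.mul ((Omega.continuous_fst h0 (i + 1)).continuousAt.div
      (Omega.continuous_fst h0 i).continuousAt (right_ne_zero_of_mul hZ.X_fst.ne'))).sub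
    (continuousAt_const.mul ((Omega.continuous_snd h0 (i + 1)).continuousAt.div
      (Omega.continuous_snd h0 i).continuousAt (right_ne_zero_of_mul hZ.Y_fst.ne')))
  have hα' : ∀ᶠ Z' : Omega U r in 𝓝 Z, sX = -1 → sY = 1 → 0 <
      (sX * (Z.1 0 (i + 1) / Z.1 0 i) - sY * (Z.2 0 (i + 1) / Z.2 0 i)) *
      (sX * (Z'.1 0 (i + 1) / Z'.1 0 i) - sY * (Z'.2 0 (i + 1) / Z'.2 0 i)) := by
    by_cases hs : sX = -1 ∧ sY = 1
    · filter_upwards [(continuousAt_const.mul hc).eventually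
        (lt_mem_nhds (mul_self_pos.2 (hα hs.1 hs.2)))] with Z' h _ _
      exact h
    · exact Eventually.of_forall fun Z' h1 h2 => absurd ⟨h1, h2⟩ hs
  filter_upwards [hZ.eventually h0, hα'] with Z' h1 h2
  exact locallyEquivalent_of_crossing hr hU h0 hZ h1 h2

theorem fin_two_eq : ∀ k : Fin 2, k = 0 ∨ k = 1 := by decide

theorem one_add_one_fin_two : (1 : Fin 2) + 1 = 0 := rfl

/-- The numerator of the sliding speed is the determinant, up to a sign depending on the axis. -/
theorem slideSpeed_num_ne {Z : Omega U r} {k : Fin 2} {p : Plane}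
    (h : Z.1 p 0 * Z.2 p 1 - Z.1 p 1 * Z.2 p 0 ≠ 0) :
    Z.2 p (k + 1) * Z.1 p k - Z.1 p (k + 1) * Z.2 p k ≠ 0 := by
  rcases fin_two_eq k with rfl | rfl
  · rw [zero_add]
    intro h'
    exact h (by linear_combination h')
  · rw [one_add_one_fin_two]
    intro h'
    exact h (by linear_combination -h')

theorem SignPattern.stable_of_sliding (hr : 1 ≤ r) (hU : IsOpen U) (h0 : (0 : Plane) ∈ U) {ε s : ℝ}
    (hneg : ∀ k, Z.1 0 k * Z.2 0 k < 0)
    (hZ : SignPattern Z i ε (-ε) s s) (hdet : Z.1 0 0 * Z.2 0 1 - Z.1 0 1 * Z.2 0 0 ≠ 0) :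
    StructurallyStable Z := by
  refine ⟨{Z' | LocallyEquivalent Z Z'}, ?_, fun Z' h => h⟩
  have hden : ∀ k, Z.2 0 k - Z.1 0 k ≠ 0 := fun k h => by
    have := hneg k
    rw [sub_eq_zero.1 h] at this
    exact absurd this (not_lt.2 (mul_self_nonneg _))
  have hsl : ∀ k, slideSpeed Z k 0 ≠ 0 := fun k =>
    div_ne_zero (slideSpeed_num_ne hdet) (hden (k + 1))
  choose e he1 he using fun k => exists_sign (hsl k)
  have hc : ∀ᶠ Z' : Omega U r in 𝓝 Z, ∀ k, 0 < e k * slideSpeed Z' k 0 := by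
    rw [Filter.eventually_all]
    intro k
    have hX := fun k => (Omega.continuous_fst (r := r) h0 k).continuousAt (x := Z)
    have hY := fun k => (Omega.continuous_snd (r := r) h0 k).continuousAt (x := Z)
    have : ContinuousAt (fun Z' : Omega U r => slideSpeed Z' k 0) Z :=
      (((hY (k + 1)).mul (hX k)).sub ((hX (k + 1)).mul (hY k))).div
        ((hY (k + 1)).sub (hX (k + 1))) (hden (k + 1))
    exact (continuousAt_const.mul this).eventually (lt_mem_nhds (he k))
  filter_upwards [hZ.eventually h0, hc] with Z' h1 h2
  exact locallyEquivalent_of_sliding hr hU h0 hZ h1 he1 he h2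

/-- The quotient `α_Z` is different from `1` if and only if the slopes of `X` and `Y` at the origin
are different in absolute value. -/
theorem alpha_eq_one_iff (i : Fin 2) {x y : Plane} (hx : ∀ k, x k ≠ 0) (hy : ∀ k, y k ≠ 0) :
    ((x 0 * y 1) / (x 1 * y 0)) ^ 2 = 1 ↔
      x (i + 1) * y i = y (i + 1) * x i ∨ x (i + 1) * y i = -(y (i + 1) * x i) := by
  have h1 : x 1 * y 0 ≠ 0 := mul_ne_zero (hx 1) (hy 0)
  rw [sq_eq_one_iff, div_eq_iff h1, div_eq_iff h1]
  rcases fin_two_eq i with rfl | rfl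
  · rw [zero_add]
    constructor <;> rintro (h | h)
    · exact Or.inl (by linear_combination -h)
    · exact Or.inr (by linear_combination h)
    · exact Or.inl (by linear_combination -h)
    · exact Or.inr (by linear_combination h)
  · rw [one_add_one_fin_two]
    constructor <;> rintro (h | h)
    · exact Or.inl (by linear_combination h)
    · exact Or.inr (by linear_combination h)
    · exact Or.inl (by linear_combination h)
    · exact Or.inr (by linear_combination h)

theorem SignPattern.fst_ne (h : SignPattern Z i εX εY sX sY) (k : Fin 2) : Z.1 0 k ≠ 0 := by
  rcases fin_two_cases i k with rfl | rfl
  · exact right_ne_zero_of_mul h.X_fst.ne'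
  · exact right_ne_zero_of_mul (right_ne_zero_of_mul h.X_snd.ne')

theorem SignPattern.snd_ne (h : SignPattern Z i εX εY sX sY) (k : Fin 2) : Z.2 0 k ≠ 0 := by
  rcases fin_two_cases i k with rfl | rfl
  · exact right_ne_zero_of_mul h.Y_fst.ne'
  · exact right_ne_zero_of_mul (right_ne_zero_of_mul h.Y_snd.ne')

theorem SignPattern.slope_eq_iff (h : SignPattern Z i εX εY sX sY) (hX : sX = -1) (hY : sY = 1) :
    sX * (Z.1 0 (i + 1) / Z.1 0 i) - sY * (Z.2 0 (i + 1) / Z.2 0 i) = 0 ↔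
      Z.1 0 (i + 1) * Z.2 0 i = -(Z.2 0 (i + 1) * Z.1 0 i) := by
  have h1 := h.fst_ne i
  have h2 := h.snd_ne i
  rw [hX, hY]
  field_simp
  constructor <;> intro h <;> linarith

/-- The condition for stability in terms of the values at the origin. -/
theorem stable_of_conditions (hr : 1 ≤ r) (hU : IsOpen U) (h0 : (0 : Plane) ∈ U)
    (h : ConditionA Z ∨ ConditionB Z ∨ ConditionC Z) : StructurallyStable Z := by
  rcases h with h | h | ⟨⟨i, hi, hj⟩, hα⟩
  · obtain ⟨ε, sX, sY, hp, h1, -⟩ := exists_signPattern_crossing (Z := Z) (i := 0) (h 0) (h 1).ne'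
    refine hp.stable_of_crossing hr hU h0 fun h2 h3 => ?_
    have := h1 (h 1)
    rw [h2, h3] at this
    norm_num at this
  · obtain ⟨ε, s, hp⟩ := exists_signPattern_sliding (Z := Z) 0 h.1
    exact hp.stable_of_sliding hr hU h0 h.1 h.2
  · obtain ⟨ε, sX, sY, hp, -, h1⟩ := exists_signPattern_crossing hi hj.ne
    refine hp.stable_of_crossing hr hU h0 fun h2 h3 h4 => ?_
    refine hα ((hp.isTransient_iff hr hU h0).2 ⟨h2, h3⟩) ?_
    rw [alpha_eq_one_iff i hp.fst_ne hp.snd_ne]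
    exact Or.inr ((hp.slope_eq_iff h2 h3).1 h4)

/-! ### The conditions are open and dense -/

/-- The only delicate clause is transience in (C). For a transient field `α` stays different from
one by continuity; for any other field transience remains false nearby, since it is read off from
the sign pattern. -/
theorem isOpen_conditions (hr : 1 ≤ r) (hU : IsOpen U) (h0 : (0 : Plane) ∈ U) :
    IsOpen {Z : Omega U r | ConditionA Z ∨ ConditionB Z ∨ ConditionC Z} := by
  have hX := fun k => Omega.continuous_fst (r := r) h0 k
  have hY := fun k => Omega.continuous_snd (r := r) h0 k
  have hm : ∀ k, Continuous fun Z : Omega U r => Z.1 0 k * Z.2 0 k := fun k => (hX k).mul (hY k)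
  have hpos : ∀ (Z : Omega U r) k, 0 < Z.1 0 k * Z.2 0 k →
      ∀ᶠ Z' : Omega U r in 𝓝 Z, 0 < Z'.1 0 k * Z'.2 0 k := fun Z k h =>
    (hm k).continuousAt.eventually (lt_mem_nhds h)
  have hneg : ∀ (Z : Omega U r) k, Z.1 0 k * Z.2 0 k < 0 →
      ∀ᶠ Z' : Omega U r in 𝓝 Z, Z'.1 0 k * Z'.2 0 k < 0 := fun Z k h =>
    (hm k).continuousAt.eventually (gt_mem_nhds h)
  rw [isOpen_iff_mem_nhds]
  rintro Z (h | h | ⟨⟨i, hi, hj⟩, hα⟩)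
  · filter_upwards [Filter.eventually_all.2 fun k => hpos Z k (h k)] with Z' h' using Or.inl h'
  · have hd : ContinuousAt (fun Z : Omega U r => Z.1 0 0 * Z.2 0 1 - Z.1 0 1 * Z.2 0 0) Z :=
      (((hX 0).mul (hY 1)).sub ((hX 1).mul (hY 0))).continuousAt
    filter_upwards [Filter.eventually_all.2 fun k => hneg Z k (h.1 k), hd.eventually_ne h.2]
      with Z' h1 h2 using Or.inr (Or.inl ⟨h1, h2⟩)
  · obtain ⟨ε, sX, sY, hp, -, -⟩ := exists_signPattern_crossing hi hj.ne
    by_cases ht : IsTransient Z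
    · have hd : ContinuousAt (fun Z : Omega U r =>
          ((Z.1 0 0 * Z.2 0 1) / (Z.1 0 1 * Z.2 0 0)) ^ 2) Z :=
        (((hX 0).mul (hY 1)).continuousAt.div ((hX 1).mul (hY 0)).continuousAt
          (mul_ne_zero (hp.fst_ne 1) (hp.snd_ne 0))).pow 2
      filter_upwards [hpos Z i hi, hneg Z (i + 1) hj, hd.eventually_ne (hα ht)]
        with Z' h1 h2 h3 using Or.inr (Or.inr ⟨⟨i, h1, h2⟩, fun _ => h3⟩)
    · filter_upwards [hpos Z i hi, hneg Z (i + 1) hj, hp.eventually h0] with Z' h1 h2 h3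
      refine Or.inr (Or.inr ⟨⟨i, h1, h2⟩, fun h4 => absurd ?_ ht⟩)
      exact (hp.isTransient_iff hr hU h0).2 ((h3.isTransient_iff hr hU h0).1 h4)

theorem conditions_of_ne (hX : ∀ k, Z.1 0 k ≠ 0) (hY : ∀ k, Z.2 0 k ≠ 0)
    (h1 : Z.1 0 0 * Z.2 0 1 - Z.1 0 1 * Z.2 0 0 ≠ 0)
    (h2 : Z.1 0 0 * Z.2 0 1 + Z.1 0 1 * Z.2 0 0 ≠ 0) :
    ConditionA Z ∨ ConditionB Z ∨ ConditionC Z := by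
  have hα : ((Z.1 0 0 * Z.2 0 1) / (Z.1 0 1 * Z.2 0 0)) ^ 2 ≠ 1 := by
    intro h
    rcases (alpha_eq_one_iff 0 hX hY).1 h with h | h
    · rw [zero_add] at h
      exact h1 (by linear_combination -h)
    · rw [zero_add] at h
      exact h2 (by linear_combination h)
  rcases (mul_ne_zero (hX 0) (hY 0)).lt_or_gt with h | h <;>
    rcases (mul_ne_zero (hX 1) (hY 1)).lt_or_gt with h' | h'
  · exact Or.inr (Or.inl ⟨Fin.forall_fin_two.2 ⟨h, h'⟩, h1⟩)
  · exact Or.inr (Or.inr ⟨⟨1, h', h⟩, fun _ => hα⟩)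
  · exact Or.inr (Or.inr ⟨⟨0, h, h'⟩, fun _ => hα⟩)
  · exact Or.inl (Fin.forall_fin_two.2 ⟨h, h'⟩)

theorem eventually_quadratic_ne {a b c : ℝ} (h : a ≠ 0 ∨ b ≠ 0 ∨ c ≠ 0) :
    ∀ᶠ t in 𝓝[≠] (0 : ℝ), a * t ^ 2 + b * t + c ≠ 0 := by
  by_cases hc : c = 0
  · have : ∀ᶠ t in 𝓝[≠] (0 : ℝ), a * t + b ≠ 0 := by
      by_cases hb : b = 0
      · filter_upwards [self_mem_nhdsWithin] with t ht
        have ha : a ≠ 0 := h.resolve_right (by simp [hb, hc])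
        simpa [hb] using ⟨ha, ht⟩
      · have h1 : Continuous fun t : ℝ => a * t + b := by fun_prop
        exact nhdsWithin_le_nhds (h1.continuousAt.eventually_ne (by simpa using hb))
    filter_upwards [this, self_mem_nhdsWithin] with t h1 h2
    have e : a * t ^ 2 + b * t + c = t * (a * t + b) := by rw [hc]; ring
    rw [e]
    exact mul_ne_zero h2 h1
  · have h1 : Continuous fun t : ℝ => a * t ^ 2 + b * t + c := by fun_prop
    exact nhdsWithin_le_nhds (h1.continuousAt.eventually_ne (by simpa using hc))

/-- The pair `(X + t x, Y + t y)` for constant fields `x` and `y`. -/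
def Omega.translate (hU : IsOpen U) (hUb : Bornology.IsBounded U) (Z : Omega U r) (x y : Plane)
    (t : ℝ) : Omega U r :=
  (Z.1.perturb hU hUb (contDiff_const (c := x)) t, Z.2.perturb hU hUb (contDiff_const (c := y)) t)

theorem Omega.tendsto_translate (hU : IsOpen U) (hUb : Bornology.IsBounded U) (Z : Omega U r)
    (x y : Plane) : Tendsto (Z.translate hU hUb x y) (𝓝 0) (𝓝 Z) :=
  (Z.1.tendsto_perturb hU hUb contDiff_const).prodMk_nhds
    (Z.2.tendsto_perturb hU hUb contDiff_const)

theorem Omega.translate_fst (hU : IsOpen U) (hUb : Bornology.IsBounded U) (h0 : (0 : Plane) ∈ U)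
    (Z : Omega U r) (x y : Plane) (t : ℝ) (k : Fin 2) :
    (Z.translate hU hUb x y t).1 0 k = Z.1 0 k + t * x k :=
  Z.1.perturb_apply hU hUb contDiff_const t h0 k

theorem Omega.translate_snd (hU : IsOpen U) (hUb : Bornology.IsBounded U) (h0 : (0 : Plane) ∈ U)
    (Z : Omega U r) (x y : Plane) (t : ℝ) (k : Fin 2) :
    (Z.translate hU hUb x y t).2 0 k = Z.2 0 k + t * y k :=
  Z.2.perturb_apply hU hUb contDiff_const t h0 k

/-- The conditions hold if no component and neither of `X_1 Y_2 ± X_2 Y_1` vanishes at the origin.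
Along a suitable line of constant perturbations these are nonzero polynomials in `t`. -/
theorem dense_conditions (hU : IsOpen U) (hUb : Bornology.IsBounded U) (h0 : (0 : Plane) ∈ U) :
    Dense {Z : Omega U r | ConditionA Z ∨ ConditionB Z ∨ ConditionC Z} := by
  intro Z
  -- The directions `(1, 2)` and `(1, 1)` give leading coefficients `-1` and `3` in the two
  -- quadratic expressions, whatever `Z` is.
  refine mem_closure_of_tendsto ((Z.tendsto_translate hU hUb (pt 0 1 2) (pt 0 1 1)).mono_left
    nhdsWithin_le_nhds : Tendsto _ (𝓝[≠] (0 : ℝ)) _) ?_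
  have hv : ∀ a b : ℝ, pt 0 a b 0 = a ∧ pt 0 a b 1 = b := fun a b => ⟨pt_fst .., pt_snd ..⟩
  have hl : ∀ x a : ℝ, a ≠ 0 → ∀ᶠ t in 𝓝[≠] (0 : ℝ), x + t * a ≠ 0 := fun x a ha => by
    filter_upwards [eventually_quadratic_ne (a := 0) (b := a) (c := x) (Or.inr (Or.inl ha))]
      with t ht
    intro h
    exact ht (by linear_combination h)
  have e5 := eventually_quadratic_ne (a := -1) (b := Z.1 0 0 + Z.2 0 1 - Z.1 0 1 - 2 * Z.2 0 0)
    (c := Z.1 0 0 * Z.2 0 1 - Z.1 0 1 * Z.2 0 0) (Or.inl (by norm_num))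
  have e6 := eventually_quadratic_ne (a := 3) (b := Z.1 0 0 + Z.2 0 1 + Z.1 0 1 + 2 * Z.2 0 0)
    (c := Z.1 0 0 * Z.2 0 1 + Z.1 0 1 * Z.2 0 0) (Or.inl (by norm_num))
  filter_upwards [hl (Z.1 0 0) 1 one_ne_zero, hl (Z.1 0 1) 2 two_ne_zero,
    hl (Z.2 0 0) 1 one_ne_zero, hl (Z.2 0 1) 1 one_ne_zero, e5, e6] with t h1 h2 h3 h4 h5 h6
  refine conditions_of_ne (Fin.forall_fin_two.2 ⟨?_, ?_⟩) (Fin.forall_fin_two.2 ⟨?_, ?_⟩) ?_ ?_ <;>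
    simp only [Omega.translate_fst hU hUb h0, Omega.translate_snd hU hUb h0, (hv _ _).1, (hv _ _).2]
  · exact h1
  · exact h2
  · exact h3
  · exact h4
  · exact fun h => h5 (by linear_combination h)
  · exact fun h => h6 (by linear_combination h)

end

section


variable {U : Set Plane} {r : ℕ} {Z Z' Z'' : Omega U r} {i : Fin 2}

/-! ### Invariants of the equivalence -/

/-- Local equivalence regardless of the orientation. -/
def WeaklyEquivalent (Z Z' : Omega U r) : Prop :=
  ∃ h : OpenPartialHomeomorph Plane Plane, 0 ∈ h.source ∧ 0 ∈ h.target ∧ h 0 = 0 ∧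
    (∀ p ∈ h.source, h p ∈ switching ↔ p ∈ switching) ∧
    MapsTrajectories h h.source Z Z' ∧ MapsTrajectories h.symm h.target Z' Z

theorem LocallyEquivalent.weak (h : LocallyEquivalent Z Z') : WeaklyEquivalent Z Z' := by
  obtain ⟨h, -, -, h1, h2, h3, -, h4, h5, h6⟩ := h
  exact ⟨h, h1, h2, h3, h4, h5, h6⟩

theorem WeaklyEquivalent.symm (h : WeaklyEquivalent Z Z') : WeaklyEquivalent Z' Z := by
  obtain ⟨h, h1, h2, h3, h4, h5, h6⟩ := h
  refine ⟨h.symm, h2, h1, ?_, fun p hp => ?_, h6, by rwa [h.symm_symm]⟩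
  · have := h.left_inv h1
    rwa [h3] at this
  · have := h4 _ (h.map_target hp)
    rw [h.right_inv hp] at this
    exact this.symm

theorem endpoints_of_image {a b c d : ℝ} {σ : ℝ → ℝ} (hab : a < b) (hcd : c < d)
    (hσ : StrictMonoOn σ (Icc c d)) (himg : σ '' Icc c d = Icc a b) :
    MapsTo σ (Icc c d) (Icc a b) ∧ σ c = a ∧ σ d = b := by
  have hmaps : MapsTo σ (Icc c d) (Icc a b) := fun t ht => himg ▸ mem_image_of_mem σ ht
  have hc : c ∈ Icc c d := left_mem_Icc.2 hcd.le
  have hd : d ∈ Icc c d := right_mem_Icc.2 hcd.le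
  refine ⟨hmaps, le_antisymm ?_ (hmaps hc).1, le_antisymm (hmaps hd).2 ?_⟩
  · obtain ⟨x, hx, hxa⟩ : a ∈ σ '' Icc c d := himg ▸ left_mem_Icc.2 hab.le
    rw [← hxa]
    exact hσ.monotoneOn hc hx hx.1
  · obtain ⟨x, hx, hxb⟩ : b ∈ σ '' Icc c d := himg ▸ right_mem_Icc.2 hab.le
    rw [← hxb]
    exact hσ.monotoneOn hx hd hx.2

theorem MapsTrajectories.arc {h : Plane → Plane} {W : Set Plane} (hm : MapsTrajectories h W Z Z')
    {a b : ℝ} {γ : ℝ → Plane} (hab : a < b) (hγ : IsTrajectory Z (Icc a b) γ)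
    (hW : MapsTo γ (Icc a b) W) : ∃ (c d : ℝ) (σ : ℝ → ℝ), c < d ∧ StrictMonoOn σ (Icc c d) ∧
      MapsTo σ (Icc c d) (Icc a b) ∧ σ c = a ∧ σ d = b ∧
      IsTrajectory Z' (Icc c d) (fun s => h (γ (σ s))) := by
  obtain ⟨c, d, σ, hcd, hσ, himg, ht⟩ := hm a b γ hab hγ hW
  obtain ⟨h1, h2, h3⟩ := endpoints_of_image hab hcd hσ himg
  exact ⟨c, d, σ, hcd, hσ, h1, h2, h3, ht⟩

theorem OpenPartialHomeomorph.preimage_mem_nhds_zero (h : OpenPartialHomeomorph Plane Plane)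
    (h0 : 0 ∈ h.source) (hz : h 0 = 0) {N : Set Plane} (hN : N ∈ 𝓝 0) :
    h.source ∩ h ⁻¹' N ∈ 𝓝 (0 : Plane) :=
  inter_mem (h.open_source.mem_nhds h0) ((h.continuousAt h0).preimage_mem_nhds (by rwa [hz]))

/-- Arbitrarily close to the origin there are arcs of trajectories inside the switching set. -/
def HasSwitchingArcs (Z : Omega U r) : Prop :=
  ∀ N ∈ 𝓝 (0 : Plane), ∃ (a b : ℝ) (γ : ℝ → Plane), a < b ∧ IsTrajectory Z (Icc a b) γ ∧
    ∀ t ∈ Icc a b, γ t ∈ N ∧ γ t ∈ switching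

/-- Arbitrarily close to the origin there are arcs of trajectories which reach the switching set. -/
def HasLandingArcs (Z : Omega U r) : Prop :=
  ∀ N ∈ 𝓝 (0 : Plane), ∃ (a b : ℝ) (γ : ℝ → Plane), a < b ∧ IsTrajectory Z (Icc a b) γ ∧
    MapsTo γ (Icc a b) N ∧ γ a ∉ switching ∧ γ b ∈ switching

theorem HasSwitchingArcs.of_equivalent (hZ : HasSwitchingArcs Z) (h : WeaklyEquivalent Z Z') :
    HasSwitchingArcs Z' := by
  obtain ⟨h, h1, -, h3, h4, h5, -⟩ := h
  intro N hN
  obtain ⟨a, b, γ, hab, hγ, hm⟩ := hZ _ (OpenPartialHomeomorph.preimage_mem_nhds_zero h h1 h3 hN)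
  obtain ⟨c, d, σ, hcd, -, hσ, -, -, ht⟩ := h5.arc hab hγ fun t ht => (hm t ht).1.1
  exact ⟨c, d, _, hcd, ht, fun t ht => ⟨(hm _ (hσ ht)).1.2,
    (h4 _ (hm _ (hσ ht)).1.1).2 (hm _ (hσ ht)).2⟩⟩

theorem HasLandingArcs.of_equivalent (hZ : HasLandingArcs Z) (h : WeaklyEquivalent Z Z') :
    HasLandingArcs Z' := by
  obtain ⟨h, h1, -, h3, h4, h5, -⟩ := h
  intro N hN
  obtain ⟨a, b, γ, hab, hγ, hm, ha, hb⟩ :=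
    hZ _ (OpenPartialHomeomorph.preimage_mem_nhds_zero h h1 h3 hN)
  obtain ⟨c, d, σ, hcd, -, hσ, hc, hd, ht⟩ := h5.arc hab hγ fun t ht => (hm ht).1
  refine ⟨c, d, _, hcd, ht, fun t ht => (hm (hσ ht)).2, ?_, ?_⟩
  · simp only [hc]
    rwa [h4 _ (hm (left_mem_Icc.2 hab.le)).1]
  · simp only [hd]
    rwa [h4 _ (hm (right_mem_Icc.2 hab.le)).1]

section Charts

variable {εX εY sX sY : ℝ}

theorem SignPattern.exists_localChart (hr : 1 ≤ r) (hU : IsOpen U) (h0 : (0 : Plane) ∈ U)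
    (hZ : SignPattern Z i εX εY sX sY) : ∃ mX MX mY MY ρ₀ : ℝ, 0 < ρ₀ ∧
      ∀ ρ, 0 < ρ → ρ ≤ ρ₀ → Nonempty (LocalChart Z i εX εY sX sY mX MX mY MY ρ) := by
  obtain ⟨mX, MX, mY, MY, k1, k2, k3, k4, k5, k6, -, -⟩ :=
    exists_brackets (slope_pos hZ.X_fst hZ.X_snd) (slope_pos hZ.Y_fst hZ.Y_snd)
  obtain ⟨ρ, hρ, h⟩ := PWS.exists_localChart hr hU h0 Z i hZ.εX_sign hZ.εY_sign hZ.sX_sign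
    hZ.sY_sign hZ.X_fst hZ.Y_fst k1 k4 k2 k3 k5 k6
  exact ⟨mX, MX, mY, MY, ρ, hρ, h⟩

theorem SignPattern.exists_localChart_in (hr : 1 ≤ r) (hU : IsOpen U) (h0 : (0 : Plane) ∈ U)
    (hZ : SignPattern Z i εX εY sX sY) {N : Set Plane} (hN : N ∈ 𝓝 0) : ∃ mX MX mY MY ρ : ℝ,
      box ρ ⊆ N ∧ Nonempty (LocalChart Z i εX εY sX sY mX MX mY MY ρ) := by
  obtain ⟨mX, MX, mY, MY, ρ₀, hρ₀, h⟩ := hZ.exists_localChart hr hU h0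
  obtain ⟨ρ₁, hρ₁, h1⟩ := exists_box_subset hN
  exact ⟨mX, MX, mY, MY, min ρ₀ ρ₁, h1 _ (min_le_right _ _),
    h _ (lt_min hρ₀ hρ₁) (min_le_left _ _)⟩

/-- Along an arc near the origin the coordinate `i` is strictly monotone, so an arc inside `Σ` would
have a piece in `Σ_{i+1}`; but this axis is left at once where it is crossing. -/
theorem SignPattern.not_hasSwitchingArcs (hr : 1 ≤ r) (hU : IsOpen U) (h0 : (0 : Plane) ∈ U)
    {ε s : ℝ} (hZ : SignPattern Z i ε ε s s) : ¬ HasSwitchingArcs Z := by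
  intro hs
  obtain ⟨mX, MX, mY, MY, ρ, -, ⟨c⟩⟩ := hZ.exists_localChart_in hr hU h0 univ_mem
  obtain ⟨a, b, γ, hab, hγ, hm⟩ := hs _ (box_mem_nhds c.ρ_pos)
  have ho := c.graphOrbit_of_trajectory hab hγ fun t ht => (hm t ht).1
  have ha : a ∈ Icc a b := left_mem_Icc.2 hab.le
  have hb : b ∈ Icc a b := right_mem_Icc.2 hab.le
  obtain ⟨t, ht, htu⟩ : ∃ t ∈ Icc a b, γ t i ≠ 0 := by
    by_contra! h
    exact hab.ne (ho.mono.injOn ha hb (by simp only [h a ha, h b hb]))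
  have h1 : ∀ᶠ s in 𝓝[Icc a b] t, γ s (i + 1) = 0 := by
    filter_upwards [eventually_nhdsWithin_of_continuousOn ho.cont ht (eventually_coord_ne htu),
      self_mem_nhdsWithin] with s h1 h2
    exact ((mem_switching i).1 (hm s h2).2).resolve_left h1
  have := nhdsWithin_diff_neBot hab ht
  obtain ⟨s, h2, h3⟩ := ((ho.cross rfl t ht (h1.self_of_nhdsWithin ht)).and
    (nhdsWithin_mono t sdiff_subset h1)).exists
  exact h2 h3

/-- The sliding axis itself is a trajectory, even across the origin. -/
theorem SignPattern.hasSwitchingArcs (hr : 1 ≤ r) (hU : IsOpen U) (h0 : (0 : Plane) ∈ U)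
    {ε s : ℝ} (hZ : SignPattern Z i ε ε s (-s)) : HasSwitchingArcs Z := by
  intro N hN
  obtain ⟨mX, MX, mY, MY, ρ, hsub, ⟨c⟩⟩ := hZ.exists_localChart_in hr hU h0 hN
  set δ : ℝ → Plane := fun t => pt i (ε * t) 0 with hδ
  have hδi : ∀ t, δ t i = ε * t := fun t => pt_fst ..
  have hδi' : ∀ t, δ t (i + 1) = 0 := fun t => pt_snd ..
  have hne : s ≠ -s := fun h => by
    rcases hZ.sX_sign with h' | h' <;> rw [h'] at h <;> norm_num at h
  have hcont : Continuous δ := (continuous_pt i).comp (f := fun t => (ε * t, (0 : ℝ)))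
    ((continuous_const.mul continuous_id).prodMk continuous_const)
  have ho : GraphOrbit c 0 ρ δ := by
    refine ⟨hcont.continuousOn, ?_, fun t _ h => ?_, fun t _ h => ?_, fun _ t _ _ => ?_,
      fun h => absurd h hne, fun h => absurd h hne, fun h => absurd h hne⟩
    · simp only [hδi, ← mul_assoc, mul_self_sign hZ.εX_sign, one_mul]
      exact strictMonoOn_id
    · simp [hδi'] at h
    · simp [hδi'] at h
    · exact Eventually.of_forall hδi'
  have hbox : MapsTo δ (Icc 0 ρ) (box ρ) := fun t ht => by
    refine pt_mem_box.2 ⟨?_, by simpa using c.ρ_pos.le⟩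
    rw [abs_mul, abs_eq_one_of_sign hZ.εX_sign, one_mul, abs_of_nonneg ht.1]
    exact ht.2
  obtain ⟨c₀, d₀, σ, hcd, -, himg, ht⟩ := ho.exists_trajectory c.ρ_pos hbox
  refine ⟨c₀, d₀, _, hcd, ht, fun t ht => ⟨hsub (hbox (himg ▸ mem_image_of_mem σ ht)), ?_⟩⟩
  exact (mem_switching i).2 (Or.inr (hδi' _))

/-- A trajectory inside a quadrant of `X` can end on the crossing axis `Σ_i`, where trajectories
contain their end points. -/
theorem SignPattern.hasLandingArcs (hr : 1 ≤ r) (hU : IsOpen U) (h0 : (0 : Plane) ∈ U)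
    {ε s : ℝ} (hZ : SignPattern Z i ε ε s (-s)) : HasLandingArcs Z := by
  intro N hN
  obtain ⟨mX, MX, mY, MY, ρ, hsub, ⟨c⟩⟩ := hZ.exists_localChart_in hr hU h0 hN
  have hne : s ≠ -s := fun h => by
    rcases hZ.sX_sign with h' | h' <;> rw [h'] at h <;> norm_num at h
  have hρ := c.ρ_pos
  -- The sign `-ε` puts the part of the leaf before the time `0`, where `ε * t` has the sign `-ε`,
  -- into the quadrants with `u v > 0`.
  set κ := -ε * (ρ / 2) with hκ
  have hκabs : |κ| = ρ / 2 := by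
    rw [hκ, abs_mul, abs_neg, abs_eq_one_of_sign hZ.εX_sign, one_mul, abs_of_pos (by linarith)]
  have hεκ : ε * κ = -(ρ / 2) := by
    rw [hκ, ← mul_assoc, mul_neg, mul_self_sign hZ.εX_sign]
    ring
  set δ : ℝ → Plane := fun t => pt i (ε * t) (c.X.fol.W (ε * t) κ) with hδ
  have hδi : ∀ t, δ t i = ε * t := fun t => pt_fst ..
  have hδi' : ∀ t, δ t (i + 1) = c.X.fol.W (ε * t) κ := fun t => pt_snd ..
  have hWc : Continuous fun t => c.X.fol.W (ε * t) κ :=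
    c.X.fol.continuous_W.comp (f := fun t => (ε * t, κ))
      ((continuous_const.mul continuous_id).prodMk continuous_const)
  have hcont : Continuous δ := (continuous_pt i).comp (f := fun t => (ε * t, c.X.fol.W (ε * t) κ))
    ((continuous_const.mul continuous_id).prodMk hWc)
  have hev : ∀ᶠ t in 𝓝 (0 : ℝ), |c.X.fol.W (ε * t) κ| < ρ ∧ ε * c.X.fol.W (ε * t) κ < 0 := by
    refine (hWc.abs.continuousAt.eventually (gt_mem_nhds ?_)).and
      (((continuous_const (y := ε)).mul hWc).continuousAt.eventually (gt_mem_nhds ?_))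
    · change |c.X.fol.W (ε * 0) κ| < ρ
      rw [mul_zero, c.X.fol.W_zero, hκabs]
      linarith
    · change ε * c.X.fol.W (ε * 0) κ < 0
      rw [mul_zero, c.X.fol.W_zero, hεκ]
      linarith
  obtain ⟨τ, hτ, hball⟩ := Metric.eventually_nhds_iff.1 hev
  set a := -min (τ / 2) ρ with ha
  have ha0 : a < 0 := neg_neg_of_pos (lt_min (by linarith) hρ)
  have hτa : -τ < a := by
    have := min_le_left (τ / 2) ρ
    linarith
  have hρa : -ρ ≤ a := neg_le_neg (min_le_right _ _)
  have hI : ∀ t ∈ Icc a 0, |c.X.fol.W (ε * t) κ| < ρ ∧ ε * c.X.fol.W (ε * t) κ < 0 := fun t ht =>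
    hball (by rw [Real.dist_eq, sub_zero, abs_of_nonpos ht.2]; linarith [ht.1])
  have hv : ∀ t ∈ Icc a 0, δ t (i + 1) ≠ 0 := fun t ht h => by
    have := (hI t ht).2
    rw [← hδi', h, mul_zero] at this
    exact lt_irrefl _ this
  have hmul : ∀ t ∈ Icc a 0, 0 ≤ δ t i * δ t (i + 1) := fun t ht => by
    rw [hδi, hδi']
    have := mul_nonneg_of_nonpos_of_nonpos ht.2 (hI t ht).2.le
    linarith
  have ho : GraphOrbit c a 0 δ := by
    refine ⟨hcont.continuousOn, ?_, fun t _ _ => Eventually.of_forall fun s => ?_,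
      fun t ht h => absurd h (hmul t ht).not_gt, fun _ t ht h => absurd h (hv t ht),
      fun h => absurd h hne, fun h => absurd h hne, fun h => absurd h hne⟩
    · simp only [hδi, ← mul_assoc, mul_self_sign hZ.εX_sign, one_mul]
      exact strictMonoOn_id
    · simp only [FieldChart.lab, hδi, hδi', c.X.fol.H_W]
  have hbox : MapsTo δ (Icc a 0) (box ρ) := fun t ht => by
    refine pt_mem_box.2 ⟨?_, (hI t ht).1.le⟩
    rw [abs_mul, abs_eq_one_of_sign hZ.εX_sign, one_mul, abs_of_nonpos ht.2]
    linarith [ht.1]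
  obtain ⟨c₀, d₀, σ, hcd, hσ, himg, ht⟩ := ho.exists_trajectory ha0 hbox
  obtain ⟨hm, hσc, hσd⟩ := endpoints_of_image ha0 hcd hσ himg
  refine ⟨c₀, d₀, _, hcd, ht, fun t ht => hsub (hbox (hm ht)), ?_, ?_⟩
  · simp only [hσc, mem_switching i, not_or]
    refine ⟨?_, hv a (left_mem_Icc.2 ha0.le)⟩
    rw [hδi]
    exact mul_ne_zero (by rcases hZ.εX_sign with h | h <;> rw [h] <;> norm_num) ha0.ne
  · simp only [hσd, mem_switching i]
    left
    rw [hδi, mul_zero]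

theorem SignPattern.not_hasLandingArcs (hr : 1 ≤ r) (hU : IsOpen U) (h0 : (0 : Plane) ∈ U)
    {ε s : ℝ} (hZ : SignPattern Z i ε (-ε) s s) : ¬ HasLandingArcs Z := by
  intro hl
  obtain ⟨mX, MX, mY, MY, ρ, -, ⟨c⟩⟩ := hZ.exists_localChart_in hr hU h0 univ_mem
  obtain ⟨a, b, γ, hab, hγ, hm, ha, hb⟩ := hl _ (box_mem_nhds c.ρ_pos)
  have := c.sign_eq_of_trajectory hγ hm a (left_mem_Icc.2 hab.le) b (right_mem_Icc.2 hab.le)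
  rw [mem_switching i] at ha hb
  rw [eq_zero_iff_of_sign_eq (this i), eq_zero_iff_of_sign_eq (this (i + 1))] at ha
  exact ha hb

end Charts

/-! ### Tangencies at the origin are not stable -/

/-- If one factor vanishes it is moved in the direction dictated by the sign of the other; if both
vanish, the increments `1` and `σ` produce `σ * t ^ 2`. -/
theorem eventually_sign_affine {x y σ : ℝ} (hσ : σ = 1 ∨ σ = -1) (h : x * y = 0 ∨ 0 < σ * (x * y)) :
    ∃ a b : ℝ, ∀ᶠ t in 𝓝[>] (0 : ℝ), 0 < σ * ((x + t * a) * (y + t * b)) := by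
  have hs := mul_self_sign hσ
  by_cases hx : x = 0
  · by_cases hy : y = 0
    · refine ⟨1, σ, ?_⟩
      filter_upwards [self_mem_nhdsWithin] with t ht
      have e : σ * ((x + t * 1) * (y + t * σ)) = t * t * (σ * σ) := by rw [hx, hy]; ring
      rw [e, hs]
      have : (0 : ℝ) < t := ht
      positivity
    · obtain ⟨τ, -, hτ⟩ := exists_sign hy
      refine ⟨σ * τ, 0, ?_⟩
      filter_upwards [self_mem_nhdsWithin] with t ht
      have e : σ * ((x + t * (σ * τ)) * (y + t * 0)) = t * (σ * σ) * (τ * y) := by rw [hx]; ring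
      rw [e, hs, mul_one]
      exact mul_pos ht hτ
  · by_cases hy : y = 0
    · obtain ⟨τ, -, hτ⟩ := exists_sign hx
      refine ⟨0, σ * τ, ?_⟩
      filter_upwards [self_mem_nhdsWithin] with t ht
      have e : σ * ((x + t * 0) * (y + t * (σ * τ))) = t * (σ * σ) * (τ * x) := by rw [hy]; ring
      rw [e, hs, mul_one]
      exact mul_pos ht hτ
    · refine ⟨0, 0, Eventually.of_forall fun t => ?_⟩
      rw [mul_zero, add_zero, add_zero]
      exact h.resolve_left (mul_ne_zero hx hy)

theorem frequently_sign (hU : IsOpen U) (hUb : Bornology.IsBounded U) (h0 : (0 : Plane) ∈ U)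
    {σ : Fin 2 → ℝ} (hσ : ∀ k, σ k = 1 ∨ σ k = -1)
    (h : ∀ k, Z.1 0 k * Z.2 0 k = 0 ∨ 0 < σ k * (Z.1 0 k * Z.2 0 k)) {V : Set (Omega U r)}
    (hV : V ∈ 𝓝 Z) : ∃ Z' ∈ V, ∀ k, 0 < σ k * (Z'.1 0 k * Z'.2 0 k) := by
  choose a b hab using fun k => eventually_sign_affine (hσ k) (h k)
  have h1 : ∀ᶠ t in 𝓝[>] (0 : ℝ),
      Z.translate hU hUb (pt 0 (a 0) (a 1)) (pt 0 (b 0) (b 1)) t ∈ V :=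
    nhdsWithin_le_nhds (Z.tendsto_translate hU hUb _ _ hV)
  obtain ⟨t, ht, ht'⟩ := (h1.and (Filter.eventually_all.2 hab)).exists
  refine ⟨_, ht, fun k => ?_⟩
  have e : ∀ c : Fin 2 → ℝ, pt 0 (c 0) (c 1) k = c k := fun c => by
    rcases fin_two_eq k with rfl | rfl
    exacts [pt_fst .., pt_snd ..]
  rw [Omega.translate_fst hU hUb h0, Omega.translate_snd hU hUb h0, e a, e b]
  exact ht' k

/-- If `X_i Y_i` vanishes, both signs of it occur nearby while the sign `τ` on the other axis is
kept. If the other axis is crossing, the two perturbations differ in having arcs inside the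
switching set; if it slides, they differ in having arcs that land on it. -/
theorem StructurallyStable.mul_ne_zero (hr : 1 ≤ r) (hU : IsOpen U) (hUb : Bornology.IsBounded U)
    (h0 : (0 : Plane) ∈ U) (hZ : StructurallyStable Z) (i : Fin 2) : Z.1 0 i * Z.2 0 i ≠ 0 := by
  intro hi
  obtain ⟨V, hV, hVZ⟩ := hZ
  obtain ⟨τ, hτ, hτ'⟩ : ∃ τ : ℝ, (τ = 1 ∨ τ = -1) ∧
      (Z.1 0 (i + 1) * Z.2 0 (i + 1) = 0 ∨ 0 < τ * (Z.1 0 (i + 1) * Z.2 0 (i + 1))) := by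
    by_cases h : Z.1 0 (i + 1) * Z.2 0 (i + 1) = 0
    · exact ⟨1, Or.inl rfl, Or.inl h⟩
    · obtain ⟨τ, h1, h2⟩ := exists_sign h
      exact ⟨τ, h1, Or.inr h2⟩
  have hne : i + 1 ≠ i := fin_two_ne i
  have key : ∀ s : ℝ, (s = 1 ∨ s = -1) → ∃ Z' ∈ V, 0 < s * (Z'.1 0 i * Z'.2 0 i) ∧
      0 < τ * (Z'.1 0 (i + 1) * Z'.2 0 (i + 1)) := by
    intro s hs
    obtain ⟨Z', h1, h2⟩ := frequently_sign (Z := Z) hU hUb h0 (σ := fun k => if k = i then s else τ)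
      (fun k => by split_ifs <;> assumption)
      ((forall_fin_two' i).2 ⟨Or.inl hi, by simpa only [if_neg hne] using hτ'⟩) hV
    refine ⟨Z', h1, ?_, ?_⟩
    · simpa using h2 i
    · simpa only [if_neg hne] using h2 (i + 1)
  obtain ⟨Z₁, hZ₁, p1, p1'⟩ := key 1 (Or.inl rfl)
  obtain ⟨Z₂, hZ₂, p2, p2'⟩ := key (-1) (Or.inr rfl)
  have h12 := (hVZ _ hZ₁).weak
  have h22 := (hVZ _ hZ₂).weak
  rw [one_mul] at p1
  rw [neg_one_mul, neg_pos] at p2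
  rcases hτ with rfl | rfl
  · rw [one_mul] at p1' p2'
    obtain ⟨ε, sX, sY, q1, q2, -⟩ := exists_signPattern_crossing p1 p1'.ne'
    obtain rfl := q2 p1'
    obtain ⟨ε', sX', sY', q1', -, q2'⟩ := exists_signPattern_crossing (i := i + 1) p2'
      (by rw [fin_two_add]; exact p2.ne)
    rw [fin_two_add] at q2'
    obtain rfl := q2' p2
    exact q1.not_hasSwitchingArcs hr hU h0
      (((q1'.hasSwitchingArcs hr hU h0).of_equivalent h22.symm).of_equivalent h12)
  · rw [neg_one_mul, neg_pos] at p1' p2'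
    obtain ⟨ε, sX, sY, q1, -, q2⟩ := exists_signPattern_crossing p1 p1'.ne
    obtain rfl := q2 p1'
    obtain ⟨ε', s', q1'⟩ := exists_signPattern_sliding (Z := Z₂) i
      ((forall_fin_two' i).2 ⟨p2, p2'⟩)
    exact q1'.not_hasLandingArcs hr hU h0
      (((q1.hasLandingArcs hr hU h0).of_equivalent h12.symm).of_equivalent h22)

end

section


variable {U : Set Plane} {r : ℕ} {Z Z' : Omega U r} {i : Fin 2}

/-! ### Vanishing determinants are not stable -/

/-- An arc of a trajectory in `N ∩ Σ` starts at `p` and ends in a connected subset `C` of `N ∩ Σ`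
which contains the origin but not `p`. -/
structure InwardArc (Z : Omega U r) (N C : Set Plane) (p : Plane) : Prop where
  arc : ∃ (a b : ℝ) (γ : ℝ → Plane), a < b ∧ IsTrajectory Z (Icc a b) γ ∧
    (∀ t ∈ Icc a b, γ t ∈ N ∧ γ t ∈ switching) ∧ γ a = p ∧ γ b ∈ C
  sub : ∀ q ∈ C, q ∈ N ∧ q ∈ switching
  conn : IsPreconnected C
  zero_mem : 0 ∈ C
  not_mem : p ∉ C

/-- An arc of a trajectory in `N ∩ Σ` starts in a connected subset of `N ∩ Σ` which contains the
origin, and leaves this set. -/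
def OutwardArc (Z : Omega U r) (N : Set Plane) : Prop :=
  ∃ (a b : ℝ) (γ : ℝ → Plane) (C : Set Plane), a < b ∧ IsTrajectory Z (Icc a b) γ ∧
    (∀ t ∈ Icc a b, γ t ∈ N ∧ γ t ∈ switching) ∧ (∀ q ∈ C, q ∈ N ∧ q ∈ switching) ∧
    IsPreconnected C ∧ 0 ∈ C ∧ γ a ∈ C ∧ γ b ∉ C

/-- Two adjacent half axes lead to the origin, and some half axis leads away from it. -/
def HasAdjacentInwardArcs (Z : Omega U r) : Prop :=
  ∀ N ∈ 𝓝 (0 : Plane), OutwardArc Z N ∧ ∃ (C C' D : Set Plane) (p q : Plane),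
    InwardArc Z N C p ∧ InwardArc Z N C' q ∧ C ∩ C' ⊆ {0} ∧ IsPreconnected D ∧
    (∀ x ∈ D, x ∈ N ∧ x ∉ switching) ∧ p ∈ closure D ∧ q ∈ closure D

/-- The invariant speaks only of arcs, connected sets and closures, so everything is carried over by
taking images. Injectivity of `h` on its source keeps points outside the images of the sets that
avoid them. -/
theorem HasAdjacentInwardArcs.of_equivalent (hZ : HasAdjacentInwardArcs Z)
    (h : WeaklyEquivalent Z Z') : HasAdjacentInwardArcs Z' := by
  obtain ⟨h, h1, -, h3, h4, h5, -⟩ := h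
  intro N hN
  obtain ⟨ho, C, C', D, p, q, hp, hq, hCC, hDc, hD, hpD, hqD⟩ :=
    hZ _ (OpenPartialHomeomorph.preimage_mem_nhds_zero h h1 h3 hN)
  have hin : ∀ C p, InwardArc Z (h.source ∩ h ⁻¹' N) C p → p ∈ h.source ∧
      InwardArc Z' N (h '' C) (h p) := by
    rintro C p ⟨⟨a, b, γ, hab, hγ, hm, ha, hb⟩, hC, hc, h0, hn⟩
    obtain ⟨c, d, σ, hcd, -, hσ, hσc, hσd, ht⟩ := h5.arc hab hγ fun t ht => (hm t ht).1.1
    have hps : p ∈ h.source := ha ▸ (hm a (left_mem_Icc.2 hab.le)).1.1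
    refine ⟨hps, ⟨c, d, _, hcd, ht, fun t ht => ⟨(hm _ (hσ ht)).1.2,
      (h4 _ (hm _ (hσ ht)).1.1).2 (hm _ (hσ ht)).2⟩, by simp only [hσc, ha], ?_⟩, ?_,
      hc.image _ (h.continuousOn.mono fun x hx => (hC x hx).1.1), ⟨0, h0, h3⟩, ?_⟩
    · simp only [hσd]
      exact mem_image_of_mem _ hb
    · rintro _ ⟨x, hx, rfl⟩
      exact ⟨(hC x hx).1.2, (h4 _ (hC x hx).1.1).2 (hC x hx).2⟩
    · rintro ⟨x, hx, hxp⟩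
      exact hn (h.injOn (hC x hx).1.1 hps hxp ▸ hx)
  obtain ⟨hps, hp'⟩ := hin C p hp
  obtain ⟨hqs, hq'⟩ := hin C' q hq
  have hcl : ∀ x ∈ h.source, x ∈ closure D → h x ∈ closure (h '' D) := fun x hx hxD =>
    (h.continuousAt hx).continuousWithinAt.mem_closure_image hxD
  refine ⟨?_, h '' C, h '' C', h '' D, h p, h q, hp', hq', ?_,
    hDc.image _ (h.continuousOn.mono fun x hx => (hD x hx).1.1), ?_, hcl p hps hpD, hcl q hqs hqD⟩
  · obtain ⟨a, b, γ, C, hab, hγ, hm, hC, hc, h0, ha, hb⟩ := ho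
    obtain ⟨c, d, σ, hcd, -, hσ, hσc, hσd, ht⟩ := h5.arc hab hγ fun t ht => (hm t ht).1.1
    refine ⟨c, d, _, h '' C, hcd, ht, fun t ht => ⟨(hm _ (hσ ht)).1.2,
      (h4 _ (hm _ (hσ ht)).1.1).2 (hm _ (hσ ht)).2⟩, ?_,
      hc.image _ (h.continuousOn.mono fun x hx => (hC x hx).1.1), ⟨0, h0, h3⟩, ?_, ?_⟩
    · rintro _ ⟨x, hx, rfl⟩
      exact ⟨(hC x hx).1.2, (h4 _ (hC x hx).1.1).2 (hC x hx).2⟩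
    · simp only [hσc]
      exact mem_image_of_mem _ ha
    · simp only [hσd]
      rintro ⟨x, hx, hxp⟩
      exact hb (h.injOn (hC x hx).1.1 (hm b (right_mem_Icc.2 hab.le)).1.1 hxp ▸ hx)
  · rintro _ ⟨⟨x, hx, rfl⟩, ⟨y, hy, hxy⟩⟩
    have := h.injOn (hq.sub y hy).1.1 (hp.sub x hx).1.1 hxy
    subst this
    have hy0 : y = 0 := hCC ⟨hx, hy⟩
    rw [hy0, h3]
    rfl
  · rintro _ ⟨x, hx, rfl⟩
    exact ⟨(hD x hx).1.2, fun hs => (hD x hx).2 ((h4 _ (hD x hx).1.1).1 hs)⟩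

section Sliding

variable {ε s mX MX mY MY ρ : ℝ}

theorem pt_mem_switching (k : Fin 2) (x : ℝ) : pt k x 0 ∈ switching :=
  (mem_switching k).2 (Or.inr (pt_snd ..))

theorem pt_mul_eq_zero (i k : Fin 2) (x : ℝ) : pt k x 0 i * pt k x 0 (i + 1) = 0 := by
  rw [← mul_coord i, mul_coord k, pt_snd, mul_zero]

theorem LocalChart.exists_axis_arc (c : LocalChart Z i ε (-ε) s s mX MX mY MY ρ) {e : Fin 2 → ℝ}
    (he : ∀ k, ∀ p ∈ box ρ, 0 < e k * slideSpeed Z k p) (he1 : ∀ k, e k = 1 ∨ e k = -1) (k : Fin 2)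
    {x y : ℝ} (hxy : e k * x < e k * y) (hpos : 0 < x * y) (hx : |x| ≤ ρ) (hy : |y| ≤ ρ) :
    ∃ (a b : ℝ) (γ : ℝ → Plane), a < b ∧ IsTrajectory Z (Icc a b) γ ∧
      (∀ t ∈ Icc a b, γ t ∈ box ρ ∧ γ t ∈ switching) ∧ γ a = pt k x 0 ∧ γ b = pt k y 0 := by
  set δ : ℝ → Plane := fun t => pt k ((1 - t) * x + t * y) 0 with hδ
  have hsgn : ∀ t ∈ Icc (0 : ℝ) 1, SignType.sign ((1 - t) * x + t * y) = SignType.sign x := by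
    intro t ht
    rcases mul_pos_iff.1 hpos with ⟨h1, h2⟩ | ⟨h1, h2⟩
    · rw [sign_pos h1, sign_pos]
      rcases ht.2.lt_or_eq with h | h
      · exact add_pos_of_pos_of_nonneg (mul_pos (by linarith) h1) (mul_nonneg ht.1 h2.le)
      · rw [h]
        linarith
    · rw [sign_neg h1, sign_neg]
      rcases ht.2.lt_or_eq with h | h
      · exact add_neg_of_neg_of_nonpos (mul_neg_of_pos_of_neg (by linarith) h1)
          (mul_nonpos_of_nonneg_of_nonpos ht.1 h2.le)
      · rw [h]
        linarith
  have hδk : ∀ t, δ t k = (1 - t) * x + t * y := fun t => pt_fst ..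
  have hδk' : ∀ t, δ t (k + 1) = 0 := fun t => pt_snd ..
  have ho : CellOrbit c e 0 1 δ := by
    refine ⟨?_, fun t ht t' ht' => ?_, fun h => absurd (pt_mul_eq_zero i k _) h.ne',
      fun h => absurd (pt_mul_eq_zero i k _) h.ne, fun l hl hl' => ?_⟩
    · refine ((continuous_pt k).comp (f := fun t : ℝ => ((1 - t) * x + t * y, (0 : ℝ)))
        ?_).continuousOn
      fun_prop
    · refine (forall_fin_two' k).2 ⟨?_, ?_⟩
      · rw [hδk, hδk, hsgn t ht, hsgn t' ht']
      · rw [hδk', hδk']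
    · have hlk : l = k := by
        rcases fin_two_cases k l with h | h
        · exact h
        · exact absurd (h ▸ hδk' 0) hl'
      subst hlk
      intro t _ t' _ htt
      simp only [hδk]
      nlinarith
  have hbox : MapsTo δ (Icc 0 1) (box ρ) := fun t ht => by
    refine pt_mem_box.2 ⟨?_, by simpa using c.ρ_pos.le⟩
    rw [abs_le] at hx hy ⊢
    constructor <;> nlinarith [ht.1, ht.2, hx.1, hx.2, hy.1, hy.2]
  obtain ⟨c₀, d₀, σ, hcd, hσ, himg, ht⟩ := ho.exists_trajectory he he1 zero_lt_one hbox
  obtain ⟨hm, hσc, hσd⟩ := endpoints_of_image zero_lt_one hcd hσ himg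
  refine ⟨c₀, d₀, _, hcd, ht, fun t ht => ⟨hbox (hm ht), pt_mem_switching _ _⟩, ?_, ?_⟩
  · simp only [hσc, hδ]
    congr 1
    ring
  · simp only [hσd, hδ]
    congr 1
    ring

/-- The segment from the origin to `pt k x 0`. -/
def axisSegment (k : Fin 2) (x : ℝ) : Set Plane := (fun t : ℝ => pt k (t * x) 0) '' Icc 0 1

theorem isPreconnected_axisSegment (k : Fin 2) (x : ℝ) : IsPreconnected (axisSegment k x) := by
  refine isPreconnected_Icc.image _ ((continuous_pt k).comp (f := fun t : ℝ => (t * x, (0 : ℝ)))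
    ?_).continuousOn
  fun_prop

theorem mem_axisSegment_iff {k : Fin 2} {x y : ℝ} (h : 0 < x * y) :
    pt k x 0 ∈ axisSegment k y ↔ |x| ≤ |y| := by
  constructor
  · rintro ⟨t, ht, h⟩
    have := congrArg (fun p : Plane => p k) h
    simp only [pt_fst] at this
    rw [← this, abs_mul, abs_of_nonneg ht.1]
    exact mul_le_of_le_one_left (abs_nonneg y) ht.2
  · intro hxy
    have hy : y ≠ 0 := right_ne_zero_of_mul h.ne'
    have hd : x / y = |x| / |y| := by
      rw [← abs_div, abs_of_pos]
      rcases mul_pos_iff.1 h with h | h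
      exacts [div_pos h.1 h.2, div_pos_of_neg_of_neg h.1 h.2]
    refine ⟨x / y, ⟨by rw [hd]; positivity, by rw [hd]; exact div_le_one_of_le₀ hxy (abs_nonneg y)⟩,
      ?_⟩
    simp only
    rw [div_mul_cancel₀ _ hy]

theorem axisSegment_sub {k : Fin 2} {x ρ : ℝ} (hx : |x| ≤ ρ) :
    ∀ q ∈ axisSegment k x, q ∈ box ρ ∧ q ∈ switching := by
  rintro _ ⟨t, ht, rfl⟩
  refine ⟨pt_mem_box.2 ⟨?_, ?_⟩, pt_mem_switching _ _⟩
  · rw [abs_mul, abs_of_nonneg ht.1]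
    exact (mul_le_of_le_one_left (abs_nonneg x) ht.2).trans hx
  · rw [abs_zero]
    exact (abs_nonneg x).trans hx

theorem zero_mem_axisSegment (k : Fin 2) (x : ℝ) : 0 ∈ axisSegment k x :=
  ⟨0, left_mem_Icc.2 zero_le_one, by simp [pt_zero]⟩

theorem mem_axisSegment_self (k : Fin 2) (x : ℝ) : pt k x 0 ∈ axisSegment k x :=
  ⟨1, right_mem_Icc.2 zero_le_one, by simp⟩

/-- Where the sliding speed does not vanish at the origin, each axis has one half leading inward and
one leading outward. The inward halves of the two axes bound a common quadrant. -/
theorem SignPattern.hasAdjacentInwardArcs (hr : 1 ≤ r) (hU : IsOpen U) (h0 : (0 : Plane) ∈ U)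
    (hZ : SignPattern Z i ε (-ε) s s) (hsl : ∀ k, slideSpeed Z k 0 ≠ 0) :
    HasAdjacentInwardArcs Z := by
  intro N hN
  choose e he1 he using fun k => exists_sign (hsl k)
  obtain ⟨mX, MX, mY, MY, ρ₀, hρ₀, hch⟩ := hZ.exists_localChart hr hU h0
  obtain ⟨ρ₁, hρ₁, h1⟩ := exists_box_slideSpeed hU h0 he
  obtain ⟨ρ₂, hρ₂, h2⟩ := exists_box_subset hN
  set ρ := min ρ₀ (min ρ₁ ρ₂) with hρdef
  have hρ : 0 < ρ := lt_min hρ₀ (lt_min hρ₁ hρ₂)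
  have he2 := h1 ρ ((min_le_right _ _).trans (min_le_left _ _))
  have hN' : box ρ ⊆ N := h2 ρ ((min_le_right _ _).trans (min_le_right _ _))
  obtain ⟨c⟩ := hch ρ hρ (min_le_left _ _)
  have habs : ∀ k (x : ℝ), |e k * x| = |x| := fun k x => by
    rw [abs_mul, abs_eq_one_of_sign (he1 k), one_mul]
  have hee : ∀ k (x : ℝ), e k * (e k * x) = x := fun k x => by
    rw [← mul_assoc, mul_self_sign (he1 k), one_mul]
  have hmul : ∀ k (x y : ℝ), e k * x * (e k * y) = x * y := fun k x y => by
    linear_combination x * y * mul_self_sign (he1 k)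
  have hin : ∀ k, InwardArc Z N (axisSegment k (e k * (-(ρ / 2)))) (pt k (e k * (-ρ)) 0) := by
    intro k
    obtain ⟨a, b, γ, hab, hγ, hm, ha, hb⟩ := c.exists_axis_arc he2 he1 k (x := e k * (-ρ))
      (y := e k * (-(ρ / 2))) (by rw [hee, hee]; linarith) (by rw [hmul]; nlinarith)
      (by rw [habs, abs_neg, abs_of_pos hρ])
      (by rw [habs, abs_neg, abs_of_pos (half_pos hρ)]; linarith)
    refine ⟨⟨a, b, γ, hab, hγ, fun t ht => ⟨hN' (hm t ht).1, (hm t ht).2⟩, ha, ?_⟩, fun q hq => ?_,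
      isPreconnected_axisSegment _ _, zero_mem_axisSegment _ _, ?_⟩
    · rw [hb]
      exact mem_axisSegment_self _ _
    · have := axisSegment_sub (ρ := ρ) (by
        rw [habs, abs_neg, abs_of_pos (half_pos hρ)]
        linarith) q hq
      exact ⟨hN' this.1, this.2⟩
    · rw [mem_axisSegment_iff (by rw [hmul]; nlinarith), habs, habs, abs_neg, abs_neg,
        abs_of_pos hρ, abs_of_pos (half_pos hρ)]
      linarith
  -- The set `D` is the part inside the square of the open quadrant between the two inward half
  -- axes; it is convex.
  refine ⟨?_, _, _, {p | (0 < e i * (-p i) ∧ e i * (-p i) ≤ ρ) ∧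
    (0 < e (i + 1) * (-p (i + 1)) ∧ e (i + 1) * (-p (i + 1)) ≤ ρ)}, _, _, hin i, hin (i + 1),
    ?_, ?_, ?_, ?_, ?_⟩
  · obtain ⟨a, b, γ, hab, hγ, hm, ha, hb⟩ := c.exists_axis_arc he2 he1 i (x := e i * (ρ / 2))
      (y := e i * ρ) (by rw [hee, hee]; linarith) (by rw [hmul]; nlinarith)
      (by rw [habs, abs_of_pos (half_pos hρ)]; linarith) (by rw [habs, abs_of_pos hρ])
    refine ⟨a, b, γ, axisSegment i (e i * (ρ / 2)), hab, hγ,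
      fun t ht => ⟨hN' (hm t ht).1, (hm t ht).2⟩, fun q hq => ?_,
      isPreconnected_axisSegment _ _, zero_mem_axisSegment _ _, ?_, ?_⟩
    · have := axisSegment_sub (ρ := ρ) (by
        rw [habs, abs_of_pos (half_pos hρ)]
        linarith) q hq
      exact ⟨hN' this.1, this.2⟩
    · rw [ha]
      exact mem_axisSegment_self _ _
    · rw [hb, mem_axisSegment_iff (by rw [hmul]; nlinarith), habs, habs,
        abs_of_pos hρ, abs_of_pos (half_pos hρ)]
      linarith
  · rintro _ ⟨⟨t, -, rfl⟩, ⟨t', -, h⟩⟩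
    refine (plane_eq_zero (i + 1)).2 ⟨?_, ?_⟩
    · simp
    · have := congrArg (fun p : Plane => p (i + 1 + 1)) h
      simp only [pt_snd] at this
      exact this.symm
  · refine Convex.isPreconnected ?_
    intro p hp q hq a b ha hb hab
    simp only [mem_ofPred_eq, PiLp.add_apply, PiLp.smul_apply, smul_eq_mul] at hp hq ⊢
    have key : ∀ (e x y : ℝ), 0 < e * (-x) ∧ e * (-x) ≤ ρ → 0 < e * (-y) ∧ e * (-y) ≤ ρ →
        0 < e * (-(a * x + b * y)) ∧ e * (-(a * x + b * y)) ≤ ρ := by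
      intro e x y h1 h2
      have e1 : e * (-(a * x + b * y)) = a * (e * -x) + b * (e * -y) := by ring
      rw [e1]
      constructor
      · rcases ha.lt_or_eq with h | h
        · exact add_pos_of_pos_of_nonneg (mul_pos h h1.1) (mul_nonneg hb h2.1.le)
        · rw [← h] at hab ⊢
          rw [zero_add] at hab
          rw [hab]
          linarith [h2.1]
      · nlinarith [mul_le_mul_of_nonneg_left h1.2 ha, mul_le_mul_of_nonneg_left h2.2 hb]
    exact ⟨key _ _ _ hp.1 hq.1, key _ _ _ hp.2 hq.2⟩
  · rintro p ⟨⟨p1, p2⟩, p3, p4⟩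
    constructor
    · refine hN' fun k => ?_
      have : ∀ k, 0 < e k * (-p k) → e k * (-p k) ≤ ρ → |p k| ≤ ρ := fun k h h' => by
        rw [← abs_neg, ← habs k, abs_of_pos h]
        exact h'
      rcases fin_two_cases i k with rfl | rfl
      exacts [this _ p1 p2, this _ p3 p4]
    · rw [mem_switching i, not_or]
      constructor <;> intro h
      · rw [h] at p1
        simp at p1
      · rw [h] at p3
        simp at p3
  · have hlim : Tendsto (fun t : ℝ => pt i (e i * (-ρ)) (e (i + 1) * (-t))) (𝓝[>] 0)
        (𝓝 (pt i (e i * (-ρ)) 0)) := by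
      have hc : Continuous fun t : ℝ => pt i (e i * (-ρ)) (e (i + 1) * (-t)) :=
        (continuous_pt i).comp (f := fun t : ℝ => (e i * (-ρ), e (i + 1) * (-t)))
          (by fun_prop)
      have := hc.tendsto 0
      rw [neg_zero, mul_zero] at this
      exact this.mono_left nhdsWithin_le_nhds
    refine mem_closure_of_tendsto hlim ?_
    filter_upwards [Ioc_mem_nhdsGT hρ] with t ht
    simp only [pt_fst, pt_snd, mul_neg, hee, neg_neg]
    exact ⟨⟨hρ, le_rfl⟩, ht.1, ht.2⟩
  · have hlim : Tendsto (fun t : ℝ => pt (i + 1) (e (i + 1) * (-ρ)) (e i * (-t))) (𝓝[>] 0)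
        (𝓝 (pt (i + 1) (e (i + 1) * (-ρ)) 0)) := by
      have hc : Continuous fun t : ℝ => pt (i + 1) (e (i + 1) * (-ρ)) (e i * (-t)) :=
        (continuous_pt (i + 1)).comp (f := fun t : ℝ => (e (i + 1) * (-ρ), e i * (-t)))
          (by fun_prop)
      have := hc.tendsto 0
      rw [neg_zero, mul_zero] at this
      exact this.mono_left nhdsWithin_le_nhds
    refine mem_closure_of_tendsto hlim ?_
    filter_upwards [Ioc_mem_nhdsGT hρ] with t ht
    have h2 : ∀ x y, pt (i + 1) x y i = y := fun x y => by
      have := pt_snd (i + 1) x y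
      rwa [fin_two_add] at this
    simp only [pt_fst, h2, mul_neg, hee, neg_neg]
    exact ⟨⟨ht.1, ht.2⟩, hρ, le_rfl⟩

end Sliding

end

/-! ### Simple zeros of the determinant and instability. -/

section


variable {U : Set Plane} {r : ℕ} {Z Z' : Omega U r} {i : Fin 2}

/-- The projection of `C` to the coordinate `k` is an interval containing `0`, and a point of `Σ`
with nonzero coordinate `k` is determined by this coordinate. -/
theorem mem_of_isPreconnected_switching {C : Set Plane} (hC : IsPreconnected C)
    (hsw : C ⊆ switching) (h0 : 0 ∈ C) {k : Fin 2} {p q : Plane} (hp : p ∈ C)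
    (hq : q (k + 1) = 0) (hpq : 0 < p k * q k) (hle : |q k| ≤ |p k|) : q ∈ C := by
  have hint : IsPreconnected ((fun x : Plane => x k) '' C) :=
    hC.image _ (continuous_coord k).continuousOn
  have hord := hint.ordConnected
  have h1 : (0 : ℝ) ∈ (fun x : Plane => x k) '' C := ⟨0, h0, rfl⟩
  have h2 : p k ∈ (fun x : Plane => x k) '' C := ⟨p, hp, rfl⟩
  have h3 : q k ∈ (fun x : Plane => x k) '' C := by
    rcases mul_pos_iff.1 hpq with ⟨h, h'⟩ | ⟨h, h'⟩
    · rw [abs_of_pos h, abs_of_pos h'] at hle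
      exact hord.out h1 h2 ⟨h'.le, hle⟩
    · rw [abs_of_neg h, abs_of_neg h'] at hle
      exact hord.out h2 h1 ⟨by linarith, h'.le⟩
  obtain ⟨x, hx, hxq⟩ := h3
  have hx0 : x (k + 1) = 0 := ((mem_switching k).1 (hsw hx)).resolve_left fun h => by
    simp only at hxq
    rw [hxq] at h
    rw [h, mul_zero] at hpq
    exact lt_irrefl _ hpq
  have : x = q := plane_ext k hxq (by rw [hx0, hq])
  exact this ▸ hx

section Sliding

variable {ε s mX MX mY MY ρ : ℝ}

/-- If the sliding speed changes sign at the origin, the squared distance to the origin is monotone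
on both halves of the axis in the same sense, given by the sign of `κ k`. -/
theorem LocalChart.axis_arc_mono (c : LocalChart Z i ε (-ε) s s mX MX mY MY ρ) {κ : Fin 2 → ℝ}
    (hκ : ∀ p ∈ box ρ, ∀ k, p (k + 1) = 0 → p k ≠ 0 → 0 < κ k * (p k * slideSpeed Z k p))
    {a b : ℝ} {γ : ℝ → Plane} (hab : a < b) (hγ : IsTrajectory Z (Icc a b) γ)
    (hm : ∀ t ∈ Icc a b, γ t ∈ box ρ ∧ γ t ∈ switching) :
    (γ a = 0 ∧ γ b = 0) ∨ ∃ k, γ a (k + 1) = 0 ∧ γ b (k + 1) = 0 ∧ 0 < γ a k * γ b k ∧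
      κ k * γ a k ^ 2 < κ k * γ b k ^ 2 := by
  have hbox : MapsTo γ (Icc a b) (box ρ) := fun t ht => (hm t ht).1
  have hsign := c.sign_eq_of_trajectory hγ hbox
  obtain ⟨hc, -, -, hs, -⟩ := (c.isTrajectory_iff hbox).1 hγ
  have ha : a ∈ Icc a b := left_mem_Icc.2 hab.le
  have hb : b ∈ Icc a b := right_mem_Icc.2 hab.le
  have hz : ∀ t ∈ Icc a b, ∀ k, γ a k = 0 ↔ γ t k = 0 := fun t ht k =>
    eq_zero_iff_of_sign_eq (hsign a ha t ht k)
  by_cases h0 : γ a = 0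
  · refine Or.inl ⟨h0, (plane_eq_zero i).2 ⟨?_, ?_⟩⟩ <;> rw [← hz b hb, h0] <;> rfl
  right
  obtain ⟨k, hk⟩ : ∃ k, γ a (k + 1) = 0 := by
    rcases (mem_switching i).1 (hm a ha).2 with h | h
    · exact ⟨i + 1, by rwa [fin_two_add]⟩
    · exact ⟨i, h⟩
  have hk' : γ a k ≠ 0 := fun h => h0 ((plane_eq_zero k).2 ⟨h, hk⟩)
  refine ⟨k, hk, (hz b hb _).1 hk, mul_pos_of_sign_eq hk' (hsign b hb a ha k), ?_⟩
  have hmono : StrictMonoOn (fun t => κ k * γ t k ^ 2) (Icc a b) := by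
    refine strictMonoOn_of_local (continuousOn_const.mul
      (((continuous_coord k).comp_continuousOn hc).pow 2)) fun t ht => ?_
    have h1 := (hz t ht _).1 hk
    have h2 := mt (hz t ht _).2 hk'
    have h3 := hasDerivWithinAt_coord (hs t ht k h1 h2).2 k
    rw [slidingField_fst] at h3
    refine eventually_lt_of_hasDerivWithinAt_pos ((h3.pow 2).const_mul (κ k)) ?_
    have := hκ _ (hbox ht) k h1 h2
    simp only [Nat.cast_ofNat, Nat.add_one_sub_one, pow_one]
    linarith
  exact hmono ha hb hab

/-- An axis leads inward on both halves or outward on both. Since some axis leads outward, both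
inward arcs lie on the other one, and the connected set `D` puts them on the same half of it. Two
connected sets reaching from the origin into one half axis then share more than the origin. -/
theorem SignPattern.not_hasAdjacentInwardArcs (hr : 1 ≤ r) (hU : IsOpen U) (h0 : (0 : Plane) ∈ U)
    (hZ : SignPattern Z i ε (-ε) s s) {κ : Fin 2 → ℝ}
    (hκ : ∀ᶠ p in 𝓝 (0 : Plane), ∀ k, p (k + 1) = 0 → p k ≠ 0 →
      0 < κ k * (p k * slideSpeed Z k p)) : ¬ HasAdjacentInwardArcs Z := by
  intro had
  obtain ⟨mX, MX, mY, MY, ρ, hsub, ⟨c⟩⟩ := hZ.exists_localChart_in hr hU h0 hκ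
  obtain ⟨⟨a, b, γ, C, hab, hγ, hm, hC, hCc, hC0, ha, hb⟩, C₁, C₂, D, p, q, hp, hq, hCC, hDc, hD,
    hpD, hqD⟩ := had _ (box_mem_nhds c.ρ_pos)
  have hin : ∀ C p, InwardArc Z (box ρ) C p → ∃ k, p (k + 1) = 0 ∧ κ k < 0 ∧
      ∃ y ∈ C, y (k + 1) = 0 ∧ 0 < p k * y k := by
    rintro C p ⟨⟨a, b, γ, hab, hγ, hm, rfl, hb⟩, hC, hc, h0, hn⟩
    rcases c.axis_arc_mono (fun p hp => hsub hp) hab hγ hm with h | ⟨k, h1, h2, h3, h4⟩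
    · rw [h.1] at hn
      exact absurd h0 hn
    · refine ⟨k, h1, not_le.1 fun hk => hn ?_, γ b, hb, h2, h3⟩
      refine mem_of_isPreconnected_switching hc (fun q hq => (hC q hq).2) h0 hb h1
        (by rwa [mul_comm]) (sq_le_sq.1 ?_)
      exact (lt_of_mul_lt_mul_left h4 hk).le
  have hout : ∃ k, 0 < κ k := by
    rcases c.axis_arc_mono (fun p hp => hsub hp) hab hγ hm with h | ⟨k, h1, h2, h3, h4⟩
    · rw [h.2] at hb
      exact absurd hC0 hb
    · refine ⟨k, not_le.1 fun hk => hb ?_⟩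
      refine mem_of_isPreconnected_switching hCc (fun q hq => (hC q hq).2) hC0 ha h2 h3
        (sq_le_sq.1 ?_)
      by_contra! hlt
      nlinarith
  obtain ⟨k, hpk, hk, y, hy, hyk, hpy⟩ := hin _ _ hp
  obtain ⟨l, hql, hl, z, hz, hzl, hqz⟩ := hin _ _ hq
  obtain ⟨m, hm'⟩ := hout
  have hkm : k = m + 1 := (fin_two_cases m k).resolve_left fun h => by
    rw [h] at hk
    exact lt_asymm hk hm'
  have hlm : l = m + 1 := (fin_two_cases m l).resolve_left fun h => by
    rw [h] at hl
    exact lt_asymm hl hm'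
  obtain rfl : l = k := hlm.trans hkm.symm
  -- the set `D` lies on one side of the axis `p l = 0`
  have hpq : 0 < p l * q l := by
    have hne : p l ≠ 0 := left_ne_zero_of_mul hpy.ne'
    have hne' : q l ≠ 0 := left_ne_zero_of_mul hqz.ne'
    have hDne : ∀ x ∈ D, x l ≠ 0 := fun x hx h => (hD x hx).2 ((mem_switching l).2 (Or.inl h))
    have hside : (∀ x ∈ D, 0 < x l) ∨ (∀ x ∈ D, x l < 0) := by
      have hord := (hDc.image _ (continuous_coord l).continuousOn).ordConnected
      by_contra! h
      obtain ⟨⟨x, hx, hx'⟩, ⟨x₁, hx₁, hx₁'⟩⟩ := h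
      obtain ⟨w, hw, hw'⟩ := hord.out (mem_image_of_mem _ hx) (mem_image_of_mem _ hx₁) ⟨hx', hx₁'⟩
      exact hDne w hw hw'
    have hcl : ∀ (P : Set ℝ), IsClosed P → (∀ x ∈ D, x l ∈ P) → p l ∈ P ∧ q l ∈ P := by
      intro P hP h
      have : closure D ⊆ (fun x : Plane => x l) ⁻¹' P :=
        closure_minimal h (hP.preimage (continuous_coord l))
      exact ⟨this hpD, this hqD⟩
    rcases hside with h | h
    · have := hcl (Ici 0) isClosed_Ici fun x hx => (h x hx).le
      exact mul_pos (lt_of_le_of_ne this.1 hne.symm) (lt_of_le_of_ne this.2 hne'.symm)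
    · have := hcl (Iic 0) isClosed_Iic fun x hx => (h x hx).le
      exact mul_pos_of_neg_of_neg (lt_of_le_of_ne this.1 hne) (lt_of_le_of_ne this.2 hne')
  have hyz : 0 < y l * z l := by
    have : 0 < (p l * q l) * (y l * z l) := by nlinarith [mul_pos hpy hqz]
    exact pos_of_mul_pos_right this hpq.le
  have hcap : ∀ w : Plane, w ∈ C₁ → w ∈ C₂ → w l = 0 := fun w h h' => by
    have : w = 0 := hCC ⟨h, h'⟩
    rw [this]
    rfl
  rcases le_total |y l| |z l| with h | h
  · have := mem_of_isPreconnected_switching hq.conn (fun q hq' => (hq.sub q hq').2) hq.zero_mem hz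
      hyk (by rwa [mul_comm]) h
    exact left_ne_zero_of_mul hyz.ne' (hcap y hy this)
  · have := mem_of_isPreconnected_switching hp.conn (fun q hq' => (hp.sub q hq').2) hp.zero_mem hy
      hzl hyz h
    exact right_ne_zero_of_mul hyz.ne' (hcap z this hz)

end Sliding

theorem eventually_mul_pos_of_hasDerivAt {f : ℝ → ℝ} {d : ℝ} (hf : HasDerivAt f d 0) (h0 : f 0 = 0)
    (hd : d ≠ 0) : ∀ᶠ x in 𝓝[≠] (0 : ℝ), 0 < d * (x * f x) := by
  have h1 := hasDerivAt_iff_tendsto_slope.1 hf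
  have h2 : ∀ᶠ x in 𝓝[≠] (0 : ℝ), 0 < d * slope f 0 x :=
    (h1.const_mul d).eventually (lt_mem_nhds (mul_self_pos.2 hd))
  filter_upwards [h2, self_mem_nhdsWithin] with x hx hx0
  have hx0' : x ≠ 0 := hx0
  rw [slope_def_field, h0, sub_zero, sub_zero] at hx
  have e : d * (x * f x) = x ^ 2 * (d * (f x / x)) := by field_simp
  rw [e]
  positivity

theorem VField.differentiableAt_axis (hr : 1 ≤ r) (hU : IsOpen U) (h0 : (0 : Plane) ∈ U)
    (V : VField U r) (k l : Fin 2) : DifferentiableAt ℝ (fun x : ℝ => V (pt k x 0) l) 0 := by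
  have hcd : ContDiffAt ℝ 1 V 0 :=
    (V.contDiffOn.contDiffAt (hU.mem_nhds h0)).of_le (by exact_mod_cast hr)
  have h1 : DifferentiableAt ℝ (fun p => V p l) (pt k 0 0) := by
    rw [pt_zero]
    exact ((contDiffAt_piLp 2).1 hcd l).differentiableAt (by norm_num)
  have h2 : DifferentiableAt ℝ (fun x : ℝ => pt k x 0) 0 := by
    refine (differentiableAt_piLp 2).2 ((forall_fin_two' k).2 ⟨?_, ?_⟩)
    · simp only [pt_fst]
      exact differentiableAt_id
    · simp only [pt_snd]
      exact differentiableAt_const _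
  exact DifferentiableAt.comp (g := fun p => V p l) (f := fun x : ℝ => pt k x 0) (0 : ℝ) h1 h2

/-- If `det Z` vanishes at the origin there are arbitrarily small perturbations for which `det Z`
still vanishes at the origin but changes its sign there along both axes. -/
theorem exists_simple_zeros (hr : 1 ≤ r) (hU : IsOpen U) (hUb : Bornology.IsBounded U)
    (h0 : (0 : Plane) ∈ U) (hneg : ∀ k, Z.1 0 k * Z.2 0 k < 0)
    (hdet : Z.1 0 0 * Z.2 0 1 - Z.1 0 1 * Z.2 0 0 = 0) {V : Set (Omega U r)} (hV : V ∈ 𝓝 Z) :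
    ∃ Z' ∈ V, (∀ k, Z'.1 0 k * Z'.2 0 k < 0) ∧ ∃ κ : Fin 2 → ℝ,
      ∀ᶠ p in 𝓝 (0 : Plane), ∀ k, p (k + 1) = 0 → p k ≠ 0 →
        0 < κ k * (p k * slideSpeed Z' k p) := by
  -- This field vanishes at the origin, so the determinant there stays zero. At the point with
  -- coordinate `x` of either axis it equals `(x, 0)`; thus `t G` adds `t Y_2 (0)` to the derivative
  -- of the determinant along both axes, in the numbering of the coordinates from one.
  set G : Plane → Plane := fun p => pt 0 (p 0 + p 1) 0 with hGdef
  have hG : ContDiff ℝ r G := by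
    refine (contDiff_piLp 2).2 (Fin.forall_fin_two.2 ⟨?_, ?_⟩)
    · have : (fun p : Plane => G p 0) = fun p => p 0 + p 1 := funext fun p => pt_fst ..
      rw [this]
      fun_prop
    · have : (fun p : Plane => G p 1) = fun _ => 0 := funext fun p => pt_snd ..
      rw [this]
      exact contDiff_const
  have hG0 : ∀ p, G p 0 = p 0 + p 1 := fun p => pt_fst ..
  have hG1 : ∀ p, G p 1 = 0 := fun p => pt_snd ..
  set Zt : ℝ → Omega U r := fun t => (Z.1.perturb hU hUb hG t, Z.2) with hZt
  have hZt1 : ∀ t p k, p ∈ U → (Zt t).1 p k = Z.1 p k + t * G p k := fun t p k hp =>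
    Z.1.perturb_apply hU hUb hG t hp k
  have htend : Tendsto Zt (𝓝 0) (𝓝 Z) :=
    (Z.1.tendsto_perturb hU hUb hG).prodMk_nhds tendsto_const_nhds
  have hGz : ∀ k, G 0 k = 0 := Fin.forall_fin_two.2 ⟨by simp [hG0], hG1 0⟩
  have hval : ∀ t k, (Zt t).1 0 k = Z.1 0 k := fun t k => by
    rw [hZt1 t 0 k h0, hGz, mul_zero, add_zero]
  -- the determinant along the axes
  set f : Fin 2 → ℝ → ℝ := fun k x =>
    Z.1 (pt k x 0) 0 * Z.2 (pt k x 0) 1 - Z.1 (pt k x 0) 1 * Z.2 (pt k x 0) 0 with hf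
  have hdf : ∀ k, DifferentiableAt ℝ (f k) 0 := fun k =>
    ((Z.1.differentiableAt_axis hr hU h0 k 0).mul (Z.2.differentiableAt_axis hr hU h0 k 1)).sub
      ((Z.1.differentiableAt_axis hr hU h0 k 1).mul (Z.2.differentiableAt_axis hr hU h0 k 0))
  have hY1 : Z.2 0 1 ≠ 0 := right_ne_zero_of_mul (hneg 1).ne
  have hne : ∀ k, ∀ᶠ t in 𝓝[≠] (0 : ℝ), deriv (f k) 0 + t * Z.2 0 1 ≠ 0 := fun k => by
    filter_upwards [eventually_quadratic_ne (a := 0) (b := Z.2 0 1) (c := deriv (f k) 0)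
      (Or.inr (Or.inl hY1))] with t ht h
    exact ht (by linear_combination h)
  obtain ⟨t, ht, htV⟩ := ((Filter.eventually_all.2 hne).and
    (nhdsWithin_le_nhds (htend hV))).exists
  refine ⟨Zt t, htV, fun k => by rw [hval]; exact hneg k, ?_⟩
  set g : Fin 2 → ℝ → ℝ := fun k x => f k x + t * (x * Z.2 (pt k x 0) 1) with hg
  have hgd : ∀ k, HasDerivAt (g k) (deriv (f k) 0 + t * Z.2 0 1) 0 := fun k => by
    have h1 := (hdf k).hasDerivAt
    have h2 := (Z.2.differentiableAt_axis hr hU h0 k 1).hasDerivAt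
    have h3 := h1.add (((hasDerivAt_id (0 : ℝ)).mul h2).const_mul t)
    refine h3.congr_deriv ?_
    simp [pt_zero]
  have hg0 : ∀ k, g k 0 = 0 := fun k => by
    simp only [hg, hf, pt_zero, zero_mul, mul_zero, add_zero]
    exact hdet
  have hgpos := fun k => eventually_mul_pos_of_hasDerivAt (hgd k) (hg0 k) (ht k)
  -- The sign relating the numerator of the sliding speed along coordinate `k` to the determinant.
  set τ : Fin 2 → ℝ := fun k => if k = 0 then 1 else -1 with hτ
  have hτ2 : ∀ k, τ k * τ k = 1 := Fin.forall_fin_two.2 ⟨by simp [hτ], by simp [hτ]⟩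
  have hnum : ∀ k x, pt k x 0 ∈ U → (Zt t).2 (pt k x 0) (k + 1) * (Zt t).1 (pt k x 0) k -
      (Zt t).1 (pt k x 0) (k + 1) * (Zt t).2 (pt k x 0) k = τ k * g k x := by
    intro k x hx
    have hsum : pt k x 0 0 + pt k x 0 1 = x := by
      rcases fin_two_eq k with rfl | rfl
      · have h1 := pt_fst 0 x 0
        have h2 := pt_snd 0 x 0
        rw [zero_add] at h2
        rw [h1, h2, add_zero]
      · have h1 := pt_fst 1 x 0
        have h2 := pt_snd 1 x 0
        rw [one_add_one_fin_two] at h2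
        rw [h1, h2, zero_add]
    have e0 : (Zt t).1 (pt k x 0) 0 = Z.1 (pt k x 0) 0 + t * x := by rw [hZt1 _ _ _ hx, hG0, hsum]
    have e1 : (Zt t).1 (pt k x 0) 1 = Z.1 (pt k x 0) 1 := by
      rw [hZt1 _ _ _ hx, hG1, mul_zero, add_zero]
    rcases fin_two_eq k with rfl | rfl
    · rw [zero_add, e0, e1]
      simp only [hg, hf, hτ, if_true]
      ring
    · rw [one_add_one_fin_two, e0, e1]
      simp only [hg, hf, hτ, one_ne_zero, if_false]
      ring
  set den : Fin 2 → ℝ := fun k => Z.2 0 (k + 1) - Z.1 0 (k + 1) with hden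
  have hden0 : ∀ k, den k ≠ 0 := fun k h => by
    have := hneg (k + 1)
    rw [sub_eq_zero.1 h] at this
    exact absurd this (not_lt.2 (mul_self_nonneg _))
  have hdenc : ∀ k, ∀ᶠ p in 𝓝 (0 : Plane), 0 < den k * ((Zt t).2 p (k + 1) - (Zt t).1 p (k + 1)) := by
    intro k
    have hc : ∀ W : VField U r, ContinuousAt (fun p => W p (k + 1)) 0 := fun W =>
      (continuous_coord (k + 1)).continuousAt.comp
        (W.contDiffOn.continuousOn.continuousAt (hU.mem_nhds h0))
    refine (continuousAt_const.mul ((hc _).sub (hc _))).eventually (lt_mem_nhds ?_)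
    change 0 < den k * ((Zt t).2 0 (k + 1) - (Zt t).1 0 (k + 1))
    rw [hval]
    exact mul_self_pos.2 (hden0 k)
  -- The sign of the sliding speed just beyond the origin: sign of the numerator, times derivative
  -- of the determinant, times the sign of the denominator.
  refine ⟨fun k => τ k * (deriv (f k) 0 + t * Z.2 0 1) * den k, ?_⟩
  rw [Filter.eventually_all]
  intro k
  have h1 := hgpos k
  rw [eventually_nhdsWithin_iff] at h1
  have h2 : ∀ᶠ p in 𝓝 (0 : Plane), p k ≠ 0 →
      0 < (deriv (f k) 0 + t * Z.2 0 1) * (p k * g k (p k)) :=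
    ((continuous_coord k).tendsto (0 : Plane)).eventually h1
  filter_upwards [h2, hdenc k, hU.mem_nhds h0] with p hp1 hp2 hpU hpk hpk'
  have hpe : p = pt k (p k) 0 := plane_ext k (pt_fst ..).symm (by rw [hpk, pt_snd])
  have hn := hnum k (p k) (hpe ▸ hpU)
  rw [← hpe] at hn
  rw [slideSpeed, hn]
  have h3 := hp1 hpk'
  have hd : (Zt t).2 p (k + 1) - (Zt t).1 p (k + 1) ≠ 0 := right_ne_zero_of_mul hp2.ne'
  set E := (Zt t).2 p (k + 1) - (Zt t).1 p (k + 1)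
  have e : τ k * (deriv (f k) 0 + t * Z.2 0 1) * den k * (p k * (τ k * g k (p k) / E)) =
      (τ k * τ k) * ((deriv (f k) 0 + t * Z.2 0 1) * (p k * g k (p k))) * ((den k * E) / E ^ 2) := by
    field_simp
  rw [e, hτ2, one_mul]
  positivity

/-- By density some nearby field has nonzero determinant at the origin, and another one has simple
zeros of it along both axes. Adjacent inward half axes exist for the first field and not for the
second. -/
theorem StructurallyStable.det_ne_zero (hr : 1 ≤ r) (hU : IsOpen U) (hUb : Bornology.IsBounded U)
    (h0 : (0 : Plane) ∈ U) (hZ : StructurallyStable Z) (hneg : ∀ k, Z.1 0 k * Z.2 0 k < 0) :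
    Z.1 0 0 * Z.2 0 1 - Z.1 0 1 * Z.2 0 0 ≠ 0 := by
  intro hdet
  obtain ⟨V, hV, hVZ⟩ := hZ
  obtain ⟨Z₂, hZ₂, hneg₂, κ, hκ⟩ := exists_simple_zeros hr hU hUb h0 hneg hdet hV
  have hopen : ∀ᶠ Z' in 𝓝 Z, ∀ k, Z'.1 0 k * Z'.2 0 k < 0 := Filter.eventually_all.2 fun k =>
    ((Omega.continuous_fst h0 k).mul (Omega.continuous_snd h0 k)).continuousAt.eventually
      (gt_mem_nhds (hneg k))
  obtain ⟨Z₁, ⟨hZ₁, hneg₁⟩, hc⟩ := (dense_conditions hU hUb h0).inter_nhds_nonempty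
    (Filter.inter_mem hV hopen) |>.imp fun _ h => h.symm
  have hdet₁ : Z₁.1 0 0 * Z₁.2 0 1 - Z₁.1 0 1 * Z₁.2 0 0 ≠ 0 := by
    rcases hc with h | h | ⟨⟨k, h, -⟩, -⟩
    · exact absurd (h 0) (hneg₁ 0).not_gt
    · exact h.2
    · exact absurd h (hneg₁ k).not_gt
  obtain ⟨ε, s, hp⟩ := exists_signPattern_sliding 0 hneg₁
  obtain ⟨ε', s', hp'⟩ := exists_signPattern_sliding 0 hneg₂
  refine hp'.not_hasAdjacentInwardArcs hr hU h0 hκ ?_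
  refine ((hp.hasAdjacentInwardArcs hr hU h0 fun k => ?_).of_equivalent
    (hVZ _ hZ₁).weak.symm).of_equivalent (hVZ _ hZ₂).weak
  refine div_ne_zero (slideSpeed_num_ne hdet₁) fun h => ?_
  have := hneg₁ (k + 1)
  rw [sub_eq_zero.1 h] at this
  exact absurd this (not_lt.2 (mul_self_nonneg _))

end

section


/-! ### Orientation preserving maps which fix an axis -/

/-- The angle makes one full turn and may be a multiple of `π` only at the times `0`, `1 / 2` and
`1`. By the intermediate value theorem it passes through `π` exactly at the middle, and the two
halves of the time interval correspond to the two half turns. -/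
theorem sin_pos_of_half_turns {φ : ℝ → ℝ} (hφ : ContinuousOn φ (Icc 0 1)) {m : ℤ}
    (h0 : φ 0 = m * (2 * Real.pi)) (h1 : φ 1 - φ 0 = 2 * Real.pi)
    (hsin : ∀ t ∈ Icc (0 : ℝ) 1, t ≠ 0 → t ≠ 1 / 2 → t ≠ 1 → Real.sin (φ t) ≠ 0) :
    (∀ t ∈ Ioo (0 : ℝ) (1 / 2), 0 < Real.sin (φ t)) ∧
      ∀ t ∈ Ioo (1 / 2 : ℝ) 1, Real.sin (φ t) < 0 := by
  have hπ := Real.pi_pos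
  set ψ : ℝ → ℝ := fun t => φ t - φ 0 with hψ
  have hψc : ContinuousOn ψ (Icc 0 1) := hφ.sub continuousOn_const
  have hψs : ∀ t, Real.sin (φ t) = Real.sin (ψ t) := fun t => by
    rw [hψ, h0, Real.sin_sub_int_mul_two_pi]
  have hψ0 : ψ 0 = 0 := sub_self _
  have hψ1 : ψ 1 = 2 * Real.pi := h1
  have hne : ∀ t ∈ Icc (0 : ℝ) 1, t ≠ 0 → t ≠ 1 / 2 → t ≠ 1 → ∀ n : ℤ, ψ t ≠ n * Real.pi := by
    intro t ht a b c n h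
    refine hsin t ht a b c ?_
    rw [hψs, h, Real.sin_int_mul_pi]
  have ivt : ∀ x ∈ Icc (0 : ℝ) 1, ∀ y ∈ Icc (0 : ℝ) 1, ∀ z ∈ uIcc (ψ x) (ψ y),
      ∃ t ∈ uIcc x y, ψ t = z := by
    intro x hx y hy z hz
    exact intermediate_value_uIcc (hψc.mono (uIcc_subset_Icc hx hy)) hz
  have hmem : ∀ t, t ∈ Ioo (0 : ℝ) (1 / 2) → t ∈ Icc (0 : ℝ) 1 := fun t ht =>
    ⟨ht.1.le, by linarith [ht.2]⟩
  have hmem' : ∀ t, t ∈ Ioo (1 / 2 : ℝ) 1 → t ∈ Icc (0 : ℝ) 1 := fun t ht =>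
    ⟨by linarith [ht.1], ht.2.le⟩
  have hz : (0 : ℝ) ∈ Icc (0 : ℝ) 1 := left_mem_Icc.2 zero_le_one
  have ho : (1 : ℝ) ∈ Icc (0 : ℝ) 1 := right_mem_Icc.2 zero_le_one
  have hh : (1 / 2 : ℝ) ∈ Icc (0 : ℝ) 1 := by constructor <;> norm_num
  have b1 : ∀ t ∈ Ioo (0 : ℝ) (1 / 2), ψ t < Real.pi := by
    intro t ht
    by_contra! h
    obtain ⟨x, hx, hxπ⟩ := ivt 0 hz t (hmem t ht) Real.pi (by
      rw [hψ0, mem_uIcc]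
      exact Or.inl ⟨hπ.le, h⟩)
    rw [uIcc_of_le ht.1.le] at hx
    refine hne x ⟨hx.1, by linarith [hx.2, ht.2]⟩ ?_ ?_ ?_ 1 (by rw [hxπ]; simp)
    · rintro rfl
      rw [hψ0] at hxπ
      linarith
    · linarith [hx.2, ht.2]
    · linarith [hx.2, ht.2]
  have b2 : ∀ t ∈ Ioo (1 / 2 : ℝ) 1, Real.pi < ψ t := by
    intro t ht
    by_contra! h
    obtain ⟨x, hx, hxπ⟩ := ivt t (hmem' t ht) 1 ho Real.pi (by
      rw [hψ1, mem_uIcc]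
      exact Or.inl ⟨h, by linarith⟩)
    rw [uIcc_of_le ht.2.le] at hx
    refine hne x ⟨by linarith [hx.1, ht.1], hx.2⟩ ?_ ?_ ?_ 1 (by rw [hxπ]; simp)
    · linarith [hx.1, ht.1]
    · linarith [hx.1, ht.1]
    · rintro rfl
      rw [hψ1] at hxπ
      linarith
  have hhalf : ψ (1 / 2) = Real.pi := by
    have hI1 : Icc (0 : ℝ) (1 / 2) ⊆ Icc 0 1 := Icc_subset_Icc_right (by norm_num)
    have hI2 : Icc (1 / 2 : ℝ) 1 ⊆ Icc 0 1 := Icc_subset_Icc_left (by norm_num)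
    refine le_antisymm ?_ ?_
    · have hcl : (1 / 2 : ℝ) ∈ closure (Ioo (0 : ℝ) (1 / 2)) := by
        rw [closure_Ioo (by norm_num)]
        exact right_mem_Icc.2 (by norm_num)
      have := ((hψc _ hh).mono (Ioo_subset_Icc_self.trans hI1)).mem_closure_image hcl
      exact closure_minimal (by rintro _ ⟨t, ht, rfl⟩; exact (b1 t ht).le) isClosed_Iic this
    · have hcl : (1 / 2 : ℝ) ∈ closure (Ioo (1 / 2 : ℝ) 1) := by
        rw [closure_Ioo (by norm_num)]
        exact left_mem_Icc.2 (by norm_num)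
      have := ((hψc _ hh).mono (Ioo_subset_Icc_self.trans hI2)).mem_closure_image hcl
      exact closure_minimal (by rintro _ ⟨t, ht, rfl⟩; exact (b2 t ht).le) isClosed_Ici this
  constructor
  · intro t ht
    rw [hψs]
    refine Real.sin_pos_of_pos_of_lt_pi ?_ (b1 t ht)
    by_contra! h
    obtain ⟨x, hx, hx0⟩ := ivt t (hmem t ht) (1 / 2) hh 0 (by
      rw [hhalf, mem_uIcc]
      exact Or.inl ⟨h, hπ.le⟩)
    rw [uIcc_of_le ht.2.le] at hx
    refine hne x ⟨by linarith [hx.1, ht.1], by linarith [hx.2]⟩ ?_ ?_ ?_ 0 (by rw [hx0]; simp)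
    · linarith [hx.1, ht.1]
    · rintro rfl
      rw [hhalf] at hx0
      linarith
    · linarith [hx.2]
  · intro t ht
    have h2 : ψ t < 2 * Real.pi := by
      by_contra! h
      obtain ⟨x, hx, hx0⟩ := ivt (1 / 2) hh t (hmem' t ht) (2 * Real.pi) (by
        rw [hhalf, mem_uIcc]
        exact Or.inl ⟨by linarith, h⟩)
      rw [uIcc_of_le ht.1.le] at hx
      refine hne x ⟨by linarith [hx.1], by linarith [hx.2, ht.2]⟩ ?_ ?_ ?_ 2 (by rw [hx0]; simp)
      · linarith [hx.1]
      · rintro rfl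
        rw [hhalf] at hx0
        linarith
      · linarith [hx.2, ht.2]
    rw [hψs, ← Real.sin_sub_two_pi]
    exact Real.sin_neg_of_neg_of_neg_pi_lt (by linarith) (by linarith [b2 t ht])

/-- The circle of radius `s` about the origin, with the coordinates in the order `i`, `i + 1`. -/
def circle (i : Fin 2) (s t : ℝ) : Plane :=
  pt i (s * Real.cos (2 * Real.pi * t)) (s * Real.sin (2 * Real.pi * t))

theorem norm_sq_coord (i : Fin 2) (p : Plane) : ‖p‖ ^ 2 = p i ^ 2 + p (i + 1) ^ 2 := by
  rw [EuclideanSpace.real_norm_sq_eq, Fin.sum_univ_two]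
  rcases fin_two_eq i with rfl | rfl
  · rw [zero_add]
  · rw [one_add_one_fin_two, add_comm]

theorem norm_circle (i : Fin 2) {s : ℝ} (hs : 0 < s) (t : ℝ) : ‖circle i s t‖ = s := by
  rw [← sq_eq_sq₀ (norm_nonneg _) hs.le, norm_sq_coord i, circle, pt_fst, pt_snd]
  have := Real.sin_sq_add_cos_sq (2 * Real.pi * t)
  linear_combination s ^ 2 * this

/-- Applied to small circles, preservation of winding numbers gives a continuous angle of the image
curve which makes one full turn. -/
theorem PreservesOrientationAt.exists_angle {h : Plane → Plane} (hor : PreservesOrientationAt h 0)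
    (h0 : h 0 = 0) (i : Fin 2) : ∃ κ > 0, ∀ s, 0 < s → s < κ → ∃ φ : ℝ → ℝ,
      ContinuousOn φ (Icc 0 1) ∧ φ 1 - φ 0 = 2 * Real.pi ∧ ∀ t ∈ Icc (0 : ℝ) 1,
        h (circle i s t) i = ‖h (circle i s t)‖ * Real.cos (φ t) ∧
        h (circle i s t) (i + 1) = ‖h (circle i s t)‖ * Real.sin (φ t) := by
  obtain ⟨κ, hκ, hor⟩ := hor
  refine ⟨κ, hκ, fun s hs hsκ => ?_⟩
  have hcont : Continuous (circle i s) := (continuous_pt i).comp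
    (f := fun t => (s * Real.cos (2 * Real.pi * t), s * Real.sin (2 * Real.pi * t))) (by fun_prop)
  have hloop : circle i s 0 = circle i s 1 := by
    simp [circle]
  have hmem : ∀ t ∈ Icc (0 : ℝ) 1, circle i s t ∈ Metric.ball 0 κ ∧ circle i s t ≠ 0 := by
    intro t _
    rw [mem_ball_zero_iff, norm_circle i hs, ← norm_ne_zero_iff, norm_circle i hs]
    exact ⟨hsκ, hs.ne'⟩
  have key := hor (circle i s) hcont.continuousOn hloop hmem
  simp only [h0] at key
  have hz : ∀ k, (0 : Plane) k = 0 := fun k => rfl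
  rcases fin_two_eq i with rfl | rfl
  · obtain ⟨θ, h1, h2, h3⟩ := key 1 ⟨fun t => 2 * Real.pi * t, by fun_prop, fun t _ => by
      rw [sub_zero, norm_circle 0 hs, hz, hz, sub_zero, sub_zero]
      have e := pt_snd 0 (s * Real.cos (2 * Real.pi * t)) (s * Real.sin (2 * Real.pi * t))
      rw [zero_add] at e
      exact ⟨pt_fst .., e⟩, by simp⟩
    refine ⟨θ, h1, by simpa using h3, fun t ht => ?_⟩
    simpa [hz] using h2 t ht
  -- For `i = 1` the coordinates are exchanged, so the circle runs clockwise and the polar angle is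
  -- replaced by its complement `π / 2 - θ`.
  · obtain ⟨θ, h1, h2, h3⟩ := key (-1) ⟨fun t => Real.pi / 2 - 2 * Real.pi * t, by fun_prop,
      fun t _ => by
        rw [sub_zero, norm_circle 1 hs, hz, hz, sub_zero, sub_zero, Real.cos_pi_div_two_sub,
          Real.sin_pi_div_two_sub]
        have e := pt_snd 1 (s * Real.cos (2 * Real.pi * t)) (s * Real.sin (2 * Real.pi * t))
        rw [one_add_one_fin_two] at e
        exact ⟨e, pt_fst ..⟩, by simp⟩
    refine ⟨fun t => Real.pi / 2 - θ t, continuousOn_const.sub h1, ?_, fun t ht => ?_⟩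
    · push_cast at h3
      linarith
    · rw [Real.cos_pi_div_two_sub, Real.sin_pi_div_two_sub, one_add_one_fin_two]
      have := h2 t ht
      simp only [hz, sub_zero] at this
      exact this.symm

theorem exists_circle_pos {i : Fin 2} {p : Plane} (hp : 0 < p (i + 1)) :
    ∃ t ∈ Ioo (0 : ℝ) (1 / 2), p = circle i ‖p‖ t := by
  have hsq := norm_sq_coord i p
  have hn : 0 < ‖p‖ := norm_pos_iff.2 fun h => by rw [h] at hp; exact lt_irrefl _ hp
  have hlt : |p i| < ‖p‖ := by
    refine abs_lt_of_sq_lt_sq ?_ hn.le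
    nlinarith
  have h1 := abs_lt.1 hlt
  have hd1 : -1 < p i / ‖p‖ := by
    rw [lt_div_iff₀ hn]
    linarith
  have hd2 : p i / ‖p‖ < 1 := by
    rw [div_lt_iff₀ hn]
    linarith
  have hπ := Real.pi_pos
  have e : 2 * Real.pi * (Real.arccos (p i / ‖p‖) / (2 * Real.pi)) = Real.arccos (p i / ‖p‖) := by
    field_simp
  refine ⟨Real.arccos (p i / ‖p‖) / (2 * Real.pi), ⟨by
    have := Real.arccos_pos.2 hd2
    positivity, ?_⟩, ?_⟩
  · rw [div_lt_iff₀ (by positivity)]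
    have := Real.arccos_lt_pi.2 hd1
    linarith
  · rw [circle, e]
    refine plane_ext i ?_ ?_
    · rw [pt_fst, Real.cos_arccos hd1.le hd2.le]
      field_simp
    · rw [pt_snd, Real.sin_arccos]
      have : 1 - (p i / ‖p‖) ^ 2 = (p (i + 1) / ‖p‖) ^ 2 := by
        field_simp
        linarith
      rw [this, Real.sqrt_sq (by positivity)]
      field_simp

theorem exists_circle_neg {i : Fin 2} {p : Plane} (hp : p (i + 1) < 0) :
    ∃ t ∈ Ioo (1 / 2 : ℝ) 1, p = circle i ‖p‖ t := by
  -- Reflection in the axis reduces the lower half plane to the upper one, with `t` replaced by `1 -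
  -- t`.
  set q := pt i (p i) (-p (i + 1)) with hq
  have hqp : ‖q‖ = ‖p‖ := by
    rw [← sq_eq_sq₀ (norm_nonneg _) (norm_nonneg _), norm_sq_coord i, norm_sq_coord i, hq, pt_fst,
      pt_snd, neg_sq]
  obtain ⟨t, ht, h⟩ := exists_circle_pos (i := i) (p := q) (by rw [hq, pt_snd]; linarith)
  rw [hqp] at h
  refine ⟨1 - t, ⟨by linarith [ht.2], by linarith [ht.1]⟩, ?_⟩
  have h1 := congrArg (fun p : Plane => p i) h
  have h2 := congrArg (fun p : Plane => p (i + 1)) h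
  simp only [hq, circle, pt_fst, pt_snd] at h1 h2
  have e : 2 * Real.pi * (1 - t) = 2 * Real.pi - 2 * Real.pi * t := by ring
  refine plane_ext i ?_ ?_
  · rw [circle, pt_fst, e, Real.cos_two_pi_sub, h1]
  · rw [circle, pt_snd, e, Real.sin_two_pi_sub]
    linarith

/-- An orientation preserving map which fixes both half axes of `{p (i + 1) = 0}` and maps the
complement of this axis to itself preserves the sides of this axis. -/
theorem PreservesOrientationAt.preserves_sides {h : Plane → Plane}
    (hor : PreservesOrientationAt h 0) (h0 : h 0 = 0) (i : Fin 2) {N : Set Plane} (hN : N ∈ 𝓝 0)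
    (hax : ∀ p ∈ N, p (i + 1) = 0 → h p (i + 1) = 0) (hpos : ∀ p ∈ N, p (i + 1) = 0 → 0 < p i →
      0 < h p i) (hoff : ∀ p ∈ N, p (i + 1) ≠ 0 → h p (i + 1) ≠ 0) :
    ∀ᶠ p in 𝓝 (0 : Plane), (0 < p (i + 1) → 0 < h p (i + 1)) ∧
      (p (i + 1) < 0 → h p (i + 1) < 0) := by
  obtain ⟨κ, hκ, hang⟩ := hor.exists_angle h0 i
  obtain ⟨κ', hκ', hball⟩ := Metric.mem_nhds_iff.1 hN
  have hπ := Real.pi_pos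
  have key : ∀ s, 0 < s → s < min κ κ' →
      (∀ t ∈ Ioo (0 : ℝ) (1 / 2), 0 < h (circle i s t) (i + 1)) ∧
      ∀ t ∈ Ioo (1 / 2 : ℝ) 1, h (circle i s t) (i + 1) < 0 := by
    intro s hs hsκ
    have hcN : ∀ t, circle i s t ∈ N := fun t => hball (by
      rw [mem_ball_zero_iff, norm_circle i hs]
      exact hsκ.trans_le (min_le_right _ _))
    obtain ⟨φ, h1, h2, h3⟩ := hang s hs (hsκ.trans_le (min_le_left _ _))
    have hsin : ∀ t ∈ Icc (0 : ℝ) 1, t ≠ 0 → t ≠ 1 / 2 → t ≠ 1 → Real.sin (φ t) ≠ 0 := by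
      intro t ht n0 n1 n2 hz
      refine hoff _ (hcN t) ?_ (by rw [(h3 t ht).2, hz, mul_zero])
      rw [circle, pt_snd]
      refine mul_ne_zero hs.ne' ?_
      rcases lt_or_gt_of_ne n1 with h | h
      · have ht0 : 0 < t := lt_of_le_of_ne ht.1 n0.symm
        exact (Real.sin_pos_of_pos_of_lt_pi (by positivity) (by nlinarith)).ne'
      · have ht1 : t < 1 := lt_of_le_of_ne ht.2 n2
        rw [← Real.sin_sub_two_pi]
        exact (Real.sin_neg_of_neg_of_neg_pi_lt (by nlinarith) (by nlinarith)).ne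
    have hz : (0 : ℝ) ∈ Icc (0 : ℝ) 1 := left_mem_Icc.2 zero_le_one
    have e1 : circle i s 0 (i + 1) = 0 := by simp [circle]
    have e2 : 0 < circle i s 0 i := by simpa [circle] using hs
    obtain ⟨c1, c2⟩ := h3 0 hz
    have hu := hpos _ (hcN 0) e1 e2
    rw [hax _ (hcN 0) e1] at c2
    have hn : ‖h (circle i s 0)‖ ≠ 0 := fun hn => by
      rw [c1, hn, zero_mul] at hu
      exact lt_irrefl _ hu
    have hn' : 0 < ‖h (circle i s 0)‖ := lt_of_le_of_ne (norm_nonneg _) hn.symm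
    have hs0 : Real.sin (φ 0) = 0 := (mul_eq_zero.1 c2.symm).resolve_left hn
    -- The circle starts on the positive half axis, which `h` maps into itself; hence the initial
    -- angle is a multiple of `2π`.
    have hc0 : Real.cos (φ 0) = 1 := by
      have h5 := Real.sin_sq_add_cos_sq (φ 0)
      rw [c1] at hu
      have h6 := pos_of_mul_pos_right hu hn'.le
      rw [hs0] at h5
      nlinarith
    obtain ⟨m, hm⟩ := (Real.cos_eq_one_iff _).1 hc0
    obtain ⟨r1, r2⟩ := sin_pos_of_half_turns h1 hm.symm h2 hsin
    refine ⟨fun t ht => ?_, fun t ht => ?_⟩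
    · have htI : t ∈ Icc (0 : ℝ) 1 := ⟨ht.1.le, by linarith [ht.2]⟩
      have h4 := (h3 t htI).2
      have h5 := r1 t ht
      have h6 : h (circle i s t) (i + 1) ≠ 0 := hoff _ (hcN t) (by
        rw [circle, pt_snd]
        exact (mul_pos hs (Real.sin_pos_of_pos_of_lt_pi (by have := ht.1; positivity)
          (by nlinarith [ht.2]))).ne')
      exact lt_of_le_of_ne (by rw [h4]; positivity) h6.symm
    · have htI : t ∈ Icc (0 : ℝ) 1 := ⟨by linarith [ht.1], ht.2.le⟩
      have h4 := (h3 t htI).2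
      have h5 := r2 t ht
      have h6 : h (circle i s t) (i + 1) ≠ 0 := by
        refine fun hz => hsin t htI (by linarith [ht.1]) ht.1.ne' ht.2.ne ?_
        by_contra hne
        have hn0 : ‖h (circle i s t)‖ = 0 := by
          rw [hz] at h4
          exact (mul_eq_zero.1 h4.symm).resolve_right hne
        refine hoff _ (hcN t) ?_ hz
        rw [circle, pt_snd, ← Real.sin_sub_two_pi]
        exact (mul_neg_of_pos_of_neg hs (Real.sin_neg_of_neg_of_neg_pi_lt (by nlinarith [ht.2])
          (by nlinarith [ht.1]))).ne
      exact lt_of_le_of_ne (by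
        rw [h4]
        exact mul_nonpos_of_nonneg_of_nonpos (norm_nonneg _) h5.le) h6
  filter_upwards [Metric.ball_mem_nhds (0 : Plane) (lt_min hκ hκ')] with p hp
  rw [mem_ball_zero_iff] at hp
  refine ⟨fun hv => ?_, fun hv => ?_⟩
  · have hn : 0 < ‖p‖ := norm_pos_iff.2 fun h => by rw [h] at hv; exact lt_irrefl _ hv
    obtain ⟨t, ht, he⟩ := exists_circle_pos hv
    rw [he]
    exact (key _ hn hp).1 t ht
  · have hn : 0 < ‖p‖ := norm_pos_iff.2 fun h => by rw [h] at hv; exact lt_irrefl _ hv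
    obtain ⟨t, ht, he⟩ := exists_circle_neg hv
    rw [he]
    exact (key _ hn hp).2 t ht

end

section


variable {U : Set Plane} {r : ℕ} {Z Z' : Omega U r} {i : Fin 2} {ε sX sY sX' sY' : ℝ}
  {mX MX mY MY ρ mX' MX' mY' MY' ρ' : ℝ}

/-! ### The sliding axis under an equivalence -/

/-- Bridges the equivalence and the topological description: an orbit is travelled as a trajectory,
mapped, and read again as an orbit of the second field. -/
theorem GraphOrbit.exists_map {c : LocalChart Z i ε ε sX sY mX MX mY MY ρ}
    (c' : LocalChart Z' i ε ε sX' sY' mX' MX' mY' MY' ρ') {h : Plane → Plane} {W : Set Plane}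
    (hm : MapsTrajectories h W Z Z') {a b : ℝ} {δ : ℝ → Plane} (hab : a < b)
    (hδ : GraphOrbit c a b δ) (hbox : MapsTo δ (Icc a b) (box ρ)) (hW : MapsTo δ (Icc a b) W)
    (hbox' : ∀ t ∈ Icc a b, h (δ t) ∈ box ρ') : ∃ (c₀ d₀ : ℝ) (τ : ℝ → ℝ), c₀ < d₀ ∧
      StrictMonoOn τ (Icc c₀ d₀) ∧ τ '' Icc c₀ d₀ = Icc a b ∧
      GraphOrbit c' c₀ d₀ (fun s => h (δ (τ s))) := by
  obtain ⟨c₀, d₀, σ, hcd, hσ, himg, ht⟩ := hδ.exists_trajectory hab hbox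
  have h1 := (endpoints_of_image hab hcd hσ himg).1
  obtain ⟨c₁, d₁, σ', hcd', hσ', himg', ht'⟩ := hm c₀ d₀ _ hcd ht fun t ht => hW (h1 ht)
  have h2 := (endpoints_of_image hcd hcd' hσ' himg').1
  refine ⟨c₁, d₁, fun s => σ (σ' s), hcd', fun x hx y hy hxy => hσ (h2 hx) (h2 hy) (hσ' hx hy hxy),
    ?_, c'.graphOrbit_of_trajectory hcd' ht' fun t ht => hbox' _ (h1 (h2 ht))⟩
  rw [← himg, ← himg', image_image]

/-- The coordinate `i` is strictly monotone, so the curve cannot spend time in `Σ_i`. -/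
theorem GraphOrbit.snd_eq_zero_of_switching {c : LocalChart Z i ε ε sX sY mX MX mY MY ρ} {a b : ℝ}
    {δ : ℝ → Plane} (hab : a < b) (hδ : GraphOrbit c a b δ)
    (hsw : ∀ t ∈ Icc a b, δ t ∈ switching) {t : ℝ} (ht : t ∈ Icc a b) : δ t (i + 1) = 0 := by
  by_contra hne
  have h1 : ∀ᶠ s in 𝓝[Icc a b] t, δ s i = 0 := by
    filter_upwards [eventually_nhdsWithin_of_continuousOn hδ.cont ht (eventually_coord_ne hne),
      self_mem_nhdsWithin] with s h1 h2
    exact ((mem_switching i).1 (hsw s h2)).resolve_right h1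
  have := nhdsWithin_diff_neBot hab ht
  have h2 : ∀ᶠ s in 𝓝[Icc a b \ {t}] t, δ s i = 0 := nhdsWithin_mono t sdiff_subset h1
  obtain ⟨s, hs, hs'⟩ := (h2.and self_mem_nhdsWithin).exists
  refine hs'.2 (hδ.mono.injOn hs'.1 ht ?_)
  simp only [hs, h1.self_of_nhdsWithin ht]

/-- An equivalence sends the sliding axis to the sliding axis, preserving its orientation. -/
theorem exists_axis_strictMonoOn (c : LocalChart Z i ε ε sX sY mX MX mY MY ρ)
    (c' : LocalChart Z' i ε ε sX' sY' mX' MX' mY' MY' ρ') (hs : sX ≠ sY)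
    {h : OpenPartialHomeomorph Plane Plane} (h0 : 0 ∈ h.source) (hz : h 0 = 0)
    (hsw : ∀ p ∈ h.source, h p ∈ switching ↔ p ∈ switching)
    (hm : MapsTrajectories h h.source Z Z') : ∃ κ > 0,
      (∀ u ∈ Icc (-κ) κ, pt i u 0 ∈ h.source ∧ h (pt i u 0) (i + 1) = 0) ∧
      StrictMonoOn (fun u => h (pt i u 0) i) (Icc (-κ) κ) := by
  obtain ⟨κ, hκ, hsub⟩ := exists_box_subset (inter_mem (box_mem_nhds c.ρ_pos)
    (OpenPartialHomeomorph.preimage_mem_nhds_zero h h0 hz (box_mem_nhds c'.ρ_pos)))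
  have hsub' : ∀ u ∈ Icc (-κ) κ, pt i u 0 ∈ box ρ ∩ (h.source ∩ h ⁻¹' box ρ') := fun u hu =>
    hsub κ le_rfl (pt_mem_box.2 ⟨abs_le.2 hu, by simpa using hκ.le⟩)
  have hεI : ∀ t ∈ Icc (-κ) κ, ε * t ∈ Icc (-κ) κ := fun t ht => by
    rw [mem_Icc, ← abs_le, abs_mul, abs_eq_one_of_sign c.εX_sign, one_mul]
    exact abs_le.2 ht
  set δ : ℝ → Plane := fun t => pt i (ε * t) 0 with hδ
  have hδi : ∀ t, δ t i = ε * t := fun t => pt_fst ..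
  have hδi' : ∀ t, δ t (i + 1) = 0 := fun t => pt_snd ..
  have hcont : Continuous δ := (continuous_pt i).comp (f := fun t => (ε * t, (0 : ℝ)))
    ((continuous_const.mul continuous_id).prodMk continuous_const)
  -- The axis `Σ_{i+1}` is an orbit through the origin, and it lies in the switching set; so must
  -- its image, which forces it into the same axis.
  have ho : GraphOrbit c (-κ) κ δ := by
    refine ⟨hcont.continuousOn, ?_, fun t _ h => ?_, fun t _ h => ?_, fun _ t _ _ => ?_,
      fun h => absurd h hs, fun h => absurd h hs, fun h => absurd h hs⟩
    · simp only [hδi, ← mul_assoc, mul_self_sign c.εX_sign, one_mul]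
      exact strictMonoOn_id
    · simp [hδi'] at h
    · simp [hδi'] at h
    · exact Eventually.of_forall hδi'
  obtain ⟨c₀, d₀, τ, hcd, hτ, himg, hg⟩ := ho.exists_map c' hm (by linarith)
    (fun t ht => (hsub' _ (hεI t ht)).1) (fun t ht => (hsub' _ (hεI t ht)).2.1)
    fun t ht => (hsub' _ (hεI t ht)).2.2
  have hτm : ∀ s ∈ Icc c₀ d₀, τ s ∈ Icc (-κ) κ := fun s hs => himg ▸ mem_image_of_mem τ hs
  have hsnd : ∀ s ∈ Icc c₀ d₀, h (δ (τ s)) (i + 1) = 0 := fun s hs =>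
    hg.snd_eq_zero_of_switching hcd (fun t ht => (hsw _ (hsub' _ (hεI _ (hτm t ht))).2.1).2
      ((mem_switching i).2 (Or.inr (hδi' _)))) hs
  have hpre : ∀ u ∈ Icc (-κ) κ, ∃ s ∈ Icc c₀ d₀, ε * τ s = u := by
    intro u hu
    obtain ⟨s, hs, hsu⟩ : ε * u ∈ τ '' Icc c₀ d₀ := himg ▸ hεI u hu
    exact ⟨s, hs, by rw [hsu, ← mul_assoc, mul_self_sign c.εX_sign, one_mul]⟩
  refine ⟨κ, hκ, fun u hu => ⟨(hsub' u hu).2.1, ?_⟩, fun u hu v hv huv => ?_⟩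
  · obtain ⟨s, hs, rfl⟩ := hpre u hu
    exact hsnd s hs
  · obtain ⟨s, hs, rfl⟩ := hpre u hu
    obtain ⟨t, ht, rfl⟩ := hpre v hv
    have h1 := fun x hx y hy => hg.mono.lt_iff_lt (a := x) (b := y) hx hy
    have h2 := fun x hx y hy => hτ.lt_iff_lt (a := x) (b := y) hx hy
    simp only [hδ] at h1
    rcases c.εX_sign with hε | hε <;> simp only [hε] at huv h1 ⊢
    · have := (h1 s hs t ht).2 ((h2 s hs t ht).1 (by linarith))
      linarith
    · have := (h1 t ht s hs).2 ((h2 t ht s hs).1 (by linarith))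
      linarith

/-- An orientation preserving equivalence preserves the sides of the sliding axis. -/
theorem eventually_sides (c : LocalChart Z i ε ε sX sY mX MX mY MY ρ)
    (c' : LocalChart Z' i ε ε sX' sY' mX' MX' mY' MY' ρ') (hs : sX ≠ sY)
    {h : OpenPartialHomeomorph Plane Plane} (h0 : 0 ∈ h.source) (hz : h 0 = 0)
    (hor : PreservesOrientationAt h 0)
    (hsw : ∀ p ∈ h.source, h p ∈ switching ↔ p ∈ switching)
    (hm : MapsTrajectories h h.source Z Z') :
    ∀ᶠ p in 𝓝 (0 : Plane), (0 < p (i + 1) → 0 < h p (i + 1)) ∧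
      (p (i + 1) < 0 → h p (i + 1) < 0) := by
  obtain ⟨κ, hκ, hax, hmono⟩ := exists_axis_strictMonoOn c c' hs h0 hz hsw hm
  set χ : ℝ → ℝ := fun u => h (pt i u 0) i with hχ
  have hχ0 : χ 0 = 0 := by simp [hχ, hz]
  have hpt : Continuous fun u : ℝ => pt i u 0 := (continuous_pt i).comp (f := fun u => (u, (0 : ℝ)))
    (continuous_id.prodMk continuous_const)
  have hχc : ContinuousOn χ (Icc (-κ) κ) := (continuous_coord i).comp_continuousOn
    (h.continuousOn.comp hpt.continuousOn fun u hu => (hax u hu).1)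
  have hk0 : (0 : ℝ) ∈ Icc (-κ) κ := ⟨by linarith, hκ.le⟩
  have hkl : -κ ∈ Icc (-κ) κ := left_mem_Icc.2 (by linarith)
  have hkr : κ ∈ Icc (-κ) κ := right_mem_Icc.2 (by linarith)
  have hl : χ (-κ) < 0 := hχ0 ▸ hmono hkl hk0 (by linarith)
  have hr : 0 < χ κ := hχ0 ▸ hmono hk0 hkr hκ
  obtain ⟨η, hη, hηsub⟩ := exists_box_subset
    (OpenPartialHomeomorph.preimage_mem_nhds_zero h h0 hz
      (box_mem_nhds (lt_min (neg_pos.2 hl) hr)))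
  have hN : box (min η κ) ∈ 𝓝 (0 : Plane) := box_mem_nhds (lt_min hη hκ)
  have hp : ∀ p ∈ box (min η κ), p (i + 1) = 0 → p i ∈ Icc (-κ) κ ∧ p = pt i (p i) 0 :=
    fun p hp hp0 => ⟨abs_le.1 ((hp i).trans (min_le_right _ _)), by
      rw [← hp0]
      exact (pt_eta i p).symm⟩
  refine hor.preserves_sides hz i hN (fun p hpN hp0 => ?_) (fun p hpN hp0 hpi => ?_)
    fun p hpN hp0 hq0 => ?_
  · obtain ⟨h1, h2⟩ := hp p hpN hp0
    rw [h2]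
    exact (hax _ h1).2
  · obtain ⟨h1, h2⟩ := hp p hpN hp0
    have h3 : χ 0 < χ (p i) := hmono hk0 h1 hpi
    rw [hχ0] at h3
    rwa [h2]
  -- The image of the axis covers a neighbourhood of the origin in the axis, by the intermediate
  -- value theorem. By injectivity no point off the axis can be mapped there.
  · obtain ⟨hps, hpb⟩ := hηsub _ (min_le_left η κ) hpN
    have hb := hpb i
    have h1 : h p i ∈ Icc (χ (-κ)) (χ κ) := by
      have h2 := abs_le.1 (hb.trans (min_le_left _ _))
      have h3 := abs_le.1 (hb.trans (min_le_right _ _))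
      exact ⟨by linarith, h3.2⟩
    obtain ⟨u, hu, hup⟩ := intermediate_value_Icc (by linarith : -κ ≤ κ) hχc h1
    have : h (pt i u 0) = h p := plane_ext i hup (by rw [(hax u hu).2, hq0])
    have := h.injOn (hax u hu).1 hps this
    rw [← this, pt_snd] at hp0
    exact hp0 rfl

end

section


variable {U : Set Plane} {r : ℕ} {Z Z' : Omega U r} {i : Fin 2} {ε : ℝ}
  {mX MX mY MY ρ mX' MX' mY' MY' ρ' : ℝ}

/-! ### The first return to the sliding axis -/

/-- The label of the leaf through a point of the half-plane `0 < ς * p (i + 1)`. -/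
def LocalChart.sideLab {sX sY : ℝ} (c : LocalChart Z i ε ε sX sY mX MX mY MY ρ) (ς : ℝ)
    (p : Plane) : ℝ :=
  if 0 ≤ ς * p i then c.X.lab p else c.Y.lab p

theorem LocalChart.continuous_sideLab {sX sY : ℝ} (c : LocalChart Z i ε ε sX sY mX MX mY MY ρ)
    {ς : ℝ} (hς : ς = 1 ∨ ς = -1) : Continuous (c.sideLab ς) := by
  refine Continuous.if_le c.X.continuous_lab c.Y.continuous_lab continuous_const
    (continuous_const.mul (continuous_coord i)) fun p hp => ?_
  have h0 : p i = 0 := (mul_eq_zero.1 hp.symm).resolve_left (by rcases hς with h | h <;> simp [h])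
  simp only [FieldChart.lab, h0, Foliation.H_zero]

/-- The exceptional set allows for the instant at which a leaf of one field continues into a leaf of
the other, where the label is only known to be continuous. -/
theorem eq_of_locally_constant_off_point {f : ℝ → ℝ} {a b : ℝ} (hab : a ≤ b) {s : Set ℝ}
    (hs : s.Countable) (hf : ContinuousOn f (Icc a b))
    (hl : ∀ t ∈ Ioo a b, t ∉ s → ∀ᶠ x in 𝓝 t, f x = f t) : f a = f b := by
  have := MeasureTheory.integral_eq_of_hasDerivAt_off_countable_of_le f (fun _ => 0) hab hs hf
    (fun t ht => (hasDerivAt_const t (f t)).congr_of_eventuallyEq (hl t ht.1 ht.2))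
    intervalIntegrable_const
  simp only [intervalIntegral.integral_zero] at this
  linarith

/-- On one side of `Σ_{i+1}` the labels of both foliations agree along `Σ_i`, as both equal the
height there. Hence the combined label is continuous and survives the crossing of `Σ_i`, which
happens at most once. -/
theorem GraphOrbit.sideLab_eq {sX sY : ℝ} {c : LocalChart Z i ε ε sX sY mX MX mY MY ρ} {a b : ℝ}
    {δ : ℝ → Plane} {ς : ℝ} (hς : ς = 1 ∨ ς = -1) (hab : a ≤ b) (hδ : GraphOrbit c a b δ)
    (hside : ∀ t ∈ Icc a b, 0 < ς * δ t (i + 1)) : c.sideLab ς (δ a) = c.sideLab ς (δ b) := by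
  refine eq_of_locally_constant_off_point (f := fun t => c.sideLab ς (δ t))
    (s := {t | t ∈ Icc a b ∧ δ t i = 0}) hab ?_
    ((c.continuous_sideLab hς).comp_continuousOn hδ.cont) fun t ht hts => ?_
  · refine Set.Subsingleton.countable fun x hx y hy => hδ.mono.injOn hx.1 hy.1 ?_
    simp only [hx.2, hy.2]
  · have htI : t ∈ Icc a b := Ioo_subset_Icc_self ht
    have hn : 𝓝[Icc a b] t = 𝓝 t := nhdsWithin_eq_nhds.2 (Icc_mem_nhds ht.1 ht.2)
    have hne : ς * δ t i ≠ 0 := mul_ne_zero (by rcases hς with h | h <;> simp [h])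
      fun h => hts ⟨htI, h⟩
    have hct : ContinuousAt δ t := hδ.cont.continuousAt (Icc_mem_nhds ht.1 ht.2)
    have hci : ContinuousAt (fun s => ς * δ s i) t :=
      continuousAt_const.mul ((continuous_coord i).continuousAt.comp hct)
    have hprod : δ t i * δ t (i + 1) = (ς * δ t i) * (ς * δ t (i + 1)) := by
      have := mul_self_sign hς
      linear_combination (-(δ t i * δ t (i + 1))) * this
    rcases hne.lt_or_gt with h | h
    · have h1 := hδ.neg t htI (hprod ▸ mul_neg_of_neg_of_pos h (hside t htI))
      rw [hn] at h1
      filter_upwards [h1, hci.eventually (gt_mem_nhds h)] with x hx hx'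
      rw [LocalChart.sideLab, LocalChart.sideLab, if_neg hx'.not_ge, if_neg h.not_ge, hx]
    · have h1 := hδ.pos t htI (hprod ▸ mul_pos h (hside t htI))
      rw [hn] at h1
      filter_upwards [h1, hci.eventually (lt_mem_nhds h)] with x hx hx'
      rw [LocalChart.sideLab, LocalChart.sideLab, if_pos hx'.le, if_pos h.le, hx]

/-- The leaf labelled `k`, in the half-plane `0 < ς * p (i + 1)`, as a graph over `Σ_{i+1}`. -/
def LocalChart.leaf {sX sY : ℝ} (c : LocalChart Z i ε ε sX sY mX MX mY MY ρ) (ς k u : ℝ) : Plane :=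
  pt i u (if 0 ≤ ς * u then c.X.fol.W u k else c.Y.fol.W u k)

theorem LocalChart.continuous_leaf {sX sY : ℝ} (c : LocalChart Z i ε ε sX sY mX MX mY MY ρ)
    {ς : ℝ} (hς : ς = 1 ∨ ς = -1) (k : ℝ) : Continuous (c.leaf ς k) := by
  have h : ∀ W : ℝ → ℝ → ℝ, Continuous (Function.uncurry W) → Continuous fun u => W u k :=
    fun W hW => hW.comp (f := fun u => (u, k)) (continuous_id.prodMk continuous_const)
  refine (continuous_pt i).comp (f := fun u => (u, _)) (continuous_id.prodMk ?_)
  refine Continuous.if_le (h _ c.X.fol.continuous_W) (h _ c.Y.fol.continuous_W) continuous_const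
    (continuous_const.mul continuous_id) fun u hu => ?_
  have h0 : u = 0 := (mul_eq_zero.1 hu.symm).resolve_left (by rcases hς with h | h <;> simp [h])
  simp only [h0, Foliation.W_zero]

section Transient

variable (c : LocalChart Z i ε ε (-1) 1 mX MX mY MY ρ)

theorem Foliation.W_pos_iff {F : ℝ → ℝ → ℝ} {m M : ℝ} (f : Foliation F (-1) m M) {u k : ℝ} :
    0 < f.W u k ↔ f.K u < k := by
  rw [← (f.strictMono_H u).lt_iff_lt, f.H_W, f.H_axis_of_neg_one rfl]

theorem Foliation.W_neg_iff {F : ℝ → ℝ → ℝ} {m M : ℝ} (f : Foliation F (-1) m M) {u k : ℝ} :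
    f.W u k < 0 ↔ k < f.K u := by
  rw [← (f.strictMono_H u).lt_iff_lt, f.H_W, f.H_axis_of_neg_one rfl]

theorem Foliation.W_pos_iff' {F : ℝ → ℝ → ℝ} {m M : ℝ} (f : Foliation F 1 m M) {u k : ℝ} :
    0 < f.W u k ↔ -k < f.K u := by
  rw [← (f.strictMono_H u).lt_iff_lt, f.H_W, f.H_axis_of_one rfl, neg_lt]

theorem Foliation.W_neg_iff' {F : ℝ → ℝ → ℝ} {m M : ℝ} (f : Foliation F 1 m M) {u k : ℝ} :
    f.W u k < 0 ↔ f.K u < -k := by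
  rw [← (f.strictMono_H u).lt_iff_lt, f.H_W, f.H_axis_of_one rfl, lt_neg]

theorem LocalChart.leaf_fst {sX sY : ℝ} (c : LocalChart Z i ε ε sX sY mX MX mY MY ρ) (ς k u : ℝ) :
    c.leaf ς k u i = u := pt_fst ..

theorem LocalChart.leaf_snd {sX sY : ℝ} (c : LocalChart Z i ε ε sX sY mX MX mY MY ρ) (ς k u : ℝ) :
    c.leaf ς k u (i + 1) = if 0 ≤ ς * u then c.X.fol.W u k else c.Y.fol.W u k := pt_snd ..

/-- The leaf labelled `k` stays in its half-plane between its end points. -/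
theorem LocalChart.leaf_side {ς k u : ℝ} (hς : ς = 1 ∨ ς = -1)
    (h1 : ς * c.Y.fol.K.symm (-k) < ς * u) (h2 : ς * u < ς * c.X.fol.K.symm k) :
    0 < ς * c.leaf ς k u (i + 1) := by
  rw [c.leaf_snd]
  rcases hς with rfl | rfl
  · simp only [one_mul] at h1 h2 ⊢
    rw [OrderIso.symm_apply_lt] at h1
    rw [OrderIso.lt_symm_apply] at h2
    split_ifs
    · exact c.X.fol.W_pos_iff.2 h2
    · exact c.Y.fol.W_pos_iff'.2 h1
  · simp only [neg_mul, one_mul, neg_lt_neg_iff] at h1 h2 ⊢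
    rw [OrderIso.lt_symm_apply] at h1
    rw [OrderIso.symm_apply_lt] at h2
    refine neg_pos.2 ?_
    split_ifs
    · exact c.X.fol.W_neg_iff.2 h2
    · exact c.Y.fol.W_neg_iff'.2 h1

theorem LocalChart.graphOrbit_leaf {ς k a b : ℝ} (hς : ς = 1 ∨ ς = -1)
    (hside : ∀ t ∈ Icc a b, 0 < ς * c.leaf ς k (ε * t) (i + 1)) :
    GraphOrbit c a b fun t => c.leaf ς k (ε * t) := by
  have hlab : ∀ u, 0 ≤ ς * u → c.X.lab (c.leaf ς k u) = k := fun u hu => by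
    rw [FieldChart.lab, c.leaf_fst, c.leaf_snd, if_pos hu, c.X.fol.H_W]
  have hlab' : ∀ u, ς * u < 0 → c.Y.lab (c.leaf ς k u) = k := fun u hu => by
    rw [FieldChart.lab, c.leaf_fst, c.leaf_snd, if_neg hu.not_ge, c.Y.fol.H_W]
  have hprod : ∀ p : Plane, p i * p (i + 1) = (ς * p i) * (ς * p (i + 1)) := fun p => by
    have := mul_self_sign hς
    linear_combination (-(p i * p (i + 1))) * this
  have hci : Continuous fun t : ℝ => ς * (ε * t) := by fun_prop
  have hne : (-1 : ℝ) ≠ 1 := by norm_num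
  refine ⟨((c.continuous_leaf hς k).comp (continuous_const.mul continuous_id)).continuousOn, ?_,
    fun t ht h => ?_, fun t ht h => ?_, fun _ t ht h => ?_, fun h => absurd h hne,
    fun h => absurd h hne, fun h => absurd h hne⟩
  · simp only [c.leaf_fst, ← mul_assoc, mul_self_sign c.εX_sign, one_mul]
    exact strictMonoOn_id
  · rw [hprod, c.leaf_fst] at h
    have h1 := pos_of_mul_pos_left h (hside t ht).le
    filter_upwards [nhdsWithin_le_nhds (hci.continuousAt.eventually (lt_mem_nhds h1))] with s hs
    rw [hlab _ hs.le, hlab _ h1.le]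
  · rw [hprod, c.leaf_fst] at h
    have h1 := neg_of_mul_neg_left h (hside t ht).le
    filter_upwards [nhdsWithin_le_nhds (hci.continuousAt.eventually (gt_mem_nhds h1))] with s hs
    rw [hlab' _ hs, hlab' _ h1]
  · have := hside t ht
    rw [h, mul_zero] at this
    exact absurd this (lt_irrefl _)

end Transient

end

/-! ### Images of leaves under an equivalence. -/

section


variable {U : Set Plane} {r : ℕ} {Z Z' : Omega U r} {i : Fin 2} {ε : ℝ}
  {mX MX mY MY ρ mX' MX' mY' MY' ρ' : ℝ}

theorem Foliation.eventually_K_symm {F : ℝ → ℝ → ℝ} {s m M : ℝ} (f : Foliation F s m M) {β : ℝ}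
    (hβ : 0 < β) : ∀ᶠ k in 𝓝 (0 : ℝ), |f.K.symm k| < β := by
  have h : ContinuousAt (fun k => |f.K.symm k|) 0 := f.K.symm.continuous.abs.continuousAt
  refine h.eventually (gt_mem_nhds ?_)
  change |f.K.symm 0| < β
  rwa [symm_fix f.K_zero, abs_zero]

theorem LocalChart.eventually_leaf_mem {sX sY : ℝ} (c : LocalChart Z i ε ε sX sY mX MX mY MY ρ)
    {N : Set Plane} (hN : N ∈ 𝓝 0) : ∃ β > 0, ∀ ς u k : ℝ, |u| < β → |k| < β → c.leaf ς k u ∈ N := by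
  have h : ∀ W : ℝ → ℝ → ℝ, Continuous (Function.uncurry W) → W 0 0 = 0 →
      ∀ᶠ q in 𝓝 (0 : ℝ × ℝ), pt i q.1 (W q.1 q.2) ∈ N := fun W hW h0 => by
    have h1 : Continuous fun q : ℝ × ℝ => pt i q.1 (W q.1 q.2) :=
      (continuous_pt i).comp (f := fun q : ℝ × ℝ => (q.1, W q.1 q.2)) (continuous_fst.prodMk hW)
    refine h1.continuousAt.preimage_mem_nhds ?_
    simpa [h0] using hN
  obtain ⟨β, hβ, hball⟩ := Metric.eventually_nhds_iff.1
    ((h _ c.X.fol.continuous_W (c.X.fol.W_zero 0)).and (h _ c.Y.fol.continuous_W (c.Y.fol.W_zero 0)))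
  refine ⟨β, hβ, fun ς u k hu hk => ?_⟩
  have := @hball (u, k) (by simpa [Prod.dist_eq] using ⟨hu, hk⟩)
  rw [LocalChart.leaf]
  split_ifs
  exacts [this.1, this.2]

/-- An equivalence of transient fields with a sliding axis intertwines the maps between the end
points of the leaves on both sides of this axis. -/
theorem eventually_map_endpoints (c : LocalChart Z i ε ε (-1) 1 mX MX mY MY ρ)
    (c' : LocalChart Z' i ε ε (-1) 1 mX' MX' mY' MY' ρ')
    {h : OpenPartialHomeomorph Plane Plane} (h0 : 0 ∈ h.source) (hz : h 0 = 0)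
    (hor : PreservesOrientationAt h 0)
    (hsw : ∀ p ∈ h.source, h p ∈ switching ↔ p ∈ switching)
    (hm : MapsTrajectories h h.source Z Z') : ∃ κ > 0,
      StrictMonoOn (fun u => h (pt i u 0) i) (Icc (-κ) κ) ∧ ∀ᶠ k in 𝓝[≠] (0 : ℝ),
        c'.X.fol.K (h (pt i (c.X.fol.K.symm k) 0) i) =
          -c'.Y.fol.K (h (pt i (c.Y.fol.K.symm (-k)) 0) i) := by
  have hs : (-1 : ℝ) ≠ 1 := by norm_num
  obtain ⟨κ, hκ, hax, hmono⟩ := exists_axis_strictMonoOn c c' hs h0 hz hsw hm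
  refine ⟨κ, hκ, hmono, ?_⟩
  obtain ⟨β, hβ, hleaf⟩ := c.eventually_leaf_mem (inter_mem (inter_mem (box_mem_nhds c.ρ_pos)
    (OpenPartialHomeomorph.preimage_mem_nhds_zero h h0 hz (box_mem_nhds c'.ρ_pos)))
    (eventually_sides c c' hs h0 hz hor hsw hm))
  have hβκ : 0 < min β κ := lt_min hβ hκ
  have hev : ∀ᶠ k in 𝓝 (0 : ℝ), |c.X.fol.K.symm k| < min β κ ∧ |c.Y.fol.K.symm (-k)| < min β κ ∧
      |k| < β := by
    refine (c.X.fol.eventually_K_symm hβκ).and (Filter.Eventually.and ?_ ?_)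
    · have h1 : Tendsto (fun k : ℝ => -k) (𝓝 0) (𝓝 0) := by
        simpa using (continuous_neg (G := ℝ)).tendsto 0
      exact h1.eventually (c.Y.fol.eventually_K_symm hβκ)
    · exact continuous_abs.continuousAt.eventually (gt_mem_nhds (by simpa using hβ))
  filter_upwards [nhdsWithin_le_nhds hev, self_mem_nhdsWithin] with k ⟨hkX, hkY, hkβ⟩ hk0
  obtain ⟨ς, hς, hςk⟩ := exists_sign hk0
  have hςς := mul_self_sign hς
  have hςne : ς ≠ 0 := left_ne_zero_of_mul hςk.ne'
  set x := c.X.fol.K.symm k with hx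
  set y := c.Y.fol.K.symm (-k) with hy
  have hKx : c.X.fol.K x = k := c.X.fol.K.apply_symm_apply k
  have hKy : c.Y.fol.K y = -k := c.Y.fol.K.apply_symm_apply (-k)
  have hx0 : 0 < ς * x := by
    have h1 : 0 < x ↔ 0 < k := by rw [← hKx, ← c.X.fol.K.lt_iff_lt (x := 0), c.X.fol.K_zero]
    have h2 : x < 0 ↔ k < 0 := by rw [← hKx, ← c.X.fol.K.lt_iff_lt (y := 0), c.X.fol.K_zero]
    rcases hς with rfl | rfl
    · linarith [h1.2 (by linarith)]
    · linarith [h2.2 (by linarith)]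
  have hy0 : ς * y < 0 := by
    have h1 : 0 < y ↔ 0 < -k := by rw [← hKy, ← c.Y.fol.K.lt_iff_lt (x := 0), c.Y.fol.K_zero]
    have h2 : y < 0 ↔ -k < 0 := by rw [← hKy, ← c.Y.fol.K.lt_iff_lt (y := 0), c.Y.fol.K_zero]
    rcases hς with rfl | rfl
    · linarith [h2.2 (by linarith)]
    · linarith [h1.2 (by linarith)]
  have habs : ∀ u : ℝ, |ς * u| = |u| := fun u => by
    rw [abs_mul, abs_eq_one_of_sign hς, one_mul]
  have hxI : x ∈ Icc (-κ) κ := abs_le.1 (hkX.le.trans (min_le_right _ _))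
  have hyI : y ∈ Icc (-κ) κ := abs_le.1 (hkY.le.trans (min_le_right _ _))
  have h0I : (0 : ℝ) ∈ Icc (-κ) κ := ⟨by linarith, hκ.le⟩
  have hmem : ∀ t ∈ Icc (ς * y) (ς * x), c.leaf ς k (ς * t) ∈ _ := fun t ht => by
    refine hleaf ς (ς * t) k ?_ hkβ
    have h1 := abs_lt.1 ((habs x).trans_lt (hkX.trans_le (min_le_left _ _)))
    have h2 := abs_lt.1 ((habs y).trans_lt (hkY.trans_le (min_le_left _ _)))
    rw [habs, abs_lt]
    exact ⟨h2.1.trans_le ht.1, ht.2.trans_lt h1.2⟩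
  have hside : ∀ t ∈ Ioo (ς * y) (ς * x), 0 < ς * c.leaf ς k (ς * t) (i + 1) := fun t ht => by
    refine c.leaf_side hς ?_ ?_ <;> rw [← mul_assoc, hςς, one_mul]
    exacts [ht.1, ht.2]
  have hside' : ∀ t ∈ Ioo (ς * y) (ς * x), 0 < ς * h (c.leaf ς k (ς * t)) (i + 1) := fun t ht => by
    have h1 := (hmem t (Ioo_subset_Icc_self ht)).2
    have h2 := hside t ht
    rcases hς with rfl | rfl
    · rw [one_mul] at h2 ⊢
      exact h1.1 h2
    · rw [neg_one_mul, neg_pos] at h2 ⊢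
      exact h1.2 h2
  -- The label of the image along the leaf. It is constant on the open interval, where the image is
  -- an orbit on one side of the sliding axis. No trajectory inside the side reaches its end points
  -- on this axis, so they are treated by continuity.
  set G : ℝ → ℝ := fun t => c'.sideLab ς (h (c.leaf ς k (ς * t))) with hG
  have hGc : ContinuousOn G (Icc (ς * y) (ς * x)) :=
    (c'.continuous_sideLab hς).comp_continuousOn (h.continuousOn.comp
      ((c.continuous_leaf hς k).comp (continuous_const.mul continuous_id)).continuousOn
      fun t ht => (hmem t ht).1.2.1)
  -- The parameter `ς * t` of the leaf runs from the end `y` to the end `x`, while the motion runs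
  -- in the direction `ε`; the factor `e = ε * ς` converts between the two.
  have hconst : ∀ e : ℝ, e = ε * ς → ∀ a b : ℝ, a < b → e * a ∈ Ioo (ς * y) (ς * x) →
      e * b ∈ Ioo (ς * y) (ς * x) → G (e * a) = G (e * b) := by
    intro e he a b hab ha hb
    have hsign : e = 1 ∨ e = -1 := by
      rcases hς with h | h <;> rcases c.εX_sign with h' | h' <;> simp [he, h, h']
    have het : ∀ t, ε * t = ς * (e * t) := fun t => by
      rw [he]
      linear_combination (-(ε * t)) * hςς
    have hI : ∀ t ∈ Icc a b, e * t ∈ Ioo (ς * y) (ς * x) := fun t ht => by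
      rcases hsign with h | h <;> simp only [h, one_mul, neg_one_mul, mem_Ioo] at ha hb ⊢
      · exact ⟨ha.1.trans_le ht.1, ht.2.trans_lt hb.2⟩
      · exact ⟨hb.1.trans_le (neg_le_neg ht.2), (neg_le_neg ht.1).trans_lt ha.2⟩
    have hI' := fun t ht => hmem _ (Ioo_subset_Icc_self (hI t ht))
    have ho : GraphOrbit c a b fun t => c.leaf ς k (ε * t) := c.graphOrbit_leaf hς fun t ht => by
      rw [het]
      exact hside _ (hI t ht)
    obtain ⟨c₀, d₀, τ, hcd, hτ, himg, hg⟩ := ho.exists_map c' hm hab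
      (fun t ht => by simp only [het]; exact (hI' t ht).1.1)
      (fun t ht => by simp only [het]; exact (hI' t ht).1.2.1)
      fun t ht => by simp only [het]; exact (hI' t ht).1.2.2
    obtain ⟨h1, h2, h3⟩ := endpoints_of_image hab hcd hτ himg
    have := hg.sideLab_eq hς hcd.le fun t ht => by
      simp only [het]
      exact hside' _ (hI _ (h1 ht))
    simpa only [h2, h3, het] using this
  have hAB : ς * y < ς * x := hy0.trans hx0
  have hends : G (ς * y) = G (ς * x) := by
    refine eq_of_locally_constant_off_point hAB.le countable_empty hGc fun t ht _ => ?_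
    filter_upwards [Ioo_mem_nhds ht.1 ht.2] with s hs'
    have hee : ε * ς * (ε * ς) = 1 := by
      linear_combination (ς * ς) * mul_self_sign c.εX_sign + hςς
    have hinv : ∀ u, ε * ς * (ε * ς * u) = u := fun u => by rw [← mul_assoc, hee, one_mul]
    rcases lt_trichotomy (ε * ς * s) (ε * ς * t) with hlt | heq | hgt
    · have := hconst _ rfl _ _ hlt (by rwa [hinv]) (by rwa [hinv])
      rwa [hinv, hinv] at this
    · rw [← hinv s, heq, hinv]
    · have := hconst _ rfl _ _ hgt (by rwa [hinv]) (by rwa [hinv])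
      rw [hinv, hinv] at this
      exact this.symm
  have hχ0 : h (pt i 0 0) i = 0 := by simp [hz]
  have hςp : ∀ u, ς * (ς * u) = u := fun u => by rw [← mul_assoc, hςς, one_mul]
  -- At the end `x` the image lies on the axis, on the half where `X` acts on the side `ς`, so its
  -- label is that of a leaf of `X'` through a point of the axis.
  have hGx : G (ς * x) = c'.X.fol.K (h (pt i x 0) i) := by
    have h1 : c.leaf ς k (ς * (ς * x)) = pt i x 0 := by
      have h2 : c.X.fol.W x k = 0 := by
        refine le_antisymm (not_lt.1 fun h => ?_) (not_lt.1 fun h => ?_)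
        · exact (c.X.fol.W_pos_iff.1 h).ne hKx
        · exact (c.X.fol.W_neg_iff.1 h).ne' hKx
      rw [hςp, LocalChart.leaf, if_pos hx0.le, h2]
    have h2 : 0 ≤ ς * h (pt i x 0) i := by
      rcases hς with rfl | rfl
      · have h3 : h (pt i 0 0) i < h (pt i x 0) i := hmono h0I hxI (by linarith)
        rw [one_mul]
        linarith
      · have h3 : h (pt i x 0) i < h (pt i 0 0) i := hmono hxI h0I (by linarith)
        linarith
    simp only [hG, h1]
    rw [LocalChart.sideLab, if_pos h2, FieldChart.lab, (hax x hxI).2,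
      c'.X.fol.H_axis_of_neg_one rfl]
  have hGy : G (ς * y) = -c'.Y.fol.K (h (pt i y 0) i) := by
    have h1 : c.leaf ς k (ς * (ς * y)) = pt i y 0 := by
      have h2 : c.Y.fol.W y k = 0 := by
        refine le_antisymm (not_lt.1 fun h => ?_) (not_lt.1 fun h => ?_)
        · exact (c.Y.fol.W_pos_iff'.1 h).ne' hKy
        · exact (c.Y.fol.W_neg_iff'.1 h).ne hKy
      rw [hςp, LocalChart.leaf, if_neg hy0.not_ge, h2]
    have h2 : ς * h (pt i y 0) i < 0 := by
      rcases hς with rfl | rfl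
      · have h3 : h (pt i y 0) i < h (pt i 0 0) i := hmono hyI h0I (by linarith)
        linarith
      · have h3 : h (pt i 0 0) i < h (pt i y 0) i := hmono h0I hyI (by linarith)
        linarith
    simp only [hG, h1]
    rw [LocalChart.sideLab, if_neg h2.not_ge, FieldChart.lab, (hax y hyI).2,
      c'.Y.fol.H_axis_of_one rfl]
  rw [← hGx, ← hGy, hends]

/-! ### The invariant of the return maps -/

section Return

variable (c : LocalChart Z i ε ε (-1) 1 mX MX mY MY ρ)

/-- On the axis an equivalence intertwines the maps between the end points of the leaves: here for the
two leaves which end at a point of the negative half of the axis. -/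
theorem eventually_return (c' : LocalChart Z' i ε ε (-1) 1 mX' MX' mY' MY' ρ')
    {h : OpenPartialHomeomorph Plane Plane} (h0 : 0 ∈ h.source) (hz : h 0 = 0)
    (hor : PreservesOrientationAt h 0)
    (hsw : ∀ p ∈ h.source, h p ∈ switching ↔ p ∈ switching)
    (hm : MapsTrajectories h h.source Z Z') : ∃ χ : ℝ → ℝ, ∃ κ > 0, χ 0 = 0 ∧
      StrictMonoOn χ (Icc (-κ) κ) ∧ ∀ᶠ x in 𝓝[<] (0 : ℝ), x ∈ Icc (-κ) 0 ∧
        c.X.fol.K.symm (-c.Y.fol.K x) ∈ Ioc 0 κ ∧ c.Y.fol.K.symm (-c.X.fol.K x) ∈ Ioc 0 κ ∧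
        c'.X.fol.K (χ (c.X.fol.K.symm (-c.Y.fol.K x))) = -c'.Y.fol.K (χ x) ∧
        c'.X.fol.K (χ x) = -c'.Y.fol.K (χ (c.Y.fol.K.symm (-c.X.fol.K x))) := by
  obtain ⟨κ, hκ, hmono, hev⟩ := eventually_map_endpoints c c' h0 hz hor hsw hm
  refine ⟨_, κ, hκ, by simp [hz], hmono, ?_⟩
  have hK : ∀ {F : ℝ → ℝ → ℝ} {s m M : ℝ} (f : Foliation F s m M),
      Tendsto f.K (𝓝[<] 0) (𝓝[<] 0) := fun f => by
    refine tendsto_nhdsWithin_iff.2 ⟨?_, ?_⟩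
    · have := f.K.continuous.tendsto 0
      rw [f.K_zero] at this
      exact this.mono_left nhdsWithin_le_nhds
    · filter_upwards [self_mem_nhdsWithin] with x hx
      have := f.K.strictMono (show x < 0 from hx)
      rwa [f.K_zero] at this
  have hn : Tendsto (fun k : ℝ => -k) (𝓝[<] 0) (𝓝[>] 0) := by
    simpa using tendsto_neg_nhdsLT (a := (0 : ℝ))
  have hpos : 𝓝[>] (0 : ℝ) ≤ 𝓝[≠] 0 := nhdsWithin_mono _ fun x hx => ne_of_gt hx
  have hneg : 𝓝[<] (0 : ℝ) ≤ 𝓝[≠] 0 := nhdsWithin_mono _ fun x hx => ne_of_lt hx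
  have hsym : ∀ {F : ℝ → ℝ → ℝ} {s m M : ℝ} (f : Foliation F s m M),
      ∀ᶠ k in 𝓝[>] (0 : ℝ), f.K.symm k ∈ Ioc 0 κ := fun f => by
    filter_upwards [nhdsWithin_le_nhds (f.eventually_K_symm hκ), self_mem_nhdsWithin] with k h1 h2
    have : 0 < f.K.symm k := by
      rw [OrderIso.lt_symm_apply, f.K_zero]
      exact h2
    exact ⟨this, by rw [abs_of_pos this] at h1; exact h1.le⟩
  filter_upwards [(hn.comp (hK c.Y.fol)).eventually (hsym c.X.fol),
    (hn.comp (hK c.X.fol)).eventually (hsym c.Y.fol),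
    (hn.comp (hK c.Y.fol)).eventually (hpos hev), (hK c.X.fol).eventually (hneg hev),
    Ioo_mem_nhdsLT (show -κ < 0 by linarith)] with x h1 h2 h3 h4 h5
  refine ⟨Ioo_subset_Icc_self h5, h1, h2, ?_, ?_⟩
  · simpa using h3
  · simpa using h4

theorem Foliation.le_K_of_pos {F : ℝ → ℝ → ℝ} {s m M : ℝ} (f : Foliation F s m M) {x : ℝ}
    (hx : 0 < x) : m * x ≤ f.K x ∧ f.K x ≤ M * x := by
  have h1 := f.le_K x
  have h2 := f.K_le x
  have h3 : 0 < f.K x := f.K_zero ▸ f.K.strictMono hx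
  rw [abs_of_pos hx, abs_of_pos h3] at h1 h2
  exact ⟨h1, h2⟩

theorem Foliation.le_K_of_neg {F : ℝ → ℝ → ℝ} {s m M : ℝ} (f : Foliation F s m M) {x : ℝ}
    (hx : x < 0) : m * -x ≤ -f.K x ∧ -f.K x ≤ M * -x := by
  have h1 := f.le_K x
  have h2 := f.K_le x
  have h3 : f.K x < 0 := f.K_zero ▸ f.K.strictMono hx
  rw [abs_of_neg hx, abs_of_neg h3] at h1 h2
  exact ⟨h1, h2⟩

/-- The two leaves ending at `x < 0` have their other ends on the positive half axis. For the second
field the slope of `X` dominates, so the end on the upper side is closer to the origin than `x` and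
the one on the lower side is farther away. The increasing map `χ` brings this order back to the
first field. -/
theorem eventually_return_lt (c' : LocalChart Z' i ε ε (-1) 1 mX' MX' mY' MY' ρ') (hM : MY' < mX')
    {h : OpenPartialHomeomorph Plane Plane} (h0 : 0 ∈ h.source) (hz : h 0 = 0)
    (hor : PreservesOrientationAt h 0)
    (hsw : ∀ p ∈ h.source, h p ∈ switching ↔ p ∈ switching)
    (hm : MapsTrajectories h h.source Z Z') : ∀ᶠ x in 𝓝[<] (0 : ℝ),
      c.X.fol.K.symm (-c.Y.fol.K x) < c.Y.fol.K.symm (-c.X.fol.K x) := by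
  obtain ⟨χ, κ, hκ, hχ0, hχ, hev⟩ := eventually_return c c' h0 hz hor hsw hm
  have h0I : (0 : ℝ) ∈ Icc (-κ) κ := ⟨by linarith, hκ.le⟩
  filter_upwards [hev, self_mem_nhdsWithin] with x ⟨hx, hu, hl, e1, e2⟩ hx0
  have hxI : x ∈ Icc (-κ) κ := ⟨hx.1, hx.2.trans hκ.le⟩
  have huI : c.X.fol.K.symm (-c.Y.fol.K x) ∈ Icc (-κ) κ := ⟨by linarith [hu.1], hu.2⟩
  have hlI : c.Y.fol.K.symm (-c.X.fol.K x) ∈ Icc (-κ) κ := ⟨by linarith [hl.1], hl.2⟩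
  have k1 : χ x < 0 := hχ0 ▸ hχ hxI h0I hx0
  have k2 := hχ0 ▸ hχ h0I huI hu.1
  have k3 := hχ0 ▸ hχ h0I hlI hl.1
  refine (hχ.lt_iff_lt huI hlI).1 ?_
  have a1 := (c'.X.fol.le_K_of_pos k2).1
  have a2 := (c'.Y.fol.le_K_of_neg k1).2
  have a3 := (c'.X.fol.le_K_of_neg k1).1
  have a4 := (c'.Y.fol.le_K_of_pos k3).2
  have hp := c'.mX_pos
  have b1 : χ (c.X.fol.K.symm (-c.Y.fol.K x)) < -χ x := by nlinarith
  have b2 : -χ x < χ (c.Y.fol.K.symm (-c.X.fol.K x)) := by nlinarith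
  exact b1.trans b2

theorem eventually_lt_return (c' : LocalChart Z' i ε ε (-1) 1 mX' MX' mY' MY' ρ') (hM : MX' < mY')
    {h : OpenPartialHomeomorph Plane Plane} (h0 : 0 ∈ h.source) (hz : h 0 = 0)
    (hor : PreservesOrientationAt h 0)
    (hsw : ∀ p ∈ h.source, h p ∈ switching ↔ p ∈ switching)
    (hm : MapsTrajectories h h.source Z Z') : ∀ᶠ x in 𝓝[<] (0 : ℝ),
      c.Y.fol.K.symm (-c.X.fol.K x) < c.X.fol.K.symm (-c.Y.fol.K x) := by
  obtain ⟨χ, κ, hκ, hχ0, hχ, hev⟩ := eventually_return c c' h0 hz hor hsw hm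
  have h0I : (0 : ℝ) ∈ Icc (-κ) κ := ⟨by linarith, hκ.le⟩
  filter_upwards [hev, self_mem_nhdsWithin] with x ⟨hx, hu, hl, e1, e2⟩ hx0
  have hxI : x ∈ Icc (-κ) κ := ⟨hx.1, hx.2.trans hκ.le⟩
  have huI : c.X.fol.K.symm (-c.Y.fol.K x) ∈ Icc (-κ) κ := ⟨by linarith [hu.1], hu.2⟩
  have hlI : c.Y.fol.K.symm (-c.X.fol.K x) ∈ Icc (-κ) κ := ⟨by linarith [hl.1], hl.2⟩
  have k1 : χ x < 0 := hχ0 ▸ hχ hxI h0I hx0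
  have k2 := hχ0 ▸ hχ h0I huI hu.1
  have k3 := hχ0 ▸ hχ h0I hlI hl.1
  refine (hχ.lt_iff_lt hlI huI).1 ?_
  have a1 := (c'.X.fol.le_K_of_pos k2).2
  have a2 := (c'.Y.fol.le_K_of_neg k1).1
  have a3 := (c'.X.fol.le_K_of_neg k1).2
  have a4 := (c'.Y.fol.le_K_of_pos k3).1
  have hp := c'.mY_pos
  have b1 : χ (c.Y.fol.K.symm (-c.X.fol.K x)) < -χ x := by nlinarith
  have b2 : -χ x < χ (c.X.fol.K.symm (-c.Y.fol.K x)) := by nlinarith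
  exact b1.trans b2

end Return

/-! ### Stability implies the conditions -/

/-- The ratio of the slopes of both fields is not one for a stable transient field. -/
theorem StructurallyStable.slope_ne (hr : 1 ≤ r) (hU : IsOpen U) (hUb : Bornology.IsBounded U)
    (h0 : (0 : Plane) ∈ U) (hS : StructurallyStable Z) (hZ : SignPattern Z i ε ε (-1) 1) :
    Z.1 0 (i + 1) * Z.2 0 i ≠ -(Z.2 0 (i + 1) * Z.1 0 i) := by
  intro heq
  obtain ⟨V, hV, hVZ⟩ := hS
  obtain ⟨mX, MX, mY, MY, ρ, -, ⟨c⟩⟩ := hZ.exists_localChart_in hr hU h0 univ_mem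
  have hX0 : Z.1 0 i ≠ 0 := hZ.fst_ne i
  have hY0 : Z.2 0 i ≠ 0 := hZ.snd_ne i
  have hslope : Z.1 0 (i + 1) / Z.1 0 i = -(Z.2 0 (i + 1) / Z.2 0 i) := by
    field_simp
    linarith
  -- Adding `t * X_i (0)` to `X_{i+1}` shifts the slope of `X` at the origin by exactly `t`. As this
  -- slope is negative, `t < 0` makes `X` steeper than `Y`, and `t > 0` makes it less steep.
  set Zt : ℝ → Omega U r := fun t => Z.translate hU hUb (pt i 0 (Z.1 0 i)) 0 t with hZt
  have e1 : ∀ t, (Zt t).1 0 (i + 1) / (Zt t).1 0 i = Z.1 0 (i + 1) / Z.1 0 i + t := fun t => by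
    rw [Omega.translate_fst hU hUb h0, Omega.translate_fst hU hUb h0, pt_fst, pt_snd, mul_zero,
      add_zero]
    field_simp
  have e2 : ∀ t, (Zt t).2 0 (i + 1) / (Zt t).2 0 i = Z.2 0 (i + 1) / Z.2 0 i := fun t => by
    rw [Omega.translate_snd hU hUb h0, Omega.translate_snd hU hUb h0]
    simp
  have hev : ∀ᶠ t in 𝓝 (0 : ℝ), Zt t ∈ V ∧ SignPattern (Zt t) i ε ε (-1) 1 :=
    (Z.tendsto_translate hU hUb _ _).eventually ((show ∀ᶠ Z' in 𝓝 Z, Z' ∈ V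
      from hV).and (hZ.eventually h0))
  have hlt : ∀ᶠ x in 𝓝[<] (0 : ℝ),
      c.X.fol.K.symm (-c.Y.fol.K x) < c.Y.fol.K.symm (-c.X.fol.K x) := by
    obtain ⟨t, ⟨ht, hp⟩, ht0⟩ :=
      ((hev.filter_mono (nhdsWithin_le_nhds (s := Iio 0))).and self_mem_nhdsWithin).exists
    obtain ⟨m, M, m', M', k1, k2, k3, k4, k5, k6, -, k7⟩ :=
      exists_brackets (slope_pos hp.X_fst hp.X_snd) (slope_pos hp.Y_fst hp.Y_snd)
    obtain ⟨ρ', hρ', hc⟩ := PWS.exists_localChart hr hU h0 (Zt t) i hp.εX_sign hp.εY_sign hp.sX_sign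
      hp.sY_sign hp.X_fst hp.Y_fst k1 k4 k2 k3 k5 k6
    obtain ⟨c'⟩ := hc ρ' hρ' le_rfl
    obtain ⟨h, -, -, h1, -, h3, h4, h5, h6, -⟩ := hVZ _ ht
    refine eventually_return_lt c c' (k7 ?_) h1 h3 h4 h5 h6
    rw [e1, e2, hslope]
    have : t < 0 := ht0
    linarith
  have hgt : ∀ᶠ x in 𝓝[<] (0 : ℝ),
      c.Y.fol.K.symm (-c.X.fol.K x) < c.X.fol.K.symm (-c.Y.fol.K x) := by
    obtain ⟨t, ⟨ht, hp⟩, ht0⟩ :=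
      ((hev.filter_mono (nhdsWithin_le_nhds (s := Ioi 0))).and self_mem_nhdsWithin).exists
    obtain ⟨m, M, m', M', k1, k2, k3, k4, k5, k6, k7, -⟩ :=
      exists_brackets (slope_pos hp.X_fst hp.X_snd) (slope_pos hp.Y_fst hp.Y_snd)
    obtain ⟨ρ', hρ', hc⟩ := PWS.exists_localChart hr hU h0 (Zt t) i hp.εX_sign hp.εY_sign hp.sX_sign
      hp.sY_sign hp.X_fst hp.Y_fst k1 k4 k2 k3 k5 k6
    obtain ⟨c'⟩ := hc ρ' hρ' le_rfl
    obtain ⟨h, -, -, h1, -, h3, h4, h5, h6, -⟩ := hVZ _ ht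
    refine eventually_lt_return c c' (k7 ?_) h1 h3 h4 h5 h6
    rw [e1, e2, hslope]
    have : 0 < t := ht0
    linarith
  -- Equivalence with both perturbations imposes opposite strict orders on the same two points,
  -- which belong to `Z` alone.
  obtain ⟨x, hx, hx'⟩ := (hlt.and hgt).exists
  exact lt_asymm hx hx'

theorem StructurallyStable.conditions (hr : 1 ≤ r) (hU : IsOpen U) (hUb : Bornology.IsBounded U)
    (h0 : (0 : Plane) ∈ U) (hS : StructurallyStable Z) :
    ConditionA Z ∨ ConditionB Z ∨ ConditionC Z := by
  have hne := hS.mul_ne_zero hr hU hUb h0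
  by_cases hA : ∀ k, 0 < Z.1 0 k * Z.2 0 k
  · exact Or.inl hA
  by_cases hB : ∀ k, Z.1 0 k * Z.2 0 k < 0
  · exact Or.inr (Or.inl ⟨hB, hS.det_ne_zero hr hU hUb h0 hB⟩)
  refine Or.inr (Or.inr ?_)
  push Not at hA hB
  obtain ⟨j, hj⟩ := hA
  obtain ⟨i, hi⟩ := hB
  have hi' : 0 < Z.1 0 i * Z.2 0 i := lt_of_le_of_ne hi (hne i).symm
  have hj' : Z.1 0 j * Z.2 0 j < 0 := lt_of_le_of_ne hj (hne j)
  obtain rfl : j = i + 1 := (fin_two_cases i j).resolve_left fun h => by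
    rw [h] at hj'
    exact lt_asymm hi' hj'
  refine ⟨⟨i, hi', hj'⟩, fun ht hα => ?_⟩
  obtain ⟨ε, sX, sY, hp, -, -⟩ := exists_signPattern_crossing hi' hj'.ne
  obtain ⟨rfl, rfl⟩ := (hp.isTransient_iff hr hU h0).1 ht
  rcases (alpha_eq_one_iff i hp.fst_ne hp.snd_ne).1 hα with h | h
  -- The two slopes have opposite signs, so they cannot be equal; only equality of their absolute
  -- values remains.
  · have h1 : (Z.1 0 (i + 1) * Z.2 0 i) * (Z.2 0 (i + 1) * Z.1 0 i) < 0 := by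
      have := mul_neg_of_pos_of_neg hi' hj'
      linarith
    rw [h] at h1
    exact absurd h1 (mul_self_nonneg _).not_gt
  · exact hS.slope_ne hr hU hUb h0 hp h

end

end PWS

end

/-! ### The theorem: characterisation, openness and density. -/

theorem theoremA (r : ℕ) (hr : 1 ≤ r) (U : Set PWS.Plane) (hU : IsOpen U)
    (hUb : Bornology.IsBounded U) (h0 : (0 : PWS.Plane) ∈ U) :
    (∀ Z : PWS.Omega U r, PWS.StructurallyStable Z ↔
      (PWS.ConditionA Z ∨ PWS.ConditionB Z ∨ PWS.ConditionC Z)) ∧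
    IsOpen {Z : PWS.Omega U r | PWS.StructurallyStable Z} ∧
    Dense {Z : PWS.Omega U r | PWS.StructurallyStable Z} := by
  have key : ∀ Z : PWS.Omega U r, PWS.StructurallyStable Z ↔
      (PWS.ConditionA Z ∨ PWS.ConditionB Z ∨ PWS.ConditionC Z) := fun _ =>
    ⟨fun h => h.conditions hr hU hUb h0, fun h => PWS.stable_of_conditions hr hU h0 h⟩
  simp only [key, true_and, implies_true]
  exact ⟨PWS.isOpen_conditions hr hU h0, PWS.dense_conditions hU hUb h0⟩
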